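/- **Theorem.** Let $k\ge 2$ be a fixed integer. For a nonempty set $S$ of vertices of a finite simple graph $G=(V,E)$ put $\phi_G(S)=|E(S,V\setminus S)|/|S|$, where $E(S,V\setminus S)$ is the set of edges with exactly one endpoint in $S$. The problem *unweighted $k$-Sparsest Cut* asks, given $G$ and a rational number $N$, whether $V$ can be partitioned into $k$ nonempty sets $S_1,\dots,S_k$ with $\phi_G(S_j)\le N$ for all $j$. The machine model is the random access machine (unit-cost instructions: constants, addition, truncated subtraction, multiplication, integer division, indirect load and store, conditional jump). 1. There is a program that solves unweighted $k$-Sparsest Cut when $G$ is given together with a tree decomposition of width $tw$ with $O(n)$ nodes, where $n\ge 1$ is the number of vertices of $G$, in time $O(k^{tw}n^{6k+1})$, using $O(k^{tw}n^{3k+1})$ memory cells (hence space exponential in $tw$), all numbers occurring having $O(tw+\log n+\operatorname{size}(N))$ bits, where $\operatorname{size}(N)\ge 1$ is the number of bits of the numerator and the denominator of $N$ and logarithms are rounded so that $\log n\ge1$. More precisely, there is one program such that for every $c$ there is a constant $C$, depending only on $k$ and $c$, for which these bounds hold with factor $C$ for all graphs on $n\ge1$ vertices, all $N$, and all tree decompositions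 with at most $cn$ nodes. In particular, for a decomposition of minimum width, $tw$ is the treewidth of $G$. 2. Unweighted $k$-Sparsest Cut is fixed-parameter tractable in the treewidth of the input graph, no tree decomposition being given: there are a program, a computable function $f$ and a constant $c$ (all depending on $k$) such that the program answers every instance $x=(G,N)$ correctly in time at most $f(tw(G))\cdot|x|^{c}$, where $|x|$ is the length of $x$ in bits; all numbers occurring have at most that many bits. -/

import Mathlib

/-! ### The unweighted `k`-sparsest cut problem -/

namespace SparsestCut

/-- The number of edges of `G` with exactly one endpoint in `S`, i.e. `|E(S, V \ S)|`. -/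
noncomputable def cutSize {V : Type} (G : SimpleGraph V) (S : Finset V) : ℕ :=
  {e ∈ G.edgeSet | ∃ u ∈ S, ∃ v ∉ S, e = s(u, v)}.ncard

/-- The edge expansion `|E(S, V \ S)| / |S|` of a set of vertices. It is used only for nonempty
sets `S`. -/
noncomputable def edgeExpansion {V : Type} (G : SimpleGraph V) (S : Finset V) : ℚ :=
  (cutSize G S : ℚ) / (S.card : ℚ)

/-- `S 0, …, S (k - 1)` are the parts of a partition of `V` into `k` (nonempty) parts. -/
structure IsKPartition {V : Type} {k : ℕ} (S : Fin k → Finset V) : Prop where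
  nonempty : ∀ j, (S j).Nonempty
  disjoint : ∀ i j, i ≠ j → Disjoint (S i) (S j)
  cover : ∀ v, ∃ j, v ∈ S j

/-- An instance of unweighted `k`-sparsest cut for a fixed `k`: a finite simple graph, with
vertex set `{0, …, n - 1}`, and a rational number. -/
structure Instance where
  n : ℕ
  graph : SimpleGraph (Fin n)
  N : ℚ

/-- The question of unweighted `k`-sparsest cut: is there a partition of the vertex set into `k`
parts, each of edge expansion at most `N`? -/
def Instance.IsYes (k : ℕ) (I : Instance) : Prop :=
  ∃ S : Fin k → Finset (Fin I.n), IsKPartition S ∧ ∀ j, edgeExpansion I.graph (S j) ≤ I.N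

/-! ### Tree decompositions -/

/-- A tree decomposition of `G` with `m` nodes. -/
structure TreeDecomposition {V : Type} (G : SimpleGraph V) (m : ℕ) where
  tree : SimpleGraph (Fin m)
  isTree : tree.IsTree
  bag : Fin m → Finset V
  vertex_mem : ∀ v, ∃ t, v ∈ bag t
  edge_mem : ∀ u v, G.Adj u v → ∃ t, u ∈ bag t ∧ v ∈ bag t
  connected : ∀ v, (tree.induce {t | v ∈ bag t}).Connected

/-- The width, i.e. the largest size of a bag minus one. (For a graph without vertices the
truncated subtraction gives `0`.) -/
def TreeDecomposition.width {V : Type} {G : SimpleGraph V} {m : ℕ}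
    (D : TreeDecomposition G m) : ℕ :=
  (Finset.univ.sup fun t => (D.bag t).card) - 1

/-- The treewidth: the least width of a tree decomposition. -/
noncomputable def treewidth {V : Type} (G : SimpleGraph V) : ℕ :=
  sInf {w | ∃ (m : ℕ) (D : TreeDecomposition G m), D.width = w}

/-! ### Random access machines

A program is a list of instructions. It works on registers and on a memory with random access, all
of them holding natural numbers. Every instruction costs one unit of time; the size of the numbers
is measured separately by `WordBound`, and the amount of memory by `SpaceBound`. -/

/-- The instructions. Here `r`, `a`, `b` are names of registers. -/
inductive Instr where
  /-- `r := c`, for a constant `c` -/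
  | const (r c : ℕ)
  /-- `r := a + b` -/
  | add (r a b : ℕ)
  /-- `r := max (a - b) 0` -/
  | sub (r a b : ℕ)
  /-- `r := a * b` -/
  | mul (r a b : ℕ)
  /-- `r := ⌊a / b⌋`, and `0` if `b` holds `0` -/
  | div (r a b : ℕ)
  /-- `r := ` the contents of the memory cell whose address is in `a` -/
  | load (r a : ℕ)
  /-- write the contents of `b` to the memory cell whose address is in `a` -/
  | store (a b : ℕ)
  /-- continue at position `l` of the program if `r` holds `0` -/
  | jumpZero (r l : ℕ)

abbrev Program := List Instr

/-- A configuration of the machine: program counter, registers and memory. -/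
structure Config where
  pc : ℕ
  reg : ℕ → ℕ
  mem : ℕ → ℕ

/-- Write `v` to register `r` and move on to the next instruction. -/
def Config.setReg (s : Config) (r v : ℕ) : Config :=
  { pc := s.pc + 1, reg := Function.update s.reg r v, mem := s.mem }

/-- The effect of one instruction. -/
def Instr.exec (s : Config) : Instr → Config
  | .const r c => s.setReg r c
  | .add r a b => s.setReg r (s.reg a + s.reg b)
  | .sub r a b => s.setReg r (s.reg a - s.reg b)
  | .mul r a b => s.setReg r (s.reg a * s.reg b)
  | .div r a b => s.setReg r (s.reg a / s.reg b)
  | .load r a => s.setReg r (s.mem (s.reg a))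
  | .store a b =>
      { pc := s.pc + 1, reg := s.reg, mem := Function.update s.mem (s.reg a) (s.reg b) }
  | .jumpZero r l => { pc := if s.reg r = 0 then l else s.pc + 1, reg := s.reg, mem := s.mem }

/-- The memory address that an instruction reads or writes, if any. -/
def Instr.address (s : Config) : Instr → Option ℕ
  | .load _ a => some (s.reg a)
  | .store a _ => some (s.reg a)
  | _ => none

/-- One step. The machine stops when the program counter leaves the program. -/
def step (P : Program) (s : Config) : Config :=
  match P[s.pc]? with
  | some i => i.exec s
  | none => s

def Halted (P : Program) (s : Config) : Prop := P.length ≤ s.pc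

/-- At the start the input stands in the memory, from address `0` on; everything else is `0`. -/
def start (x : List ℕ) : Config :=
  { pc := 0, reg := fun _ => 0, mem := fun a => x.getD a 0 }

/-- The configuration after `t` steps on input `x`. -/
def run (P : Program) (x : List ℕ) (t : ℕ) : Config := (step P)^[t] (start x)

/-- On input `x`, the program stops after at most `T` steps, with register `0` holding `1` if
`answer` is true and `0` otherwise. -/
def AnswersWithin (P : Program) (x : List ℕ) (answer : Prop) (T : ℕ) : Prop :=
  ∃ t ≤ T, Halted P (run P x t) ∧
    (answer → (run P x t).reg 0 = 1) ∧ (¬ answer → (run P x t).reg 0 = 0)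

/-- On input `x`, only memory cells of address less than `S` are ever read or written. -/
def SpaceBound (P : Program) (x : List ℕ) (S : ℕ) : Prop :=
  ∀ t, ∀ i ∈ P[(run P x t).pc]?, ∀ a ∈ i.address (run P x t), a < S

/-- On input `x`, all registers and memory cells always hold numbers of at most `W` bits. -/
def WordBound (P : Program) (x : List ℕ) (W : ℕ) : Prop :=
  ∀ t a, ((run P x t).reg a).size ≤ W ∧ ((run P x t).mem a).size ≤ W

/-! ### Encodings of inputs -/

open Classical in
/-- The rows of a 0-1 matrix, one after the other. -/
noncomputable def encodeMatrix {r s : ℕ} (R : Fin r → Fin s → Prop) : List ℕ :=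
  (List.ofFn fun i => List.ofFn fun j => if R i j then 1 else 0).flatten

/-- A rational number as sign, numerator and denominator. -/
def encodeRat (q : ℚ) : List ℕ := [if q < 0 then 1 else 0, q.num.natAbs, q.den]

/-- An instance is given by `n`, `N` and the adjacency matrix of the graph. -/
noncomputable def Instance.encode (I : Instance) : List ℕ :=
  I.n :: encodeRat I.N ++ encodeMatrix I.graph.Adj

/-- A tree decomposition is given by the number of nodes, the adjacency matrix of the tree and the
incidence matrix of nodes and vertices. -/
noncomputable def TreeDecomposition.encode {n m : ℕ} {G : SimpleGraph (Fin n)}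
    (D : TreeDecomposition G m) : List ℕ :=
  m :: encodeMatrix D.tree.Adj ++ encodeMatrix fun t v => v ∈ D.bag t

/-- The number of bits of an input, with one more bit per number as a separator. -/
def inputSize (x : List ℕ) : ℕ := (x.map fun a => a.size + 1).sum

/-- The number of bits of a rational number. -/
def ratSize (q : ℚ) : ℕ := q.num.natAbs.size + q.den.size

/-! ### Fixed-parameter tractability -/

/-- The problem with set of inputs `I`, encoded by `enc`, with yes-instances `yes`, is
fixed-parameter tractable for the parameter `κ`: there are a program that answers every input `x`
correctly, a computable function `f` and a constant `c`, such that the time is at most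
`f (κ x) * |x| ^ c`. All numbers that occur have at most that many bits, so that unit cost and
logarithmic cost of the instructions lead to the same notion. -/
def FixedParameterTractable {I : Type} (enc : I → List ℕ) (yes : I → Prop) (κ : I → ℕ) : Prop :=
  ∃ (P : Program) (f : ℕ → ℕ) (c : ℕ), Computable f ∧ ∀ x : I,
    AnswersWithin P (enc x) (yes x) (f (κ x) * inputSize (enc x) ^ c) ∧
    WordBound P (enc x) (f (κ x) * inputSize (enc x) ^ c)

end SparsestCut

/-!
A partition of the vertices into `k` parts is a surjective colouring with `k` colours, and its
quality depends only on the sizes of the colour classes and the sizes of their cuts. Both kinds of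
numbers are put together in one number, the weight of the colouring, written in base
`radix n = (n + 1) (n² + 1)` with one digit for each colour (`sum_ownWeight`). The weights that occur
are found by dynamic programming along an elimination order, i.e. a numbering of the vertices with
sets `H i` of earlier vertices which contain the earlier neighbours of `i` and are cliques in the
chordal completion (`Elim`). Eliminating the last vertex `i` merges the weights attained at `i`,
for all colours of `i`, into those of the node of the largest element of `H i`: the new weights are
sums of old ones (`Elim.attained_step`). If the sets `H i` have fewer than `w` elements, there are
`n` eliminations, `k ^ w` colourings of a bag, and `radix n ^ k = O(n ^ (3 k))` weights, of which all
pairs are added. This gives time `O(k ^ w n ^ (6 k + 1))` and space `O(k ^ w n ^ (3 k + 1))`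
(`wp_dp`, `cost_dp_le`).

The algorithms are written in a small language `Cmd` of assignments and bounded loops, for which
weakest preconditions `Wp` state the correctness and, at the same time, bounds for all values and
indices. The translation into machine programs (`Cmd.program_spec`) turns these into bounds for
time, space and numbers; the time is read off from the syntax by `Cmd.cost`. The arrays are stored
above the input, with the entries of different arrays alternating.

With a tree decomposition, a search of the tree from one of its nodes numbers the nodes, and the
vertices are placed bag by bag: a vertex that is new in the bag of a node gets as `H i` the
vertices of that bag that have been placed before (`wp_tree`). Two vertices of a bag that have both
been placed earlier also lie in the bag of the parent of the node, whence the cliques.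

Without a tree decomposition, an elimination order with sets of at most `4 tw + O(1)` elements is
computed by the method of Robertson and Seymour. The vertices without a place are divided into
regions, and the placed neighbours of a region lie in a set `S` of vertices that are joined to each
other. Vertices of the region are placed one after the other, with `S` as the set `H i`, and added
to `S`. When `S` gets `3 s + 1` elements, all of its subsets `P` are tried, and `s + 1` augmenting
paths decide whether at most `s` vertices separate `P` from `S \ P` (`wp_flow`, `wp_split`). Such a
separator `X`, if both parts have at most `2 s` elements, is placed and the region is divided along
it (`divideCmd`); otherwise `s` is increased. By `TreeDecomposition.exists_isSeparation` the latter
can happen only for `s ≤ tw`: in an elimination order with sets `H i` of at most `tw` elements, the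
bag of the first node into which more than `s` elements of `S` have been merged is a balanced
separator (`Elim.exists_separation`). Hence the time is a function of `tw` times a polynomial.
-/

namespace SparsestCut

open Finset

/-! ### A loop language over scalars and arrays -/

/-- The names of the scalar variables. Those used throughout are the result `out`, the number `n` of
vertices, the number `m` of nodes of a tree decomposition, the number `nn` of nodes of a graph that
is searched, the number `pc` of vertices in the elimination order, the current vertex `u`, the label
`l` of a region, and the size `s` of separators. In the dynamic program, `kk` is the number of
colours, `K` the number of colourings of a bag, `M` the number of weights, and `rr` the base of the
number system for weights. -/
inductive Sc
  | out | n | nsucc | nsq | m | msq | mn | nn | cnt | pc | u | l | kk | rr | M | K | w | sl | i | pa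
  | g | o | s | rounds | choices | found | hit | cur | y | fst | snd | it
  deriving DecidableEq

/-- The names of the arrays. Two-dimensional ones are stored row by row: the graph `adj`, the sets
`H` of an elimination order, the sets `W` from which these are taken, and the directed graph `E` that
is searched with marks `D` and predecessors `F`. The array `ord` is the elimination order, `plc`
marks its elements, and `T` is the table of the dynamic program. -/
inductive Ar
  | adj | ord | H | W | plc | E | D | F | slot | pw | rp | T | U | V | side | lab | pos
  deriving DecidableEq

/-- The values of all variables. -/
@[ext] structure St where
  sc : Sc → ℕ
  ar : Ar → ℕ → ℕ

/-- Assign to a scalar. -/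
def St.setSc (σ : St) (j : Sc) (v : ℕ) : St := ⟨Function.update σ.sc j v, σ.ar⟩

/-- Assign to an array entry. -/
def St.setAr (σ : St) (a : Ar) (i v : ℕ) : St :=
  ⟨σ.sc, Function.update σ.ar a (Function.update (σ.ar a) i v)⟩

@[simp] lemma St.setSc_sc (σ : St) (j j' : Sc) (v : ℕ) :
    (σ.setSc j v).sc j' = if j' = j then v else σ.sc j' := by
  simp [St.setSc, Function.update_apply]

@[simp] lemma St.setSc_ar (σ : St) (j : Sc) (v : ℕ) : (σ.setSc j v).ar = σ.ar := rfl

@[simp] lemma St.setAr_sc (σ : St) (a : Ar) (i v : ℕ) : (σ.setAr a i v).sc = σ.sc := rfl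

@[simp] lemma St.setAr_ar (σ : St) (a a' : Ar) (i i' v : ℕ) :
    (σ.setAr a i v).ar a' i' = if a' = a ∧ i' = i then v else σ.ar a' i' := by
  by_cases h : a' = a
  · subst h; simp [St.setAr, Function.update_apply]
  · simp [St.setAr, h]

/-- Arithmetic expressions. `inp e` reads the input, `ar a e` reads entry `e` of the array `a`, and
`sum x j e` is the sum of `e` over all values of the variable `x` below the scalar `j`. -/
inductive Expr
  | lit (c : ℕ)
  | var (x : ℕ)
  | sc (j : Sc)
  | inp (e : Expr)
  | ar (a : Ar) (e : Expr)
  | add (e f : Expr)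
  | sub (e f : Expr)
  | mul (e f : Expr)
  | div (e f : Expr)
  | sum (x : ℕ) (j : Sc) (e : Expr)

namespace Expr

instance : Add Expr := ⟨Expr.add⟩
instance : Sub Expr := ⟨Expr.sub⟩
instance : Mul Expr := ⟨Expr.mul⟩
instance : Div Expr := ⟨Expr.div⟩
instance (c : ℕ) : OfNat Expr c := ⟨Expr.lit c⟩
instance : Coe Sc Expr := ⟨Expr.sc⟩

/-- The value of an expression, for the input `I` and the values `ρ` of the bound variables. -/
def eval (I : ℕ → ℕ) : Expr → (ℕ → ℕ) → St → ℕ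
  | lit c, _, _ => c
  | var x, ρ, _ => ρ x
  | sc j, _, σ => σ.sc j
  | inp e, ρ, σ => I (e.eval I ρ σ)
  | ar a e, ρ, σ => σ.ar a (e.eval I ρ σ)
  | add e f, ρ, σ => e.eval I ρ σ + f.eval I ρ σ
  | sub e f, ρ, σ => e.eval I ρ σ - f.eval I ρ σ
  | mul e f, ρ, σ => e.eval I ρ σ * f.eval I ρ σ
  | div e f, ρ, σ => e.eval I ρ σ / f.eval I ρ σ
  | sum x j e, ρ, σ => ∑ i ∈ range (σ.sc j), e.eval I (Function.update ρ x i) σ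

variable (I : ℕ → ℕ) (ρ : ℕ → ℕ) (σ : St) (e f : Expr)

@[simp] lemma eval_ofNat (c : ℕ) [c.AtLeastTwo] :
    eval I (no_index (OfNat.ofNat c)) ρ σ = OfNat.ofNat c := rfl
@[simp] lemma eval_zero : eval I 0 ρ σ = 0 := rfl
@[simp] lemma eval_one : eval I 1 ρ σ = 1 := rfl
@[simp] lemma eval_lit (c : ℕ) : eval I (lit c) ρ σ = c := rfl
@[simp] lemma eval_var (x : ℕ) : eval I (var x) ρ σ = ρ x := rfl
@[simp] lemma eval_sc (j : Sc) : eval I (sc j) ρ σ = σ.sc j := rfl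
@[simp] lemma eval_inp : eval I (inp e) ρ σ = I (e.eval I ρ σ) := rfl
@[simp] lemma eval_ar (a : Ar) : eval I (ar a e) ρ σ = σ.ar a (e.eval I ρ σ) := rfl
@[simp] lemma eval_add : eval I (e + f) ρ σ = e.eval I ρ σ + f.eval I ρ σ := rfl
@[simp] lemma eval_sub : eval I (e - f) ρ σ = e.eval I ρ σ - f.eval I ρ σ := rfl
@[simp] lemma eval_mul : eval I (e * f) ρ σ = e.eval I ρ σ * f.eval I ρ σ := rfl
@[simp] lemma eval_div : eval I (e / f) ρ σ = e.eval I ρ σ / f.eval I ρ σ := rfl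
@[simp] lemma eval_sum (x : ℕ) (j : Sc) : eval I (sum x j e) ρ σ =
    ∑ i ∈ range (σ.sc j), e.eval I (Function.update ρ x i) σ := rfl

/-- An expression used as a condition is true if its value is not `0`. -/
def Holds : Prop := e.eval I ρ σ ≠ 0

instance : Decidable (Holds I ρ σ e) := inferInstanceAs (Decidable (_ ≠ _))

/-- Negation, as a number `0` or `1`. -/
def not : Expr := 1 - e
/-- The truth value, as `0` or `1`. -/
def tv : Expr := e.not.not
/-- The comparison of two values, as `0` or `1`. -/
def lt : Expr := (f - e).tv
/-- The comparison of two values, as `0` or `1`. -/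
def le : Expr := (f.lt e).not
/-- Equality of two values, as `0` or `1`. -/
def eq : Expr := e.le f * f.le e
/-- Bounded existential quantifier. -/
def ex (x : ℕ) (j : Sc) : Expr := sum x j e
/-- Bounded universal quantifier. -/
def all (x : ℕ) (j : Sc) : Expr := (e.not.ex x j).not
/-- The remainder of a division; division by `0` leaves the dividend. -/
def mod : Expr := e - (e / f) * f

lemma eval_tv : eval I e.tv ρ σ = if Holds I ρ σ e then 1 else 0 := by
  by_cases h : Holds I ρ σ e <;> simp only [h, if_true, if_false] <;>
    simp only [tv, not, eval_sub, eval_one, Holds] at h ⊢ <;> omega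

lemma eval_mod : eval I (e.mod f) ρ σ = e.eval I ρ σ % f.eval I ρ σ := by
  simp only [mod, eval_sub, eval_mul, eval_div]
  rw [Nat.mod_eq_sub_mul_div, mul_comm]

@[simp] lemma holds_not : Holds I ρ σ e.not ↔ ¬ Holds I ρ σ e := by
  simp only [not, eval_sub, eval_one, Holds]; omega

@[simp] lemma holds_tv : Holds I ρ σ e.tv ↔ Holds I ρ σ e := by simp [tv]

@[simp] lemma holds_lt : Holds I ρ σ (e.lt f) ↔ e.eval I ρ σ < f.eval I ρ σ := by
  simp only [lt, holds_tv]; simp only [Holds, eval_sub]; omega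

@[simp] lemma holds_le : Holds I ρ σ (e.le f) ↔ e.eval I ρ σ ≤ f.eval I ρ σ := by
  simp [le]

@[simp] lemma holds_mul : Holds I ρ σ (e * f) ↔ Holds I ρ σ e ∧ Holds I ρ σ f := by
  simp [Holds]

@[simp] lemma holds_add : Holds I ρ σ (e + f) ↔ Holds I ρ σ e ∨ Holds I ρ σ f := by
  simp only [Holds, eval_add]; omega

@[simp] lemma holds_eq : Holds I ρ σ (e.eq f) ↔ e.eval I ρ σ = f.eval I ρ σ := by
  simp only [eq, holds_mul, holds_le]; omega

@[simp] lemma holds_ex (x : ℕ) (j : Sc) : Holds I ρ σ (e.ex x j) ↔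
    ∃ i < σ.sc j, Holds I (Function.update ρ x i) σ e := by
  simp [Holds, ex, Finset.sum_eq_zero_iff]

@[simp] lemma holds_all (x : ℕ) (j : Sc) : Holds I ρ σ (e.all x j) ↔
    ∀ i < σ.sc j, Holds I (Function.update ρ x i) σ e := by
  simp [all]

@[simp] lemma holds_ar (a : Ar) : Holds I ρ σ (ar a e) ↔ σ.ar a (e.eval I ρ σ) ≠ 0 := Iff.rfl
@[simp] lemma holds_sc (j : Sc) : Holds I ρ σ (sc j) ↔ σ.sc j ≠ 0 := Iff.rfl

/-- The number of values of `x` below the scalar `j` for which a condition holds. -/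
def count (x : ℕ) (j : Sc) : Expr := sum x j e.tv

lemma eval_count (x : ℕ) (j : Sc) : eval I (e.count x j) ρ σ =
    #{i ∈ range (σ.sc j) | Holds I (Function.update ρ x i) σ e} := by
  simp [count, eval_tv]

end Expr

/-- Commands: assignments to scalars and to array entries, and loops `loop x j c` that run `c` for
all values of the variable `x` below the value that the scalar `j` has at the beginning. -/
inductive Cmd
  | skip
  | set (j : Sc) (e : Expr)
  | put (a : Ar) (e f : Expr)
  | seq (c d : Cmd)
  | ite (e : Expr) (c d : Cmd)
  | loop (x : ℕ) (j : Sc) (c : Cmd)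

infixr:60 " ;; " => Cmd.seq

/-- Bounds that a command has to respect: for the indices and the values of array entries, and for
the values of the scalars. -/
structure Bounds where
  idx : ℕ
  val : ℕ
  sc : Sc → ℕ

namespace Cmd

open SparsestCut.Expr

/-- Conditional without alternative. -/
def when (e : Expr) (c : Cmd) : Cmd := .ite e c .skip

/-- The effect of a command. -/
def exec (I : ℕ → ℕ) : Cmd → (ℕ → ℕ) → St → St
  | skip, _, σ => σ
  | set j e, ρ, σ => σ.setSc j (e.eval I ρ σ)
  | put a e f, ρ, σ => σ.setAr a (e.eval I ρ σ) (f.eval I ρ σ)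
  | seq c d, ρ, σ => d.exec I ρ (c.exec I ρ σ)
  | ite e c d, ρ, σ => if Holds I ρ σ e then c.exec I ρ σ else d.exec I ρ σ
  | loop x j c, ρ, σ => Nat.rec σ (fun i τ => c.exec I (Function.update ρ x i) τ) (σ.sc j)

/-- All assignments made by a command respect the bounds. -/
def Safe (I : ℕ → ℕ) (bd : Bounds) : Cmd → (ℕ → ℕ) → St → Prop
  | skip, _, _ => True
  | set j e, ρ, σ => e.eval I ρ σ ≤ bd.sc j
  | put _ e f, ρ, σ => e.eval I ρ σ < bd.idx ∧ f.eval I ρ σ ≤ bd.val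
  | seq c d, ρ, σ => c.Safe I bd ρ σ ∧ d.Safe I bd ρ (c.exec I ρ σ)
  | ite e c d, ρ, σ => if Holds I ρ σ e then c.Safe I bd ρ σ else d.Safe I bd ρ σ
  | loop x j c, ρ, σ => ∀ i < σ.sc j, c.Safe I bd (Function.update ρ x i)
      (Nat.rec σ (fun i τ => c.exec I (Function.update ρ x i) τ) i)

/-- The command respects the bounds, and the state that it leads to has the property `Q`. -/
def Wp (I : ℕ → ℕ) (bd : Bounds) (c : Cmd) (ρ : ℕ → ℕ) (Q : St → Prop) (σ : St) : Prop :=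
  c.Safe I bd ρ σ ∧ Q (c.exec I ρ σ)

/-- The scalars to which a command assigns. -/
def scs : Cmd → List Sc
  | skip => []
  | set j _ => [j]
  | put _ _ _ => []
  | seq c d => c.scs ++ d.scs
  | ite _ c d => c.scs ++ d.scs
  | loop _ _ c => c.scs

/-- The arrays to which a command assigns. -/
def ars : Cmd → List Ar
  | skip => []
  | set _ _ => []
  | put a _ _ => [a]
  | seq c d => c.ars ++ d.ars
  | ite _ c d => c.ars ++ d.ars
  | loop _ _ c => c.ars

/-- Two states agree except for the scalars and arrays to which `c` assigns. -/
structure Frame (c : Cmd) (σ τ : St) : Prop where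
  sc : ∀ j, j ∉ c.scs → τ.sc j = σ.sc j
  ar : ∀ a, a ∉ c.ars → τ.ar a = σ.ar a

variable {I : ℕ → ℕ} {bd : Bounds} {ρ : ℕ → ℕ} {σ : St} {Q Q' : St → Prop} {c d : Cmd}

lemma Frame.refl (c : Cmd) (σ : St) : Frame c σ σ := ⟨fun _ _ => rfl, fun _ _ => rfl⟩

lemma Frame.trans {c : Cmd} {σ τ υ : St} (h : Frame c σ τ) (h' : Frame c τ υ) : Frame c σ υ :=
  ⟨fun j hj => (h'.sc j hj).trans (h.sc j hj), fun a ha => (h'.ar a ha).trans (h.ar a ha)⟩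

lemma frame_exec (c : Cmd) (ρ : ℕ → ℕ) (σ : St) : Frame c σ (c.exec I ρ σ) := by
  induction c generalizing ρ σ with
  | skip => exact Frame.refl _ _
  | set j e =>
    refine ⟨fun j' h => ?_, fun a _ => rfl⟩
    simp only [scs, List.mem_singleton] at h
    simp [exec, h]
  | put a e f =>
    refine ⟨fun j' _ => rfl, fun a' h => ?_⟩
    simp only [ars, List.mem_singleton] at h
    funext i
    simp [exec, h]
  | seq c d hc hd =>
    refine ⟨fun j h => ?_, fun a h => ?_⟩
    · simp only [scs, List.mem_append, not_or] at h
      exact ((hd _ _).sc j h.2).trans ((hc _ _).sc j h.1)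
    · simp only [ars, List.mem_append, not_or] at h
      exact ((hd _ _).ar a h.2).trans ((hc _ _).ar a h.1)
  | ite e c d hc hd =>
    refine ⟨fun j h => ?_, fun a h => ?_⟩
    · simp only [scs, List.mem_append, not_or] at h
      simp only [exec]
      split_ifs
      exacts [(hc _ _).sc j h.1, (hd _ _).sc j h.2]
    · simp only [ars, List.mem_append, not_or] at h
      simp only [exec]
      split_ifs
      exacts [(hc _ _).ar a h.1, (hd _ _).ar a h.2]
  | loop x j c hc =>
    simp only [exec]
    generalize σ.sc j = k
    induction k with
    | zero => exact Frame.refl _ _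
    | succ k ih => exact Frame.trans ih ⟨(hc _ _).sc, (hc _ _).ar⟩

@[simp] lemma wp_skip : Wp I bd skip ρ Q σ ↔ Q σ := by simp [Wp, Safe, exec]

@[simp] lemma wp_set {j : Sc} {e : Expr} : Wp I bd (set j e) ρ Q σ ↔
    e.eval I ρ σ ≤ bd.sc j ∧ Q (σ.setSc j (e.eval I ρ σ)) := by simp [Wp, Safe, exec]

@[simp] lemma wp_put {a : Ar} {e f : Expr} : Wp I bd (put a e f) ρ Q σ ↔
    (e.eval I ρ σ < bd.idx ∧ f.eval I ρ σ ≤ bd.val) ∧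
      Q (σ.setAr a (e.eval I ρ σ) (f.eval I ρ σ)) := by simp [Wp, Safe, exec]

@[simp] lemma wp_seq : Wp I bd (c ;; d) ρ Q σ ↔ Wp I bd c ρ (Wp I bd d ρ Q) σ := by
  simp [Wp, Safe, exec, and_assoc]

lemma wp_seq_assoc {c' : Cmd} : Wp I bd ((c ;; d) ;; c') ρ Q σ ↔ Wp I bd (c ;; d ;; c') ρ Q σ := by
  simp [Wp, Safe, exec, and_assoc]

lemma wp_ite {e : Expr} : Wp I bd (ite e c d) ρ Q σ ↔
    (Holds I ρ σ e → Wp I bd c ρ Q σ) ∧ (¬ Holds I ρ σ e → Wp I bd d ρ Q σ) := by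
  by_cases h : Holds I ρ σ e <;> simp [Wp, Safe, exec, h]

lemma wp_when {e : Expr} : Wp I bd (when e c) ρ Q σ ↔
    (Holds I ρ σ e → Wp I bd c ρ Q σ) ∧ (¬ Holds I ρ σ e → Q σ) := by
  simp [when, wp_ite]

lemma Wp.mono (h : Wp I bd c ρ Q σ) (hQ : ∀ τ, Frame c σ τ → Q τ → Q' τ) : Wp I bd c ρ Q' σ :=
  ⟨h.1, hQ _ (frame_exec _ _ _) h.2⟩

/-- The invariant rule for loops. -/
lemma wp_loop {x : ℕ} {j : Sc} (Inv : ℕ → St → Prop) (h0 : Inv 0 σ)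
    (hstep : ∀ i < σ.sc j, ∀ τ, Frame c σ τ → Inv i τ →
      Wp I bd c (Function.update ρ x i) (Inv (i + 1)) τ)
    (hQ : ∀ τ, Frame c σ τ → Inv (σ.sc j) τ → Q τ) : Wp I bd (loop x j c) ρ Q σ := by
  have key : ∀ k ≤ σ.sc j, ∀ τ, τ = Nat.rec (motive := fun _ => St) σ
      (fun i τ => c.exec I (Function.update ρ x i) τ) k → Frame c σ τ ∧ Inv k τ := by
    intro k
    induction k with
    | zero => rintro - τ rfl; exact ⟨Frame.refl _ _, h0⟩
    | succ k ih =>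
      rintro hk τ rfl
      obtain ⟨hf, hi⟩ := ih (by omega) _ rfl
      exact ⟨hf.trans (frame_exec _ _ _), (hstep k (by omega) _ hf hi).2⟩
  refine ⟨fun i hi => ?_, ?_⟩
  · obtain ⟨hf, hi'⟩ := key i hi.le _ rfl
    exact (hstep i hi _ hf hi').1
  · obtain ⟨hf, hi'⟩ := key _ le_rfl _ rfl
    exact hQ _ hf hi'

end Cmd

/-! ### Translation into machine programs -/

/-- The number by which the addresses of two consecutive entries of an array differ. -/
def stride : ℕ := 20

lemma Ar.ctorIdx_lt (a : Ar) : a.ctorIdx < stride := by cases a <;> decide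

lemma Sc.ctorIdx_inj {j j' : Sc} : j.ctorIdx = j'.ctorIdx ↔ j = j' :=
  ⟨fun h => by rw [← Sc.ofNat_ctorIdx j, h, Sc.ofNat_ctorIdx], fun h => h ▸ rfl⟩

lemma Ar.ctorIdx_inj {a a' : Ar} : a.ctorIdx = a'.ctorIdx ↔ a = a' :=
  ⟨fun h => by rw [← Ar.ofNat_ctorIdx a, h, Ar.ofNat_ctorIdx], fun h => h ▸ rfl⟩

/-- The register that holds a scalar. -/
def rS (j : Sc) : ℕ := 4 * j.ctorIdx
/-- The register that holds a loop variable. -/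
def rV (x : ℕ) : ℕ := 4 * x + 1
/-- The registers for intermediate results. -/
def rT (d : ℕ) : ℕ := 4 * d + 2
/-- A register that always holds `0`. -/
def rZero : ℕ := 3
/-- A register that always holds `1`. -/
def rOne : ℕ := 7
/-- The register with the address of the first memory cell after the input. -/
def rBase : ℕ := 11
/-- The register with an upper bound for the addresses of the cells written so far. Reading
above it is replaced by the value `0`, so that reading needs no bounds of its own. -/
def rLim : ℕ := 15

/-- Replace the address in register `rT d` by the contents of that cell if the address is less than
the contents of the register `lim`, and by `0` otherwise. -/
def guardedLoad (lim d : ℕ) : List Instr :=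
  [.sub (rT (d + 1)) lim (rT d), .sub (rT (d + 1)) rOne (rT (d + 1)),
    .sub (rT (d + 1)) rOne (rT (d + 1)), .mul (rT d) (rT d) (rT (d + 1)), .load (rT d) (rT d),
    .mul (rT d) (rT d) (rT (d + 1))]

/-- Turn the index in register `rT d` into the address of the entry of the array `a`, using the
register `rT t`. -/
def addressCode (a : Ar) (d t : ℕ) : List Instr :=
  [.const (rT t) stride, .mul (rT d) (rT d) (rT t), .const (rT t) a.ctorIdx,
    .add (rT d) (rT d) (rT t), .add (rT d) (rT d) rBase]

namespace Expr

/-- The number of instructions of the code of an expression. -/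
def len : Expr → ℕ
  | lit _ => 1
  | var _ => 1
  | sc _ => 1
  | inp e => e.len + 6
  | ar _ e => e.len + 11
  | add e f => e.len + f.len + 1
  | sub e f => e.len + f.len + 1
  | mul e f => e.len + f.len + 1
  | div e f => e.len + f.len + 1
  | sum _ _ e => e.len + 8

/-- Code that computes the value of an expression in the register `rT d`; it starts at position
`o` of the program and uses no register `rT d'` with `d' < d`. -/
def code : Expr → ℕ → ℕ → List Instr
  | lit c, _, d => [.const (rT d) c]
  | var x, _, d => [.add (rT d) (rV x) rZero]
  | sc j, _, d => [.add (rT d) (rS j) rZero]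
  | inp e, o, d => e.code o d ++ guardedLoad rBase d
  | ar a e, o, d => e.code o d ++ (addressCode a d (d + 1) ++ guardedLoad rLim d)
  | add e f, o, d => e.code o d ++ (f.code (o + e.len) (d + 1) ++ [.add (rT d) (rT d) (rT (d + 1))])
  | sub e f, o, d => e.code o d ++ (f.code (o + e.len) (d + 1) ++ [.sub (rT d) (rT d) (rT (d + 1))])
  | mul e f, o, d => e.code o d ++ (f.code (o + e.len) (d + 1) ++ [.mul (rT d) (rT d) (rT (d + 1))])
  | div e f, o, d => e.code o d ++ (f.code (o + e.len) (d + 1) ++ [.div (rT d) (rT d) (rT (d + 1))])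
  | sum x j e, o, d =>
    [.const (rT d) 0, .add (rT (d + 1)) (rS j) rZero, .const (rV x) 0] ++
      ([.jumpZero (rT (d + 1)) (o + e.len + 8)] ++ (e.code (o + 4) (d + 2) ++
        [.add (rT d) (rT d) (rT (d + 2)), .add (rV x) (rV x) rOne,
          .sub (rT (d + 1)) (rT (d + 1)) rOne, .jumpZero rZero (o + 3)]))

lemma length_code (e : Expr) (o d : ℕ) : (e.code o d).length = e.len := by
  induction e generalizing o d <;> simp [code, len, guardedLoad, addressCode, *] <;> omega

/-- A bound for the time that the code of an expression takes if the scalars are bounded by `B`. -/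
def cost (B : Sc → ℕ) : Expr → ℕ
  | lit _ => 1
  | var _ => 1
  | sc _ => 1
  | inp e => e.cost B + 6
  | ar _ e => e.cost B + 11
  | add e f => e.cost B + f.cost B + 1
  | sub e f => e.cost B + f.cost B + 1
  | mul e f => e.cost B + f.cost B + 1
  | div e f => e.cost B + f.cost B + 1
  | sum _ j e => B j * (e.cost B + 5) + 4

/-- If all variables, array entries and inputs are at most `Z`, then all numbers that occur in the
evaluation of an expression `e` are at most `Z ^ e.deg`. -/
def deg : Expr → ℕ
  | lit c => c + 1
  | var _ => 1
  | sc _ => 1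
  | inp e => e.deg + 1
  | ar a e => e.deg + stride + a.ctorIdx + 4
  | add e f => e.deg + f.deg
  | sub e f => e.deg + f.deg
  | mul e f => e.deg + f.deg
  | div e f => e.deg + f.deg
  | sum _ _ e => e.deg + 1

/-- All variables belong to the list or are bound by a sum, and no variable is bound
again within its scope. -/
def Scoped : List ℕ → Expr → Prop
  | _, lit _ => True
  | L, var y => y ∈ L
  | _, sc _ => True
  | L, inp e => e.Scoped L
  | L, ar _ e => e.Scoped L
  | L, add e f => e.Scoped L ∧ f.Scoped L
  | L, sub e f => e.Scoped L ∧ f.Scoped L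
  | L, mul e f => e.Scoped L ∧ f.Scoped L
  | L, div e f => e.Scoped L ∧ f.Scoped L
  | L, sum y _ e => y ∉ L ∧ e.Scoped (y :: L)

instance decScoped : ∀ (e : Expr) (L : List ℕ), Decidable (e.Scoped L)
  | lit _, _ => inferInstanceAs (Decidable True)
  | var _, _ => inferInstanceAs (Decidable (_ ∈ _))
  | sc _, _ => inferInstanceAs (Decidable True)
  | inp e, L => decScoped e L
  | ar _ e, L => decScoped e L
  | add e f, L => @instDecidableAnd _ _ (decScoped e L) (decScoped f L)
  | sub e f, L => @instDecidableAnd _ _ (decScoped e L) (decScoped f L)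
  | mul e f, L => @instDecidableAnd _ _ (decScoped e L) (decScoped f L)
  | div e f, L => @instDecidableAnd _ _ (decScoped e L) (decScoped f L)
  | sum y _ e, L => @instDecidableAnd (y ∉ L) _ _ (decScoped e (y :: L))

lemma deg_pos (e : Expr) : 0 < e.deg := by
  induction e <;> simp only [deg] <;> omega

end Expr

/-- The values of all scalars and array entries of a state are at most `Z`. -/
structure St.Le (σ : St) (Z : ℕ) : Prop where
  sc : ∀ j, σ.sc j ≤ Z
  ar : ∀ a i, σ.ar a i ≤ Z

lemma add_le_pow_add {Z a b x y : ℕ} (hZ : 2 ≤ Z) (ha : 0 < a) (hb : 0 < b) (hx : x ≤ Z ^ a)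
    (hy : y ≤ Z ^ b) : x + y ≤ Z ^ (a + b) := by
  have h1 : 2 ≤ Z ^ a := hZ.trans (Nat.le_self_pow ha.ne' Z)
  have h2 : 2 ≤ Z ^ b := hZ.trans (Nat.le_self_pow hb.ne' Z)
  rw [pow_add]; nlinarith

lemma le_pow_self {Z : ℕ} (hZ : 2 ≤ Z) (c : ℕ) : c ≤ Z ^ c :=
  (Nat.lt_pow_self (by omega)).le

lemma Expr.eval_le {I : ℕ → ℕ} {Z : ℕ} (hZ : 2 ≤ Z) (hI : ∀ a, I a ≤ Z) (e : Expr) {ρ : ℕ → ℕ}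
    {σ : St} (hρ : ∀ x, ρ x ≤ Z) (hσ : σ.Le Z) : e.eval I ρ σ ≤ Z ^ e.deg := by
  have mono : ∀ {a b x : ℕ}, a ≤ b → x ≤ Z ^ a → x ≤ Z ^ b := fun hab hx =>
    hx.trans (Nat.pow_le_pow_right (by omega) hab)
  have one : ∀ {b x : ℕ}, 1 ≤ b → x ≤ Z → x ≤ Z ^ b := fun hb hx => mono hb (by simpa using hx)
  induction e generalizing ρ with
  | lit c => exact mono (Nat.le_succ c) (le_pow_self hZ c)
  | var x => exact one le_rfl (hρ x)
  | sc j => exact one le_rfl (hσ.sc j)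
  | inp e ih => exact one (by simp [deg]) (hI _)
  | ar a e ih => exact one (by simp [deg]) (hσ.ar _ _)
  | add e f he hf => exact add_le_pow_add hZ e.deg_pos f.deg_pos (he hρ) (hf hρ)
  | sub e f he hf => exact (Nat.sub_le _ _).trans (mono (by simp [deg]) (he hρ))
  | mul e f he hf =>
    rw [deg, pow_add]; exact Nat.mul_le_mul (he hρ) (hf hρ)
  | div e f he hf => exact (Nat.div_le_self _ _).trans (mono (by simp [deg]) (he hρ))
  | sum x j e he =>
    simp only [eval, deg]
    refine (Finset.sum_le_card_nsmul _ _ (Z ^ e.deg) fun i hi => he fun y => ?_).trans ?_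
    · rw [Function.update_apply]
      split_ifs
      · exact (mem_range.1 hi).le.trans (hσ.sc j)
      · exact hρ y
    · rw [card_range, smul_eq_mul, pow_succ']
      exact Nat.mul_le_mul_right _ (hσ.sc j)

namespace Cmd

/-- The number of instructions of the code of a command. -/
def len : Cmd → ℕ
  | skip => 0
  | set _ e => e.len + 1
  | put _ e f => e.len + f.len + 9
  | seq c d => c.len + d.len
  | ite e c d => e.len + c.len + d.len + 2
  | loop _ _ c => c.len + 6

/-- Code that carries out a command. It starts at position `o` of the program and uses no register
`rT d'` with `d' < d`. An assignment to an array entry raises the contents of `rLim` above the address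
it writes to. A loop keeps the number of remaining rounds in `rT d`. -/
def code : Cmd → ℕ → ℕ → List Instr
  | skip, _, _ => []
  | set j e, o, d => e.code o d ++ [.add (rS j) (rT d) rZero]
  | put a e f, o, d => e.code o d ++ (f.code (o + e.len) (d + 1) ++ (addressCode a d (d + 2) ++
      [.add (rT (d + 2)) (rT d) rOne, .sub (rT (d + 2)) (rT (d + 2)) rLim,
        .add rLim rLim (rT (d + 2)), .store (rT d) (rT (d + 1))]))
  | seq c c', o, d => c.code o d ++ c'.code (o + c.len) d
  | ite e c c', o, d => e.code o d ++ ([.jumpZero (rT d) (o + e.len + c.len + 2)] ++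
      (c.code (o + e.len + 1) d ++ ([.jumpZero rZero (o + e.len + c.len + c'.len + 2)] ++
        c'.code (o + e.len + c.len + 2) d)))
  | loop x j c, o, d =>
    [.add (rT d) (rS j) rZero, .const (rV x) 0] ++ ([.jumpZero (rT d) (o + c.len + 6)] ++
      (c.code (o + 3) (d + 1) ++ [.add (rV x) (rV x) rOne, .sub (rT d) (rT d) rOne,
        .jumpZero rZero (o + 2)]))

lemma length_code (c : Cmd) (o d : ℕ) : (c.code o d).length = c.len := by
  induction c generalizing o d <;>
    simp [code, len, addressCode, Expr.length_code, *] <;> omega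

/-- A bound for the time that the code of a command takes if the scalars are bounded by `B`. -/
def cost (B : Sc → ℕ) : Cmd → ℕ
  | skip => 0
  | set _ e => e.cost B + 1
  | put _ e f => e.cost B + f.cost B + 9
  | seq c d => c.cost B + d.cost B
  | ite e c d => e.cost B + c.cost B + d.cost B + 2
  | loop _ j c => B j * (c.cost B + 4) + 3

/-- If all variables, array entries and inputs are at most `Z`, then all numbers that occur in the
execution of a command `c` are at most `Z ^ c.deg`. -/
def deg : Cmd → ℕ
  | skip => 1
  | set _ e => e.deg
  | put a e f => e.deg + f.deg + stride + a.ctorIdx + 4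
  | seq c d => c.deg + d.deg
  | ite e c d => e.deg + c.deg + d.deg
  | loop _ _ c => c.deg + 1

/-- All variables belong to the list or are bound by a loop or a sum, and no variable is bound
again within its scope. -/
def Scoped : List ℕ → Cmd → Prop
  | _, skip => True
  | L, set _ e => e.Scoped L
  | L, put _ e f => e.Scoped L ∧ f.Scoped L
  | L, seq c d => c.Scoped L ∧ d.Scoped L
  | L, ite e c d => e.Scoped L ∧ c.Scoped L ∧ d.Scoped L
  | L, loop y _ c => y ∉ L ∧ c.Scoped (y :: L)

instance decScoped : ∀ (c : Cmd) (L : List ℕ), Decidable (c.Scoped L)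
  | skip, _ => inferInstanceAs (Decidable True)
  | set _ e, L => e.decScoped L
  | put _ e f, L => @instDecidableAnd _ _ (e.decScoped L) (f.decScoped L)
  | seq c d, L => @instDecidableAnd _ _ (decScoped c L) (decScoped d L)
  | ite e c d, L => @instDecidableAnd _ _ (e.decScoped L)
      (@instDecidableAnd _ _ (decScoped c L) (decScoped d L))
  | loop y _ c, L => @instDecidableAnd (y ∉ L) _ _ (decScoped c (y :: L))

end Cmd

/-! ### Runs of machine programs -/

/-- No register or memory cell holds a number greater than `V`. -/
structure Config.Le (s : Config) (V : ℕ) : Prop where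
  reg : ∀ r, s.reg r ≤ V
  mem : ∀ a, s.mem a ≤ V

/-- In the configuration `s` no number exceeds `V`, and the next instruction accesses no cell of
address `A` or more. -/
structure Config.Good (P : Program) (A V : ℕ) (s : Config) : Prop where
  le : s.Le V
  addr : ∀ i ∈ P[s.pc]?, ∀ a ∈ i.address s, a < A

/-- The program `P` leads from `s` to `s'` within at most `T` steps, and all configurations before
`s'` are good. -/
def Reach (P : Program) (A V T : ℕ) (s s' : Config) : Prop :=
  ∃ t ≤ T, (step P)^[t] s = s' ∧ ∀ u < t, ((step P)^[u] s).Good P A V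

section
variable {P : Program} {A V T T' : ℕ} {s s' s'' : Config}

lemma Reach.refl (P : Program) (A V T : ℕ) (s : Config) : Reach P A V T s s :=
  ⟨0, T.zero_le, rfl, by simp⟩

lemma Reach.trans (h : Reach P A V T s s') (h' : Reach P A V T' s' s'') :
    Reach P A V (T + T') s s'' := by
  obtain ⟨t, ht, e, hg⟩ := h
  obtain ⟨t', ht', e', hg'⟩ := h'
  refine ⟨t' + t, by omega, by rw [Function.iterate_add_apply, e, e'], fun u hu => ?_⟩
  by_cases h : u < t
  · exact hg u h
  · obtain ⟨v, rfl⟩ := Nat.exists_eq_add_of_le' (not_lt.1 h)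
    rw [Function.iterate_add_apply, e]
    exact hg' v (by omega)

lemma Reach.mono (h : Reach P A V T s s') (hT : T ≤ T') : Reach P A V T' s s' := by
  obtain ⟨t, ht, e⟩ := h
  exact ⟨t, ht.trans hT, e⟩

/-- The code `l` stands in the program `P` from position `o` on. -/
def CodeAt (P : Program) (o : ℕ) (l : List Instr) : Prop := ∀ i, i < l.length → P[o + i]? = l[i]?

@[simp] lemma codeAt_nil {o : ℕ} : CodeAt P o [] := by simp [CodeAt]

lemma codeAt_cons {o : ℕ} {i : Instr} {l : List Instr} :
    CodeAt P o (i :: l) ↔ P[o]? = some i ∧ CodeAt P (o + 1) l := by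
  refine ⟨fun h => ⟨by simpa using h 0 (by simp), fun j hj => ?_⟩, fun h j hj => ?_⟩
  · simpa [add_assoc, add_comm 1] using h (j + 1) (by simpa using hj)
  · cases j with
    | zero => simpa using h.1
    | succ j => simpa [add_assoc, add_comm 1] using h.2 j (by simpa using hj)

lemma codeAt_append {o : ℕ} {l l' : List Instr} :
    CodeAt P o (l ++ l') ↔ CodeAt P o l ∧ CodeAt P (o + l.length) l' := by
  induction l generalizing o with
  | nil => simp
  | cons i l ih => simp [codeAt_cons, ih, and_assoc, add_assoc, add_comm 1]

lemma reach_step {i : Instr} (hi : P[s.pc]? = some i) (hs : s.Le V)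
    (ha : ∀ a ∈ i.address s, a < A) : Reach P A V 1 s (i.exec s) := by
  refine ⟨1, le_rfl, by simp [step, hi], fun u hu => ?_⟩
  obtain rfl : u = 0 := by omega
  exact ⟨hs, by simpa [hi] using ha⟩

lemma Config.Le.setReg (hs : s.Le V) {r v : ℕ} (hv : v ≤ V) : (s.setReg r v).Le V :=
  ⟨fun r' => by simp only [Config.setReg, Function.update_apply]; split_ifs <;> simp [hv, hs.reg],
    hs.mem⟩

/-- Instructions without jumps may be executed one after the other, starting from `s`. -/
def Straight (A V : ℕ) : List Instr → Config → Prop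
  | [], _ => True
  | i :: l, s => (i.exec s).pc = s.pc + 1 ∧ (∀ a ∈ i.address s, a < A) ∧ (i.exec s).Le V ∧
      Straight A V l (i.exec s)

lemma reach_straight {l : List Instr} (hP : CodeAt P s.pc l) (hs : s.Le V) (hl : Straight A V l s) :
    Reach P A V l.length s (l.foldl (fun s i => i.exec s) s) ∧
      (l.foldl (fun s i => i.exec s) s).Le V := by
  induction l generalizing s with
  | nil => exact ⟨Reach.refl _ _ _ _ _, hs⟩
  | cons i l ih =>
    obtain ⟨h1, h2, h3, h4⟩ := hl
    rw [codeAt_cons] at hP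
    obtain ⟨h5, h6⟩ := ih (h1 ▸ hP.2) h3 h4
    exact ⟨by simpa [add_comm] using (reach_step hP.1 hs h2).trans h5, h6⟩

end

/-! ### Correctness of the translation -/

@[simp] lemma Config.setReg_reg (s : Config) (r r' v : ℕ) :
    (s.setReg r v).reg r' = if r' = r then v else s.reg r' := by
  simp [Config.setReg, Function.update_apply]

@[simp] lemma Config.setReg_mem (s : Config) (r v : ℕ) : (s.setReg r v).mem = s.mem := rfl

@[simp] lemma Config.setReg_pc (s : Config) (r v : ℕ) : (s.setReg r v).pc = s.pc + 1 := rfl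

section registers
variable (d d' x y : ℕ) (j j' : Sc)
@[simp] lemma rT_inj : rT d = rT d' ↔ d = d' := by unfold rT; omega
@[simp] lemma rV_inj : rV x = rV y ↔ x = y := by unfold rV; omega
@[simp] lemma rS_inj : rS j = rS j' ↔ j = j' := by
  rw [← Sc.ctorIdx_inj]; unfold rS; omega
@[simp] lemma rT_ne_rV : rT d ≠ rV x := by unfold rT rV; omega
@[simp] lemma rV_ne_rT : rV x ≠ rT d := by unfold rT rV; omega
@[simp] lemma rT_ne_rS : rT d ≠ rS j := by unfold rT rS; omega
@[simp] lemma rS_ne_rT : rS j ≠ rT d := by unfold rT rS; omega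
@[simp] lemma rS_ne_rV : rS j ≠ rV x := by unfold rV rS; omega
@[simp] lemma rV_ne_rS : rV x ≠ rS j := by unfold rV rS; omega
@[simp] lemma rZero_ne_rT : rZero ≠ rT d := by unfold rT rZero; omega
@[simp] lemma rOne_ne_rT : rOne ≠ rT d := by unfold rT rOne; omega
@[simp] lemma rBase_ne_rT : rBase ≠ rT d := by unfold rT rBase; omega
@[simp] lemma rLim_ne_rT : rLim ≠ rT d := by unfold rT rLim; omega
@[simp] lemma rT_ne_rLim : rT d ≠ rLim := by unfold rT rLim; omega
@[simp] lemma rZero_ne_rV : rZero ≠ rV x := by unfold rV rZero; omega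
@[simp] lemma rOne_ne_rV : rOne ≠ rV x := by unfold rV rOne; omega
@[simp] lemma rBase_ne_rV : rBase ≠ rV x := by unfold rV rBase; omega
@[simp] lemma rLim_ne_rV : rLim ≠ rV x := by unfold rV rLim; omega
@[simp] lemma rV_ne_rLim : rV x ≠ rLim := by unfold rV rLim; omega
@[simp] lemma rZero_ne_rS : rZero ≠ rS j := by unfold rS rZero; omega
@[simp] lemma rOne_ne_rS : rOne ≠ rS j := by unfold rS rOne; omega
@[simp] lemma rBase_ne_rS : rBase ≠ rS j := by unfold rS rBase; omega
@[simp] lemma rLim_ne_rS : rLim ≠ rS j := by unfold rS rLim; omega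
@[simp] lemma rS_ne_rLim : rS j ≠ rLim := by unfold rS rLim; omega
@[simp] lemma rZero_ne_rLim : rZero ≠ rLim := by unfold rZero rLim; omega
@[simp] lemma rOne_ne_rLim : rOne ≠ rLim := by unfold rOne rLim; omega
@[simp] lemma rBase_ne_rLim : rBase ≠ rLim := by unfold rBase rLim; omega
end registers

/-- Between `s` and `s'` only registers for intermediate results from number `d` on, and registers
of variables outside of `L`, have changed. -/
structure Keep (L : List ℕ) (d : ℕ) (s s' : Config) : Prop where
  mem : s'.mem = s.mem
  reg : ∀ r, (∀ d', d ≤ d' → r ≠ rT d') → (∀ y, y ∉ L → r ≠ rV y) → s'.reg r = s.reg r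

lemma Keep.trans {L : List ℕ} {d : ℕ} {s s' s'' : Config} (h : Keep L d s s')
    (h' : Keep L d s' s'') : Keep L d s s'' :=
  ⟨h'.mem.trans h.mem, fun r h1 h2 => (h'.reg r h1 h2).trans (h.reg r h1 h2)⟩

lemma Keep.mono {L L' : List ℕ} {d d' : ℕ} {s s' : Config} (h : Keep L d s s') (hd : d' ≤ d)
    (hL : ∀ y ∈ L', y ∈ L) : Keep L' d' s s' :=
  ⟨h.mem, fun r h1 h2 => h.reg r (fun e he => h1 e (hd.trans he)) fun y hy =>
    h2 y fun hy' => hy (hL y hy')⟩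

lemma Keep.tmp {L : List ℕ} {d d' : ℕ} {s s' : Config} (h : Keep L d s s') (hd : d' < d) :
    s'.reg (rT d') = s.reg (rT d') :=
  h.reg _ (fun e he => by simp; omega) (by simp)

/-- The configuration `s` represents the state `σ` and the values `ρ` of the variables in `L`; the
input `I` stands below the address `base`. -/
structure Rep (I : ℕ → ℕ) (base bnd : ℕ) (L : List ℕ) (ρ : ℕ → ℕ) (σ : St) (s : Config) :
    Prop where
  sc : ∀ j, s.reg (rS j) = σ.sc j
  var : ∀ y ∈ L, s.reg (rV y) = ρ y
  zero : s.reg rZero = 0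
  one : s.reg rOne = 1
  base_eq : s.reg rBase = base
  inp : ∀ a < base, s.mem a = I a
  ar : ∀ a i, s.mem (base + i * stride + a.ctorIdx) = σ.ar a i
  lim : ∀ b, s.reg rLim ≤ b → s.mem b = 0
  base_le : base ≤ s.reg rLim
  lim_le : s.reg rLim ≤ base + bnd * stride

section
variable {I : ℕ → ℕ} {base bnd : ℕ} {L : List ℕ} {ρ : ℕ → ℕ} {σ : St} {s s' : Config} {d : ℕ}
  {P : Program} {A V Z : ℕ}

lemma Rep.keep (h : Rep I base bnd L ρ σ s) (hk : Keep L d s s') : Rep I base bnd L ρ σ s' where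
  sc j := by rw [hk.reg _ (by simp) (by simp), h.sc]
  var y hy := by
    rw [hk.reg _ (by simp) fun z hz => by simp only [ne_eq, rV_inj]; rintro rfl; exact hz hy,
      h.var y hy]
  zero := by rw [hk.reg _ (by simp) (by simp), h.zero]
  one := by rw [hk.reg _ (by simp) (by simp), h.one]
  base_eq := by rw [hk.reg _ (by simp) (by simp), h.base_eq]
  inp a ha := by rw [hk.mem, h.inp a ha]
  ar a i := by rw [hk.mem, h.ar]
  lim b hb := by
    rw [hk.reg _ (by simp) (by simp)] at hb
    rw [hk.mem, h.lim b hb]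
  base_le := by rw [hk.reg _ (by simp) (by simp)]; exact h.base_le
  lim_le := by rw [hk.reg _ (by simp) (by simp)]; exact h.lim_le

lemma keep_setReg_tmp {e v : ℕ} (hd : d ≤ e) : Keep L d s (s.setReg (rT e) v) :=
  ⟨rfl, fun r h _ => by simp [h e hd]⟩

lemma reach_guardedLoad {lim : ℕ} (hP : CodeAt P s.pc (guardedLoad lim d)) (hs : s.Le V)
    (h1 : s.reg rOne = 1) (hlim : s.reg lim ≤ A) (hA : 0 < A) (hV : 1 ≤ V) :
    ∃ s', Reach P A V 6 s s' ∧ s'.Le V ∧ s'.pc = s.pc + 6 ∧ Keep L d s s' ∧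
      s'.reg (rT d) = if s.reg (rT d) < s.reg lim then s.mem (s.reg (rT d)) else 0 := by
  have hstr : Straight A V (guardedLoad lim d) s := by
    by_cases hc : s.reg (rT d) < s.reg lim
    · have e1 : 1 - (1 - (s.reg lim - s.reg (rT d))) = 1 := by omega
      simp only [guardedLoad, Straight, Instr.exec, Instr.address, Config.setReg_pc, Option.mem_def,
        reduceCtorEq, false_implies, implies_true, true_and, Config.setReg_reg, Config.setReg_mem,
        if_true, rOne_ne_rT, if_false, rT_inj, h1, e1, mul_one,
        show ∀ d, d ≠ d + 1 from fun d => by omega, show ∀ d, d + 1 ≠ d from fun d => by omega,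
        Option.some.injEq, forall_eq']
      have l1 := hs.setReg (r := rT (d + 1)) ((Nat.sub_le (s.reg lim) (s.reg (rT d))).trans
        (hs.reg lim))
      have l2 := l1.setReg (r := rT (d + 1)) (v := 1 - (s.reg lim - s.reg (rT d))) (by omega)
      have l3 := l2.setReg (r := rT (d + 1)) hV
      have l4 := l3.setReg (r := rT d) (hs.reg (rT d))
      have l5 := l4.setReg (r := rT d) (hs.mem (s.reg (rT d)))
      exact ⟨l1, l2, l3, l4, by omega, l5, l5.setReg (hs.mem _), trivial⟩
    · have e1 : 1 - (1 - (s.reg lim - s.reg (rT d))) = 0 := by omega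
      simp only [guardedLoad, Straight, Instr.exec, Instr.address, Config.setReg_pc, Option.mem_def,
        reduceCtorEq, false_implies, implies_true, true_and, Config.setReg_reg, Config.setReg_mem,
        if_true, rOne_ne_rT, if_false, rT_inj, h1, e1, mul_zero,
        show ∀ d, d ≠ d + 1 from fun d => by omega, show ∀ d, d + 1 ≠ d from fun d => by omega,
        Option.some.injEq, forall_eq']
      have l1 := hs.setReg (r := rT (d + 1)) ((Nat.sub_le (s.reg lim) (s.reg (rT d))).trans
        (hs.reg lim))
      have l2 := l1.setReg (r := rT (d + 1)) (v := 1 - (s.reg lim - s.reg (rT d))) (by omega)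
      have l3 := l2.setReg (r := rT (d + 1)) (v := 0) (by omega)
      have l4 := l3.setReg (r := rT d) (v := 0) (by omega)
      have l5 := l4.setReg (r := rT d) (hs.mem 0)
      exact ⟨l1, l2, l3, l4, hA, l5, l5.setReg (v := 0) (by omega), trivial⟩
  obtain ⟨hr, hle⟩ := reach_straight hP hs hstr
  refine ⟨_, hr, hle, ?_, ⟨?_, fun r hr' _ => ?_⟩, ?_⟩
  · simp [guardedLoad, Instr.exec]
  · simp [guardedLoad, Instr.exec]
  · simp [guardedLoad, Instr.exec, hr' d le_rfl, hr' (d + 1) (by omega)]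
  · simp only [guardedLoad, List.foldl, Instr.exec, Config.setReg_reg, Config.setReg_mem,
        if_true, rOne_ne_rT, if_false, rT_inj, h1,
        show ∀ d, d ≠ d + 1 from fun d => by omega, show ∀ d, d + 1 ≠ d from fun d => by omega]
    split_ifs with hc
    · have e1 : 1 - (1 - (s.reg lim - s.reg (rT d))) = 1 := by omega
      simp [e1]
    · have e1 : 1 - (1 - (s.reg lim - s.reg (rT d))) = 0 := by omega
      simp [e1]

lemma reach_addressCode {a : Ar} {t : ℕ} (hP : CodeAt P s.pc (addressCode a d t)) (hs : s.Le V)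
    (hdt : d < t) (hV : s.reg (rT d) * stride + a.ctorIdx + s.reg rBase ≤ V) (hV' : stride ≤ V) :
    ∃ s', Reach P A V 5 s s' ∧ s'.Le V ∧ s'.pc = s.pc + 5 ∧
      (∀ r, r ≠ rT d → r ≠ rT t → s'.reg r = s.reg r) ∧ s'.mem = s.mem ∧
      s'.reg (rT d) = s.reg rBase + s.reg (rT d) * stride + a.ctorIdx := by
  have hlt := a.ctorIdx_lt
  have hstr : Straight A V (addressCode a d t) s := by
    simp only [addressCode, Straight, Instr.exec, Instr.address, Config.setReg_pc, Option.mem_def,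
        reduceCtorEq, false_implies, implies_true, true_and, Config.setReg_reg,
        if_true, if_false, rT_inj, rBase_ne_rT, hdt.ne, hdt.ne']
    have l1 := hs.setReg (r := rT t) hV'
    have l2 := l1.setReg (r := rT d) (v := s.reg (rT d) * stride) (by omega)
    have l3 := l2.setReg (r := rT t) (v := a.ctorIdx) (by omega)
    have l4 := l3.setReg (r := rT d) (v := s.reg (rT d) * stride + a.ctorIdx) (by omega)
    exact ⟨l1, l2, l3, l4, l4.setReg hV, trivial⟩
  obtain ⟨hr, hle⟩ := reach_straight hP hs hstr
  refine ⟨_, hr, hle, ?_, fun r h1 h2 => ?_, ?_, ?_⟩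
  · simp [addressCode, Instr.exec]
  · simp [addressCode, Instr.exec, h1, h2]
  · simp [addressCode, Instr.exec]
  · simp [addressCode, Instr.exec, hdt.ne]; ring

/-- What is needed about the numbers `base`, `bnd` and the bounds for the translated programs. -/
structure Params (I : ℕ → ℕ) (base bnd Z V : ℕ) : Prop where
  two_le : 2 ≤ Z
  inp_le : ∀ a, I a ≤ Z
  inp_zero : ∀ a, base ≤ a → I a = 0
  base_pos : 0 < base
  base_le : base ≤ Z
  le_V : base + bnd * stride ≤ V

/-- The code of an expression computes its value. -/
theorem Expr.reach_code (hp : Params I base bnd Z V) (B : Sc → ℕ) (e : Expr) :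
    ∀ {o d : ℕ} {L : List ℕ} {ρ : ℕ → ℕ} {s : Config}, CodeAt P o (e.code o d) → s.pc = o →
    s.Le V → Rep I base bnd L ρ σ s → e.Scoped L → Z ^ e.deg ≤ V → (∀ x, ρ x ≤ Z) → σ.Le Z →
    (∀ j, σ.sc j ≤ B j) →
    ∃ s', Reach P (base + bnd * stride) V (e.cost B) s s' ∧ s'.Le V ∧ s'.pc = o + e.len ∧
      Keep L d s s' ∧ s'.reg (rT d) = e.eval I ρ σ := by
  have hZV : ∀ {k}, 0 < k → Z ^ k ≤ V → Z ≤ V := fun hk h =>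
    (Nat.le_self_pow hk.ne' Z).trans h
  have h2 := hp.two_le
  -- an arithmetic operation on two values that have been computed before
  have bin : ∀ (e f : Expr) (i : ℕ → Instr) (op : ℕ → ℕ → ℕ),
      (∀ d s, (i d).exec s = s.setReg (rT d) (op (s.reg (rT d)) (s.reg (rT (d + 1))))) →
      (∀ d s, (i d).address s = none) →
      (∀ {o d : ℕ} {L : List ℕ} {ρ : ℕ → ℕ} {s : Config}, CodeAt P o (e.code o d) → s.pc = o →
        s.Le V → Rep I base bnd L ρ σ s → e.Scoped L → Z ^ e.deg ≤ V → (∀ x, ρ x ≤ Z) → σ.Le Z →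
        (∀ j, σ.sc j ≤ B j) →
        ∃ s', Reach P (base + bnd * stride) V (e.cost B) s s' ∧ s'.Le V ∧ s'.pc = o + e.len ∧
          Keep L d s s' ∧ s'.reg (rT d) = e.eval I ρ σ) →
      (∀ {o d : ℕ} {L : List ℕ} {ρ : ℕ → ℕ} {s : Config}, CodeAt P o (f.code o d) → s.pc = o →
        s.Le V → Rep I base bnd L ρ σ s → f.Scoped L → Z ^ f.deg ≤ V → (∀ x, ρ x ≤ Z) → σ.Le Z →
        (∀ j, σ.sc j ≤ B j) →
        ∃ s', Reach P (base + bnd * stride) V (f.cost B) s s' ∧ s'.Le V ∧ s'.pc = o + f.len ∧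
          Keep L d s s' ∧ s'.reg (rT d) = f.eval I ρ σ) →
      ∀ {o d : ℕ} {L : List ℕ} {ρ : ℕ → ℕ} {s : Config},
        CodeAt P o (e.code o d ++ (f.code (o + e.len) (d + 1) ++ [i d])) → s.pc = o →
        s.Le V → Rep I base bnd L ρ σ s → (e.Scoped L ∧ f.Scoped L) → Z ^ (e.deg + f.deg) ≤ V →
        (∀ x, ρ x ≤ Z) → σ.Le Z → (∀ j, σ.sc j ≤ B j) →
        op (e.eval I ρ σ) (f.eval I ρ σ) ≤ V →
        ∃ s', Reach P (base + bnd * stride) V (e.cost B + f.cost B + 1) s s' ∧ s'.Le V ∧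
          s'.pc = o + (e.len + f.len + 1) ∧ Keep L d s s' ∧
          s'.reg (rT d) = op (e.eval I ρ σ) (f.eval I ρ σ) := by
    intro e f i op hi hia he hf o d L ρ s hP hpc hs hR hL hV hρ hσ hB hop
    rw [codeAt_append, codeAt_append, length_code, length_code] at hP
    obtain ⟨s1, r1, l1, p1, k1, v1⟩ := he hP.1 hpc hs hR hL.1
      ((Nat.pow_le_pow_right (by omega) (by omega)).trans hV) hρ hσ hB
    obtain ⟨s2, r2, l2, p2, k2, v2⟩ := hf hP.2.1 p1 l1 (hR.keep k1) hL.2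
      ((Nat.pow_le_pow_right (by omega) (by omega)).trans hV) hρ hσ hB
    have v1' : s2.reg (rT d) = e.eval I ρ σ := by rw [k2.tmp (by omega), v1]
    have r3 := reach_step (A := base + bnd * stride) (s := s2) (by
      rw [p2]; exact (codeAt_cons.1 hP.2.2).1) l2 (by simp [hia])
    rw [hi, v1', v2] at r3
    refine ⟨_, (r1.trans r2).trans r3, l2.setReg hop, by simp [p2]; omega, ?_, by simp⟩
    exact (k1.trans (k2.mono (by omega) fun _ h => h)).trans (keep_setReg_tmp le_rfl)
  induction e with
  | lit c =>
    intro o d L ρ s hP hpc hs hR hL hV hρ hσ hB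
    have hc : c ≤ V := (eval_le h2 hp.inp_le (lit c) hρ hσ).trans hV
    have r := reach_step (A := base + bnd * stride) (s := s) (by
      rw [hpc]; exact (codeAt_cons.1 hP).1) hs (by simp [Instr.address])
    exact ⟨_, r, hs.setReg hc, by simp [Instr.exec, hpc, len], keep_setReg_tmp le_rfl,
      by simp [Instr.exec]⟩
  | var x =>
    intro o d L ρ s hP hpc hs hR hL hV hρ hσ hB
    have hc : ρ x ≤ V := (eval_le h2 hp.inp_le (var x) hρ hσ).trans hV
    have r := reach_step (A := base + bnd * stride) (s := s) (by
      rw [hpc]; exact (codeAt_cons.1 hP).1) hs (by simp [Instr.address])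
    simp only [Instr.exec, hR.var x hL, hR.zero, add_zero] at r
    exact ⟨_, r, hs.setReg hc, by simp [hpc, len], keep_setReg_tmp le_rfl, by simp⟩
  | sc j =>
    intro o d L ρ s hP hpc hs hR hL hV hρ hσ hB
    have hc : σ.sc j ≤ V := (eval_le h2 hp.inp_le (sc j) hρ hσ).trans hV
    have r := reach_step (A := base + bnd * stride) (s := s) (by
      rw [hpc]; exact (codeAt_cons.1 hP).1) hs (by simp [Instr.address])
    simp only [Instr.exec, hR.sc j, hR.zero, add_zero] at r
    exact ⟨_, r, hs.setReg hc, by simp [hpc, len], keep_setReg_tmp le_rfl, by simp⟩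
  | inp e ih =>
    intro o d L ρ s hP hpc hs hR hL hV hρ hσ hB
    rw [code, codeAt_append, length_code] at hP
    have := hp.base_pos
    obtain ⟨s1, r1, l1, p1, k1, v1⟩ := ih hP.1 hpc hs hR hL
      ((Nat.pow_le_pow_right (by omega) (by simp [deg])).trans hV) hρ hσ hB
    have R1 := hR.keep k1
    obtain ⟨s2, r2, l2, p2, k2, v2⟩ := reach_guardedLoad (A := base + bnd * stride) (L := L)
      (lim := rBase) (p1 ▸ hP.2) l1 R1.one (by rw [R1.base_eq]; omega) (by omega)
      (by have := hZV (by simp [deg]) hV; omega)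
    refine ⟨s2, r1.trans r2, l2, by rw [p2, p1, len]; omega, k1.trans k2, ?_⟩
    rw [v2, v1, R1.base_eq, eval_inp]
    split_ifs with h
    · exact R1.inp _ h
    · exact (hp.inp_zero _ (by omega)).symm
  | ar a e ih =>
    intro o d L ρ s hP hpc hs hR hL hV hρ hσ hB
    rw [code, codeAt_append, codeAt_append, length_code] at hP
    have := hp.base_pos
    obtain ⟨s1, r1, l1, p1, k1, v1⟩ := ih hP.1 hpc hs hR hL
      ((Nat.pow_le_pow_right (by omega) (by simp [deg]; omega)).trans hV) hρ hσ hB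
    have R1 := hR.keep k1
    have hval := eval_le h2 hp.inp_le e hρ hσ
    have hstride : stride ≤ Z ^ stride := le_pow_self h2 _
    have hidx : a.ctorIdx ≤ Z ^ (a.ctorIdx + 1) :=
      (le_pow_self h2 _).trans (Nat.pow_le_pow_right (by omega) (by omega))
    have hmul : e.eval I ρ σ * stride ≤ Z ^ (e.deg + stride) := by
      rw [pow_add]; exact Nat.mul_le_mul hval hstride
    have hsum := add_le_pow_add h2 (by omega) (by omega) (add_le_pow_add h2 (by
      have := e.deg_pos; omega) (by omega) hmul hidx)
      (show base ≤ Z ^ 1 by simpa using hp.base_le)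
    have hsum' : e.eval I ρ σ * stride + a.ctorIdx + base ≤ V :=
      hsum.trans ((Nat.pow_le_pow_right (by omega) (by simp [deg]; omega)).trans hV)
    obtain ⟨s2, r2, l2, p2, k2, m2, v2⟩ := reach_addressCode (A := base + bnd * stride)
      (p1 ▸ hP.2.1) l1 (Nat.lt_succ_self d) (by rw [v1, R1.base_eq]; exact hsum')
      (hstride.trans ((Nat.pow_le_pow_right (by omega) (by simp [deg]; omega)).trans hV))
    have K2 : Keep L d s1 s2 := ⟨m2, fun r h _ => k2 r (h d le_rfl) (h _ (by omega))⟩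
    have R2 := R1.keep K2
    obtain ⟨s3, r3, l3, p3, k3, v3⟩ := reach_guardedLoad (A := base + bnd * stride) (L := L)
      (lim := rLim) (p2 ▸ p1 ▸ hP.2.2) l2 R2.one R2.lim_le (by omega)
      (by have := hZV (by simp [deg]) hV; omega)
    refine ⟨s3, by simpa [cost, add_assoc] using (r1.trans r2).trans r3, l3,
      by rw [p3, p2, p1, len]; omega, (k1.trans K2).trans k3, ?_⟩
    rw [v3, v2, v1, R1.base_eq, eval_ar, ← R2.ar]
    split_ifs with h
    · rfl
    · exact (R2.lim _ (by omega)).symm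
  | add e f he hf =>
    intro o d L ρ s hP hpc hs hR hL hV hρ hσ hB
    exact bin e f (fun d => .add (rT d) (rT d) (rT (d + 1))) _ (fun _ _ => rfl) (fun _ _ => rfl) he
      hf hP hpc hs hR hL hV hρ hσ hB ((eval_le h2 hp.inp_le (add e f) hρ hσ).trans hV)
  | sub e f he hf =>
    intro o d L ρ s hP hpc hs hR hL hV hρ hσ hB
    exact bin e f (fun d => .sub (rT d) (rT d) (rT (d + 1))) _ (fun _ _ => rfl) (fun _ _ => rfl) he
      hf hP hpc hs hR hL hV hρ hσ hB ((eval_le h2 hp.inp_le (sub e f) hρ hσ).trans hV)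
  | mul e f he hf =>
    intro o d L ρ s hP hpc hs hR hL hV hρ hσ hB
    exact bin e f (fun d => .mul (rT d) (rT d) (rT (d + 1))) _ (fun _ _ => rfl) (fun _ _ => rfl) he
      hf hP hpc hs hR hL hV hρ hσ hB ((eval_le h2 hp.inp_le (mul e f) hρ hσ).trans hV)
  | div e f he hf =>
    intro o d L ρ s hP hpc hs hR hL hV hρ hσ hB
    exact bin e f (fun d => .div (rT d) (rT d) (rT (d + 1))) _ (fun _ _ => rfl) (fun _ _ => rfl) he
      hf hP hpc hs hR hL hV hρ hσ hB ((eval_le h2 hp.inp_le (div e f) hρ hσ).trans hV)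
  | sum x j e ih =>
    intro o d L ρ s hP hpc hs hR hL hV hρ hσ hB
    have hZ := hZV (by simp [deg]) hV
    have hxL : x ∉ L := hL.1
    rw [code, codeAt_append, codeAt_append, codeAt_append, length_code] at hP
    obtain ⟨hP0, hP1, hP2, hP3⟩ := hP
    replace hP1 := (codeAt_cons.1 hP1).1
    simp only [List.length_cons, List.length_nil, zero_add] at hP1 hP2 hP3
    have hj := hσ.sc j
    -- the initialisation
    have hstr : Straight (base + bnd * stride) V
        [.const (rT d) 0, .add (rT (d + 1)) (rS j) rZero, .const (rV x) 0] s := by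
      simp only [Straight, Instr.exec, Instr.address, Config.setReg_pc, Option.mem_def,
        reduceCtorEq, false_implies, implies_true, true_and, Config.setReg_reg, rS_ne_rT, if_false,
        rZero_ne_rT, hR.zero, hR.sc, add_zero]
      have l1 := hs.setReg (r := rT d) (v := 0) (by omega)
      have l2 := l1.setReg (r := rT (d + 1)) (v := σ.sc j) (by omega)
      exact ⟨l1, l2, l2.setReg (by omega), trivial⟩
    obtain ⟨r0, l0⟩ := reach_straight (hpc ▸ hP0) hs hstr
    set s0 := List.foldl (fun s i => Instr.exec s i) s
      [.const (rT d) 0, .add (rT (d + 1)) (rS j) rZero, .const (rV x) 0] with hs0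
    have p0 : s0.pc = o + 3 := by simp [hs0, Instr.exec, hpc]
    have k0 : Keep L d s s0 := ⟨by simp [hs0, Instr.exec], fun r h1 h2 => by
      simp [hs0, Instr.exec, h1 d le_rfl, h1 (d + 1) (by omega), h2 x hxL]⟩
    -- the loop
    have loop : ∀ k ≤ σ.sc j, ∀ s1 : Config, s1.pc = o + 3 → s1.Le V → Keep L d s s1 →
        s1.reg (rV x) = σ.sc j - k → s1.reg (rT (d + 1)) = k →
        s1.reg (rT d) = ∑ i ∈ range (σ.sc j - k), e.eval I (Function.update ρ x i) σ →
        ∃ s', Reach P (base + bnd * stride) V (k * (e.cost B + 5) + 1) s1 s' ∧ s'.Le V ∧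
          s'.pc = o + (e.len + 8) ∧ Keep L d s s' ∧
          s'.reg (rT d) = ∑ i ∈ range (σ.sc j), e.eval I (Function.update ρ x i) σ := by
      intro k
      induction k with
      | zero =>
        intro _ s1 p1 l1 k1 _ c1 v1
        have r := reach_step (A := base + bnd * stride) (s := s1) (by rw [p1]; exact hP1) l1
          (by simp [Instr.address])
        refine ⟨_, r.mono (by omega), ⟨l1.reg, l1.mem⟩, ?_, ⟨k1.mem, k1.reg⟩, ?_⟩
        · simp [Instr.exec, c1]; omega
        · simpa [Instr.exec] using v1
      | succ k ihk =>
        intro hk s1 p1 l1 k1 x1 c1 v1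
        have R1 := hR.keep k1
        have ra := reach_step (A := base + bnd * stride) (s := s1) (by rw [p1]; exact hP1) l1
          (by simp [Instr.address])
        simp only [Instr.exec, c1, Nat.add_eq_zero_iff, one_ne_zero, and_false, if_false, p1] at ra
        set s2 : Config := ⟨o + 3 + 1, s1.reg, s1.mem⟩ with hs2
        have R2 : Rep I base bnd (x :: L) (Function.update ρ x (σ.sc j - (k + 1))) σ s2 :=
          ⟨R1.sc, fun y hy => by
            rw [Function.update_apply]
            split_ifs with hyx
            · rw [hyx]; exact x1
            · exact R1.var y (by simpa [hyx] using hy), R1.zero, R1.one, R1.base_eq, R1.inp, R1.ar,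
            R1.lim, R1.base_le, R1.lim_le⟩
        have hρ' : ∀ i ≤ σ.sc j, ∀ y, Function.update ρ x i y ≤ Z := fun i hi y => by
          rw [Function.update_apply]
          split_ifs
          exacts [by omega, hρ y]
        obtain ⟨s3, rb, l3, p3, k3, v3⟩ := ih (s := s2) hP2 rfl ⟨l1.reg, l1.mem⟩ R2 hL.2
          ((Nat.pow_le_pow_right (by omega) (by simp [deg])).trans hV) (hρ' _ (by omega)) hσ hB
        have k3' : Keep L d s2 s3 := k3.mono (by omega) fun y hy => by simp [hy]
        have R3 := (R2.keep k3)
        have xv : s3.reg (rV x) = σ.sc j - (k + 1) := by rw [R3.var x (by simp)]; simp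
        have cv : s3.reg (rT (d + 1)) = k + 1 := by rw [k3.tmp (by omega)]; exact c1
        have av : s3.reg (rT d) = ∑ i ∈ range (σ.sc j - (k + 1)),
            e.eval I (Function.update ρ x i) σ := by rw [k3.tmp (by omega)]; exact v1
        have hsucc : σ.sc j - k = σ.sc j - (k + 1) + 1 := by omega
        have hle : ∑ i ∈ range (σ.sc j - k), e.eval I (Function.update ρ x i) σ ≤ V := by
          refine le_trans ?_ ((eval_le h2 hp.inp_le (sum x j e) hρ hσ).trans hV)
          exact Finset.sum_le_sum_of_subset fun i hi => by simp at hi ⊢; omega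
        rw [hsucc, Finset.sum_range_succ] at hle
        have hstr : Straight (base + bnd * stride) V [.add (rT d) (rT d) (rT (d + 2)),
            .add (rV x) (rV x) rOne, .sub (rT (d + 1)) (rT (d + 1)) rOne] s3 := by
          simp only [Straight, Instr.exec, Instr.address, Config.setReg_pc, Option.mem_def,
            reduceCtorEq, false_implies, implies_true, true_and, Config.setReg_reg, if_false,
            rV_ne_rT, rOne_ne_rT, rT_ne_rV, rOne_ne_rV, R3.one, rT_inj,
            show d + 1 ≠ d by omega, xv, cv, av, v3]
          have l4 := l3.setReg (r := rT d) hle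
          have l5 := l4.setReg (r := rV x) (v := σ.sc j - (k + 1) + 1) (by omega)
          exact ⟨l4, l5, l5.setReg (by omega), trivial⟩
        rw [show [Instr.add (rT d) (rT d) (rT (d + 2)), .add (rV x) (rV x) rOne,
          .sub (rT (d + 1)) (rT (d + 1)) rOne, .jumpZero rZero (o + 3)] =
          [.add (rT d) (rT d) (rT (d + 2)), .add (rV x) (rV x) rOne,
          .sub (rT (d + 1)) (rT (d + 1)) rOne] ++ [.jumpZero rZero (o + 3)] from rfl,
          codeAt_append] at hP3
        obtain ⟨rc, l4⟩ := reach_straight (s := s3) (by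
          rw [p3]; exact hP3.1) l3 hstr
        set s4 := List.foldl (fun s i => Instr.exec s i) s3 [Instr.add (rT d) (rT d) (rT (d + 2)),
            .add (rV x) (rV x) rOne, .sub (rT (d + 1)) (rT (d + 1)) rOne] with hs4
        have p4 : s4.pc = o + 3 + 1 + e.len + 3 := by simp [hs4, Instr.exec, p3]
        have k4 : Keep L d s3 s4 := ⟨by simp [hs4, Instr.exec], fun r h1 h2 => by
          simp [hs4, Instr.exec, h1 d le_rfl, h1 (d + 1) (by omega), h2 x hxL]⟩
        have K4 : Keep L d s s4 := (k1.trans ⟨k3'.mem, k3'.reg⟩).trans k4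
        have R4 := hR.keep K4
        have rd := reach_step (A := base + bnd * stride) (s := s4) (by
          rw [p4]; exact (codeAt_cons.1 hP3.2).1) l4
          (by simp [Instr.address])
        simp only [Instr.exec, R4.zero, if_true] at rd
        obtain ⟨s', r', l', p', k', v'⟩ := ihk (by omega) ⟨o + 3, s4.reg, s4.mem⟩ rfl
          ⟨l4.reg, l4.mem⟩ ⟨K4.mem, K4.reg⟩
          (by simp [hs4, Instr.exec, xv, R3.one]; omega)
          (by simp [hs4, Instr.exec, cv, R3.one])
          (by rw [hsucc, Finset.sum_range_succ, ← av, ← v3]; simp [hs4, Instr.exec])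
        refine ⟨s', ((((ra.trans rb).trans rc).trans rd).trans r').mono ?_, l', p', k', v'⟩
        simp only [List.length_cons, List.length_nil]
        ring_nf; omega
    obtain ⟨s', r', l', p', k', v'⟩ := loop (σ.sc j) le_rfl s0 p0 l0 k0
      (by simp [hs0, Instr.exec]) (by simp [hs0, Instr.exec, hR.sc, hR.zero])
      (by simp [hs0, Instr.exec])
    refine ⟨s', (r0.trans r').mono ?_, l', p', k', v'⟩
    have := Nat.mul_le_mul_right (e.cost B + 5) (hB j)
    simp only [List.length_cons, List.length_nil, cost]
    omega

end

/-- The values of a state respect the bounds. -/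
structure St.Within (σ : St) (bd : Bounds) : Prop where
  sc : ∀ j, σ.sc j ≤ bd.sc j
  ar : ∀ a i, σ.ar a i ≤ bd.val

/-- All bounds for values are at most `Z`. -/
structure Bounds.Le (bd : Bounds) (Z : ℕ) : Prop where
  sc : ∀ j, bd.sc j ≤ Z
  val : bd.val ≤ Z

lemma St.Within.le {σ : St} {bd : Bounds} {Z : ℕ} (h : σ.Within bd) (hb : bd.Le Z) : σ.Le Z :=
  ⟨fun j => (h.sc j).trans (hb.sc j), fun a i => (h.ar a i).trans hb.val⟩

lemma address_inj {base i i' : ℕ} {a a' : Ar} :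
    base + i * stride + a.ctorIdx = base + i' * stride + a'.ctorIdx ↔ a = a' ∧ i = i' := by
  have h1 := a.ctorIdx_lt
  have h2 := a'.ctorIdx_lt
  rw [← Ar.ctorIdx_inj]
  unfold stride at *
  omega

lemma Cmd.deg_pos (c : Cmd) : 0 < c.deg := by
  induction c with
  | set j e => exact e.deg_pos
  | _ => simp only [deg]; omega

section
variable {I : ℕ → ℕ} {base : ℕ} {L : List ℕ} {ρ : ℕ → ℕ} {σ : St} {s s' : Config} {d : ℕ}
  {P : Program} {A V Z : ℕ} {bd : Bounds}

/-- The code of a command carries out the command. -/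
theorem Cmd.reach_code (hp : Params I base bd.idx Z V) (hb : bd.Le Z) (c : Cmd) :
    ∀ {o d : ℕ} {L : List ℕ} {ρ : ℕ → ℕ} {σ : St} {s : Config}, CodeAt P o (c.code o d) →
    s.pc = o → s.Le V → Rep I base bd.idx L ρ σ s → c.Scoped L → Z ^ c.deg ≤ V → (∀ x, ρ x ≤ Z) →
    σ.Within bd → c.Safe I bd ρ σ →
    ∃ s', Reach P (base + bd.idx * stride) V (c.cost bd.sc) s s' ∧ s'.Le V ∧ s'.pc = o + c.len ∧
      Rep I base bd.idx L ρ (c.exec I ρ σ) s' ∧ (∀ d' < d, s'.reg (rT d') = s.reg (rT d')) ∧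
      (c.exec I ρ σ).Within bd := by
  have h2 := hp.two_le
  have hZV : ∀ {k}, 0 < k → Z ^ k ≤ V → Z ≤ V := fun hk h =>
    (Nat.le_self_pow hk.ne' Z).trans h
  have mono : ∀ {a b}, a ≤ b → Z ^ b ≤ V → Z ^ a ≤ V := fun hab h =>
    (Nat.pow_le_pow_right (by omega) hab).trans h
  induction c with
  | skip =>
    intro o d L ρ σ s hP hpc hs hR hL hV hρ hσ hsafe
    exact ⟨s, Reach.refl _ _ _ _ _, hs, by simpa [len] using hpc, hR, fun _ _ => rfl, hσ⟩
  | set j e =>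
    intro o d L ρ σ s hP hpc hs hR hL hV hρ hσ hsafe
    rw [code, codeAt_append, Expr.length_code] at hP
    obtain ⟨s1, r1, l1, p1, k1, v1⟩ := e.reach_code hp bd.sc hP.1 hpc hs hR hL hV hρ (hσ.le hb)
      hσ.sc
    have R1 := hR.keep k1
    have r2 := reach_step (A := base + bd.idx * stride) (s := s1) (by
      rw [p1]; exact (codeAt_cons.1 hP.2).1) l1 (by simp [Instr.address])
    have hle : e.eval I ρ σ ≤ V := (Expr.eval_le h2 hp.inp_le e hρ (hσ.le hb)).trans hV
    simp only [Instr.exec, v1, R1.zero, add_zero] at r2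
    refine ⟨_, r1.trans r2, l1.setReg hle, by simp [p1, len]; omega, ?_, fun d' hd => ?_, ?_⟩
    · exact ⟨fun j' => by simp [exec, R1.sc], fun y hy => by simp [R1.var y hy], by simp [R1.zero],
        by simp [R1.one], by simp [R1.base_eq], R1.inp, R1.ar, fun b h => R1.lim b (by simpa using h),
        by simpa using R1.base_le, by simpa using R1.lim_le⟩
    · simp [k1.tmp hd]
    · refine ⟨fun j' => ?_, hσ.ar⟩
      simp only [exec, St.setSc_sc]
      split_ifs with h
      · exact h ▸ hsafe
      · exact hσ.sc j'
  | put a e f =>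
    intro o d L ρ σ s hP hpc hs hR hL hV hρ hσ hsafe
    rw [code, codeAt_append, codeAt_append, codeAt_append, Expr.length_code,
      Expr.length_code] at hP
    obtain ⟨hP1, hP2, hP3, hP4⟩ := hP
    obtain ⟨s1, r1, l1, p1, k1, v1⟩ := e.reach_code hp bd.sc hP1 hpc hs hR hL.1
      (mono (by simp [deg]; omega) hV) hρ (hσ.le hb) hσ.sc
    obtain ⟨s2, r2, l2, p2, k2, v2⟩ := f.reach_code hp bd.sc hP2 p1 l1 (hR.keep k1) hL.2
      (mono (by simp [deg]; omega) hV) hρ (hσ.le hb) hσ.sc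
    have k2' := k2.mono (d' := d) (by omega) fun _ h => h
    have R2 := (hR.keep k1).keep k2'
    have v1' : s2.reg (rT d) = e.eval I ρ σ := by rw [k2.tmp (by omega), v1]
    obtain ⟨hs1, hs2⟩ := hsafe
    set i := e.eval I ρ σ with hi
    set v := f.eval I ρ σ with hv
    have hidx := a.ctorIdx_lt
    have hlt : i * stride + a.ctorIdx + base + 1 ≤ base + bd.idx * stride := by
      unfold stride at *; omega
    have hVle := hp.le_V
    obtain ⟨s3, r3, l3, p3, k3, m3, v3⟩ := reach_addressCode (A := base + bd.idx * stride)
      (p2 ▸ hP3) l2 (show d < d + 2 by omega) (by rw [v1', R2.base_eq]; omega)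
      ((le_pow_self h2 stride).trans (mono (by simp [deg]; omega) hV))
    rw [R2.base_eq, v1'] at v3
    have R3 : Rep I base bd.idx L ρ σ s3 := R2.keep (d := d)
      ⟨m3, fun r h _ => k3 r (h d le_rfl) (h _ (by omega))⟩
    have v3' : s3.reg (rT (d + 1)) = v := by rw [k3 _ (by simp) (by simp), v2]
    have hlim := R3.lim_le
    set ad := base + i * stride + a.ctorIdx with had
    have hstr : Straight (base + bd.idx * stride) V [.add (rT (d + 2)) (rT d) rOne,
        .sub (rT (d + 2)) (rT (d + 2)) rLim, .add rLim rLim (rT (d + 2)),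
        .store (rT d) (rT (d + 1))] s3 := by
      simp only [Straight, Instr.exec, Instr.address, Config.setReg_pc, Option.mem_def,
        reduceCtorEq, false_implies, implies_true, true_and, Config.setReg_reg, if_false, if_true,
        rLim_ne_rT, rT_ne_rLim, rT_inj, R3.one, v3, v3', Option.some.injEq, forall_eq',
        show d ≠ d + 2 by omega, show d + 1 ≠ d + 2 by omega]
      have l4 := l3.setReg (r := rT (d + 2)) (v := ad + 1) (by omega)
      have l5 := l4.setReg (r := rT (d + 2)) (v := ad + 1 - s3.reg rLim) (by omega)
      have l6 := l5.setReg (r := rLim) (v := s3.reg rLim + (ad + 1 - s3.reg rLim)) (by omega)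
      refine ⟨l4, l5, l6, by omega, ⟨l6.reg, fun b => ?_⟩, trivial⟩
      simp only [Function.update_apply]
      split_ifs
      · exact v2 ▸ l2.reg _
      · exact l6.mem b
    obtain ⟨r4, l4⟩ := reach_straight (p3 ▸ p2 ▸ hP4) l3 hstr
    have hVv : v ≤ bd.val := hs2
    refine ⟨_, (((r1.trans r2).trans r3).trans r4).mono ?_, l4, ?_, ?_, fun d' hd => ?_, ?_⟩
    · simp [cost]
    · simp [Instr.exec, p3, p2, len]; omega
    · refine ⟨fun j => by simp [Instr.exec, exec, R3.sc], fun y hy => by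
        simp [Instr.exec, R3.var y hy], by simp [Instr.exec, R3.zero], by simp [Instr.exec, R3.one],
        by simp [Instr.exec, R3.base_eq], fun b hb' => ?_, fun a' i' => ?_, fun b hb' => ?_, ?_, ?_⟩
      · have : b ≠ ad := by omega
        simp [Instr.exec, v3, v3', this, R3.inp b hb']
      · have := address_inj (base := base) (i := i') (i' := i) (a := a') (a' := a)
        rw [← had] at this
        simp [Instr.exec, exec, v3, v3', Function.update_apply, this,
          R3.ar, ← hi, ← hv]
      · simp [Instr.exec, v3, v3', R3.one] at hb'
        have : b ≠ ad := by omega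
        simp [Instr.exec, v3, v3', this, R3.lim b (by omega)]
      · have := R3.base_le
        simp [Instr.exec, v3, v3', R3.one]; omega
      · simp [Instr.exec, v3, v3', R3.one]; omega
    · simp only [List.foldl, Instr.exec, Config.setReg_reg, rT_ne_rLim, if_false, rT_inj,
        show d' ≠ d + 2 by omega]
      rw [k3 _ (by simp; omega) (by simp; omega), k2.tmp (by omega), k1.tmp hd]
    · refine ⟨hσ.sc, fun a' i' => ?_⟩
      simp only [exec, St.setAr_ar]
      split_ifs
      · exact hs2
      · exact hσ.ar _ _
  | seq c c' hc hc' =>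
    intro o d L ρ σ s hP hpc hs hR hL hV hρ hσ hsafe
    rw [code, codeAt_append, length_code] at hP
    obtain ⟨s1, r1, l1, p1, R1, k1, w1⟩ := hc hP.1 hpc hs hR hL.1 (mono (by simp [deg]) hV) hρ hσ
      hsafe.1
    obtain ⟨s2, r2, l2, p2, R2, k2, w2⟩ := hc' hP.2 p1 l1 R1 hL.2 (mono (by simp [deg]) hV) hρ w1
      hsafe.2
    exact ⟨s2, r1.trans r2, l2, by rw [p2, len]; omega, R2, fun d' hd => by rw [k2 d' hd, k1 d' hd],
      w2⟩
  | ite e c c' hc hc' =>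
    intro o d L ρ σ s hP hpc hs hR hL hV hρ hσ hsafe
    rw [code, codeAt_append, codeAt_append, codeAt_append, codeAt_append, length_code,
      Expr.length_code] at hP
    obtain ⟨hP1, hP2, hP3, hP4, hP5⟩ := hP
    replace hP2 := (codeAt_cons.1 hP2).1
    replace hP4 := (codeAt_cons.1 hP4).1
    simp only [List.length_cons, List.length_nil, zero_add] at hP3 hP4 hP5
    obtain ⟨s1, r1, l1, p1, k1, v1⟩ := e.reach_code hp bd.sc hP1 hpc hs hR hL.1
      (mono (by simp [deg]; omega) hV) hρ (hσ.le hb) hσ.sc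
    have R1 := hR.keep k1
    have r2 := reach_step (A := base + bd.idx * stride) (s := s1) (by
      rw [p1]; exact hP2) l1 (by simp [Instr.address])
    by_cases h : Expr.Holds I ρ σ e
    · simp only [Safe, exec, h, if_true] at hsafe ⊢
      simp only [Instr.exec, v1, show e.eval I ρ σ ≠ 0 from h, if_false, p1] at r2
      obtain ⟨s3, r3, l3, p3, R3, k3, w3⟩ := hc (s := ⟨o + e.len + 1, s1.reg, s1.mem⟩) hP3 rfl
        ⟨l1.reg, l1.mem⟩ ⟨R1.sc, R1.var, R1.zero, R1.one, R1.base_eq, R1.inp, R1.ar, R1.lim,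
          R1.base_le, R1.lim_le⟩ hL.2.1 (mono (by simp [deg]; omega) hV) hρ hσ hsafe
      have r4 := reach_step (A := base + bd.idx * stride) (s := s3) (by
        rw [p3]; exact hP4) l3 (by simp [Instr.address])
      simp only [Instr.exec, R3.zero, if_true] at r4
      refine ⟨_, (((r1.trans r2).trans r3).trans r4).mono ?_, ⟨l3.reg, l3.mem⟩, ?_, ⟨R3.sc, R3.var,
        R3.zero, R3.one, R3.base_eq, R3.inp, R3.ar, R3.lim, R3.base_le, R3.lim_le⟩,
        fun d' hd => ?_, w3⟩
      · simp [cost]; omega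
      · simp [len]; omega
      · exact (k3 d' hd).trans (k1.tmp hd)
    · simp only [Safe, exec, h, if_false] at hsafe ⊢
      simp only [Instr.exec, v1, show e.eval I ρ σ = 0 from not_not.1 h, if_true] at r2
      obtain ⟨s3, r3, l3, p3, R3, k3, w3⟩ := hc' (o := o + e.len + c.len + 2)
        (s := ⟨o + e.len + c.len + 2, s1.reg, s1.mem⟩) (by convert hP5 using 1; omega) rfl
        ⟨l1.reg, l1.mem⟩ ⟨R1.sc, R1.var, R1.zero, R1.one, R1.base_eq, R1.inp, R1.ar, R1.lim,
          R1.base_le, R1.lim_le⟩ hL.2.2 (mono (by simp [deg]) hV) hρ hσ hsafe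
      refine ⟨_, ((r1.trans r2).trans r3).mono ?_, l3, ?_, R3, fun d' hd => ?_, w3⟩
      · simp [cost]; omega
      · dsimp only [len] at p3 ⊢; omega
      · exact (k3 d' hd).trans (k1.tmp hd)
  | loop x j c ih =>
    intro o d L ρ σ s hP hpc hs hR hL hV hρ hσ hsafe
    have hZ := hZV (by simp [deg]) hV
    have hxL : x ∉ L := hL.1
    rw [code, codeAt_append, codeAt_append, codeAt_append, length_code] at hP
    obtain ⟨hP0, hP1, hP2, hP3⟩ := hP
    replace hP1 := (codeAt_cons.1 hP1).1
    simp only [List.length_cons, List.length_nil, zero_add] at hP1 hP2 hP3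
    have hj := (hσ.le hb).sc j
    have hstr : Straight (base + bd.idx * stride) V
        [.add (rT d) (rS j) rZero, .const (rV x) 0] s := by
      simp only [Straight, Instr.exec, Instr.address, Config.setReg_pc, Option.mem_def,
        reduceCtorEq, false_implies, implies_true, true_and, hR.zero, hR.sc, add_zero]
      have l1 := hs.setReg (r := rT d) (v := σ.sc j) (by omega)
      exact ⟨l1, l1.setReg (by omega), trivial⟩
    obtain ⟨r0, l0⟩ := reach_straight (hpc ▸ hP0) hs hstr
    set s0 := List.foldl (fun s i => Instr.exec s i) s
      [.add (rT d) (rS j) rZero, .const (rV x) 0] with hs0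
    have p0 : s0.pc = o + 2 := by simp [hs0, Instr.exec, hpc]
    have k0 : Keep L d s s0 := ⟨by simp [hs0, Instr.exec], fun r h1 h2 => by
      simp [hs0, Instr.exec, h1 d le_rfl, h2 x hxL]⟩
    let it : ℕ → St := fun k => Nat.rec σ (fun i τ => c.exec I (Function.update ρ x i) τ) k
    have loop : ∀ k ≤ σ.sc j, ∀ s1 : Config, s1.pc = o + 2 → s1.Le V →
        (∀ d' < d, s1.reg (rT d') = s.reg (rT d')) →
        s1.reg (rV x) = σ.sc j - k → s1.reg (rT d) = k →
        Rep I base bd.idx L ρ (it (σ.sc j - k)) s1 → (it (σ.sc j - k)).Within bd →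
        ∃ s', Reach P (base + bd.idx * stride) V (k * (c.cost bd.sc + 4) + 1) s1 s' ∧ s'.Le V ∧
          s'.pc = o + (c.len + 6) ∧ Rep I base bd.idx L ρ (it (σ.sc j)) s' ∧
          (∀ d' < d, s'.reg (rT d') = s.reg (rT d')) ∧ (it (σ.sc j)).Within bd := by
      intro k
      induction k with
      | zero =>
        intro _ s1 p1 l1 k1 _ c1 R1 w1
        have r := reach_step (A := base + bd.idx * stride) (s := s1) (by rw [p1]; exact hP1) l1
          (by simp [Instr.address])
        simp only [Instr.exec, c1, if_true] at r
        exact ⟨_, r.mono (by omega), ⟨l1.reg, l1.mem⟩, by simp; omega, ⟨R1.sc, R1.var, R1.zero,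
          R1.one, R1.base_eq, R1.inp, R1.ar, R1.lim, R1.base_le, R1.lim_le⟩, k1, w1⟩
      | succ k ihk =>
        intro hk s1 p1 l1 k1 x1 c1 R1 w1
        have ra := reach_step (A := base + bd.idx * stride) (s := s1) (by rw [p1]; exact hP1) l1
          (by simp [Instr.address])
        simp only [Instr.exec, c1, Nat.add_eq_zero_iff, one_ne_zero, and_false, if_false, p1] at ra
        set i := σ.sc j - (k + 1) with hi
        have R2 : Rep I base bd.idx (x :: L) (Function.update ρ x i) (it i)
            ⟨o + 2 + 1, s1.reg, s1.mem⟩ :=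
          ⟨R1.sc, fun y hy => by
            rw [Function.update_apply]
            split_ifs with hyx
            · rw [hyx]; exact x1
            · exact R1.var y (by simpa [hyx] using hy), R1.zero, R1.one, R1.base_eq, R1.inp, R1.ar,
            R1.lim, R1.base_le, R1.lim_le⟩
        have hρ' : ∀ y, Function.update ρ x i y ≤ Z := fun y => by
          rw [Function.update_apply]
          split_ifs
          exacts [by omega, hρ y]
        obtain ⟨s3, rb, l3, p3, R3, k3, w3⟩ := ih (s := ⟨o + 2 + 1, s1.reg, s1.mem⟩) hP2 rfl
          ⟨l1.reg, l1.mem⟩ R2 hL.2 (mono (by simp [deg]) hV) hρ' w1 (hsafe i (by omega))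
        have xv : s3.reg (rV x) = i := by rw [R3.var x (by simp)]; simp
        have cv : s3.reg (rT d) = k + 1 := by rw [k3 d (by omega)]; exact c1
        have hsucc : σ.sc j - k = i + 1 := by omega
        have hstr : Straight (base + bd.idx * stride) V
            [.add (rV x) (rV x) rOne, .sub (rT d) (rT d) rOne] s3 := by
          simp only [Straight, Instr.exec, Instr.address, Config.setReg_pc, Option.mem_def,
            reduceCtorEq, false_implies, implies_true, true_and, Config.setReg_reg, if_false,
            rT_ne_rV, rOne_ne_rV, R3.one, xv, cv]
          have l4 := l3.setReg (r := rV x) (v := i + 1) (by omega)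
          exact ⟨l4, l4.setReg (by omega), trivial⟩
        rw [show [Instr.add (rV x) (rV x) rOne, .sub (rT d) (rT d) rOne, .jumpZero rZero (o + 2)] =
          [.add (rV x) (rV x) rOne, .sub (rT d) (rT d) rOne] ++ [.jumpZero rZero (o + 2)] from rfl,
          codeAt_append] at hP3
        obtain ⟨rc, l4⟩ := reach_straight (s := s3) (by
          rw [p3]; exact hP3.1) l3 hstr
        set s4 := List.foldl (fun s i => Instr.exec s i) s3
          [Instr.add (rV x) (rV x) rOne, .sub (rT d) (rT d) rOne] with hs4
        have p4 : s4.pc = o + 2 + 1 + c.len + 2 := by simp [hs4, Instr.exec, p3]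
        have k4 : Keep L d s3 s4 := ⟨by simp [hs4, Instr.exec], fun r h1 h2 => by
          simp [hs4, Instr.exec, h1 d le_rfl, h2 x hxL]⟩
        have R3' : Rep I base bd.idx L ρ (it (i + 1)) s3 := ⟨R3.sc, fun y hy => by
          rw [R3.var y (by simp [hy]), Function.update_of_ne (by rintro rfl; exact hxL hy)], R3.zero,
          R3.one, R3.base_eq, R3.inp, R3.ar, R3.lim, R3.base_le, R3.lim_le⟩
        have R4 := R3'.keep k4
        have rd := reach_step (A := base + bd.idx * stride) (s := s4) (by
          rw [p4]; exact (codeAt_cons.1 hP3.2).1) l4 (by simp [Instr.address])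
        simp only [Instr.exec, R4.zero, if_true] at rd
        rw [hsucc] at ihk
        obtain ⟨s', r', l', p', R', k', w'⟩ := ihk (by omega) ⟨o + 2, s4.reg, s4.mem⟩ rfl
          ⟨l4.reg, l4.mem⟩ (fun d' hd => (k4.tmp hd).trans ((k3 d' (by omega)).trans (k1 d' hd)))
          (by simp [hs4, Instr.exec, xv, R3.one])
          (by simp [hs4, Instr.exec, cv, R3.one])
          ⟨R4.sc, R4.var, R4.zero, R4.one, R4.base_eq, R4.inp, R4.ar, R4.lim, R4.base_le,
            R4.lim_le⟩ w3
        refine ⟨s', ((((ra.trans rb).trans rc).trans rd).trans r').mono ?_, l', p', R', k', w'⟩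
        simp only [List.length_cons, List.length_nil]
        ring_nf; omega
    obtain ⟨s', r', l', p', R', k', w'⟩ := loop (σ.sc j) le_rfl s0 p0 l0 (fun d' hd => k0.tmp hd)
      (by simp [hs0, Instr.exec]) (by simp [hs0, Instr.exec, hR.sc, hR.zero])
      (by rw [Nat.sub_self]; exact hR.keep k0) (by rw [Nat.sub_self]; exact hσ)
    refine ⟨s', (r0.trans r').mono ?_, l', p', R', k', w'⟩
    have := Nat.mul_le_mul_right (c.cost bd.sc + 4) (hσ.sc j)
    simp only [List.length_cons, List.length_nil, cost]
    omega

end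

/-! ### Whole programs -/

lemma step_halted {P : Program} {s : Config} (h : Halted P s) : step P s = s := by
  simp [step, List.getElem?_eq_none h]

lemma iterate_step_halted {P : Program} {s : Config} (h : Halted P s) (t : ℕ) :
    (step P)^[t] s = s := by
  induction t with
  | zero => rfl
  | succ t ih => rw [Function.iterate_succ_apply, step_halted h, ih]

/-- The state in which all variables are `0`. -/
def St.zero : St := ⟨fun _ => 0, fun _ _ => 0⟩

/-- Code that sets up the registers `rOne`, `rBase` and `rLim`, where `pre` computes the length of
the input in the register `rT 0`. -/
def prelude (pre : List Instr) : List Instr :=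
  pre ++ [.const rOne 1, .add rBase (rT 0) rZero, .add rLim (rT 0) rZero]

/-- The machine program for a command. -/
def Cmd.program (pre : List Instr) (c : Cmd) : Program :=
  prelude pre ++ c.code (pre.length + 3) 0

/-- A program obtained from a command without free variables runs within the bounds and leaves the
result of the command in register `0`. -/
theorem Cmd.program_spec {x : List ℕ} {bd : Bounds} {Z V : ℕ} {pre : List Instr} {c : Cmd}
    (hp : Params (fun a => x.getD a 0) x.length bd.idx Z V) (hb : bd.Le Z)
    (hpre : CodeAt (c.program pre) 0 pre → ∃ s,
      Reach (c.program pre) (x.length + bd.idx * stride) V pre.length (start x) s ∧ s.Le V ∧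
        s.pc = pre.length ∧ s.mem = (start x).mem ∧ s.reg (rT 0) = x.length ∧
        ∀ r, (∀ d, r ≠ rT d) → s.reg r = 0)
    (hc : c.Scoped []) (hV : Z ^ c.deg ≤ V) {Q : St → Prop}
    (hsafe : c.Wp (fun a => x.getD a 0) bd (fun _ => 0) Q St.zero) :
    ∃ τ : St, Q τ ∧ ∃ t ≤ pre.length + 3 + c.cost bd.sc,
      Halted (c.program pre) (run (c.program pre) x t) ∧
      (run (c.program pre) x t).reg 0 = τ.sc .out ∧
      SpaceBound (c.program pre) x (x.length + bd.idx * stride) ∧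
      ∀ t a, (run (c.program pre) x t).reg a ≤ V ∧ (run (c.program pre) x t).mem a ≤ V := by
  have hZ : Z ≤ V := (Nat.le_self_pow c.deg_pos.ne' Z).trans hV
  have h2 := hp.two_le
  have hcode : CodeAt (c.program pre) 0 (c.program pre) := fun i _ => by simp
  nth_rw 2 [program] at hcode
  rw [prelude, codeAt_append, codeAt_append] at hcode
  obtain ⟨⟨hc1, hc2⟩, hc3⟩ := hcode
  simp only [zero_add, List.length_append, List.length_cons, List.length_nil] at hc2 hc3
  obtain ⟨s1, r1, l1, p1, m1, v1, z1⟩ := hpre hc1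
  have hstr : Straight (x.length + bd.idx * stride) V
      [.const rOne 1, .add rBase (rT 0) rZero, .add rLim (rT 0) rZero] s1 := by
    simp only [Straight, Instr.exec, Instr.address, Config.setReg_pc, Option.mem_def,
      reduceCtorEq, false_implies, implies_true, true_and, Config.setReg_reg, if_false,
      show rT 0 ≠ rOne by decide, show rZero ≠ rOne by decide, show rT 0 ≠ rBase by decide,
      show rZero ≠ rBase by decide, v1, z1 rZero (by simp), add_zero]
    have l2 := l1.setReg (r := rOne) (v := 1) (by omega)
    have l3 := l2.setReg (r := rBase) (v := x.length) (by have := hp.base_le; omega)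
    exact ⟨l2, l3, l3.setReg (by have := hp.base_le; omega), trivial⟩
  obtain ⟨r2, l2⟩ := reach_straight (p1 ▸ hc2) l1 hstr
  set s2 := List.foldl (fun s i => Instr.exec s i) s1
    [.const rOne 1, .add rBase (rT 0) rZero, .add rLim (rT 0) rZero] with hs2
  have R2 : Rep (fun a => x.getD a 0) x.length bd.idx [] (fun _ => 0) St.zero s2 := by
    have hne : ∀ j : Sc, rS j ≠ rOne ∧ rS j ≠ rBase ∧ rS j ≠ rLim := fun j => by
      unfold rS rOne rBase rLim; omega
    refine ⟨fun j => ?_, by simp, ?_, ?_, ?_, fun a _ => ?_, fun a i => ?_, fun b hb' => ?_, ?_, ?_⟩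
    · simp [hs2, Instr.exec, hne, z1, St.zero]
    · simp [hs2, Instr.exec, show rZero ≠ rOne by decide, show rZero ≠ rBase by decide, z1]
    · simp [hs2, Instr.exec, show rOne ≠ rBase by decide]
    · simp [hs2, Instr.exec, v1, show rZero ≠ rOne by decide, show rT 0 ≠ rOne by decide, z1]
    · simp [hs2, Instr.exec, m1, start]
    · have := hp.inp_zero (x.length + i * stride + a.ctorIdx) (by omega)
      simpa [hs2, Instr.exec, m1, start, St.zero] using this
    · simp [hs2, Instr.exec, v1, show rZero ≠ rOne by decide, show rT 0 ≠ rOne by decide, z1,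
        show rT 0 ≠ rBase by decide, show rZero ≠ rBase by decide] at hb'
      have := hp.inp_zero b (by omega)
      simpa [hs2, Instr.exec, m1, start, St.zero] using this
    · simp [hs2, Instr.exec, v1, show rZero ≠ rOne by decide, show rT 0 ≠ rOne by decide, z1,
        show rT 0 ≠ rBase by decide, show rZero ≠ rBase by decide]
    · simp [hs2, Instr.exec, v1, show rZero ≠ rOne by decide, show rT 0 ≠ rOne by decide, z1,
        show rT 0 ≠ rBase by decide, show rZero ≠ rBase by decide]
  have p2 : s2.pc = pre.length + 3 := by simp [hs2, Instr.exec, p1]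
  obtain ⟨s3, r3, l3, p3, R3, -, -⟩ := c.reach_code hp hb (by simpa using hc3) p2 l2 R2 hc hV
    (by simp) ⟨by simp [St.zero], by simp [St.zero]⟩ hsafe.1
  obtain ⟨t, ht, e, hg⟩ := (r1.trans r2).trans r3
  have hhalt : Halted (c.program pre) s3 := by
    rw [Halted, p3]; simp [program, prelude, length_code]; omega
  have hall : ∀ u, (run (c.program pre) x u).Good (c.program pre) (x.length + bd.idx * stride) V := by
    intro u
    by_cases hu : u < t
    · exact hg u hu
    · obtain ⟨v, rfl⟩ := Nat.exists_eq_add_of_le' (not_lt.1 hu)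
      rw [run, Function.iterate_add_apply, e, iterate_step_halted hhalt]
      exact ⟨l3, by simp [List.getElem?_eq_none hhalt]⟩
  refine ⟨_, hsafe.2, t, by simpa using ht, by rw [run, e]; exact hhalt, ?_,
    fun u => (hall u).addr, fun u a => ⟨(hall u).le.reg a, (hall u).le.mem a⟩⟩
  rw [run, e]
  exact R3.sc .out

/-! ### Elimination orders -/

/-- The numbers `0, …, n - 1` are the vertices of a graph with adjacency relation `adj`, and
`H i` is, for every vertex `i`, a set of smaller vertices that contains the smaller neighbours of
`i` and is a clique in the graph with the edges given by `H`. Thus `n - 1, …, 0` is a perfect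
elimination order of a chordal supergraph. -/
structure Elim (n : ℕ) (adj H : ℕ → ℕ → Prop) : Prop where
  lt : ∀ i j, i < n → H i j → j < i
  closed : ∀ i j j', i < n → H i j → H i j' → j' < j → H j j'
  edge : ∀ i j, i < n → j < i → adj i j → H i j

open Classical in
/-- The parent of `i`: the number after the largest element of `H i`, or `0` if there is none. (The
node `i + 1` of the elimination tree stands for the vertex `i`, and `0` is the root.) -/
noncomputable def par (H : ℕ → ℕ → Prop) (i : ℕ) : ℕ := ({j ∈ range i | H i j}).sup (· + 1)

/-- The bag of a node of the elimination tree. -/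
def bag (H : ℕ → ℕ → Prop) : ℕ → ℕ → Prop
  | 0, _ => False
  | i + 1, u => u = i ∨ H i u

/-- When the vertices `n - 1, …, n - r` have been eliminated, `desc n H r a` is the set of those
that were merged into the node `a`. -/
noncomputable def desc (n : ℕ) (H : ℕ → ℕ → Prop) : ℕ → ℕ → Finset ℕ
  | 0, _ => ∅
  | r + 1, a => if a = par H (n - 1 - r) then
      desc n H r a ∪ insert (n - 1 - r) (desc n H r (n - 1 - r + 1)) else desc n H r a

section
variable {n : ℕ} {adj H : ℕ → ℕ → Prop}

lemma par_le (i : ℕ) : par H i ≤ i := by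
  classical
  exact Finset.sup_le fun j hj => by simp at hj; omega

lemma Elim.bag_par (h : Elim n adj H) {i u : ℕ} (hi : i < n) (hu : H i u) : bag H (par H i) u := by
  classical
  have hne : ({j ∈ range i | H i j}).Nonempty := ⟨u, by simp [hu, h.lt i u hi hu]⟩
  obtain ⟨v, hv, e⟩ := Finset.exists_mem_eq_sup _ hne (· + 1)
  have e' : par H i = v + 1 := e
  have hle : u + 1 ≤ v + 1 := e' ▸ Finset.le_sup (f := (· + 1))
    (show u ∈ ({j ∈ range i | H i j}) by simp [hu, h.lt i u hi hu])
  rw [e', bag]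
  simp only [mem_filter, mem_range] at hv
  by_cases huv : u = v
  · exact Or.inl huv
  · exact Or.inr (h.closed i v u hi hv.2 hu (by omega))

lemma Elim.lt_of_bag (h : Elim n adj H) {a u : ℕ} (ha : a ≤ n) (hu : bag H a u) : u < a := by
  cases a with
  | zero => exact hu.elim
  | succ i =>
    rcases hu with rfl | hu
    · omega
    · have := h.lt i u (by omega) hu; omega

/-- The sets `desc n H r a` for the remaining nodes `a` partition the set of eliminated vertices,
and each is separated from the rest by the bag of `a`. -/
structure DescInv (n : ℕ) (H : ℕ → ℕ → Prop) (r : ℕ) : Prop where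
  mem : ∀ a j, a ≤ n - r → j ∈ desc n H r a → n - r ≤ j ∧ j < n
  inj : ∀ a a' j, a ≤ n - r → a' ≤ n - r → j ∈ desc n H r a → j ∈ desc n H r a' → a = a'
  cover : ∀ j, n - r ≤ j → j < n → ∃ a ≤ n - r, j ∈ desc n H r a
  bdry : ∀ a j u, a ≤ n - r → j ∈ desc n H r a → H j u → u ∈ desc n H r a ∨ bag H a u

lemma Elim.descInv (h : Elim n adj H) {r : ℕ} (hr : r ≤ n) : DescInv n H r := by
  induction r with
  | zero =>
    refine ⟨?_, ?_, fun j h1 h2 => by omega, ?_⟩ <;> simp [desc]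
  | succ r ih =>
    replace ih := ih (by omega)
    obtain ⟨i, hi⟩ : ∃ i, n - 1 - r = i := ⟨_, rfl⟩
    have hir : n - r = i + 1 := by omega
    have hir' : n - (r + 1) = i := by omega
    have hin : i < n := by omega
    have hmem : ∀ a j, a ≤ i → (j ∈ desc n H (r + 1) a ↔ j ∈ desc n H r a ∨
        (a = par H i ∧ (j = i ∨ j ∈ desc n H r (i + 1)))) := by
      intro a j ha
      simp only [desc, hi]
      split_ifs with hp <;> simp [hp, or_left_comm]
    rw [show DescInv n H r ↔ DescInv n H r from Iff.rfl] at ih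
    have mem := ih.mem
    have inj := ih.inj
    have cover := ih.cover
    have bdry := ih.bdry
    rw [hir] at mem inj cover bdry
    refine ⟨fun a j ha hj => ?_, fun a a' j ha ha' hj hj' => ?_, fun j h1 h2 => ?_,
      fun a j u ha hj hu => ?_⟩
    · rw [hir'] at ha ⊢
      rcases (hmem a j ha).1 hj with hj | ⟨rfl, rfl | hj⟩
      · have := mem a j (by omega) hj; omega
      · omega
      · have := mem _ j le_rfl hj; omega
    · rw [hir'] at ha ha'
      rw [hmem a j ha] at hj
      rw [hmem a' j ha'] at hj'
      have key : ∀ b, b ≤ i → j ∈ desc n H r b → j ≠ i ∧ j ∉ desc n H r (i + 1) := by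
        intro b hb hjb
        refine ⟨?_, fun hc => ?_⟩
        · have := mem b j (by omega) hjb; omega
        · have := inj b (i + 1) j (by omega) le_rfl hjb hc; omega
      rcases hj with hj | ⟨hj1, hj2⟩ <;> rcases hj' with hj' | ⟨hj1', hj2'⟩
      · exact inj a a' j (by omega) (by omega) hj hj'
      · have := key a ha hj; tauto
      · have := key a' ha' hj'; tauto
      · rw [hj1, hj1']
    · rw [hir'] at h1 ⊢
      have hp : par H i ≤ i := par_le i
      by_cases hji : j = i
      · exact ⟨par H i, hp, (hmem _ _ hp).2 (Or.inr ⟨rfl, Or.inl hji⟩)⟩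
      · obtain ⟨a, ha, hja⟩ := cover j (by omega) h2
        by_cases hai : a = i + 1
        · exact ⟨par H i, hp, (hmem _ _ hp).2 (Or.inr ⟨rfl, Or.inr (hai ▸ hja)⟩)⟩
        · exact ⟨a, by omega, (hmem _ _ (by omega)).2 (Or.inl hja)⟩
    · rw [hir'] at ha
      rw [hmem a u ha]
      rcases (hmem a j ha).1 hj with hj | ⟨rfl, rfl | hj⟩
      · rcases bdry a j u (by omega) hj hu with h' | h' <;> tauto
      · exact Or.inr (h.bag_par hin hu)
      · rcases bdry _ j u le_rfl hj hu with h' | rfl | h'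
        · tauto
        · tauto
        · exact Or.inr (h.bag_par hin h')

lemma Elim.desc_root (h : Elim n adj H) : desc n H n 0 = range n := by
  have := h.descInv le_rfl
  ext j
  rw [mem_range]
  refine ⟨fun hj => (this.mem 0 j (by omega) hj).2, fun hj => ?_⟩
  obtain ⟨a, ha, hja⟩ := this.cover j (by omega) hj
  obtain rfl : a = 0 := by omega
  exact hja

/-! ### Balanced separations -/

open Classical in
/-- A set of `3 s + 1` vertices is separated in a balanced way by the bag of a node. The node
is the first one for which more than `s` of the vertices are eliminated and merged into it. -/
theorem Elim.exists_separation (h : Elim n adj H) (hadj : ∀ i j, adj i j → adj j i) {s : ℕ}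
    (hw : ∀ i < n, #{j ∈ range i | H i j} + 1 ≤ s) {W : Finset ℕ} (hWn : W ⊆ range n)
    (hW : #W = 3 * s + 1) : ∃ A X : Finset ℕ, X ⊆ range n ∧ Disjoint A X ∧ #X ≤ s ∧
      #(W ∩ A) ≤ 2 * s ∧ #(W \ (A ∪ X)) ≤ 2 * s ∧ ∀ a ∈ A, ∀ b < n, adj a b → b ∈ A ∪ X := by
  have hn : 0 < n := by
    by_contra hn
    have : W = ∅ := by
      rw [Nat.eq_zero_of_not_pos hn] at hWn
      simpa using hWn
    simp [this] at hW
  have hs : 1 ≤ s := le_trans (by omega) (hw 0 hn)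
  have hex : ∃ r, r ≤ n ∧ ∃ a ≤ n - r, s < #(W ∩ desc n H r a) :=
    ⟨n, le_rfl, 0, by omega, by
      rw [h.desc_root, inter_eq_left.2 hWn]; omega⟩
  obtain ⟨hrn, a, ha, hlt⟩ := Nat.find_spec hex
  have hmin := fun r' (hr' : r' < Nat.find hex) => Nat.find_min hex hr'
  obtain ⟨r, hr⟩ : ∃ r, Nat.find hex = r + 1 := by
    refine Nat.exists_eq_succ_of_ne_zero fun h0 => ?_
    rw [h0] at hlt
    simp [desc] at hlt
  rw [hr] at hrn hlt ha hmin
  have hsmall : ∀ b ≤ n - r, #(W ∩ desc n H r b) ≤ s := fun b hb => by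
    by_contra hc
    exact hmin r (by omega) ⟨by omega, b, hb, by omega⟩
  obtain ⟨i, hi⟩ : ∃ i, n - 1 - r = i := ⟨_, rfl⟩
  have hin : i < n := by omega
  have hap : a = par H i := by
    by_contra hc
    rw [desc, hi, if_neg hc] at hlt
    have := hsmall a (by omega)
    omega
  have hdef : desc n H (r + 1) a = desc n H r a ∪ insert i (desc n H r (i + 1)) := by
    rw [desc, hi, if_pos hap]
  have hI := h.descInv (show r ≤ n by omega)
  have hI' := h.descInv hrn
  have hbagle : ∀ b ≤ n, #{j ∈ range n | bag H b j} ≤ s := by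
    intro b hb
    cases b with
    | zero =>
      exact (card_eq_zero.2 (filter_eq_empty_iff.2 fun j _ hj => hj.elim)).trans_le (Nat.zero_le s)
    | succ b =>
      refine le_trans ?_ (hw b (by omega))
      have : {j ∈ range n | bag H (b + 1) j} ⊆ insert b {j ∈ range b | H b j} := by
        intro j hj
        rcases (mem_filter.1 hj).2 with rfl | hj'
        · exact mem_insert_self _ _
        · exact mem_insert_of_mem (mem_filter.2
            ⟨mem_range.2 (h.lt b j (by omega) hj'), hj'⟩)
      exact (card_le_card this).trans (card_insert_le _ _)
  have hbagdisj : ∀ r ≤ n, ∀ b ≤ n - r, Disjoint (desc n H r b) {j ∈ range n | bag H b j} := by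
    intro r hr b hb
    rw [Finset.disjoint_left]
    intro j hj hj'
    have h1 := (h.descInv hr).mem b j hb hj
    have h2 := h.lt_of_bag (show b ≤ n by omega) (mem_filter.1 hj').2
    omega
  -- a set of the partition has no neighbours outside of its bag
  have hclosed : ∀ r ≤ n, ∀ b ≤ n - r, ∀ x ∈ desc n H r b, ∀ y < n, adj x y →
      y ∈ desc n H r b ∨ bag H b y := by
    intro r hr b hb x hx y hy hxy
    have J := h.descInv hr
    have hx' := J.mem b x hb hx
    rcases lt_trichotomy y x with hyx | rfl | hyx
    · exact J.bdry b x y hb hx (h.edge x y hx'.2 hyx hxy)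
    · exact Or.inl hx
    · obtain ⟨b', hb', hy'⟩ := J.cover y (by omega) hy
      rcases J.bdry b' y x hb' hy' (h.edge y x hy hyx (hadj _ _ hxy)) with h1 | h1
      · rw [J.inj b b' x hb hb' hx h1]
        exact Or.inl hy'
      · have := h.lt_of_bag (show b' ≤ n by omega) h1
        omega
  have hcompl : ∀ A X : Finset ℕ, s < #(W ∩ A) → #(W \ (A ∪ X)) ≤ 2 * s := by
    intro A X hA
    have h1 := card_sdiff_add_card_inter W A
    have h2 : #(W \ (A ∪ X)) ≤ #(W \ A) := card_le_card (sdiff_subset_sdiff le_rfl subset_union_left)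
    omega
  by_cases hbig : s < #(W ∩ insert i (desc n H r (i + 1)))
  · refine ⟨insert i (desc n H r (i + 1)), {j ∈ range i | H i j}, ?_, ?_, ?_, ?_,
      hcompl _ _ hbig, ?_⟩
    · exact (filter_subset _ _).trans fun x hx => by simp at hx ⊢; omega
    · rw [Finset.disjoint_left]
      intro j hj hj'
      simp only [mem_filter, mem_range, mem_insert] at hj hj'
      rcases hj with rfl | hj
      · omega
      · have := hI.mem _ j (by omega) hj; omega
    · exact le_trans (by omega) (hw i hin)
    · have h1 : #(W ∩ insert i (desc n H r (i + 1))) ≤ #(W ∩ desc n H r (i + 1)) + 1 := by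
        refine (card_le_card ?_).trans (card_insert_le i _)
        intro x hx
        simp only [mem_inter, mem_insert] at hx ⊢
        tauto
      have h2 := hsmall (i + 1) (by omega)
      omega
    · intro x hx y hy hxy
      simp only [mem_union, mem_insert, mem_filter, mem_range]
      rcases mem_insert.1 hx with rfl | hx
      · rcases lt_trichotomy y x with hyx | rfl | hyx
        · exact Or.inr ⟨hyx, h.edge x y hin hyx hxy⟩
        · tauto
        · obtain ⟨b', hb', hy'⟩ := hI.cover y (by omega) hy
          rcases hI.bdry b' y x hb' hy' (h.edge y x hy hyx (hadj _ _ hxy)) with h1 | h1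
          · have := hI.mem b' x hb' h1; omega
          · have := h.lt_of_bag (show b' ≤ n by omega) h1
            obtain rfl : b' = x + 1 := by omega
            tauto
      · rcases hclosed r (by omega) (i + 1) (by omega) x hx y hy hxy with h1 | h1 | h1
        · tauto
        · tauto
        · exact Or.inr ⟨h.lt i y hin h1, h1⟩
  · refine ⟨desc n H (r + 1) a, {j ∈ range n | bag H a j}, filter_subset _ _,
      hbagdisj _ hrn a ha, hbagle a (by omega), ?_, hcompl _ _ hlt, ?_⟩
    · have h1 : #(W ∩ desc n H (r + 1) a) ≤ #(W ∩ desc n H r a) +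
          #(W ∩ insert i (desc n H r (i + 1))) := by
        rw [hdef, inter_union_distrib_left]
        exact card_union_le _ _
      have h2 := hsmall a (by omega)
      omega
    · intro x hx y hy hxy
      simp only [mem_union, mem_filter, mem_range]
      rcases hclosed _ hrn a ha x hx y hy hxy with h1 | h1 <;> tauto

/-! ### Dynamic programming over an elimination order -/

/-- The number `x` is the total weight, over all vertices that have been merged into the node `a`,
of a colouring with `k` colours that agrees with `g` on the bag of `a`. The weight of a vertex
may depend on the colours of all vertices. -/
def Attained (n : ℕ) (H : ℕ → ℕ → Prop) (k : ℕ) (own : ℕ → (ℕ → ℕ) → ℕ) (r a : ℕ) (g : ℕ → ℕ)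
    (x : ℕ) : Prop :=
  ∃ f : ℕ → ℕ, (∀ u, f u < k) ∧ (∀ u, bag H a u → f u = g u) ∧
    ∑ j ∈ desc n H r a, own j f = x

variable {k : ℕ} {own : ℕ → (ℕ → ℕ) → ℕ} {r a x : ℕ} {g g' : ℕ → ℕ}

lemma attained_congr (hg : ∀ u, bag H a u → g u = g' u) :
    Attained n H k own r a g x ↔ Attained n H k own r a g' x := by
  refine exists_congr fun f => and_congr_right fun _ => and_congr_left fun _ => ?_
  exact forall_congr' fun u => forall_congr' fun hu => by rw [hg u hu]

/-- The recursion: eliminating the vertex `i` merges the weights of its node `i + 1`, for all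
colours of `i`, into those of its parent. -/
theorem Elim.attained_step (h : Elim n adj H)
    (hown : ∀ j < n, ∀ f f', f j = f' j → (∀ u, H j u → f u = f' u) → own j f = own j f') {i : ℕ}
    (hi : i < n) (hr : n - 1 - r = i) (hrn : r < n) :
    Attained n H k own (r + 1) (par H i) g x ↔ ∃ y z, Attained n H k own r (par H i) g y ∧
      (∃ c < k, ∃ z', Attained n H k own r (i + 1) (Function.update g i c) z' ∧
        z' + own i (Function.update g i c) = z) ∧ y + z = x := by
  have hI := h.descInv hrn.le
  have hir : n - r = i + 1 := by omega
  have hp : par H i ≤ i := par_le i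
  have hdef : desc n H (r + 1) (par H i) =
      desc n H r (par H i) ∪ insert i (desc n H r (i + 1)) := by
    rw [desc, hr, if_pos rfl]
  set D1 := desc n H r (par H i) with hD1
  set D2 := desc n H r (i + 1) with hD2
  have m1 : ∀ j ∈ D1, i + 1 ≤ j ∧ j < n := fun j hj => by
    have := hI.mem _ j (by omega) hj; omega
  have m2 : ∀ j ∈ D2, i + 1 ≤ j ∧ j < n := fun j hj => by
    have := hI.mem _ j (by omega) hj; omega
  have hi2 : i ∉ D2 := fun hc => by have := m2 i hc; omega
  have hdis : Disjoint D1 (insert i D2) := by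
    rw [Finset.disjoint_left]
    intro j hj hj'
    rcases mem_insert.1 hj' with rfl | hj'
    · have := m1 j hj; omega
    · have := hI.inj _ _ j (by omega) (by omega) hj hj'
      omega
  have hsum : ∀ f, ∑ j ∈ desc n H (r + 1) (par H i), own j f =
      ∑ j ∈ D1, own j f + (∑ j ∈ D2, own j f + own i f) := fun f => by
    rw [hdef, sum_union hdis, sum_insert hi2, add_comm (own i f)]
  constructor
  · rintro ⟨f, hf, hfg, rfl⟩
    have hag : ∀ u, bag H (i + 1) u → f u = Function.update g i (f i) u := by
      rintro u (rfl | hu)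
      · simp
      · rw [Function.update_of_ne (by have := h.lt i u hi hu; omega), hfg u (h.bag_par hi hu)]
    refine ⟨_, _, ⟨f, hf, hfg, rfl⟩, ⟨f i, hf i, _, ⟨f, hf, hag, rfl⟩, rfl⟩, ?_⟩
    rw [hsum, hown i hi f (Function.update g i (f i)) (by simp) fun u hu => hag u (Or.inr hu)]
  · rintro ⟨y, z, ⟨f1, hf1, hg1, rfl⟩, ⟨c, hc, z', ⟨f2, hf2, hg2, rfl⟩, rfl⟩, rfl⟩
    have hi2' : f2 i = c := by simpa using hg2 i (Or.inl rfl)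
    have hH2 : ∀ u, H i u → f2 u = g u := fun u hu => by
      rw [hg2 u (Or.inr hu), Function.update_of_ne (by have := h.lt i u hi hu; omega)]
    let f : ℕ → ℕ := fun u => if u ∈ insert i D2 then f2 u else f1 u
    have fp : ∀ u ∈ insert i D2, f u = f2 u := fun u hu => if_pos hu
    have fn : ∀ u, u ∉ insert i D2 → f u = f1 u := fun u hu => if_neg hu
    have hsmall : ∀ u < i, u ∉ insert i D2 := fun u hu hu' => by
      rcases mem_insert.1 hu' with rfl | hu'
      · omega
      · have := m2 u hu'; omega
    have hbag : ∀ u, bag H (par H i) u → u < i := fun u hu => by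
      have := h.lt_of_bag (by omega) hu; omega
    have hH : ∀ u, H i u → f u = f2 u := fun u hu => by
      rw [fn u (hsmall u (h.lt i u hi hu)), hg1 u (h.bag_par hi hu), hH2 u hu]
    refine ⟨f, fun u => ?_, fun u hu => ?_, ?_⟩
    · by_cases hu : u ∈ insert i D2
      · rw [fp u hu]; exact hf2 u
      · rw [fn u hu]; exact hf1 u
    · rw [fn u (hsmall u (hbag u hu)), hg1 u hu]
    · rw [hsum]
      congr 1
      · refine sum_congr rfl fun j hj => hown j (m1 j hj).2 _ _ ?_ fun u hu => ?_
        · exact fn j fun hc => (Finset.disjoint_left.1 hdis) hj hc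
        · rcases hI.bdry _ j u (by omega) hj hu with h' | h'
          · exact fn u fun hc => (Finset.disjoint_left.1 hdis) h' hc
          · exact fn u (hsmall u (hbag u h'))
      · congr 1
        · refine sum_congr rfl fun j hj => hown j (m2 j hj).2 _ _ ?_ fun u hu => ?_
          · exact fp j (mem_insert_of_mem hj)
          · rcases hI.bdry _ j u (by omega) hj hu with h' | rfl | h'
            · exact fp u (mem_insert_of_mem h')
            · exact fp u (mem_insert_self _ _)
            · exact hH u h'
        · refine hown i hi _ _ ?_ fun u hu => ?_
          · rw [fp i (mem_insert_self _ _), hi2']; simp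
          · rw [hH u hu, hH2 u hu, Function.update_of_ne (by have := h.lt i u hi hu; omega)]

lemma attained_succ_of_ne {i : ℕ} (hr : n - 1 - r = i) (ha : a ≠ par H i) :
    Attained n H k own (r + 1) a g x ↔ Attained n H k own r a g x := by
  simp only [Attained, desc, hr, if_neg ha]

lemma Elim.attained_root (h : Elim n adj H) :
    Attained n H k own n 0 g x ↔ ∃ f : ℕ → ℕ, (∀ u, f u < k) ∧ ∑ j ∈ range n, own j f = x := by
  simp [Attained, h.desc_root, bag]

end

/-! ### Colourings and their weights -/

open Classical in
/-- The number of vertices of colour `c`. -/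
noncomputable def colorSize (n : ℕ) (f : ℕ → ℕ) (c : ℕ) : ℕ := #{i ∈ range n | f i = c}

open Classical in
/-- The number of edges with exactly one end of colour `c`. -/
noncomputable def colorCut (n : ℕ) (adj : ℕ → ℕ → Prop) (f : ℕ → ℕ) (c : ℕ) : ℕ :=
  #{p ∈ range n ×ˢ range n | adj p.1 p.2 ∧ f p.1 = c ∧ f p.2 ≠ c}

/-- The colour classes of `f` form a solution of the problem. -/
def IsSolution (n : ℕ) (adj : ℕ → ℕ → Prop) (k : ℕ) (N : ℚ) (f : ℕ → ℕ) : Prop :=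
  0 ≤ N ∧ ∀ c < k, 0 < colorSize n f c ∧
    N.den * colorCut n adj f c ≤ N.num.natAbs * colorSize n f c

lemma isSolution_congr {n k : ℕ} {adj adj' : ℕ → ℕ → Prop} {N : ℚ} {f : ℕ → ℕ}
    (h : ∀ i < n, ∀ j < n, (adj i j ↔ adj' i j)) :
    IsSolution n adj k N f ↔ IsSolution n adj' k N f := by
  classical
  have : ∀ c, colorCut n adj f c = colorCut n adj' f c := fun c => by
    rw [colorCut, colorCut]
    congr 1
    refine filter_congr fun p hp => ?_
    simp only [mem_product, mem_range] at hp
    rw [h _ hp.1 _ hp.2]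
  simp only [IsSolution, this]

open Classical in
/-- The weight of a vertex `j` in a colouring `f`, in the number system with base `R`: digit
number `c` counts the vertices of colour `c` and, with weight `n + 1`, the edges with exactly one
end of colour `c`. The edges between `j` and smaller vertices are counted at `j`. -/
noncomputable def ownWeight (n : ℕ) (adj : ℕ → ℕ → Prop) (R j : ℕ) (f : ℕ → ℕ) : ℕ :=
  R ^ f j + ∑ i ∈ range j, if adj j i ∧ f i ≠ f j then (n + 1) * (R ^ f j + R ^ f i) else 0

lemma colorSize_le (n : ℕ) (f : ℕ → ℕ) (c : ℕ) : colorSize n f c ≤ n := by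
  classical
  exact (card_filter_le _ _).trans (by simp)

lemma colorCut_le (n : ℕ) (adj : ℕ → ℕ → Prop) (f : ℕ → ℕ) (c : ℕ) :
    colorCut n adj f c ≤ n * n := by
  classical
  exact (card_filter_le _ _).trans (by simp)

theorem sum_ownWeight {n k : ℕ} {adj : ℕ → ℕ → Prop}
    (hadj : ∀ i < n, ∀ j < n, adj i j → adj j i) (R : ℕ)
    {f : ℕ → ℕ} (hf : ∀ u, f u < k) : ∑ j ∈ range n, ownWeight n adj R j f =
      ∑ c ∈ range k, (colorSize n f c + (n + 1) * colorCut n adj f c) * R ^ c := by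
  classical
  have hsym : ∀ i < n, ∀ j < n, (adj i j ↔ adj j i) := fun i hi j hj =>
    ⟨hadj i hi j hj, hadj j hj i hi⟩
  have h1 : ∑ j ∈ range n, R ^ f j = ∑ c ∈ range k, colorSize n f c * R ^ c := by
    simp only [colorSize, card_filter, sum_mul]
    rw [sum_comm]
    refine sum_congr rfl fun j _ => ?_
    simp [ite_mul, hf j]
  have h2 : ∑ c ∈ range k, colorCut n adj f c * R ^ c =
      ∑ i ∈ range n, ∑ j ∈ range n, if adj i j ∧ f j ≠ f i then R ^ f i else 0 := by
    simp only [colorCut, card_filter, sum_mul, sum_product]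
    rw [sum_comm]
    refine sum_congr rfl fun i _ => ?_
    rw [sum_comm]
    refine sum_congr rfl fun j _ => ?_
    rw [sum_eq_single (f i)]
    · by_cases h : adj i j ∧ f j ≠ f i <;> simp [h]
    · intro c _ hc
      simp [hc.symm]
    · intro hc
      exact absurd (mem_range.2 (hf i)) hc
  have h3 : ∀ F : ℕ → ℕ → ℕ, (∀ i, F i i = 0) → ∀ m, ∑ i ∈ range m, ∑ j ∈ range m, F i j =
      ∑ j ∈ range m, ∑ i ∈ range j, (F j i + F i j) := by
    intro F hF m
    induction m with
    | zero => simp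
    | succ m ih =>
      have hs : ∑ i ∈ range m, ∑ j ∈ range (m + 1), F i j =
          ∑ i ∈ range m, (∑ j ∈ range m, F i j + F i m) :=
        Finset.sum_congr rfl fun i _ => Finset.sum_range_succ _ _
      rw [Finset.sum_range_succ (fun i => ∑ j ∈ range (m + 1), F i j),
        Finset.sum_range_succ (fun j => F m j),
        Finset.sum_range_succ (fun j => ∑ i ∈ range j, (F j i + F i j)), ← ih, hs, hF,
        sum_add_distrib, sum_add_distrib]
      ring
  have h4 : ∀ c ∈ range k, (colorSize n f c + (n + 1) * colorCut n adj f c) * R ^ c =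
      colorSize n f c * R ^ c + (n + 1) * (colorCut n adj f c * R ^ c) := fun c _ => by ring
  rw [Finset.sum_congr rfl h4]
  simp only [ownWeight, sum_add_distrib]
  rw [h1, ← mul_sum, h2, h3 _ (by simp), mul_sum]
  congr 1
  refine sum_congr rfl fun j hj => ?_
  rw [mul_sum]
  refine sum_congr rfl fun i hi => ?_
  rw [mem_range] at hi hj
  rw [hsym i (hi.trans hj) j hj]
  by_cases h : adj j i ∧ f i ≠ f j
  · simp [h, h.2.symm]
  · rw [if_neg h, if_neg h, if_neg (by tauto)]; simp

lemma sum_digits_lt {R k : ℕ} {d : ℕ → ℕ} (hd : ∀ c < k, d c < R) :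
    ∑ c ∈ range k, d c * R ^ c < R ^ k := by
  induction k with
  | zero => simp
  | succ k ih =>
    have h1 := ih fun c hc => hd c (by omega)
    have h2 : (d k + 1) * R ^ k ≤ R * R ^ k := Nat.mul_le_mul_right _ (hd k (by omega))
    rw [sum_range_succ, pow_succ']
    linarith

lemma sum_digits_div_mod {R k c : ℕ} {d : ℕ → ℕ} (hd : ∀ c < k, d c < R) (hc : c < k) :
    (∑ c ∈ range k, d c * R ^ c) / R ^ c % R = d c := by
  have hR : 0 < R := lt_of_le_of_lt (Nat.zero_le _) (hd c hc)
  obtain ⟨m, rfl⟩ : ∃ m, k = c + 1 + m := ⟨k - (c + 1), by omega⟩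
  have h1 := sum_digits_lt (k := c) fun c' hc' => hd c' (by omega)
  have h2 : ∑ x ∈ range (c + 1 + m), d x * R ^ x = ∑ x ∈ range c, d x * R ^ x +
      R ^ c * (d c + R * ∑ i ∈ range m, d (c + 1 + i) * R ^ i) := by
    rw [sum_range_add, sum_range_succ, mul_add, mul_sum, mul_sum, add_assoc]
    congr 1
    congr 1
    · ring
    · exact sum_congr rfl fun i _ => by ring
  rw [h2, Nat.add_mul_div_left _ _ (pow_pos hR c), Nat.div_eq_of_lt h1, zero_add,
    Nat.add_mul_mod_self_left, Nat.mod_eq_of_lt (hd c hc)]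

lemma digit_lt (n : ℕ) (adj : ℕ → ℕ → Prop) (f : ℕ → ℕ) (c : ℕ) :
    colorSize n f c + (n + 1) * colorCut n adj f c < (n + 1) * (n * n + 1) := by
  have h1 := colorSize_le n f c
  have h2 := Nat.mul_le_mul_left (n + 1) (colorCut_le n adj f c)
  nlinarith

/-- The graph of an instance as a relation on numbers. -/
def Instance.adj (I : Instance) (u v : ℕ) : Prop :=
  ∃ (hu : u < I.n) (hv : v < I.n), I.graph.Adj ⟨u, hu⟩ ⟨v, hv⟩

lemma Instance.adj_symm (I : Instance) {u v : ℕ} (h : I.adj u v) : I.adj v u := by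
  obtain ⟨hu, hv, h⟩ := h
  exact ⟨hv, hu, h.symm⟩

open Classical in
lemma cutSize_eq {V : Type} [Fintype V] (G : SimpleGraph V) (S : Finset V) :
    cutSize G S = #{p : V × V | G.Adj p.1 p.2 ∧ p.1 ∈ S ∧ p.2 ∉ S} := by
  rw [cutSize, ← Set.ncard_coe_finset]
  symm
  refine Set.ncard_congr (fun p _ => s(p.1, p.2)) ?_ ?_ ?_
  · rintro ⟨u, v⟩ h
    simp only [coe_filter, mem_univ, true_and, Set.mem_ofPred_eq] at h
    exact ⟨h.1, u, h.2.1, v, h.2.2, rfl⟩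
  · rintro ⟨u, v⟩ ⟨u', v'⟩ h h' he
    simp only [coe_filter, mem_univ, true_and, Set.mem_ofPred_eq] at h h'
    rcases Sym2.eq_iff.1 he with ⟨rfl, rfl⟩ | ⟨rfl, rfl⟩
    · rfl
    · exact absurd h.2.1 h'.2.2
  · rintro e ⟨he, u, hu, v, hv, rfl⟩
    exact ⟨(u, v), by simpa [hu, hv] using he, rfl⟩

lemma edgeExpansion_le_iff {V : Type} {G : SimpleGraph V} {S : Finset V} (hS : S.Nonempty)
    {N : ℚ} : edgeExpansion G S ≤ N ↔ 0 ≤ N ∧ N.den * cutSize G S ≤ N.num.natAbs * #S := by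
  have hc : (0 : ℚ) < #S := by exact_mod_cast hS.card_pos
  have hd : (0 : ℚ) < N.den := by exact_mod_cast N.den_pos
  have h0 : 0 ≤ edgeExpansion G S := by unfold edgeExpansion; positivity
  by_cases hN : 0 ≤ N
  · have hnum : ((N.num.natAbs : ℕ) : ℚ) = N * N.den := by
      rw [Rat.mul_den_eq_num]
      rw [← Int.cast_natCast, Int.natAbs_of_nonneg (Rat.num_nonneg.2 hN)]
    rw [edgeExpansion, div_le_iff₀ hc]
    simp only [hN, true_and]
    rw [← Nat.cast_le (α := ℚ)]
    push_cast
    rw [hnum]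
    constructor
    · intro h; nlinarith
    · intro h
      have : (N.den : ℚ) * cutSize G S ≤ N.den * (N * #S) := by linarith
      exact le_of_mul_le_mul_left this hd
  · simp only [hN, false_and, iff_false]
    exact fun h => hN (h0.trans h)

theorem Instance.isYes_iff (I : Instance) {k : ℕ} (hk : 0 < k) :
    I.IsYes k ↔ ∃ f : ℕ → ℕ, (∀ u, f u < k) ∧ IsSolution I.n I.adj k I.N f := by
  classical
  have hsize : ∀ (f : ℕ → ℕ) (c : ℕ), colorSize I.n f c = #{v : Fin I.n | f v = c} := by
    intro f c
    rw [colorSize]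
    refine (card_nbij (fun v : Fin I.n => (v : ℕ)) ?_ ?_ ?_).symm
    · intro v hv; simp at hv ⊢; exact hv
    · intro v _ v' _ h; exact Fin.ext h
    · intro i hi
      simp at hi
      exact ⟨⟨i, hi.1⟩, by simpa using hi.2, rfl⟩
  have hcut : ∀ (f : ℕ → ℕ) (c : ℕ),
      colorCut I.n I.adj f c = cutSize I.graph {v : Fin I.n | f v = c} := by
    intro f c
    rw [colorCut, cutSize_eq]
    refine (card_nbij (fun p : Fin I.n × Fin I.n => ((p.1 : ℕ), (p.2 : ℕ))) ?_ ?_ ?_).symm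
    · rintro ⟨u, v⟩ h
      simp at h ⊢
      exact ⟨⟨u.2, v.2, h.1⟩, h.2⟩
    · rintro ⟨u, v⟩ _ ⟨u', v'⟩ _ h
      simp only [Prod.mk.injEq] at h
      exact Prod.ext (Fin.ext h.1) (Fin.ext h.2)
    · rintro ⟨u, v⟩ h
      simp at h
      obtain ⟨⟨hu, hv⟩, ⟨_, _, hadj⟩, h⟩ := h
      exact ⟨(⟨u, hu⟩, ⟨v, hv⟩), by simpa using ⟨hadj, h⟩, rfl⟩
  constructor
  · rintro ⟨S, hS, hle⟩
    choose g hg using hS.cover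
    refine ⟨fun u => if hu : u < I.n then g ⟨u, hu⟩ else 0, fun u => ?_, ?_, fun c hc => ?_⟩
    · dsimp only; split_ifs <;> omega
    · exact ((edgeExpansion_le_iff (hS.nonempty ⟨0, hk⟩)).1 (hle ⟨0, hk⟩)).1
    · have hSc : ({v : Fin I.n | (if hu : (v : ℕ) < I.n then ((g ⟨v, hu⟩ : Fin k) : ℕ) else 0) = c} :
          Finset (Fin I.n)) = S ⟨c, hc⟩ := by
        ext v
        simp only [mem_filter, mem_univ, true_and, Fin.is_lt, dite_true, Fin.eta]
        constructor
        · rintro rfl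
          exact hg v
        · intro hv
          by_contra hne
          exact Finset.disjoint_left.1 (hS.disjoint (g v) ⟨c, hc⟩ fun h => hne (by rw [h])) (hg v) hv
      rw [hsize, hcut, hSc]
      exact ⟨(hS.nonempty _).card_pos, ((edgeExpansion_le_iff (hS.nonempty _)).1 (hle _)).2⟩
  · rintro ⟨f, hf, hN, h⟩
    refine ⟨fun c => {v : Fin I.n | f v = c}, ⟨fun c => ?_, fun c c' hcc' => ?_, fun v => ?_⟩,
      fun c => ?_⟩
    · rw [← card_pos, ← hsize]
      exact (h c c.2).1
    · rw [Finset.disjoint_left]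
      intro v hv hv'
      simp at hv hv'
      exact hcc' (Fin.ext (hv.symm.trans hv'))
    · exact ⟨⟨f v, hf v⟩, by simp⟩
    · have h1 := h c c.2
      rw [hsize, hcut] at h1
      exact (edgeExpansion_le_iff (card_pos.1 h1.1)).2 ⟨hN, h1.2⟩

/-- Solutions do not depend on the numbering of the vertices. -/
theorem exists_isSolution_relabel {n k : ℕ} {adj : ℕ → ℕ → Prop} {N : ℚ} (hk : 0 < k) {ord : ℕ → ℕ}
    (hord : Set.BijOn ord (Set.Iio n) (Set.Iio n)) :
    (∃ f : ℕ → ℕ, (∀ u, f u < k) ∧ IsSolution n adj k N f) ↔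
      ∃ f : ℕ → ℕ, (∀ u, f u < k) ∧ IsSolution n (fun i j => adj (ord i) (ord j)) k N f := by
  classical
  have hmap : ∀ i, i < n → ord i < n := fun i hi => hord.mapsTo hi
  have key : ∀ f : ℕ → ℕ, IsSolution n adj k N f ↔
      IsSolution n (fun i j => adj (ord i) (ord j)) k N (f ∘ ord) := by
    intro f
    have h1 : ∀ c, colorSize n (f ∘ ord) c = colorSize n f c := by
      intro c
      refine card_nbij ord ?_ ?_ ?_
      · intro i hi; simp at hi ⊢; exact ⟨hmap i hi.1, hi.2⟩
      · intro i hi j hj h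
        simp at hi hj
        exact hord.injOn hi.1 hj.1 h
      · intro v hv
        simp at hv
        obtain ⟨i, hi, rfl⟩ := hord.surjOn hv.1
        exact ⟨i, by simpa using ⟨hi, hv.2⟩, rfl⟩
    have h2 : ∀ c, colorCut n (fun i j => adj (ord i) (ord j)) (f ∘ ord) c = colorCut n adj f c := by
      intro c
      refine card_nbij (Prod.map ord ord) ?_ ?_ ?_
      · rintro ⟨i, j⟩ h
        simp at h ⊢
        exact ⟨⟨hmap i h.1.1, hmap j h.1.2⟩, h.2⟩
      · rintro ⟨i, j⟩ hi ⟨i', j'⟩ hi' h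
        simp at hi hi' h
        exact Prod.ext (hord.injOn hi.1.1 hi'.1.1 h.1) (hord.injOn hi.1.2 hi'.1.2 h.2)
      · rintro ⟨u, v⟩ h
        simp at h
        obtain ⟨i, hi, rfl⟩ := hord.surjOn h.1.1
        obtain ⟨j, hj, rfl⟩ := hord.surjOn h.1.2
        exact ⟨(i, j), by simpa using ⟨⟨hi, hj⟩, h.2⟩, rfl⟩
    simp only [IsSolution, h1, h2]
  constructor
  · rintro ⟨f, hf, h⟩
    exact ⟨f ∘ ord, fun u => hf _, (key f).1 h⟩
  · rintro ⟨f, hf, h⟩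
    refine ⟨fun v => if v < n then f (Function.invFunOn ord (Set.Iio n) v) else 0, fun u => ?_,
      (key _).2 ?_⟩
    · dsimp only; split_ifs
      exacts [hf _, hk]
    · have : ∀ i < n, ((fun v => if v < n then f (Function.invFunOn ord (Set.Iio n) v) else 0) ∘ ord)
          i = f i := fun i hi => by
        simp only [Function.comp, hmap i hi, if_true]
        rw [hord.injOn.leftInvOn_invFunOn hi]
      have h1 : ∀ c, colorSize n ((fun v => if v < n then
          f (Function.invFunOn ord (Set.Iio n) v) else 0) ∘ ord) c = colorSize n f c := by
        intro c
        rw [colorSize, colorSize]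
        congr 1
        exact filter_congr fun i hi => by rw [this i (mem_range.1 hi)]
      have h2 : ∀ c, colorCut n (fun i j => adj (ord i) (ord j)) ((fun v => if v < n then
          f (Function.invFunOn ord (Set.Iio n) v) else 0) ∘ ord) c =
          colorCut n (fun i j => adj (ord i) (ord j)) f c := by
        intro c
        rw [colorCut, colorCut]
        congr 1
        refine filter_congr fun p hp => ?_
        simp only [mem_product, mem_range] at hp
        rw [this p.1 hp.1, this p.2 hp.2]
      simpa only [IsSolution, h1, h2] using h

open SparsestCut.Expr SparsestCut.Cmd

/-! ### The dynamic program: preparations -/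

/-- The relation given by a matrix with `n` columns that is stored row by row. -/
def rel (n : ℕ) (A : ℕ → ℕ) (i j : ℕ) : Prop := j < n ∧ A (i * n + j) ≠ 0

lemma index_inj {n i i' j j' : ℕ} (hj : j < n) (hj' : j' < n) :
    i * n + j = i' * n + j' ↔ i = i' ∧ j = j' := by
  refine ⟨fun h => ?_, fun ⟨h1, h2⟩ => by rw [h1, h2]⟩
  have h1 : (i * n + j) / n = i := by
    rw [mul_comm, Nat.mul_add_div (by omega), Nat.div_eq_of_lt hj, add_zero]
  have h2 : (i' * n + j') / n = i' := by
    rw [mul_comm, Nat.mul_add_div (by omega), Nat.div_eq_of_lt hj', add_zero]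
  have h3 : i = i' := by rw [← h1, h, h2]
  subst h3
  exact ⟨rfl, by omega⟩

lemma index_lt {n m i j : ℕ} (hi : i < m) (hj : j < n) : i * n + j < m * n :=
  calc i * n + j < i * n + n := by omega
    _ = (i + 1) * n := by ring
    _ ≤ m * n := Nat.mul_le_mul_right _ hi

/-- Store the powers `b ^ i`, for `i` below the scalar `j`, and compute the next power in `acc`. -/
def powers (a : Ar) (acc b j : Sc) : Cmd :=
  .set acc 1 ;; .loop 0 j (.put a (var 0) acc ;; .set acc (sc acc * sc b))

section
variable {I : ℕ → ℕ} {bd : Bounds} {ρ : ℕ → ℕ} {σ : St}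

lemma wp_powers {a : Ar} {acc b j : Sc} (h1 : b ≠ acc) (h2 : j ≠ acc) (hb : 0 < σ.sc b)
    (hidx : σ.sc j ≤ bd.idx) (hsc : σ.sc b ^ σ.sc j ≤ bd.sc acc) (hval : σ.sc b ^ σ.sc j ≤ bd.val) :
    Wp I bd (powers a acc b j) ρ (fun τ => τ.sc acc = σ.sc b ^ σ.sc j ∧
      ∀ i < σ.sc j, τ.ar a i = σ.sc b ^ i) σ := by
  have hle : ∀ i ≤ σ.sc j, σ.sc b ^ i ≤ σ.sc b ^ σ.sc j := fun i hi => Nat.pow_le_pow_right hb hi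
  rw [powers, wp_seq, wp_set]
  refine ⟨le_trans (by simpa using hle 0 (Nat.zero_le _)) hsc, ?_⟩
  refine wp_loop (fun k τ => τ.sc acc = σ.sc b ^ k ∧ ∀ i < k, τ.ar a i = σ.sc b ^ i) (by simp) ?_ ?_
  · rintro i hi τ hF ⟨ha, hpw⟩
    have hb' : τ.sc b = σ.sc b := by
      rw [hF.sc b (by simpa [scs] using h1)]; simp [h1]
    simp only [St.setSc_sc, if_neg h2] at hi
    simp only [wp_seq, wp_put, wp_set, eval_var, Function.update_self, eval_sc, eval_mul,
      St.setAr_sc, ha, hb', St.setSc_ar, St.setSc_sc, if_true, St.setAr_ar, true_and]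
    refine ⟨⟨by omega, (hle i hi.le).trans hval⟩, ?_, (pow_succ _ _).symm, fun i' hi' => ?_⟩
    · rw [← pow_succ]; exact (hle _ hi).trans hsc
    · by_cases h : i' = i
      · simp [h]
      · simp [h, hpw i' (by omega)]
  · rintro τ hF hI
    simpa only [St.setSc_sc, if_neg h2] using hI

/-- The entry `(i, j)` of a matrix with as many columns as the graph has vertices. -/
def entry (a : Ar) (i j : Expr) : Expr := ar a (i * sc .n + j)

/-- Compute in the scalar `w` the maximal size of a set `H i`, plus one. -/
def widthCmd : Cmd :=
  .set .w 0 ;;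
  .loop 0 .n (.when ((sc .w).lt ((entry .H (var 0) (var 1)).count 1 .n + 1))
    (.set .w ((entry .H (var 0) (var 1)).count 1 .n + 1)))

open Classical in
lemma card_rel_eq {n : ℕ} {A : ℕ → ℕ} {i : ℕ} :
    #{j ∈ range n | A (i * n + j) ≠ 0} = #{j ∈ range n | rel n A i j} := by
  congr 1
  exact filter_congr fun j hj => by simp [rel, mem_range.1 hj]

open Classical in
lemma wp_width {n w : ℕ} (hn : σ.sc .n = n)
    (hw : ∀ i < n, #{j ∈ range n | rel n (σ.ar .H) i j} + 1 ≤ w) (hsc : w ≤ bd.sc .w) :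
    Wp I bd widthCmd ρ (fun τ => τ.sc .w ≤ w ∧
      ∀ i < n, #{j ∈ range n | rel n (σ.ar .H) i j} + 1 ≤ τ.sc .w) σ := by
  rw [widthCmd, wp_seq, wp_set]
  refine ⟨by simp, ?_⟩
  refine wp_loop (fun k τ => τ.sc .w ≤ w ∧
    ∀ i < k, #{j ∈ range n | rel n (σ.ar .H) i j} + 1 ≤ τ.sc .w) (by simp) ?_ ?_
  · rintro i hi τ hF ⟨ha, hb⟩
    simp only [St.setSc_sc, reduceCtorEq, if_false, hn] at hi
    have hn' : τ.sc .n = n := by rw [hF.sc .n (by decide)]; simp [hn]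
    have hH : τ.ar .H = σ.ar .H := by rw [hF.ar .H (by decide)]; simp
    have hc : ((entry .H (var 0) (var 1)).count 1 .n).eval I (Function.update ρ 0 i) τ =
        #{j ∈ range n | rel n (σ.ar .H) i j} := by
      rw [eval_count, ← card_rel_eq, hn']
      simp [entry, hn', hH]
    rw [wp_when]
    simp only [holds_lt, eval_sc, eval_add, eval_one, wp_set, hc]
    refine ⟨fun h => ⟨(hw i hi).trans hsc, ?_⟩, fun h => ⟨ha, fun i' hi' => ?_⟩⟩
    · simp only [St.setSc_sc, if_true]
      refine ⟨hw i hi, fun i' hi' => ?_⟩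
      by_cases h' : i' = i
      · rw [h']
      · have := hb i' (by omega); omega
    · by_cases h' : i' = i
      · rw [h']; omega
      · exact hb i' (by omega)
  · rintro τ hF hI
    simpa [hn] using hI

/-- Give every vertex the least slot that is not used by a vertex of `H i`. -/
def slotCmd : Cmd :=
  .loop 0 .n (.set .sl 0 ;;
    .loop 1 .n (.when ((entry .H (var 0) (var 2) * (ar .slot (var 2)).eq (sc .sl)).ex 2 .n)
      (.set .sl (sc .sl + 1))) ;;
    .put .slot (var 0) (sc .sl))

open Classical in
lemma wp_slot {n w : ℕ} (hn : σ.sc .n = n) (hlt : ∀ i j, i < n → rel n (σ.ar .H) i j → j < i)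
    (hw : ∀ i < n, #{j ∈ range n | rel n (σ.ar .H) i j} + 1 ≤ w) (hsc : n ≤ bd.sc .sl)
    (hidx : n ≤ bd.idx) (hval : n ≤ bd.val) :
    Wp I bd slotCmd ρ (fun τ => ∀ i < n, τ.ar .slot i < w ∧
      ∀ j, rel n (σ.ar .H) i j → τ.ar .slot j ≠ τ.ar .slot i) σ := by
  refine wp_loop (fun k τ => ∀ i < k, τ.ar .slot i < w ∧
    ∀ j, rel n (σ.ar .H) i j → τ.ar .slot j ≠ τ.ar .slot i) (by simp) ?_
    (fun τ hF hI => by rwa [hn] at hI)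
  rintro i hi τ hF hI
  rw [hn] at hi
  have hn' : τ.sc .n = n := by rw [hF.sc .n (by decide), hn]
  have hH : τ.ar .H = σ.ar .H := hF.ar .H (by decide)
  rw [wp_seq, wp_set]
  refine ⟨by simp, ?_⟩
  rw [wp_seq]
  -- all slots below the current one are used, hence the current one is at most `#(H i)`
  refine wp_loop (fun k υ => (∀ t < υ.sc .sl, ∃ j, rel n (σ.ar .H) i j ∧ τ.ar .slot j = t) ∧
    ((∀ j, rel n (σ.ar .H) i j → τ.ar .slot j ≠ υ.sc .sl) ∨ υ.sc .sl = k)) (by simp) ?_ ?_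
  · rintro k hk υ hG ⟨h1, h2⟩
    have hn'' : υ.sc .n = n := by rw [hG.sc .n (by decide)]; simp [hn']
    have hH' : υ.ar .H = σ.ar .H := by rw [hG.ar .H (by decide)]; simp [hH]
    have hs : υ.ar .slot = τ.ar .slot := by rw [hG.ar .slot (by decide)]; simp
    simp only [St.setSc_sc, reduceCtorEq, if_false, hn'] at hk
    have hc : (∃ i_1 < n, (σ.ar .H (i * n + i_1) ≠ 0) ∧ τ.ar .slot i_1 = υ.sc .sl) ↔
        ∃ j, rel n (σ.ar .H) i j ∧ τ.ar .slot j = υ.sc .sl := by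
      simp [rel, and_assoc]
    have hsl : υ.sc .sl < n → υ.sc .sl + 1 ≤ bd.sc .sl := fun h => by omega
    rw [wp_when]
    simp only [holds_ex, holds_mul, entry, holds_ar, holds_eq, eval_add, eval_mul, eval_var, eval_sc,
      eval_ar, hn'', hH', hs, hc, wp_set, eval_one, St.setSc_sc, if_true,
      Function.update_self, ne_eq, Function.update_of_ne, not_false_eq_true,
      OfNat.zero_ne_ofNat, zero_ne_one]
    refine ⟨fun h => ?_, fun h => ⟨h1, Or.inl fun j hj hj' => h ⟨j, hj, hj'⟩⟩⟩
    obtain ⟨j, hj, hj'⟩ := h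
    have hlk : υ.sc .sl = k := by
      rcases h2 with h2 | h2
      · exact absurd hj' (h2 j hj)
      · exact h2
    refine ⟨hsl (by omega), fun t ht => ?_, Or.inr (by omega)⟩
    by_cases ht' : t = υ.sc .sl
    · exact ⟨j, hj, hj'.trans ht'.symm⟩
    · exact h1 t (by omega)
  · rintro υ hG ⟨h1, h2⟩
    have hs : υ.ar .slot = τ.ar .slot := by rw [hG.ar .slot (by decide)]; simp
    simp only [St.setSc_sc, reduceCtorEq, if_false, hn'] at h2
    have hcard : υ.sc .sl ≤ #{j ∈ range n | rel n (σ.ar .H) i j} := by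
      have : range (υ.sc .sl) ⊆ ({j ∈ range n | rel n (σ.ar .H) i j}).image (τ.ar .slot) := by
        intro t ht
        obtain ⟨j, hj, hj'⟩ := h1 t (mem_range.1 ht)
        exact mem_image.2 ⟨j, by simp [hj, hj.1], hj'⟩
      simpa using (card_le_card this).trans card_image_le
    have hcard' : #{j ∈ range n | rel n (σ.ar .H) i j} ≤ i := by
      have : {j ∈ range n | rel n (σ.ar .H) i j} ⊆ range i := fun j hj =>
        mem_range.2 (hlt i j hi (mem_filter.1 hj).2)
      simpa using card_le_card this
    have hfree : ∀ j, rel n (σ.ar .H) i j → τ.ar .slot j ≠ υ.sc .sl := by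
      rcases h2 with h2 | h2
      · exact h2
      · omega
    have hwi := hw i hi
    simp only [wp_put, eval_var, eval_sc, Function.update_self, St.setAr_ar, true_and, hs]
    refine ⟨⟨by omega, by omega⟩, fun i' hi' => ?_⟩
    by_cases h : i' = i
    · subst h
      simp only [if_true]
      refine ⟨by omega, fun j hj => ?_⟩
      have := hlt i' j hi hj
      rw [if_neg (by omega)]
      exact hfree j hj
    · obtain ⟨h3, h4⟩ := hI i' (by omega)
      simp only [h, if_false]
      refine ⟨h3, fun j hj => ?_⟩
      have := hlt i' j (by omega) hj
      rw [if_neg (by omega)]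
      exact h4 j hj

end

/-! ### The dynamic program: the main loop -/

/-- The colour that the code `g` gives to the vertex `u`: the digit at the slot of `u`. -/
def digit (k : ℕ) (slot : ℕ → ℕ) (g u : ℕ) : ℕ := g / k ^ slot u % k

/-- Replace the digit number `s` of `g` by `c`. -/
def setDigit (k g s c : ℕ) : ℕ := g - g / k ^ s % k * k ^ s + c * k ^ s

lemma setDigit_eq {k g s c : ℕ} :
    setDigit k g s c = g % k ^ s + k ^ s * (c + k * (g / k ^ s / k)) := by
  have h1 := Nat.div_add_mod g (k ^ s)
  have h2 := Nat.div_add_mod (g / k ^ s) k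
  unfold setDigit
  set q := g / k ^ s
  have h3 : g = g % k ^ s + k ^ s * (k * (q / k)) + q % k * k ^ s := by
    calc g = k ^ s * q + g % k ^ s := h1.symm
      _ = k ^ s * (k * (q / k) + q % k) + g % k ^ s := by rw [h2]
      _ = _ := by ring
  have h4 : g - q % k * k ^ s = g % k ^ s + k ^ s * (k * (q / k)) := Nat.sub_eq_of_eq_add h3
  rw [h4]; ring

lemma setDigit_lt {k g s c w : ℕ} (hk : 0 < k) (hg : g < k ^ w) (hs : s < w) (hc : c < k) :
    setDigit k g s c < k ^ w := by
  rw [setDigit_eq, Nat.div_div_eq_div_mul, ← pow_succ]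
  obtain ⟨m, rfl⟩ : ∃ m, w = s + 1 + m := ⟨w - (s + 1), by omega⟩
  have h1 : g / k ^ (s + 1) < k ^ m := by
    rw [Nat.div_lt_iff_lt_mul (pow_pos hk _), ← pow_add, add_comm m]; exact hg
  have h2 : g % k ^ s < k ^ s := Nat.mod_lt _ (pow_pos hk _)
  set q := g / k ^ (s + 1)
  calc g % k ^ s + k ^ s * (c + k * q) < k ^ s + k ^ s * (c + k * q) := by omega
    _ = k ^ s * (c + 1 + k * q) := by ring
    _ ≤ k ^ s * (k * (q + 1)) := Nat.mul_le_mul_left _ (by rw [mul_add]; omega)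
    _ ≤ k ^ s * (k * k ^ m) := Nat.mul_le_mul_left _ (Nat.mul_le_mul_left _ h1)
    _ = k ^ (s + 1 + m) := by ring

lemma setDigit_self {k g s c : ℕ} (hk : 0 < k) (hc : c < k) :
    setDigit k g s c / k ^ s % k = c := by
  rw [setDigit_eq, Nat.add_mul_div_left _ _ (pow_pos hk _),
    Nat.div_eq_of_lt (Nat.mod_lt _ (pow_pos hk _)), zero_add, Nat.add_mul_mod_self_left,
    Nat.mod_eq_of_lt hc]

lemma setDigit_of_ne {k g s s' c : ℕ} (hk : 0 < k) (hc : c < k) (hs : s' ≠ s) :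
    setDigit k g s c / k ^ s' % k = g / k ^ s' % k := by
  have h0 : g % k ^ s + k ^ s * (g / k ^ s) = g := Nat.mod_add_div _ _
  have h1 := Nat.div_add_mod (g / k ^ s) k
  rw [setDigit_eq]
  rcases lt_or_gt_of_ne hs with h | h
  · obtain ⟨m, rfl⟩ : ∃ m, s = s' + 1 + m := ⟨s - (s' + 1), by omega⟩
    have key : ∀ X, (g % k ^ (s' + 1 + m) + k ^ (s' + 1 + m) * X) / k ^ s' % k =
        g % k ^ (s' + 1 + m) / k ^ s' % k := fun X => by
      rw [show k ^ (s' + 1 + m) * X = k ^ s' * (k * (k ^ m * X)) by ring,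
        Nat.add_mul_div_left _ _ (pow_pos hk _), Nat.add_mul_mod_self_left]
    rw [key, ← key (g / k ^ (s' + 1 + m)), h0]
  · obtain ⟨m, rfl⟩ : ∃ m, s' = s + 1 + m := ⟨s' - (s + 1), by omega⟩
    have key : ∀ d < k, (g % k ^ s + k ^ s * (d + k * (g / k ^ s / k))) / k ^ (s + 1 + m) =
        g / k ^ s / k / k ^ m := fun d hd => by
      rw [pow_add, pow_add, ← Nat.div_div_eq_div_mul, ← Nat.div_div_eq_div_mul,
        Nat.add_mul_div_left _ _ (pow_pos hk _), Nat.div_eq_of_lt (Nat.mod_lt _ (pow_pos hk _)),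
        zero_add, pow_one, Nat.add_mul_div_left _ _ hk, Nat.div_eq_of_lt hd, zero_add]
    rw [key c hc, ← key _ (Nat.mod_lt (g / k ^ s) hk), add_comm (g / k ^ s % k), h1, h0]

lemma ownWeight_congr {n : ℕ} {adj H : ℕ → ℕ → Prop} (h : Elim n adj H) (R : ℕ) :
    ∀ j < n, ∀ f f', f j = f' j → (∀ u, H j u → f u = f' u) →
      ownWeight n adj R j f = ownWeight n adj R j f' := by
  intro j hj f f' hjj hu
  rw [ownWeight, ownWeight, hjj]
  congr 1
  refine sum_congr rfl fun i hi => ?_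
  by_cases ha : adj j i
  · rw [hu i (h.edge j i hj (mem_range.1 hi) ha)]
  · simp [ha]

lemma ownWeight_le {n k R j : ℕ} {adj : ℕ → ℕ → Prop} (hR : 0 < R) (hj : j ≤ n) {f : ℕ → ℕ}
    (hf : ∀ u, f u < k) :
    ownWeight n adj R j f ≤ R ^ k + n * ((n + 1) * (R ^ k + R ^ k)) := by
  classical
  have hp : ∀ u, R ^ f u ≤ R ^ k := fun u => Nat.pow_le_pow_right hR (hf u).le
  rw [ownWeight]
  refine Nat.add_le_add (hp j) ?_
  refine (sum_le_card_nsmul _ _ ((n + 1) * (R ^ k + R ^ k)) fun i _ => ?_).trans ?_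
  · split_ifs
    · exact Nat.mul_le_mul_left _ (Nat.add_le_add (hp j) (hp i))
    · exact Nat.zero_le _
  · rw [card_range, smul_eq_mul]
    exact Nat.mul_le_mul_right _ hj

/-- The values that are fixed during the main loop. -/
structure Tables (n k w R : ℕ) (slot Hm adj ord : ℕ → ℕ) (σ : St) : Prop where
  n_eq : σ.sc .n = n
  kk_eq : σ.sc .kk = k
  M_eq : σ.sc .M = R ^ k
  K_eq : σ.sc .K = k ^ w
  pw_eq : ∀ i < w, σ.ar .pw i = k ^ i
  rp_eq : ∀ c < k, σ.ar .rp c = R ^ c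
  slot_eq : σ.ar .slot = slot
  H_eq : σ.ar .H = Hm
  adj_eq : σ.ar .adj = adj
  ord_eq : σ.ar .ord = ord

lemma Tables.congr {n k w R : ℕ} {slot Hm adj ord : ℕ → ℕ} {σ τ : St}
    (h : Tables n k w R slot Hm adj ord σ) (hs : ∀ j ∈ [Sc.n, .kk, .M, .K], τ.sc j = σ.sc j)
    (ha : ∀ a ∈ [Ar.pw, .rp, .slot, .H, .adj, .ord], τ.ar a = σ.ar a) :
    Tables n k w R slot Hm adj ord τ := by
  constructor
  · rw [hs _ (by simp), h.n_eq]
  · rw [hs _ (by simp), h.kk_eq]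
  · rw [hs _ (by simp), h.M_eq]
  · rw [hs _ (by simp), h.K_eq]
  · rw [ha _ (by simp)]; exact h.pw_eq
  · rw [ha _ (by simp)]; exact h.rp_eq
  · rw [ha _ (by simp), h.slot_eq]
  · rw [ha _ (by simp), h.H_eq]
  · rw [ha _ (by simp), h.adj_eq]
  · rw [ha _ (by simp), h.ord_eq]

/-- The entry of the table `T` for the node `a`, the code `g` and the weight `x`. -/
def tEntry (a g x : Expr) : Expr := (a * sc .K + g) * sc .M + x

/-- The colour of the vertex `j` in the code `g`. -/
def digitExpr (j : Expr) : Expr := (sc .g / ar .pw (ar .slot j)).mod (sc .kk)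

/-- Set `g` to the code in variable `1` with the colour of `i` replaced by variable `2`, and `o` to
the weight of `i` in the resulting colouring. -/
def weightCmd : Cmd :=
  .set .g (var 1 - (var 1 / ar .pw (ar .slot (sc .i))).mod (sc .kk) * ar .pw (ar .slot (sc .i)) +
    var 2 * ar .pw (ar .slot (sc .i))) ;;
  .set .o (ar .rp (var 2) + sum 3 .n
    ((entry .adj (ar .ord (sc .i)) (ar .ord (var 3)) *
      ((var 3).lt (sc .i) * ((digitExpr (var 3)).eq (var 2)).not)).tv *
      ((sc .n + 1) * (ar .rp (var 2) + ar .rp (digitExpr (var 3))))))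

/-- The weights attained at the node `i + 1`, for all colours of `i`, go to the array `U`. -/
def fillCmd : Cmd :=
  .loop 2 .kk (weightCmd ;;
    .loop 3 .M (.when (ar .T (tEntry (sc .i + 1) (sc .g) (var 3)) *
      (var 3 + sc .o).lt (sc .M)) (.put .U (var 3 + sc .o) 1)))

/-- Clear the arrays `U` and `V`. -/
def clearCmd : Cmd := .loop 2 .M (.put .U (var 2) 0 ;; .put .V (var 2) 0)

/-- All sums of a weight attained at the parent and a weight in `U` go to `V`. -/
def convCmd : Cmd :=
  .loop 2 .M (.loop 3 .M (.when (ar .T (tEntry (sc .pa) (var 1) (var 2)) *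
    (ar .U (var 3) * (var 2 + var 3).lt (sc .M))) (.put .V (var 2 + var 3) 1)))

/-- Replace the weights at the parent by those in `V`. -/
def copyCmd : Cmd := .loop 2 .M (.put .T (tEntry (sc .pa) (var 1) (var 2)) (ar .V (var 2)).tv)

section
variable {I : ℕ → ℕ} {bd : Bounds} {ρ : ℕ → ℕ} {σ : St} {n k w R : ℕ} {slot Hm adj ord : ℕ → ℕ}

lemma wp_clear (hidx : σ.sc .M ≤ bd.idx) : Wp I bd clearCmd ρ
    (fun τ => ∀ x < σ.sc .M, τ.ar .U x = 0 ∧ τ.ar .V x = 0) σ := by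
  refine wp_loop (fun m τ => ∀ x < m, τ.ar .U x = 0 ∧ τ.ar .V x = 0) (by simp) ?_
    (fun τ _ h => h)
  rintro m hm τ hF hI
  simp only [wp_seq, wp_put, eval_var, eval_zero, Function.update_self, St.setAr_ar, reduceCtorEq,
    false_and, if_false, true_and, zero_le, and_true]
  refine ⟨by omega, by omega, fun x hx => ?_⟩
  by_cases h : x = m
  · simp [h]
  · simpa [h] using hI x (by omega)

/-- The relation between the positions in the elimination order that the stored graph gives. -/
def posAdj (n : ℕ) (adj ord : ℕ → ℕ) (i j : ℕ) : Prop := adj (ord i * n + ord j) ≠ 0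

lemma wp_weight {Q : St → Prop} (hT : Tables n k w R slot Hm adj ord σ) (hk : 0 < k) (hR : 0 < R)
    {i g c : ℕ} (hi : σ.sc .i = i) (hin : i < n)
    (hs : ∀ i < n, slot i < w ∧ ∀ j, rel n Hm i j → slot j ≠ slot i)
    (hρ1 : ρ 1 = g) (hρ2 : ρ 2 = c) (hg : g < k ^ w) (hc : c < k) (hbg : k ^ w ≤ bd.sc .g)
    (hbo : R ^ k + n * ((n + 1) * (R ^ k + R ^ k)) ≤ bd.sc .o)
    (hQ : Q ((σ.setSc .g (setDigit k g (slot i) c)).setSc .o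
      (ownWeight n (posAdj n adj ord) R i (digit k slot (setDigit k g (slot i) c))))) :
    Wp I bd weightCmd ρ Q σ := by
  classical
  have hlt := setDigit_lt hk hg (hs i hin).1 hc
  have hg' : (var 1 - (var 1 / ar .pw (ar .slot (sc .i))).mod (sc .kk) *
      ar .pw (ar .slot (sc .i)) + var 2 * ar .pw (ar .slot (sc .i))).eval I ρ σ =
        setDigit k g (slot i) c := by
    simp [eval_mod, hi, hT.slot_eq, hT.pw_eq _ (hs i hin).1, hρ1, hρ2, hT.kk_eq, setDigit]
  set g' := setDigit k g (slot i) c with hg'def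
  set τ := σ.setSc .g g' with hτ
  have hTτ : Tables n k w R slot Hm adj ord τ := hT.congr (by simp [hτ]) (by simp [hτ])
  have hi' : τ.sc .i = i := by simp [hτ, hi]
  have hgτ : τ.sc .g = g' := by simp [hτ]
  have hdi : digit k slot g' i = c := setDigit_self hk hc
  have ho : (ar .rp (var 2) + sum 3 .n
      ((entry .adj (ar .ord (sc .i)) (ar .ord (var 3)) *
        ((var 3).lt (sc .i) * ((digitExpr (var 3)).eq (var 2)).not)).tv *
        ((sc .n + 1) * (ar .rp (var 2) + ar .rp (digitExpr (var 3)))))).eval I ρ τ =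
      ownWeight n (posAdj n adj ord) R i (digit k slot g') := by
    have hd : ∀ j < n, (digitExpr (var 3)).eval I (Function.update ρ 3 j) τ =
        digit k slot g' j := fun j hj => by
      simp [digitExpr, eval_mod, hTτ.slot_eq, hTτ.pw_eq _ (hs j hj).1, hTτ.kk_eq, hgτ, digit]
    rw [eval_add, eval_sum, ownWeight, hdi, eval_ar, eval_var, hρ2, hTτ.rp_eq c hc, hTτ.n_eq]
    congr 1
    have hfil : range i = {j ∈ range n | j < i} := by ext j; simp; omega
    rw [hfil, sum_filter]
    refine sum_congr rfl fun j hj => ?_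
    have hdj := hd j (mem_range.1 hj)
    have hdk : digit k slot g' j < k := Nat.mod_lt _ hk
    rw [eval_mul, eval_tv]
    simp only [holds_mul, entry, holds_ar, holds_lt, holds_not, holds_eq, eval_add, eval_mul, hdj,
      eval_var, eval_sc, eval_ar, Function.update_self, hTτ.n_eq, hTτ.adj_eq, hTτ.ord_eq, hi',
      eval_one, ne_eq, Nat.reduceEqDiff, not_false_eq_true,
      Function.update_of_ne, hρ2, hTτ.rp_eq c hc, hTτ.rp_eq _ hdk]
    unfold posAdj
    by_cases h1 : adj (ord i * n + ord j) = 0 <;> by_cases h2 : j < i <;>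
      by_cases h3 : digit k slot g' j = c <;> simp [h1, h2, h3]
  rw [weightCmd, wp_seq, wp_set, hg', wp_set, ho]
  exact ⟨hlt.le.trans hbg, (ownWeight_le hR hin.le fun u => Nat.mod_lt _ hk).trans hbo, hQ⟩

lemma wp_fill (hT : Tables n k w R slot Hm adj ord σ) (hk : 0 < k) (hR : 0 < R)
    {i g : ℕ} (hi : σ.sc .i = i) (hin : i < n)
    (hs : ∀ i < n, slot i < w ∧ ∀ j, rel n Hm i j → slot j ≠ slot i)
    (hρ1 : ρ 1 = g) (hg : g < k ^ w) (hbg : k ^ w ≤ bd.sc .g)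
    (hbo : R ^ k + n * ((n + 1) * (R ^ k + R ^ k)) ≤ bd.sc .o)
    (hidx : R ^ k ≤ bd.idx) (hval : 1 ≤ bd.val) (hU : ∀ x < R ^ k, σ.ar .U x = 0) :
    Wp I bd fillCmd ρ (fun τ => ∀ z < R ^ k, τ.ar .U z ≠ 0 ↔ ∃ c < k, ∃ x < R ^ k,
      σ.ar .T (((i + 1) * k ^ w + setDigit k g (slot i) c) * R ^ k + x) ≠ 0 ∧
      x + ownWeight n (posAdj n adj ord) R i (digit k slot (setDigit k g (slot i) c)) = z) σ := by
  refine wp_loop (fun m τ => ∀ z < R ^ k, τ.ar .U z ≠ 0 ↔ ∃ c < m, ∃ x < R ^ k,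
      σ.ar .T (((i + 1) * k ^ w + setDigit k g (slot i) c) * R ^ k + x) ≠ 0 ∧
      x + ownWeight n (posAdj n adj ord) R i (digit k slot (setDigit k g (slot i) c)) = z)
    (fun z hz => by simp [hU z hz]) ?_ (fun τ _ h => by rwa [hT.kk_eq] at h)
  intro c hc τ hF hI
  rw [hT.kk_eq] at hc
  have hTτ : Tables n k w R slot Hm adj ord τ := hT.congr
    (fun j hj => hF.sc j (by fin_cases hj <;> decide)) (fun a ha => hF.ar a (by fin_cases ha <;> decide))
  have hiτ : τ.sc .i = i := by rw [hF.sc .i (by decide), hi]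
  rw [wp_seq]
  refine wp_weight hTτ hk hR hiτ hin hs (by simpa using hρ1) (by simp) hg hc hbg hbo ?_
  set g' := setDigit k g (slot i) c
  set o := ownWeight n (posAdj n adj ord) R i (digit k slot g')
  refine wp_loop (fun m υ => ∀ z < R ^ k, υ.ar .U z ≠ 0 ↔ τ.ar .U z ≠ 0 ∨ ∃ x < m,
      σ.ar .T (((i + 1) * k ^ w + g') * R ^ k + x) ≠ 0 ∧ x + o = z) (by simp) ?_ ?_
  · intro x hx υ hG hJ
    have h1 : υ.sc .i = i := by rw [hG.sc .i (by decide)]; simp [hiτ]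
    have h2 : υ.sc .g = g' := by rw [hG.sc .g (by decide)]; simp
    have h3 : υ.sc .o = o := by rw [hG.sc .o (by decide)]; simp
    have h4 : υ.sc .M = R ^ k := by rw [hG.sc .M (by decide)]; simp [hTτ.M_eq]
    have h5 : υ.sc .K = k ^ w := by rw [hG.sc .K (by decide)]; simp [hTτ.K_eq]
    have h6 : υ.ar .T = σ.ar .T := by
      rw [hG.ar .T (by decide)]; simp [hF.ar .T (by decide)]
    rw [wp_when]
    simp only [holds_mul, holds_ar, holds_lt, tEntry, eval_add, eval_mul, eval_sc, eval_var,
      eval_one, wp_put, Function.update_self, h1, h2, h3, h4, h5, h6, St.setAr_ar, true_and]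
    constructor
    · rintro ⟨h7, h8⟩
      refine ⟨⟨by omega, hval⟩, fun z hz => ?_⟩
      by_cases hz' : z = x + o
      · simp only [hz', if_true, ne_eq, one_ne_zero, not_false_eq_true, true_iff]
        exact Or.inr ⟨x, by omega, h7, rfl⟩
      · rw [if_neg hz', hJ z hz]
        refine or_congr_right ⟨fun ⟨y, hy, h⟩ => ⟨y, by omega, h⟩, fun ⟨y, hy, h⟩ => ⟨y, ?_, h⟩⟩
        have : y ≠ x := by rintro rfl; omega
        omega
    · intro h7 z hz
      rw [hJ z hz]
      refine or_congr_right ⟨fun ⟨y, hy, h⟩ => ⟨y, by omega, h⟩, fun ⟨y, hy, h⟩ => ⟨y, ?_, h⟩⟩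
      have : y ≠ x := by
        rintro rfl
        exact h7 ⟨h.1, by omega⟩
      omega
  · intro υ hG hJ z hz
    simp only [St.setSc_sc, reduceCtorEq, if_false, hTτ.M_eq] at hJ
    rw [hJ z hz, hI z hz]
    constructor
    · rintro (⟨c', hc', h⟩ | h)
      · exact ⟨c', by omega, h⟩
      · exact ⟨c, by omega, h⟩
    · rintro ⟨c', hc', h⟩
      by_cases h' : c' = c
      · subst h'; exact Or.inr h
      · exact Or.inl ⟨c', by omega, h⟩

lemma wp_conv (hT : Tables n k w R slot Hm adj ord σ) {pa g : ℕ} (hpa : σ.sc .pa = pa)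
    (hρ1 : ρ 1 = g) (hidx : R ^ k ≤ bd.idx) (hval : 1 ≤ bd.val) (hV : ∀ x < R ^ k, σ.ar .V x = 0) :
    Wp I bd convCmd ρ (fun τ => ∀ z < R ^ k, τ.ar .V z ≠ 0 ↔ ∃ x < R ^ k, ∃ y < R ^ k,
      σ.ar .T ((pa * k ^ w + g) * R ^ k + x) ≠ 0 ∧ σ.ar .U y ≠ 0 ∧ x + y = z) σ := by
  refine wp_loop (fun m τ => ∀ z < R ^ k, τ.ar .V z ≠ 0 ↔ ∃ x < m, ∃ y < R ^ k,
      σ.ar .T ((pa * k ^ w + g) * R ^ k + x) ≠ 0 ∧ σ.ar .U y ≠ 0 ∧ x + y = z)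
    (fun z hz => by simp [hV z hz]) ?_ (fun τ _ h => by rwa [hT.M_eq] at h)
  intro x hx τ hF hI
  refine wp_loop (fun m υ => ∀ z < R ^ k, υ.ar .V z ≠ 0 ↔ τ.ar .V z ≠ 0 ∨ ∃ y < m,
      σ.ar .T ((pa * k ^ w + g) * R ^ k + x) ≠ 0 ∧ σ.ar .U y ≠ 0 ∧ x + y = z) (by simp) ?_ ?_
  · intro y hy υ hG hJ
    have h1 : υ.sc .pa = pa := by rw [hG.sc .pa (by decide), hF.sc .pa (by decide), hpa]
    have h4 : υ.sc .M = R ^ k := by rw [hG.sc .M (by decide), hF.sc .M (by decide), hT.M_eq]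
    have h5 : υ.sc .K = k ^ w := by rw [hG.sc .K (by decide), hF.sc .K (by decide), hT.K_eq]
    have h6 : υ.ar .T = σ.ar .T := by rw [hG.ar .T (by decide), hF.ar .T (by decide)]
    have h7 : υ.ar .U = σ.ar .U := by rw [hG.ar .U (by decide), hF.ar .U (by decide)]
    rw [wp_when]
    simp only [holds_mul, holds_ar, holds_lt, tEntry, eval_add, eval_mul, eval_sc, eval_var,
      eval_one, wp_put, Function.update_self, h1, h4, h5, h6, h7, St.setAr_ar, true_and, hρ1,
      ne_eq, Nat.reduceEqDiff, not_false_eq_true, Function.update_of_ne,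
      OfNat.one_ne_ofNat]
    constructor
    · rintro ⟨h8, h9, h10⟩
      refine ⟨⟨by omega, hval⟩, fun z hz => ?_⟩
      by_cases hz' : z = x + y
      · simp only [hz', if_true, one_ne_zero, not_false_eq_true, true_iff]
        exact Or.inr ⟨y, by omega, h8, h9, rfl⟩
      · rw [if_neg hz', ← ne_eq, hJ z hz]
        refine or_congr_right ⟨fun ⟨y', hy, h⟩ => ⟨y', by omega, h⟩, fun ⟨y', hy, h⟩ => ⟨y', ?_, h⟩⟩
        have : y' ≠ y := by rintro rfl; omega
        omega
    · intro h8 z hz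
      rw [← ne_eq, hJ z hz]
      refine or_congr_right ⟨fun ⟨y', hy, h⟩ => ⟨y', by omega, h⟩, fun ⟨y', hy, h⟩ => ⟨y', ?_, h⟩⟩
      have : y' ≠ y := by
        rintro rfl
        exact h8 ⟨h.1, h.2.1, by omega⟩
      omega
  · intro υ hG hJ z hz
    have h4 : τ.sc .M = R ^ k := by rw [hF.sc .M (by decide), hT.M_eq]
    rw [h4] at hJ
    rw [hJ z hz, hI z hz]
    constructor
    · rintro (⟨c', hc', h⟩ | h)
      · exact ⟨c', by omega, h⟩
      · exact ⟨x, by omega, h⟩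
    · rintro ⟨c', hc', h⟩
      by_cases h' : c' = x
      · subst h'; exact Or.inr h
      · exact Or.inl ⟨c', by omega, h⟩

lemma wp_copy (hT : Tables n k w R slot Hm adj ord σ) {pa g : ℕ} (hpa : σ.sc .pa = pa)
    (hρ1 : ρ 1 = g) (hidx : (pa * k ^ w + g) * R ^ k + R ^ k ≤ bd.idx)
    (hval : 1 ≤ bd.val) :
    Wp I bd copyCmd ρ (fun τ => (∀ x < R ^ k, (τ.ar .T ((pa * k ^ w + g) * R ^ k + x)) ≠ 0 ↔ σ.ar .V x ≠ 0) ∧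
      ∀ y, (∀ x < R ^ k, y ≠ (pa * k ^ w + g) * R ^ k + x) → τ.ar .T y = σ.ar .T y) σ := by
  refine wp_loop (fun m τ => (∀ x < m, τ.ar .T ((pa * k ^ w + g) * R ^ k + x) ≠ 0 ↔ σ.ar .V x ≠ 0) ∧
      ∀ y, (∀ x < R ^ k, y ≠ (pa * k ^ w + g) * R ^ k + x) → τ.ar .T y = σ.ar .T y)
    (by simp) ?_ (fun τ _ h => by rwa [hT.M_eq] at h)
  intro x hx τ hF hI
  rw [hT.M_eq] at hx
  have h1 : τ.sc .pa = pa := by rw [hF.sc .pa (by decide), hpa]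
  have h4 : τ.sc .M = R ^ k := by rw [hF.sc .M (by decide), hT.M_eq]
  have h5 : τ.sc .K = k ^ w := by rw [hF.sc .K (by decide), hT.K_eq]
  have h6 : τ.ar .V = σ.ar .V := by rw [hF.ar .V (by decide)]
  simp only [wp_put, tEntry, eval_add, eval_mul, eval_sc, eval_var, eval_tv, holds_ar, Function.update_self,
    h1, h4, h5, h6, hρ1, ne_eq, OfNat.one_ne_ofNat, not_false_eq_true, Function.update_of_ne,
    St.setAr_ar, true_and]
  refine ⟨⟨by omega, by split_ifs <;> omega⟩, fun x' hx' => ?_, fun y hy => ?_⟩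
  · by_cases h : x' = x
    · simp [h]
    · rw [if_neg (by omega)]
      exact hI.1 x' (by omega)
  · rw [if_neg (hy x hx)]
    exact hI.2 y hy

end

/-! ### The dynamic program: the whole command -/

/-- The base of the number system for weights. -/
def radix (n : ℕ) : ℕ := (n + 1) * (n * n + 1)

lemma radix_pos (n : ℕ) : 0 < radix n := by unfold radix; positivity

/-- Compute the numbers and tables that are fixed later on. -/
def tablesCmd (k : ℕ) : Cmd :=
  .set .kk (lit k) ;; .set .nsucc (sc .n + 1) ;; .set .rr (sc .nsucc * (sc .n * sc .n + 1)) ;;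
  powers .rp .M .rr .kk ;; widthCmd ;; powers .pw .K .kk .w ;; slotCmd

/-- Before any elimination, only the weight `0` is attained. -/
def initCmd : Cmd :=
  .loop 0 .nsucc (.loop 1 .K (.put .T (tEntry (var 0) (var 1) 0) 1))

/-- Compute in `pa` the parent of `i`. -/
def parentCmd : Cmd :=
  .set .pa 0 ;; .loop 1 .n (.when (entry .H (sc .i) (var 1)) (.set .pa (var 1 + 1)))

/-- Merge the weights attained at `i + 1` into those of the parent, for the code in variable `1`. -/
def mergeCmd : Cmd := clearCmd ;; fillCmd ;; convCmd ;; copyCmd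

/-- Eliminate all vertices. -/
def eliminateCmd : Cmd :=
  .loop 0 .n (.set .i (sc .n - 1 - var 0) ;; parentCmd ;; .loop 1 .K mergeCmd)

/-- The digit for the colour in variable `1` of the weight in variable `0`. -/
def weightDigit : Expr := (var 0 / ar .rp (var 1)).mod (sc .rr)

/-- Look for a weight at the root that belongs to a solution. -/
def checkCmd : Cmd :=
  .set .out 0 ;;
  .loop 0 .M (.when (ar .T (tEntry 0 0 (var 0)) * ((inp 1).eq 0 * all (
      (lt 0 (weightDigit.mod (sc .nsucc))) *
      (inp 3 * (weightDigit / sc .nsucc)).le (inp 2 * weightDigit.mod (sc .nsucc))) 1 .kk))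
    (.set .out 1))

/-- The dynamic program. -/
def dpCmd (k : ℕ) : Cmd := tablesCmd k ;; initCmd ;; eliminateCmd ;; checkCmd

/-- Bounds that suffice for the dynamic program with bags of size at most `w`. -/
structure DPBounds (n k w : ℕ) (bd : Bounds) : Prop where
  out : 1 ≤ bd.sc .out
  kk : k ≤ bd.sc .kk
  nsucc : n + 1 ≤ bd.sc .nsucc
  rr : radix n ≤ bd.sc .rr
  M : radix n ^ k ≤ bd.sc .M
  K : k ^ w ≤ bd.sc .K
  width : w ≤ bd.sc .w
  sl : n ≤ bd.sc .sl
  i : n ≤ bd.sc .i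
  pa : n ≤ bd.sc .pa
  g : k ^ w ≤ bd.sc .g
  o : radix n ^ k + n * ((n + 1) * (radix n ^ k + radix n ^ k)) ≤ bd.sc .o
  idx : (n + 1) * k ^ w * radix n ^ k ≤ bd.idx
  idx_k : k ≤ bd.idx
  val_M : radix n ^ k ≤ bd.val
  val_K : k ^ w ≤ bd.val
  val_n : n ≤ bd.val

section
variable {I : ℕ → ℕ} {bd : Bounds} {ρ : ℕ → ℕ} {σ : St} {n k w w' R : ℕ} {slot Hm adj ord : ℕ → ℕ}

lemma DPBounds.idx_K (h : DPBounds n k w bd) (hk : 0 < k) {w' : ℕ} (hw : w' ≤ w) {a g : ℕ}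
    (ha : a ≤ n) (hg : g < k ^ w') :
    (a * k ^ w' + g) * radix n ^ k + radix n ^ k ≤ bd.idx := by
  refine le_trans ?_ h.idx
  calc (a * k ^ w' + g) * radix n ^ k + radix n ^ k = (a * k ^ w' + g + 1) * radix n ^ k := by ring
    _ ≤ ((n + 1) * k ^ w) * radix n ^ k := by
      refine Nat.mul_le_mul_right _ ?_
      calc a * k ^ w' + g + 1 ≤ a * k ^ w' + k ^ w' := by omega
        _ = (a + 1) * k ^ w' := by ring
        _ ≤ (n + 1) * k ^ w := Nat.mul_le_mul (by omega) (Nat.pow_le_pow_right hk hw)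

lemma DPBounds.idx_M (h : DPBounds n k w bd) (hk : 0 < k) : radix n ^ k ≤ bd.idx := by
  have := h.idx_K hk le_rfl (a := 0) (g := 0) (by omega) (pow_pos hk _)
  omega

lemma DPBounds.idx_n (h : DPBounds n k w bd) (hk : 0 < k) : n ≤ bd.idx := by
  refine le_trans ?_ h.idx
  have h1 : 0 < k ^ w := pow_pos hk _
  have h2 : 0 < radix n ^ k := pow_pos (radix_pos n) _
  calc n ≤ (n + 1) * 1 * 1 := by omega
    _ ≤ _ := Nat.mul_le_mul (Nat.mul_le_mul_left _ h1) h2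

lemma DPBounds.idx_w (h : DPBounds n k w bd) (hk : 2 ≤ k) : w ≤ bd.idx := by
  refine le_trans ?_ h.idx
  have h1 : w < k ^ w := Nat.lt_pow_self (by omega)
  have h2 : 0 < radix n ^ k := pow_pos (radix_pos n) _
  calc w ≤ 1 * k ^ w * 1 := by omega
    _ ≤ _ := Nat.mul_le_mul (Nat.mul_le_mul_right _ (by omega)) h2

open Classical in
lemma wp_setup (hb : DPBounds n k w bd) (hk : 2 ≤ k) (hn : σ.sc .n = n) (hH : σ.ar .H = Hm)
    (hadj : σ.ar .adj = adj) (hord : σ.ar .ord = ord)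
    (hlt : ∀ i j, i < n → rel n Hm i j → j < i)
    (hw : ∀ i < n, #{j ∈ range n | rel n Hm i j} + 1 ≤ w) (hT : ∀ x, σ.ar .T x = 0) :
    Wp I bd (tablesCmd k ;; initCmd) ρ (fun τ => ∃ w' ≤ w, ∃ slot,
      (Tables n k w' (radix n) slot Hm adj ord τ ∧ τ.sc .nsucc = n + 1 ∧ τ.sc .rr = radix n) ∧
      (∀ i < n, slot i < w' ∧ ∀ j, rel n Hm i j → slot j ≠ slot i) ∧
      ∀ a ≤ n, ∀ g < k ^ w', ∀ x < radix n ^ k,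
        τ.ar .T ((a * k ^ w' + g) * radix n ^ k + x) ≠ 0 ↔ x = 0) σ := by
  have hk0 : 0 < k := by omega
  rw [wp_seq, tablesCmd]
  simp only [wp_seq, wp_set, eval_lit, eval_add, eval_mul, eval_sc, eval_one, St.setSc_sc,
    reduceCtorEq, if_false, if_true, hn, hb.kk, hb.nsucc, true_and]
  rw [← radix]
  refine ⟨hb.rr, ?_⟩
  set σ1 := ((σ.setSc .kk k).setSc .nsucc (n + 1)).setSc .rr (radix n) with hσ1
  have e1 : σ1.sc .kk = k := by simp [hσ1]
  have e2 : σ1.sc .rr = radix n := by simp [hσ1]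
  have e3 : σ1.sc .nsucc = n + 1 := by simp [hσ1]
  have e4 : σ1.sc .n = n := by simp [hσ1, hn]
  refine (wp_powers (b := .rr) (j := .kk) (acc := .M) (by decide) (by decide) (by rw [e2]; exact radix_pos n) (by
    rw [e1]; exact hb.idx_k) (by rw [e1, e2]; exact hb.M) (by rw [e1, e2]; exact hb.val_M)).mono ?_
  rintro σ2 F2 ⟨h21, h22⟩
  rw [e1, e2] at h21 h22
  have f2n : σ2.sc .n = n := by rw [F2.sc .n (by decide), e4]
  have f2H : σ2.ar .H = Hm := by rw [F2.ar .H (by decide)]; simp [hσ1, hH]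
  rw [wp_seq]
  refine (wp_width (w := w) f2n (by rwa [f2H]) hb.width).mono ?_
  rintro σ3 F3 ⟨h31, h32⟩
  have f3k : σ3.sc .kk = k := by rw [F3.sc .kk (by decide), F2.sc .kk (by decide), e1]
  rw [f2H] at h32
  set w' := σ3.sc .w with hw'
  have hKle : k ^ w' ≤ k ^ w := Nat.pow_le_pow_right hk0 h31
  rw [wp_seq]
  refine (wp_powers (b := .kk) (j := .w) (acc := .K) (by decide) (by decide) (by rw [f3k]; omega) ?_ ?_ ?_).mono ?_
  · exact h31.trans (hb.idx_w hk)
  · rw [f3k]; exact hKle.trans hb.K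
  · rw [f3k]; exact hKle.trans hb.val_K
  rintro σ4 F4 ⟨h41, h42⟩
  rw [f3k, ← hw'] at h41 h42
  have f4n : σ4.sc .n = n := by rw [F4.sc .n (by decide), F3.sc .n (by decide), f2n]
  have f4H : σ4.ar .H = Hm := by rw [F4.ar .H (by decide), F3.ar .H (by decide), f2H]
  refine (wp_slot (w := w') f4n (by rwa [f4H]) (by rwa [f4H]) hb.sl (hb.idx_n hk0) hb.val_n).mono ?_
  rintro σ5 F5 h5
  rw [f4H] at h5
  have f5s : σ5.sc .nsucc = n + 1 := by
    rw [F5.sc .nsucc (by decide), F4.sc .nsucc (by decide), F3.sc .nsucc (by decide),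
      F2.sc .nsucc (by decide), e3]
  have f5K : σ5.sc .K = k ^ w' := by rw [F5.sc .K (by decide), h41]
  have f5M : σ5.sc .M = radix n ^ k := by
    rw [F5.sc .M (by decide), F4.sc .M (by decide), F3.sc .M (by decide), h21]
  have f5T : σ5.ar .T = σ.ar .T := by
    rw [F5.ar .T (by decide), F4.ar .T (by decide), F3.ar .T (by decide), F2.ar .T (by decide)]
    simp [hσ1]
  have hMpos : 0 < radix n ^ k := pow_pos (radix_pos n) _
  have f5 : Tables n k w' (radix n) (σ5.ar .slot) Hm adj ord σ5 := by
    refine ⟨?_, ?_, f5M, f5K, ?_, ?_, rfl, ?_, ?_, ?_⟩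
    · rw [F5.sc .n (by decide), f4n]
    · rw [F5.sc .kk (by decide), F4.sc .kk (by decide), f3k]
    · rw [F5.ar .pw (by decide)]; exact h42
    · rw [F5.ar .rp (by decide), F4.ar .rp (by decide), F3.ar .rp (by decide)]; exact h22
    · rw [F5.ar .H (by decide), f4H]
    · rw [F5.ar .adj (by decide), F4.ar .adj (by decide), F3.ar .adj (by decide),
        F2.ar .adj (by decide)]
      simp [hσ1, hadj]
    · rw [F5.ar .ord (by decide), F4.ar .ord (by decide), F3.ar .ord (by decide),
        F2.ar .ord (by decide)]
      simp [hσ1, hord]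
  have f5r : σ5.sc .rr = radix n := by
    rw [F5.sc .rr (by decide), F4.sc .rr (by decide), F3.sc .rr (by decide),
      F2.sc .rr (by decide), e2]
  refine wp_loop (fun m τ => ∀ a ≤ n, ∀ g < k ^ w', ∀ x < radix n ^ k,
      τ.ar .T ((a * k ^ w' + g) * radix n ^ k + x) ≠ 0 ↔ x = 0 ∧ a < m) ?_ ?_ ?_
  · intro a ha g hg x hx
    simp [f5T, hT]
  · intro a ha τ hF hI
    rw [f5s] at ha
    have g1 : τ.sc .K = k ^ w' := by rw [hF.sc .K (by decide), f5K]
    refine wp_loop (fun m υ => ∀ a' ≤ n, ∀ g < k ^ w', ∀ x < radix n ^ k,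
      υ.ar .T ((a' * k ^ w' + g) * radix n ^ k + x) ≠ 0 ↔
        x = 0 ∧ (a' < a ∨ a' = a ∧ g < m)) ?_ ?_ ?_
    · simpa using hI
    · intro g hg υ hG hJ
      rw [g1] at hg
      have g2 : υ.sc .K = k ^ w' := by rw [hG.sc .K (by decide), g1]
      have g3 : υ.sc .M = radix n ^ k := by
        rw [hG.sc .M (by decide), hF.sc .M (by decide), f5M]
      simp only [wp_put, tEntry, eval_add, eval_mul, eval_sc, eval_var, eval_zero, eval_one, ne_eq,
        zero_ne_one, not_false_eq_true, Function.update_of_ne, Function.update_self, g2, g3,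
        St.setAr_ar, true_and]
      have := hb.idx_K hk0 h31 (a := a) (by omega) hg
      refine ⟨⟨by omega, le_trans hMpos hb.val_M⟩, fun a' ha' g' hg' x hx => ?_⟩
      simp only [index_inj hx hMpos, index_inj hg' hg]
      have hJ' := hJ a' ha' g' hg' x hx
      by_cases h : (a' = a ∧ g' = g) ∧ x = 0
      · rw [if_pos h]
        simp only [one_ne_zero, not_false_eq_true, true_iff]
        exact ⟨h.2, Or.inr ⟨h.1.1, by omega⟩⟩
      · rw [if_neg h, ← ne_eq, hJ']
        refine and_congr_right fun hx0 => ?_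
        have : ¬ (a' = a ∧ g' = g) := fun h' => h ⟨h', hx0⟩
        omega
    · intro υ hG hJ a' ha' g' hg' x hx
      rw [hJ a' ha' g' hg' x hx, g1]
      refine and_congr_right fun _ => ?_
      omega
  · intro τ hF hI
    refine ⟨w', h31, σ5.ar .slot, ⟨f5.congr (fun j hj => hF.sc j (by fin_cases hj <;> decide))
      (fun a ha => hF.ar a (by fin_cases ha <;> decide)), ?_, ?_⟩, h5, fun a ha g hg x hx => ?_⟩
    · rw [hF.sc .nsucc (by decide), f5s]
    · rw [hF.sc .rr (by decide), f5r]
    · rw [hI a ha g hg x hx, f5s]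
      simp; omega

lemma wp_parent {i : ℕ} (hn : σ.sc .n = n) (hi : σ.sc .i = i)
    (hlt : ∀ j, rel n (σ.ar .H) i j → j < i) (hsc : n ≤ bd.sc .pa) :
    Wp I bd parentCmd ρ (fun τ => τ.sc .pa = par (rel n (σ.ar .H)) i) σ := by
  classical
  rw [parentCmd, wp_seq, wp_set]
  refine ⟨by simp, ?_⟩
  refine wp_loop (fun m τ => τ.sc .pa = ({j ∈ range m | rel n (σ.ar .H) i j}).sup (· + 1))
    (by simp) ?_ ?_
  · intro m hm τ hF hI
    simp only [St.setSc_sc, reduceCtorEq, if_false, hn] at hm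
    have h1 : τ.sc .n = n := by rw [hF.sc .n (by decide)]; simp [hn]
    have h2 : τ.sc .i = i := by rw [hF.sc .i (by decide)]; simp [hi]
    have h3 : τ.ar .H = σ.ar .H := by rw [hF.ar .H (by decide)]; simp
    have hle : ({j ∈ range m | rel n (σ.ar .H) i j}).sup (· + 1) ≤ m + 1 :=
      Finset.sup_le fun j hj => by simp at hj; omega
    rw [wp_when, range_add_one, filter_insert]
    simp only [entry, holds_ar, eval_add, eval_mul, eval_sc, eval_var, Function.update_self, h1, h2,
      h3, wp_set, eval_one, St.setSc_sc, if_true]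
    constructor
    · intro h
      rw [if_pos ⟨hm, h⟩, sup_insert]
      exact ⟨by omega, (max_eq_left hle).symm⟩
    · intro h
      rw [if_neg (fun h' => h h'.2), hI]
  · intro τ hF hI
    simp only [St.setSc_sc, reduceCtorEq, if_false, hn] at hI
    rw [hI, par]
    congr 1
    ext j
    simp only [mem_filter, mem_range]
    exact ⟨fun h => ⟨hlt j h.2, h.2⟩, fun h => ⟨h.2.1, h.2⟩⟩

lemma wp_merge (hb : DPBounds n k w bd) (hk : 0 < k) (hw' : w' ≤ w)
    (hT : Tables n k w' (radix n) slot Hm adj ord σ)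
    {i pa g : ℕ} (hi : σ.sc .i = i) (hin : i < n) (hpa : σ.sc .pa = pa) (hpan : pa ≤ n)
    (hs : ∀ i < n, slot i < w' ∧ ∀ j, rel n Hm i j → slot j ≠ slot i) (hρ : ρ 1 = g)
    (hg : g < k ^ w') :
    Wp I bd mergeCmd ρ (fun τ => (∀ x < radix n ^ k,
      τ.ar .T ((pa * k ^ w' + g) * radix n ^ k + x) ≠ 0 ↔ ∃ y z,
        (y < radix n ^ k ∧ σ.ar .T ((pa * k ^ w' + g) * radix n ^ k + y) ≠ 0) ∧
        (∃ c < k, ∃ z' < radix n ^ k,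
          σ.ar .T (((i + 1) * k ^ w' + setDigit k g (slot i) c) * radix n ^ k + z') ≠ 0 ∧
          z' + ownWeight n (posAdj n adj ord) (radix n) i
            (digit k slot (setDigit k g (slot i) c)) = z) ∧ y + z = x) ∧
      ∀ y, (∀ x < radix n ^ k, y ≠ (pa * k ^ w' + g) * radix n ^ k + x) →
        τ.ar .T y = σ.ar .T y) σ := by
  have hMpos : 0 < radix n ^ k := pow_pos (radix_pos n) _
  have hKle : k ^ w' ≤ k ^ w := Nat.pow_le_pow_right hk hw'
  have hval : 1 ≤ bd.val := le_trans hMpos hb.val_M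
  rw [mergeCmd, wp_seq]
  refine (wp_clear (by rw [hT.M_eq]; exact hb.idx_M hk)).mono fun σ1 F1 h1 => ?_
  rw [hT.M_eq] at h1
  have hT1 : Tables n k w' (radix n) slot Hm adj ord σ1 := hT.congr
    (fun j hj => F1.sc j (by fin_cases hj <;> decide)) (fun a ha => F1.ar a (by fin_cases ha <;> decide))
  rw [wp_seq]
  refine (wp_fill hT1 hk (radix_pos n) (by rw [F1.sc .i (by decide), hi]) hin hs hρ hg
    (hKle.trans hb.g) hb.o (hb.idx_M hk) hval (fun x hx => (h1 x hx).1)).mono fun σ2 F2 h2 => ?_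
  have hT2 : Tables n k w' (radix n) slot Hm adj ord σ2 := hT1.congr
    (fun j hj => F2.sc j (by fin_cases hj <;> decide)) (fun a ha => F2.ar a (by fin_cases ha <;> decide))
  rw [F1.ar .T (by decide)] at h2
  rw [wp_seq]
  refine (wp_conv hT2 (by rw [F2.sc .pa (by decide), F1.sc .pa (by decide), hpa]) hρ (hb.idx_M hk)
    hval (fun x hx => by rw [F2.ar .V (by decide)]; exact (h1 x hx).2)).mono fun σ3 F3 h3 => ?_
  have hT3 : Tables n k w' (radix n) slot Hm adj ord σ3 := hT2.congr
    (fun j hj => F3.sc j (by fin_cases hj <;> decide)) (fun a ha => F3.ar a (by fin_cases ha <;> decide))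
  rw [F2.ar .T (by decide), F1.ar .T (by decide)] at h3
  refine (wp_copy hT3 (by rw [F3.sc .pa (by decide), F2.sc .pa (by decide), F1.sc .pa (by decide),
    hpa]) hρ (hb.idx_K hk hw' hpan hg) hval).mono fun σ4 F4 h4 => ⟨fun x hx => ?_, ?_⟩
  · rw [h4.1 x hx, h3 x hx]
    constructor
    · rintro ⟨y, hy, z, hz, h5, h6, h7⟩
      exact ⟨y, z, ⟨hy, h5⟩, (h2 z hz).1 h6, h7⟩
    · rintro ⟨y, z, ⟨hy, h5⟩, h6, h7⟩
      exact ⟨y, hy, z, by omega, h5, (h2 z (by omega)).2 h6, h7⟩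
  · intro y hy
    rw [h4.2 y hy, F3.ar .T (by decide), F2.ar .T (by decide), F1.ar .T (by decide)]

lemma digit_setDigit {i g c : ℕ} (hk : 0 < k) (hc : c < k)
    (hs : ∀ j, rel n Hm i j → slot j ≠ slot i) {u : ℕ} (hu : bag (rel n Hm) (i + 1) u)
    (hlt : ∀ j, rel n Hm i j → j < i) :
    digit k slot (setDigit k g (slot i) c) u = Function.update (digit k slot g) i c u := by
  rcases hu with rfl | hu
  · rw [Function.update_self]; exact setDigit_self hk hc
  · rw [Function.update_of_ne (hlt u hu).ne]
    exact setDigit_of_ne hk hc (hs u hu)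

lemma wp_eliminate (hb : DPBounds n k w bd) (hk : 0 < k) (hw' : w' ≤ w)
    (hT : Tables n k w' (radix n) slot Hm adj ord σ)
    (hE : Elim n (posAdj n adj ord) (rel n Hm))
    (hs : ∀ i < n, slot i < w' ∧ ∀ j, rel n Hm i j → slot j ≠ slot i)
    (h0 : ∀ a ≤ n, ∀ g < k ^ w', ∀ x < radix n ^ k,
        σ.ar .T ((a * k ^ w' + g) * radix n ^ k + x) ≠ 0 ↔ x = 0) :
    Wp I bd eliminateCmd ρ (fun τ => ∀ x < radix n ^ k, τ.ar .T x ≠ 0 ↔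
      ∃ f : ℕ → ℕ, (∀ u, f u < k) ∧
        ∑ j ∈ range n, ownWeight n (posAdj n adj ord) (radix n) j f = x) σ := by
  set own := ownWeight n (posAdj n adj ord) (radix n) with hown
  have hownc := ownWeight_congr hE (radix n)
  have hMpos : 0 < radix n ^ k := pow_pos (radix_pos n) _
  refine wp_loop (fun r τ => ∀ a ≤ n - r, ∀ g < k ^ w', ∀ x < radix n ^ k,
    τ.ar .T ((a * k ^ w' + g) * radix n ^ k + x) ≠ 0 ↔
      Attained n (rel n Hm) k own r a (digit k slot g) x) ?_ ?_ ?_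
  · intro a ha g hg x hx
    rw [h0 a (by omega) g hg x hx]
    simp only [Attained, desc, sum_empty]
    exact ⟨fun h => ⟨digit k slot g, fun u => Nat.mod_lt _ hk, fun _ _ => rfl, h.symm⟩,
      fun ⟨_, _, _, h⟩ => h.symm⟩
  · intro r hr τ hF hI
    rw [hT.n_eq] at hr
    obtain ⟨i, hi⟩ : ∃ i, n - 1 - r = i := ⟨_, rfl⟩
    have hin : i < n := by omega
    have hlt : ∀ j, rel n Hm i j → j < i := fun j hj => hE.lt i j hin hj
    have hTτ : Tables n k w' (radix n) slot Hm adj ord τ := hT.congr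
      (fun j hj => hF.sc j (by fin_cases hj <;> decide))
      (fun a ha => hF.ar a (by fin_cases ha <;> decide))
    rw [wp_seq, wp_set]
    simp only [eval_sub, eval_sc, eval_one, eval_var, Function.update_self, hTτ.n_eq, hi]
    refine ⟨hin.le.trans hb.i, ?_⟩
    rw [wp_seq]
    refine (wp_parent (i := i) (by simp [hTτ.n_eq]) (by simp) (by simpa [hTτ.H_eq] using hlt)
      hb.pa).mono fun τ1 F1 h1 => ?_
    simp only [St.setSc_ar, hTτ.H_eq] at h1
    have hTτ1 : Tables n k w' (radix n) slot Hm adj ord τ1 := hTτ.congr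
      (fun j hj => by rw [F1.sc j (by fin_cases hj <;> decide)]; fin_cases hj <;> simp)
      (fun a ha => by rw [F1.ar a (by fin_cases ha <;> decide)]; rfl)
    have hi1 : τ1.sc .i = i := by rw [F1.sc .i (by decide)]; simp
    have hT1 : τ1.ar .T = τ.ar .T := by rw [F1.ar .T (by decide)]; rfl
    set pa := par (rel n Hm) i with hpa
    have hpai : pa ≤ i := par_le i
    refine wp_loop (fun m υ => ∀ a ≤ i + 1, ∀ g < k ^ w', ∀ x < radix n ^ k,
      υ.ar .T ((a * k ^ w' + g) * radix n ^ k + x) ≠ 0 ↔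
      Attained n (rel n Hm) k own (if a = pa ∧ g < m then r + 1 else r) a (digit k slot g) x)
      ?_ ?_ ?_
    · intro a ha g hg x hx
      simpa [hT1] using hI a (by omega) g hg x hx
    · intro g hg υ hG hJ
      rw [hTτ1.K_eq] at hg
      have hTυ : Tables n k w' (radix n) slot Hm adj ord υ := hTτ1.congr
        (fun j hj => hG.sc j (by fin_cases hj <;> decide))
        (fun a ha => hG.ar a (by fin_cases ha <;> decide))
      refine (wp_merge hb hk hw' hTυ (by rw [hG.sc .i (by decide), hi1]) hin
        (by rw [hG.sc .pa (by decide), h1]) (by omega) hs (by simp) hg).mono ?_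
      rintro κ - ⟨h2, h3⟩ a ha g' hg' x hx
      by_cases hc : a = pa ∧ g' = g
      · obtain ⟨rfl, rfl⟩ := hc
        rw [if_pos ⟨rfl, by omega⟩, h2 x hx, hE.attained_step hownc hin hi hr]
        refine exists_congr fun y => exists_congr fun z => ?_
        -- the codes of a vertex and of its bag are the colourings of the recursion
        have hsub : ∀ c < k, ∀ z' < radix n ^ k, (υ.ar .T (((i + 1) * k ^ w' +
            setDigit k g' (slot i) c) * radix n ^ k + z') ≠ 0 ↔
            Attained n (rel n Hm) k own r (i + 1) (Function.update (digit k slot g') i c) z') := by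
          intro c hc z' hz'
          rw [hJ (i + 1) le_rfl _ (setDigit_lt hk hg (hs i hin).1 hc) z' hz', if_neg (by omega)]
          exact attained_congr fun u hu => digit_setDigit hk hc (hs i hin).2 hu hlt
        have hsub' : ∀ c < k, own i (digit k slot (setDigit k g' (slot i) c)) =
            own i (Function.update (digit k slot g') i c) := fun c hc =>
          hownc i hin _ _ (digit_setDigit hk hc (hs i hin).2 (Or.inl rfl) hlt)
            fun u hu => digit_setDigit hk hc (hs i hin).2 (Or.inr hu) hlt
        constructor
        · rintro ⟨⟨hy, h4⟩, ⟨c, hc, z', hz', h5, h6⟩, h7⟩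
          refine ⟨?_, ⟨c, hc, z', (hsub c hc z' hz').1 h5, (congrArg (z' + ·) (hsub' c hc)).symm.trans h6⟩, h7⟩
          have := (hJ pa (by omega) g' hg y hy).1 h4
          rwa [if_neg (by omega)] at this
        · rintro ⟨h4, ⟨c, hc, z', h5, h6⟩, h7⟩
          refine ⟨⟨by omega, ?_⟩, ⟨c, hc, z', by omega, (hsub c hc z' (by omega)).2 h5,
            (congrArg (z' + ·) (hsub' c hc)).trans h6⟩, h7⟩
          refine (hJ pa (by omega) g' hg y (by omega)).2 ?_
          rwa [if_neg (by omega)]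
      · rw [h3, hJ a ha g' hg' x hx]
        · have : (a = pa ∧ g' < g) ↔ (a = pa ∧ g' < g + 1) := by omega
          simp only [this]
        · intro x' hx' he
          rw [index_inj hx hx', index_inj hg' hg] at he
          exact hc he.1
    · intro υ hG hJ a ha g hg x hx
      rw [hJ a (by omega) g hg x hx, hTτ1.K_eq]
      by_cases h : a = pa
      · rw [if_pos ⟨h, hg⟩]
      · rw [if_neg (fun h' => h h'.1), attained_succ_of_ne hi h]
  · intro τ hF hI x hx
    rw [hT.n_eq] at hI
    have := hI 0 (by omega) 0 (pow_pos hk _) x hx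
    simp only [zero_mul, zero_add] at this
    rw [this, hE.attained_root]

lemma wp_check (hb : DPBounds n k w bd) (hadj : ∀ i < n, ∀ j < n, posAdj n adj ord i j → posAdj n adj ord j i)
    (hT : Tables n k w' (radix n) slot Hm adj ord σ) (hns : σ.sc .nsucc = n + 1)
    (hrr : σ.sc .rr = radix n) {N : ℚ} (h1 : I 1 = 0 ↔ 0 ≤ N) (h2 : I 2 = N.num.natAbs)
    (h3 : I 3 = N.den)
    (h0 : ∀ x < radix n ^ k, σ.ar .T x ≠ 0 ↔
      ∃ f : ℕ → ℕ, (∀ u, f u < k) ∧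
        ∑ j ∈ range n, ownWeight n (posAdj n adj ord) (radix n) j f = x) :
    Wp I bd checkCmd ρ (fun τ => (τ.sc .out = 0 ∨ τ.sc .out = 1) ∧ (τ.sc .out = 1 ↔
      ∃ f : ℕ → ℕ, (∀ u, f u < k) ∧ IsSolution n (posAdj n adj ord) k N f)) σ := by
  set P : ℕ → Prop := fun x => ∃ f : ℕ → ℕ, (∀ u, f u < k) ∧
    IsSolution n (posAdj n adj ord) k N f ∧
    ∑ j ∈ range n, ownWeight n (posAdj n adj ord) (radix n) j f = x with hP
  have hPlt : ∀ x, P x → x < radix n ^ k := by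
    rintro x ⟨f, hf, -, rfl⟩
    rw [sum_ownWeight hadj _ hf]
    exact sum_digits_lt fun c _ => digit_lt _ _ _ _
  rw [checkCmd, wp_seq, wp_set]
  refine ⟨by simp, ?_⟩
  refine wp_loop (fun m τ => (τ.sc .out = 0 ∨ τ.sc .out = 1) ∧ (τ.sc .out = 1 ↔ ∃ x < m, P x))
    (by simp) ?_ ?_
  · intro x hx τ hF hI
    have hTτ : Tables n k w' (radix n) slot Hm adj ord τ := hT.congr
      (fun j hj => by rw [hF.sc j (by fin_cases hj <;> decide)]; fin_cases hj <;> simp)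
      (fun a ha => by rw [hF.ar a (by fin_cases ha <;> decide)]; rfl)
    have e1 : τ.sc .nsucc = n + 1 := by rw [hF.sc .nsucc (by decide)]; simp [hns]
    have e2 : τ.sc .rr = radix n := by rw [hF.sc .rr (by decide)]; simp [hrr]
    have e3 : τ.ar .T = σ.ar .T := by rw [hF.ar .T (by decide)]; rfl
    simp only [St.setSc_sc, reduceCtorEq, if_false, hT.M_eq] at hx
    have hcond : Holds I (Function.update ρ 0 x) τ
        (ar .T (tEntry 0 0 (var 0)) * ((inp 1).eq 0 * all (
      (lt 0 (weightDigit.mod (sc .nsucc))) *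
      (inp 3 * (weightDigit / sc .nsucc)).le (inp 2 * weightDigit.mod (sc .nsucc))) 1 .kk)) ↔
        P x := by
      simp only [holds_mul, holds_ar, tEntry, eval_add, eval_mul, eval_sc, eval_zero, eval_var,
        Function.update_self, zero_mul, zero_add, e3, holds_eq, eval_inp, eval_one, holds_all,
        holds_lt, holds_le, eval_mod, weightDigit, eval_div, eval_ar, e1, e2, hTτ.kk_eq,
        eval_ofNat, h1, h2, h3, ne_eq, zero_ne_one, not_false_eq_true, Function.update_of_ne]
      rw [← ne_eq, h0 x hx]
      have key : ∀ f : ℕ → ℕ, (∀ u, f u < k) →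
          ∑ j ∈ range n, ownWeight n (posAdj n adj ord) (radix n) j f = x → ∀ c < k,
          x / τ.ar .rp c % radix n % (n + 1) = colorSize n f c ∧
          x / τ.ar .rp c % radix n / (n + 1) = colorCut n (posAdj n adj ord) f c := by
        intro f hf he c hc
        rw [hTτ.rp_eq c hc, ← he, sum_ownWeight hadj _ hf,
          sum_digits_div_mod (fun c _ => show _ < radix n from digit_lt _ _ _ _) hc]
        have := colorSize_le n f c
        constructor
        · rw [Nat.add_mul_mod_self_left, Nat.mod_eq_of_lt (by omega)]
        · rw [Nat.add_mul_div_left _ _ (by omega), Nat.div_eq_of_lt (by omega), zero_add]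
      constructor
      · rintro ⟨⟨f, hf, he⟩, hN, hall⟩
        refine ⟨f, hf, ⟨hN, fun c hc => ?_⟩, he⟩
        have := hall c hc
        rwa [(key f hf he c hc).1, (key f hf he c hc).2] at this
      · rintro ⟨f, hf, ⟨hN, hall⟩, he⟩
        refine ⟨⟨f, hf, he⟩, hN, fun c hc => ?_⟩
        rw [(key f hf he c hc).1, (key f hf he c hc).2]
        exact hall c hc
    rw [wp_when, hcond]
    constructor
    · intro h
      simp only [wp_set, eval_one, St.setSc_sc, if_true]
      exact ⟨hb.out, Or.inr trivial, by simpa using ⟨x, by omega, h⟩⟩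
    · intro h
      refine ⟨hI.1, hI.2.trans ⟨fun ⟨y, hy, h'⟩ => ⟨y, by omega, h'⟩, fun ⟨y, hy, h'⟩ => ⟨y, ?_, h'⟩⟩⟩
      have : y ≠ x := by rintro rfl; exact h h'
      omega
  · intro τ hF hI
    simp only [St.setSc_sc, reduceCtorEq, if_false, hT.M_eq] at hI
    refine ⟨hI.1, hI.2.trans ⟨fun ⟨x, _, f, hf, hs, _⟩ => ⟨f, hf, hs⟩, fun ⟨f, hf, hs⟩ => ?_⟩⟩
    have : P (∑ j ∈ range n, ownWeight n (posAdj n adj ord) (radix n) j f) := ⟨f, hf, hs, rfl⟩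
    exact ⟨_, hPlt _ this, this⟩

open Classical in
/-- The dynamic program decides whether there is a solution, if it is given an elimination order
of the graph. -/
theorem wp_dp (hb : DPBounds n k w bd) (hk : 2 ≤ k) (hn : σ.sc .n = n)
    (hadj : ∀ i < n, ∀ j < n, posAdj n (σ.ar .adj) (σ.ar .ord) i j →
      posAdj n (σ.ar .adj) (σ.ar .ord) j i)
    (hE : Elim n (posAdj n (σ.ar .adj) (σ.ar .ord)) (rel n (σ.ar .H)))
    (hw : ∀ i < n, #{j ∈ range n | rel n (σ.ar .H) i j} + 1 ≤ w) (hT : ∀ x, σ.ar .T x = 0)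
    {N : ℚ} (h1 : I 1 = 0 ↔ 0 ≤ N) (h2 : I 2 = N.num.natAbs) (h3 : I 3 = N.den) :
    Wp I bd (dpCmd k) ρ (fun τ => (τ.sc .out = 0 ∨ τ.sc .out = 1) ∧ (τ.sc .out = 1 ↔
      ∃ f : ℕ → ℕ, (∀ u, f u < k) ∧
        IsSolution n (posAdj n (σ.ar .adj) (σ.ar .ord)) k N f)) σ := by
  have hk0 : 0 < k := by omega
  suffices h : Wp I bd ((tablesCmd k ;; initCmd) ;; eliminateCmd ;; checkCmd) ρ
      (fun τ => (τ.sc .out = 0 ∨ τ.sc .out = 1) ∧ (τ.sc .out = 1 ↔ ∃ f : ℕ → ℕ, (∀ u, f u < k) ∧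
        IsSolution n (posAdj n (σ.ar .adj) (σ.ar .ord)) k N f)) σ by
    rwa [dpCmd, ← wp_seq_assoc]
  rw [wp_seq]
  refine (wp_setup hb hk hn rfl rfl rfl (fun i j hi hj => hE.lt i j hi hj) hw hT).mono ?_
  rintro σ1 F1 ⟨w', hw', slot, ⟨hT1, hns, hrr⟩, hs, h0⟩
  rw [wp_seq]
  refine (wp_eliminate hb hk0 hw' hT1 hE hs h0).mono fun σ2 F2 h4 => ?_
  have hT2 : Tables n k w' (radix n) slot (σ.ar .H) (σ.ar .adj) (σ.ar .ord) σ2 := hT1.congr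
    (fun j hj => F2.sc j (by fin_cases hj <;> decide)) (fun a ha => F2.ar a (by fin_cases ha <;> decide))
  exact wp_check hb hadj hT2 (by rw [F2.sc .nsucc (by decide), hns])
    (by rw [F2.sc .rr (by decide), hrr]) h1 h2 h3 h4

end

/-! ### Searching a graph -/

/-- Mark the vertex in variable `11` if it is an unmarked out-neighbour of the vertex in variable
`12` and that vertex is marked. Marks are consecutive numbers. -/
def visitCmd : Cmd :=
  .when ((ar .D (var 11)).eq 0 * (ar .D (var 12) * ar .E (var 12 * sc .nn + var 11)))
    (.set .cnt (sc .cnt + 1) ;; .put .D (var 11) (sc .cnt) ;; .put .F (var 11) (var 12))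

/-- Mark in `D` all vertices that can be reached from marked ones in the directed graph with
adjacency matrix `E`, and store in `F` the predecessors. -/
def searchCmd : Cmd := .loop 10 .nn (.loop 11 .nn (.loop 12 .nn visitCmd))

open Classical in
/-- What holds during a search that has started with the marks `D0`. -/
structure SearchInv (nn : ℕ) (E D0 : ℕ → ℕ) (cnt0 : ℕ) (σ : St) : Prop where
  nn_eq : σ.sc .nn = nn
  E_eq : σ.ar .E = E
  keep : ∀ x, D0 x ≠ 0 → σ.ar .D x = D0 x
  new : ∀ x, D0 x = 0 → σ.ar .D x ≠ 0 → x < nn ∧ cnt0 < σ.ar .D x ∧ σ.ar .F x < nn ∧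
    σ.ar .D (σ.ar .F x) ≠ 0 ∧ σ.ar .D (σ.ar .F x) < σ.ar .D x ∧ E (σ.ar .F x * nn + x) ≠ 0
  le : ∀ x < nn, σ.ar .D x ≤ σ.sc .cnt
  count : σ.sc .cnt + #{x ∈ range nn | D0 x ≠ 0} = cnt0 + #{x ∈ range nn | σ.ar .D x ≠ 0}

/-- No edge leaves the set of marked vertices. -/
def MarksClosed (nn : ℕ) (E D : ℕ → ℕ) : Prop :=
  ∀ x < nn, ∀ y < nn, D y ≠ 0 → E (y * nn + x) ≠ 0 → D x ≠ 0

section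
variable {I : ℕ → ℕ} {bd : Bounds} {ρ : ℕ → ℕ} {σ : St} {nn cnt0 : ℕ} {E D0 : ℕ → ℕ}

lemma SearchInv.cnt_le (h : SearchInv nn E D0 cnt0 σ) : σ.sc .cnt ≤ cnt0 + nn := by
  classical
  have h1 := h.count
  have h2 : #{x ∈ range nn | σ.ar .D x ≠ 0} ≤ nn := by
    simpa using card_filter_le (range nn) (fun x => σ.ar .D x ≠ 0)
  omega

lemma SearchInv.cnt_pos_le (h : SearchInv nn E D0 cnt0 σ) : cnt0 ≤ σ.sc .cnt := by
  classical
  have h1 := h.count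
  have h2 : #{x ∈ range nn | D0 x ≠ 0} ≤ #{x ∈ range nn | σ.ar .D x ≠ 0} := by
    refine card_le_card fun x hx => ?_
    simp only [mem_filter] at hx ⊢
    exact ⟨hx.1, by rw [h.keep x hx.2]; exact hx.2⟩
  omega

open Classical in
lemma wp_visit (h : SearchInv nn E D0 cnt0 σ) {x y : ℕ} (hx : ρ 11 = x) (hy : ρ 12 = y)
    (hxn : x < nn) (hyn : y < nn) (hsc : cnt0 + nn ≤ bd.sc .cnt) (hidx : nn ≤ bd.idx)
    (hval : cnt0 + nn ≤ bd.val) :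
    Wp I bd visitCmd ρ (fun τ => SearchInv nn E D0 cnt0 τ ∧
      ((τ.ar .D = σ.ar .D ∧ (σ.ar .D y ≠ 0 → E (y * nn + x) ≠ 0 → σ.ar .D x ≠ 0)) ∨
        (¬ MarksClosed nn E (σ.ar .D) ∧
          #{x ∈ range nn | σ.ar .D x ≠ 0} < #{x ∈ range nn | τ.ar .D x ≠ 0}))) σ := by
  rw [visitCmd, wp_when]
  simp only [holds_mul, holds_eq, eval_ar, eval_var, eval_zero, holds_ar, eval_add, eval_mul,
    eval_sc, hx, hy, h.nn_eq, h.E_eq, wp_seq, wp_set, wp_put, eval_one, St.setSc_ar, St.setSc_sc,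
    if_true, St.setAr_ar, true_and]
  constructor
  · rintro ⟨h1, h2, h3⟩
    have hins : insert x {z ∈ range nn | σ.ar .D z ≠ 0} =
        {z ∈ range nn | (if z = x then σ.sc .cnt + 1 else σ.ar .D z) ≠ 0} := by
      ext z
      by_cases hz : z = x
      · simp [hz, hxn]
      · simp [hz]
    have hcard := card_insert_of_notMem (s := {z ∈ range nn | σ.ar .D z ≠ 0}) (a := x) (by simp [h1])
    rw [hins] at hcard
    have hle : #{z ∈ range nn | (if z = x then σ.sc .cnt + 1 else σ.ar .D z) ≠ 0} ≤ nn := by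
      simpa using card_filter_le (range nn)
        (fun z => (if z = x then σ.sc .cnt + 1 else σ.ar .D z) ≠ 0)
    have hcount := h.count
    have hD0 : D0 x = 0 := by
      by_contra h0
      exact h0 ((h.keep x h0).symm.trans h1)
    have hyx : y ≠ x := by rintro rfl; exact h2 h1
    have hly := h.le y hyn
    have hc0 := h.cnt_pos_le
    refine ⟨by omega, ⟨by omega, by omega⟩, ⟨by omega, by omega⟩, ⟨?_, ?_, ?_, ?_, ?_, ?_⟩,
      Or.inr ⟨fun hc => hc x hxn y hyn h2 h3 h1, ?_⟩⟩
    · simp [h.nn_eq]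
    · funext z; simp [h.E_eq]
    · intro z hz
      have : z ≠ x := by rintro rfl; exact hz hD0
      simpa [this] using h.keep z hz
    · intro z hz hz'
      by_cases hzx : z = x
      · subst hzx
        simp only [St.setAr_ar, St.setSc_ar, reduceCtorEq, false_and, if_false, true_and,
          if_true, hyx]
        exact ⟨hxn, by omega, hyn, h2, by omega, h3⟩
      · simp only [St.setAr_ar, St.setSc_ar, reduceCtorEq, false_and, if_false, true_and,
          hzx] at hz' ⊢
        obtain ⟨k1, k2, k3, k4, k5, k6⟩ := h.new z hz hz'
        have : σ.ar .F z ≠ x := fun hh => k4 (by rw [hh, h1])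
        simp only [this, if_false]
        exact ⟨k1, k2, k3, k4, k5, k6⟩
    · intro z hz
      simp only [St.setAr_ar, reduceCtorEq, false_and, if_false, true_and, St.setAr_sc,
        St.setSc_sc, if_true, St.setSc_ar]
      have := h.le z hz
      split_ifs <;> omega
    · simp only [St.setAr_ar, reduceCtorEq, false_and, if_false, true_and, St.setAr_sc,
        St.setSc_sc, if_true, St.setSc_ar]
      omega
    · simp only [reduceCtorEq, false_and, if_false]
      omega
  · intro h1
    exact ⟨h, Or.inl fun h2 h3 h4 => h1 ⟨h4, h2, h3⟩⟩

/-- After a search, the marked vertices are those that can be reached. -/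
theorem wp_search (hnn : σ.sc .nn = nn) (hle : ∀ x < nn, σ.ar .D x ≤ σ.sc .cnt)
    (hsc : σ.sc .cnt + nn ≤ bd.sc .cnt) (hidx : nn ≤ bd.idx)
    (hval : σ.sc .cnt + nn ≤ bd.val) :
    Wp I bd searchCmd ρ (fun τ => SearchInv nn (σ.ar .E) (σ.ar .D) (σ.sc .cnt) τ ∧
      MarksClosed nn (σ.ar .E) (τ.ar .D)) σ := by
  classical
  set E := σ.ar .E
  set mk : St → ℕ := fun τ => #{x ∈ range nn | τ.ar .D x ≠ 0} with hmk
  set Inv := SearchInv nn E (σ.ar .D) (σ.sc .cnt)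
  -- every round adds a mark unless the set of marked vertices is closed already
  refine wp_loop (fun r τ => Inv τ ∧ (MarksClosed nn E (τ.ar .D) ∨ r ≤ mk τ)) ?_ ?_ ?_
  · exact ⟨⟨hnn, rfl, fun _ _ => rfl, fun x h h' => absurd h h', hle, rfl⟩, Or.inr (Nat.zero_le _)⟩
  · rintro r - τ - ⟨hI, hc⟩
    have hgoal : ∀ υ, Inv υ → (MarksClosed nn E (υ.ar .D) ∨
        (¬ MarksClosed nn E (τ.ar .D) ∧ mk τ < mk υ)) →
        Inv υ ∧ (MarksClosed nn E (υ.ar .D) ∨ r + 1 ≤ mk υ) := by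
      intro υ h1 h2
      refine ⟨h1, h2.imp_right fun ⟨h3, h4⟩ => ?_⟩
      rcases hc with hc | hc
      · exact absurd hc h3
      · omega
    refine wp_loop (fun x υ => Inv υ ∧ ((υ.ar .D = τ.ar .D ∧ ∀ x' < x, ∀ y < nn,
        τ.ar .D y ≠ 0 → E (y * nn + x') ≠ 0 → τ.ar .D x' ≠ 0) ∨
        (¬ MarksClosed nn E (τ.ar .D) ∧ mk τ < mk υ))) ?_ ?_ ?_
    · exact ⟨hI, Or.inl ⟨rfl, by simp⟩⟩
    · rintro x hx υ - ⟨hJ, hd⟩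
      rw [hI.nn_eq] at hx
      refine wp_loop (fun y κ => Inv κ ∧ ((κ.ar .D = τ.ar .D ∧ (∀ x' < x, ∀ y < nn,
        τ.ar .D y ≠ 0 → E (y * nn + x') ≠ 0 → τ.ar .D x' ≠ 0) ∧ ∀ y' < y,
        τ.ar .D y' ≠ 0 → E (y' * nn + x) ≠ 0 → τ.ar .D x ≠ 0) ∨
        (¬ MarksClosed nn E (τ.ar .D) ∧ mk τ < mk κ))) ?_ ?_ ?_
      · exact ⟨hJ, hd.imp_left fun h => ⟨h.1, h.2, by simp⟩⟩
      · rintro y hy κ - ⟨hK, he⟩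
        rw [hJ.nn_eq] at hy
        refine (wp_visit hK (by simp) (by simp) hx hy hsc hidx hval).mono ?_
        rintro μ - ⟨hM, hf⟩
        refine ⟨hM, ?_⟩
        rcases he with ⟨e1, e2, e3⟩ | ⟨e1, e2⟩
        · rw [e1] at hf
          rcases hf with ⟨f1, f2⟩ | ⟨f1, f2⟩
          · refine Or.inl ⟨f1, e2, fun y' hy' => ?_⟩
            by_cases h : y' = y
            · rw [h]; exact f2
            · exact e3 y' (by omega)
          · exact Or.inr ⟨f1, f2⟩
        · refine Or.inr ⟨e1, ?_⟩
          rcases hf with ⟨f1, f2⟩ | ⟨f1, f2⟩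
          · rw [hmk] at e2 ⊢; dsimp only at e2 ⊢; rwa [f1]
          · exact e2.trans f2
      · rintro κ - ⟨hK, he⟩
        refine ⟨hK, he.imp_left fun ⟨e1, e2, e3⟩ => ⟨e1, fun x' hx' => ?_⟩⟩
        by_cases h : x' = x
        · rw [h]; rwa [hJ.nn_eq] at e3
        · exact e2 x' (by omega)
    · rintro υ - ⟨hJ, hd⟩
      refine hgoal υ hJ (hd.imp_left fun ⟨e1, e2⟩ => ?_)
      rw [e1]
      rwa [hI.nn_eq] at e2
  · rintro τ - ⟨hI, hc⟩
    refine ⟨hI, hc.elim id fun hc => ?_⟩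
    rw [hnn] at hc
    have hall : {x ∈ range nn | τ.ar .D x ≠ 0} = range nn :=
      eq_of_subset_of_card_le (filter_subset _ _) (by simpa using hc)
    intro x hx y _ _ _
    have : x ∈ {x ∈ range nn | τ.ar .D x ≠ 0} := by rw [hall]; simpa using hx
    exact (mem_filter.1 this).2

end

/-! ### Building an elimination order -/

/-- Append the vertex `u` to the elimination order, with the set of all earlier vertices in row `l`
of the matrix `W` as its set `H`. -/
def placeCmd : Cmd :=
  .put .ord (sc .pc) (sc .u) ;;
  .loop 20 .n (.put .H (sc .pc * sc .n + var 20)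
    ((var 20).lt (sc .pc) * entry .W (sc .l) (ar .ord (var 20))).tv) ;;
  .put .plc (sc .u) 1 ;;
  .set .pc (sc .pc + 1)

open Classical in
/-- The first `pc` entries of `ord` are different vertices, marked in `plc`, and `H` is an
elimination order for the subgraph that they induce. -/
structure Placed (n : ℕ) (adj : ℕ → ℕ) (w : ℕ) (σ : St) : Prop where
  n_eq : σ.sc .n = n
  pc_le : σ.sc .pc ≤ n
  ord_lt : ∀ i < σ.sc .pc, σ.ar .ord i < n
  ord_inj : ∀ i < σ.sc .pc, ∀ j < σ.sc .pc, σ.ar .ord i = σ.ar .ord j → i = j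
  plc_iff : ∀ v < n, σ.ar .plc v ≠ 0 ↔ ∃ i < σ.sc .pc, σ.ar .ord i = v
  elim : Elim (σ.sc .pc) (posAdj n adj (σ.ar .ord)) (rel n (σ.ar .H))
  card : ∀ i < σ.sc .pc, #{j ∈ range n | rel n (σ.ar .H) i j} + 1 ≤ w

/-- The vertices with property `S` that have been placed are joined to each other in `H`. -/
def IsJoined (n : ℕ) (σ : St) (S : ℕ → Prop) : Prop :=
  ∀ i < σ.sc .pc, ∀ j < i, S (σ.ar .ord i) → S (σ.ar .ord j) → rel n (σ.ar .H) i j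

section
variable {I : ℕ → ℕ} {bd : Bounds} {ρ : ℕ → ℕ} {σ : St} {n w : ℕ} {adj : ℕ → ℕ}

lemma Placed.congr {τ : St} (h : Placed n adj w σ) (h1 : τ.sc .n = σ.sc .n)
    (h2 : τ.sc .pc = σ.sc .pc) (h3 : τ.ar .ord = σ.ar .ord) (h4 : τ.ar .plc = σ.ar .plc)
    (h5 : τ.ar .H = σ.ar .H) : Placed n adj w τ := by
  constructor
  · rw [h1, h.n_eq]
  · rw [h2]; exact h.pc_le
  · rw [h2, h3]; exact h.ord_lt
  · rw [h2, h3]; exact h.ord_inj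
  · rw [h2, h3, h4]; exact h.plc_iff
  · rw [h2, h3, h5]; exact h.elim
  · rw [h2, h5]; exact h.card

lemma IsJoined.congr {τ : St} {S : ℕ → Prop} (h : IsJoined n σ S) (h2 : τ.sc .pc = σ.sc .pc)
    (h3 : τ.ar .ord = σ.ar .ord) (h5 : τ.ar .H = σ.ar .H) : IsJoined n τ S := by
  unfold IsJoined
  rw [h2, h3, h5]
  exact h

lemma IsJoined.mono {S S' : ℕ → Prop} (h : IsJoined n σ S)
    (hS : ∀ i < σ.sc .pc, S' (σ.ar .ord i) → S (σ.ar .ord i)) : IsJoined n σ S' :=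
  fun i hi j hj h1 h2 => h i hi j hj (hS i hi h1) (hS j (hj.trans hi) h2)

lemma Placed.bijOn (h : Placed n adj w σ) (hall : ∀ v < n, σ.ar .plc v ≠ 0) :
    σ.sc .pc = n ∧ Set.BijOn (σ.ar .ord) (Set.Iio n) (Set.Iio n) := by
  have hpc : σ.sc .pc = n := by
    refine le_antisymm h.pc_le ?_
    have : range n ⊆ (range (σ.sc .pc)).image (σ.ar .ord) := by
      intro v hv
      obtain ⟨i, hi, hiv⟩ := (h.plc_iff v (mem_range.1 hv)).1 (hall v (mem_range.1 hv))
      exact mem_image.2 ⟨i, mem_range.2 hi, hiv⟩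
    simpa using (card_le_card this).trans card_image_le
  refine ⟨hpc, fun i hi => h.ord_lt i (by rw [hpc]; exact hi), fun i hi j hj e => ?_, fun v hv => ?_⟩
  · exact h.ord_inj i (by rw [hpc]; exact hi) j (by rw [hpc]; exact hj) e
  · obtain ⟨i, hi, hiv⟩ := (h.plc_iff v hv).1 (hall v hv)
    exact ⟨i, by rw [hpc] at hi; exact hi, hiv⟩

open Classical in
theorem wp_place (h : Placed n adj w σ) {u l : ℕ} (hu : σ.sc .u = u) (hl : σ.sc .l = l)
    (hun : u < n) (hup : σ.ar .plc u = 0)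
    (hJ : IsJoined n σ fun v => σ.ar .W (l * n + v) ≠ 0)
    (hN : ∀ v < n, σ.ar .plc v ≠ 0 → adj (u * n + v) ≠ 0 → σ.ar .W (l * n + v) ≠ 0)
    (hw : #{v ∈ range n | σ.ar .plc v ≠ 0 ∧ σ.ar .W (l * n + v) ≠ 0} + 1 ≤ w)
    (hidx : n * n ≤ bd.idx) (hval : n ≤ bd.val) (hsc : n ≤ bd.sc .pc) :
    Wp I bd placeCmd ρ (fun τ => Placed n adj w τ ∧
      (∀ v, τ.ar .plc v ≠ 0 ↔ v = u ∨ σ.ar .plc v ≠ 0) ∧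
      ∀ S : ℕ → Prop, IsJoined n σ S → (S u → ∀ v < n, σ.ar .plc v ≠ 0 → S v →
        σ.ar .W (l * n + v) ≠ 0) → IsJoined n τ S) σ := by
  have hpc : σ.sc .pc < n := by
    by_contra hpc
    have hpc : σ.sc .pc = n := le_antisymm h.pc_le (by omega)
    have hsub : (range n).image (σ.ar .ord) ⊆ (range n).erase u := by
      intro v hv
      obtain ⟨i, hi, rfl⟩ := mem_image.1 hv
      have hi' : i < σ.sc .pc := by rw [hpc]; exact mem_range.1 hi
      refine mem_erase.2 ⟨fun e => ?_, mem_range.2 (h.ord_lt i hi')⟩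
      exact (h.plc_iff u hun).2 ⟨i, hi', e⟩ hup
    have hc := card_le_card hsub
    rw [card_image_of_injOn, card_erase_of_mem (mem_range.2 hun), card_range] at hc
    · omega
    · intro i hi j hj e
      have hi := mem_range.1 hi
      have hj := mem_range.1 hj
      exact h.ord_inj i (by omega) j (by omega) e
  have hnn : n ≤ n * n := Nat.le_mul_of_pos_left _ (by omega)
  set p := σ.sc .pc with hp
  rw [placeCmd, wp_seq, wp_put]
  simp only [eval_sc, hu, ← hp]
  refine ⟨⟨by omega, by omega⟩, ?_⟩
  set σ1 := σ.setAr .ord p u with hσ1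
  have ordp : σ1.ar .ord p = u := by simp [hσ1]
  have ord1 : ∀ i, i ≠ p → σ1.ar .ord i = σ.ar .ord i := fun i hi => by simp [hσ1, hi]
  rw [wp_seq]
  refine wp_loop (fun m τ => ∀ i j, j < n → (τ.ar .H (i * n + j) ≠ 0 ↔
      if i = p ∧ j < m then j < p ∧ σ.ar .W (l * n + σ.ar .ord j) ≠ 0
      else σ.ar .H (i * n + j) ≠ 0)) (fun i j _ => by simp [hσ1]) ?_ ?_
  · intro m hm τ hF hI
    have e1 : τ.sc .n = n := by rw [hF.sc .n (by decide)]; simp [hσ1, h.n_eq]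
    have e2 : τ.sc .pc = p := by rw [hF.sc .pc (by decide)]; simp [hσ1, ← hp]
    have e3 : τ.sc .l = l := by rw [hF.sc .l (by decide)]; simp [hσ1, hl]
    have e4 : τ.ar .W = σ.ar .W := by rw [hF.ar .W (by decide)]; funext; simp [hσ1]
    have e5 : τ.ar .ord = σ1.ar .ord := hF.ar .ord (by decide)
    replace hm : m < n := by rw [← h.n_eq]; simpa [hσ1] using hm
    simp only [wp_put, eval_add, eval_mul, eval_sc, eval_var, Function.update_self, eval_tv,
      holds_mul, holds_lt, entry, holds_ar, eval_ar, e1, e2, e3, e4, e5, St.setAr_ar, true_and]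
    refine ⟨⟨?_, by split_ifs <;> omega⟩, fun i j hj => ?_⟩
    · exact (index_lt hpc hm).trans_le hidx
    · simp only [index_inj hj hm]
      by_cases hij : i = p ∧ j = m
      · obtain ⟨rfl, rfl⟩ := hij
        simp only [true_and, if_true, Nat.lt_succ_self]
        by_cases hjp : j < p
        · simp [ord1 j (by omega)]
        · simp [hjp]
      · have : (i = p ∧ j < m + 1) ↔ (i = p ∧ j < m) := by omega
        simp only [hij, if_false, this]
        exact hI i j hj
  · intro σ2 F2 hH
    have e1 : σ2.sc .n = n := by rw [F2.sc .n (by decide)]; simp [hσ1, h.n_eq]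
    have e2 : σ2.sc .pc = p := by rw [F2.sc .pc (by decide)]; simp [hσ1, ← hp]
    have e3 : σ2.sc .u = u := by rw [F2.sc .u (by decide)]; simp [hσ1, hu]
    have e4 : σ2.ar .plc = σ.ar .plc := by rw [F2.ar .plc (by decide)]; funext; simp [hσ1]
    have e5 : σ2.ar .ord = σ1.ar .ord := F2.ar .ord (by decide)
    have hσn : σ1.sc .n = n := by simp [hσ1, h.n_eq]
    rw [hσn] at hH
    simp only [wp_seq, wp_put, wp_set, eval_sc, eval_one, eval_add, e3, St.setAr_sc, e2]
    refine ⟨⟨by omega, by omega⟩, by omega, ?_⟩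
    set τ := (σ2.setAr .plc u 1).setSc .pc (p + 1) with hτ
    have t1 : τ.sc .n = n := by simp [hτ, e1]
    have t2 : τ.sc .pc = p + 1 := by simp [hτ]
    have t3 : τ.ar .ord = σ1.ar .ord := by funext; simp [hτ, e5]
    have t4 : ∀ v, τ.ar .plc v ≠ 0 ↔ v = u ∨ σ.ar .plc v ≠ 0 := fun v => by
      by_cases hv : v = u <;> simp [hτ, hv, e4]
    have t5 : ∀ i j, rel n (τ.ar .H) i j ↔
        if i = p then j < p ∧ σ.ar .W (l * n + σ.ar .ord j) ≠ 0 else rel n (σ.ar .H) i j := by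
      intro i j
      have : τ.ar .H = σ2.ar .H := by funext; simp [hτ]
      rw [rel, this]
      by_cases hj : j < n
      · rw [hH i j hj]
        by_cases hi : i = p <;> simp [hi, hj, rel]
      · by_cases hi : i = p
        · simp only [hj, false_and, hi, if_true, false_iff]; omega
        · simp [hi, rel, hj]
    have t6 : ∀ i j, i ≠ p → (rel n (τ.ar .H) i j ↔ rel n (σ.ar .H) i j) := fun i j hi => by
      rw [t5, if_neg hi]
    have t7 : ∀ j, rel n (τ.ar .H) p j ↔ j < p ∧ σ.ar .W (l * n + σ.ar .ord j) ≠ 0 := fun j => by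
      rw [t5, if_pos rfl]
    have hplc : ∀ i < p, σ.ar .plc (σ.ar .ord i) ≠ 0 := fun i hi =>
      (h.plc_iff _ (h.ord_lt i hi)).2 ⟨i, hi, rfl⟩
    have hjoin : ∀ S : ℕ → Prop, IsJoined n σ S → (S u → ∀ v < n, σ.ar .plc v ≠ 0 → S v →
        σ.ar .W (l * n + v) ≠ 0) → IsJoined n τ S := by
      intro S hS hSu i hi j hj h1 h2
      rw [t2] at hi
      rw [t3] at h1 h2
      rw [ord1 j (by omega)] at h2
      by_cases hip : i = p
      · subst hip
        rw [ordp] at h1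
        exact (t7 j).2 ⟨hj, hSu h1 _ (h.ord_lt j hj) (hplc j hj) h2⟩
      · rw [ord1 i hip] at h1
        exact (t6 i j hip).2 (hS i (by omega) j hj h1 h2)
    refine ⟨⟨t1, by omega, ?_, ?_, ?_, ⟨?_, ?_, ?_⟩, ?_⟩, t4, hjoin⟩
    · intro i hi
      rw [t2] at hi
      rw [t3]
      by_cases hip : i = p
      · rw [hip, ordp]; exact hun
      · rw [ord1 i hip]; exact h.ord_lt i (by omega)
    · have key : ∀ i < p, σ.ar .ord i ≠ u := fun i hi e => hplc i hi (by rw [e, hup])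
      intro i hi j hj e
      rw [t2] at hi hj
      rw [t3] at e
      by_cases hip : i = p
      · by_cases hjp : j = p
        · omega
        · rw [hip, ordp, ord1 j hjp] at e
          exact absurd e.symm (key j (by omega))
      · by_cases hjp : j = p
        · rw [hjp, ordp, ord1 i hip] at e
          exact absurd e (key i (by omega))
        · rw [ord1 i hip, ord1 j hjp] at e
          exact h.ord_inj i (by omega) j (by omega) e
    · intro v hv
      rw [t4, h.plc_iff v hv, t2, t3]
      constructor
      · rintro (rfl | ⟨i, hi, rfl⟩)
        · exact ⟨p, by omega, ordp⟩
        · exact ⟨i, by omega, ord1 i (by omega)⟩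
      · rintro ⟨i, hi, rfl⟩
        by_cases hip : i = p
        · exact Or.inl (by rw [hip, ordp])
        · exact Or.inr ⟨i, by omega, (ord1 i hip).symm⟩
    · intro i j hi hij
      rw [t2] at hi
      by_cases hip : i = p
      · rw [hip, t7] at hij; omega
      · exact h.elim.lt i j (by omega) ((t6 i j hip).1 hij)
    · intro i j j' hi hij hij' hjj
      rw [t2] at hi
      by_cases hip : i = p
      · rw [hip, t7] at hij hij'
        exact (t6 j j' (by omega)).2 (hJ j hij.1 j' hjj hij.2 hij'.2)
      · have h1 := (t6 i j hip).1 hij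
        have hjp := h.elim.lt i j (by omega) h1
        exact (t6 j j' (by omega)).2
          (h.elim.closed i j j' (by omega) h1 ((t6 i j' hip).1 hij') hjj)
    · intro i j hi hj ha
      rw [t2] at hi
      rw [posAdj, t3, ord1 j (by omega)] at ha
      by_cases hip : i = p
      · rw [hip, ordp] at ha
        rw [hip, t7]
        exact ⟨by omega, hN _ (h.ord_lt j (by omega)) (hplc j (by omega)) ha⟩
      · rw [ord1 i hip] at ha
        exact (t6 i j hip).2 (h.elim.edge i j (by omega) hj ha)
    · intro i hi
      rw [t2] at hi
      by_cases hip : i = p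
      · refine le_trans (Nat.add_le_add_right ?_ 1) hw
        refine card_le_card_of_injOn (σ.ar .ord) ?_ ?_
        · intro j hj
          simp only [coe_filter, mem_range, Set.mem_ofPred_eq, hip, t7] at hj ⊢
          exact ⟨h.ord_lt j hj.2.1, hplc j hj.2.1, hj.2.2⟩
        · intro j hj j' hj' e
          simp only [coe_filter, mem_range, Set.mem_ofPred_eq, hip, t7] at hj hj'
          exact h.ord_inj j hj.2.1 j' hj'.2.1 e
      · simpa only [t6 i _ hip] using h.card i (by omega)

end

/-! ### Tree decompositions -/

/-- The order in which the nodes of a tree are treated: by their marks. -/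
def Before (M : ℕ → ℕ) (t' t : ℕ) : Prop := M t' < M t ∨ M t' = M t ∧ t' < t

/-- What is needed of the bags `B` of a tree decomposition, and of the marks `M` and predecessors
`F` of a search of the tree. -/
structure BagOrder (n m : ℕ) (adj : ℕ → ℕ → Prop) (B : ℕ → ℕ → Prop) (M F : ℕ → ℕ) : Prop where
  cover : ∀ v < n, ∃ t < m, B t v
  parent : ∀ t < m, ∀ t' < m, Before M t' t → ∀ v, B t v → B t' v →
    F t < m ∧ Before M (F t) t ∧ B (F t) v
  nbr : ∀ t < m, ∀ t' < m, Before M t' t → ∀ u v, B t u → (∀ s < m, Before M s t → ¬ B s u) →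
    B t' v → adj u v → B t v

/-- If the connected sets `U` and `S` of nodes of a tree meet, `U` contains `t` but does not meet the
connected set `Z`, `S` meets `Z`, and `p ∈ Z` is a neighbour of `t`, then `S` contains `p` and `t`:
otherwise the edge `pt` would be on a cycle. -/
lemma tree_crossing {V : Type*} {T : SimpleGraph V} (hT : T.IsAcyclic) {p t : V} (hpt : T.Adj p t)
    {Z U S : Set V} (hZ : (T.induce Z).Preconnected) (hU : (T.induce U).Preconnected)
    (hS : (T.induce S).Preconnected) (hp : p ∈ Z) (ht : t ∈ U) (hUZ : ∀ a ∈ U, a ∉ Z) {x y : V}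
    (hxU : x ∈ U) (hxS : x ∈ S) (hyS : y ∈ S) (hyZ : y ∈ Z) : p ∈ S ∧ t ∈ S := by
  by_contra hcon
  have hbridge := SimpleGraph.isAcyclic_iff_forall_adj_isBridge.1 hT hpt
  rw [SimpleGraph.isBridge_iff] at hbridge
  set T' := T \ SimpleGraph.fromEdgeSet {s(p, t)} with hT'
  -- within each of the three sets, the edge `pt` is not needed
  have key : ∀ (X : Set V), (T.induce X).Preconnected → ¬ (p ∈ X ∧ t ∈ X) → ∀ a ∈ X, ∀ b ∈ X,
      T'.Reachable a b := by
    intro X hX hpX a ha b hb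
    let f : T.induce X →g T' := ⟨Subtype.val, by
      rintro ⟨c, hc⟩ ⟨d, hd⟩ hcd
      have hcd' : T.Adj c d := hcd
      rw [hT', SimpleGraph.sdiff_adj]
      refine ⟨hcd', fun h => ?_⟩
      rw [SimpleGraph.fromEdgeSet_adj] at h
      rcases Sym2.eq_iff.1 h.1 with ⟨e1, e2⟩ | ⟨e1, e2⟩
      · exact hpX ⟨e1 ▸ hc, e2 ▸ hd⟩
      · exact hpX ⟨e2 ▸ hd, e1 ▸ hc⟩⟩
    exact (hX ⟨a, ha⟩ ⟨b, hb⟩).map f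
  have h1 := key Z hZ (fun h => hUZ t ht h.2) p hp y hyZ
  have h2 := key S hS hcon y hyS x hxS
  have h3 := key U hU (fun h => hUZ p h.1 hp) x hxU t ht
  exact hbridge ((h1.trans h2).trans h3)

lemma TreeDecomposition.bagOrder {I : Instance} {m : ℕ} (T : TreeDecomposition I.graph m)
    {M F : ℕ → ℕ} (hM : ∀ t (ht : t < m), t ≠ 0 → ∃ hF : F t < m, M (F t) < M t ∧
      T.tree.Adj ⟨F t, hF⟩ ⟨t, ht⟩) :
    BagOrder I.n m I.adj (fun t v => ∃ (ht : t < m) (hv : v < I.n), ⟨v, hv⟩ ∈ T.bag ⟨t, ht⟩)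
      M F := by
  have hroot : ∀ t < m, t ≠ 0 → M 0 < M t := by
    intro t
    induction h : M t using Nat.strong_induction_on generalizing t with
    | _ x ih =>
      intro ht h0
      obtain ⟨hF, h1, -⟩ := hM t ht h0
      by_cases hF0 : F t = 0
      · rw [hF0] at h1; omega
      · exact (ih _ (h ▸ h1) (F t) rfl hF hF0).trans (h ▸ h1)
  have hne : ∀ t < m, ∀ t' < m, Before M t' t → t ≠ 0 := by
    rintro t - t' ht' hb rfl
    by_cases h0 : t' = 0
    · subst h0; rcases hb with hb | hb <;> omega
    · have := hroot t' ht' h0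
      rcases hb with hb | hb <;> omega
  -- the nodes before `t` form a connected set
  have hconn : ∀ t < m, (T.tree.induce {s : Fin m | Before M s t}).Preconnected := by
    intro t ht
    have h0 : ∀ x (a : Fin m) (ha : Before M a t), M a = x → ∃ h0 : 0 < m,
        ∃ hb : Before M 0 t, (T.tree.induce {s : Fin m | Before M s t}).Reachable
          ⟨a, ha⟩ ⟨⟨0, h0⟩, hb⟩ := by
      intro x
      induction x using Nat.strong_induction_on with
      | _ x ih =>
        rintro ⟨a, ham⟩ ha hx
        by_cases h0 : a = 0
        · subst h0
          exact ⟨_, ha, SimpleGraph.Reachable.refl _⟩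
        · obtain ⟨hF, h1, h2⟩ := hM a ham h0
          have hb : Before M (F a) t := by
            have ha' : Before M a t := ha
            rcases ha' with ha' | ha' <;> left <;> omega
          obtain ⟨h3, h4, h5⟩ := ih _ (hx ▸ h1) ⟨F a, hF⟩ hb rfl
          refine ⟨h3, h4, SimpleGraph.Reachable.trans (SimpleGraph.Adj.reachable ?_) h5⟩
          exact h2.symm
    rintro ⟨a, ha⟩ ⟨b, hb⟩
    obtain ⟨_, _, h1⟩ := h0 _ a ha rfl
    obtain ⟨_, _, h2⟩ := h0 _ b hb rfl
    exact h1.trans h2.symm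
  have hacyc := T.isTree.isAcyclic
  refine ⟨fun v hv => ?_, ?_, ?_⟩
  · obtain ⟨t, ht⟩ := T.vertex_mem ⟨v, hv⟩
    exact ⟨t, t.2, t.2, hv, ht⟩
  · rintro t ht t' ht' hb v ⟨_, hv, h1⟩ ⟨_, _, h2⟩
    obtain ⟨hF, h3, h4⟩ := hM t ht (hne t ht t' ht' hb)
    have h5 := tree_crossing hacyc h4 (Z := {s : Fin m | Before M s t}) (U := {⟨t, ht⟩})
      (S := {s | (⟨v, hv⟩ : Fin I.n) ∈ T.bag s}) (hconn t ht)
      (by rintro ⟨a, rfl⟩ ⟨b, rfl⟩; exact SimpleGraph.Reachable.refl _)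
      (T.connected ⟨v, hv⟩).preconnected (Or.inl h3) rfl
      (by rintro a rfl (h | h) <;> simp at h) rfl h1 (y := ⟨t', ht'⟩) h2 hb
    exact ⟨hF, Or.inl h3, hF, hv, h5.1⟩
  · rintro t ht t' ht' hb u v ⟨_, hu, h1⟩ hnew ⟨_, hv, h2⟩ ⟨_, _, hadj⟩
    obtain ⟨hF, h3, h4⟩ := hM t ht (hne t ht t' ht' hb)
    obtain ⟨s, hs1, hs2⟩ := T.edge_mem _ _ hadj
    have h5 := tree_crossing hacyc h4 (Z := {s : Fin m | Before M s t})
      (U := {s | (⟨u, hu⟩ : Fin I.n) ∈ T.bag s}) (S := {s | (⟨v, hv⟩ : Fin I.n) ∈ T.bag s}) (hconn t ht)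
      (T.connected ⟨u, hu⟩).preconnected (T.connected ⟨v, hv⟩).preconnected (Or.inl h3) h1
      (fun a ha hab => hnew a a.2 hab ⟨a.2, hu, ha⟩) hs1 hs2 (y := ⟨t', ht'⟩) h2 hb
    exact ⟨ht, hv, h5.2⟩

/-- A search from the node `0` of a tree marks all nodes. -/
lemma MarksClosed.forall_ne_zero {m : ℕ} {T : SimpleGraph (Fin m)} (hT : T.Connected)
    {E M : ℕ → ℕ} (hE : ∀ a b : Fin m, E (a * m + b) ≠ 0 ↔ T.Adj a b) (h0 : M 0 ≠ 0)
    (h : MarksClosed m E M) : ∀ t < m, M t ≠ 0 := by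
  intro t ht
  obtain ⟨p⟩ := hT.preconnected ⟨0, by omega⟩ ⟨t, ht⟩
  have : ∀ (a b : Fin m), T.Walk a b → M a ≠ 0 → M b ≠ 0 := by
    intro a b p
    induction p with
    | nil => exact id
    | cons hadj _ ih => exact fun ha => ih (h _ (Fin.is_lt _) _ (Fin.is_lt _) ha ((hE _ _).2 hadj))
  exact this _ _ p h0

/-- Place the vertices of the bags, for one node of the tree after the other. -/
def placeBagsCmd : Cmd :=
  .loop 0 .cnt (.loop 1 .m (.when ((ar .D (var 1)).eq (var 0 + 1)) (.set .l (var 1) ;;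
    .loop 2 .n (.when (entry .W (sc .l) (var 2) * (ar .plc (var 2)).not)
      (.set .u (var 2) ;; placeCmd)))))

section
variable {I : ℕ → ℕ} {bd : Bounds} {ρ : ℕ → ℕ} {σ : St} {n m w : ℕ} {adj W M F : ℕ → ℕ}

open Classical in
lemma wp_placeBag (hB : BagOrder n m (fun u v => u < n ∧ v < n ∧ adj (u * n + v) ≠ 0)
      (fun t v => t < m ∧ rel n W t v) M F)
    {t : ℕ} (ht : t < m) (hl : σ.sc .l = t) (hW : σ.ar .W = W) (hP : Placed n adj w σ)
    (hplc : ∀ v < n, σ.ar .plc v ≠ 0 ↔ ∃ s < m, Before M s t ∧ rel n W s v)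
    (hJ : ∀ s < m, Before M s t → IsJoined n σ (rel n W s))
    (hw : #{v ∈ range n | rel n W t v} ≤ w)
    (hidx : n * n ≤ bd.idx) (hval : n ≤ bd.val) (hpc : n ≤ bd.sc .pc) (hu : n ≤ bd.sc .u) :
    Wp I bd (.loop 2 .n (.when (entry .W (sc .l) (var 2) * (ar .plc (var 2)).not)
      (.set .u (var 2) ;; placeCmd))) ρ (fun τ => Placed n adj w τ ∧
      (∀ v < n, τ.ar .plc v ≠ 0 ↔ ∃ s < m, (s = t ∨ Before M s t) ∧ rel n W s v) ∧
      ∀ s < m, (s = t ∨ Before M s t) → IsJoined n τ (rel n W s)) σ := by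
  refine wp_loop (fun x τ => Placed n adj w τ ∧
      (∀ v < n, τ.ar .plc v ≠ 0 ↔ (∃ s < m, Before M s t ∧ rel n W s v) ∨ v < x ∧ rel n W t v) ∧
      ∀ s < m, (s = t ∨ Before M s t) → IsJoined n τ (rel n W s)) ?_ ?_ ?_
  · refine ⟨hP, by simpa using hplc, fun s hs hst => ?_⟩
    rcases hst with rfl | hst
    · -- the vertices of the bag that have been placed belong to the bag of the predecessor
      intro i hi j hj h1 h2
      have hpl : ∀ i < σ.sc .pc, ∃ s' < m, Before M s' s ∧ rel n W s' (σ.ar .ord i) := fun i hi =>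
        (hplc _ (hP.ord_lt i hi)).1 ((hP.plc_iff _ (hP.ord_lt i hi)).2 ⟨i, hi, rfl⟩)
      obtain ⟨s1, hs1, hb1, hr1⟩ := hpl i hi
      obtain ⟨s2, hs2, hb2, hr2⟩ := hpl j (hj.trans hi)
      obtain ⟨h3, h4, _, h5⟩ := hB.parent s hs s1 hs1 hb1 _ ⟨hs, h1⟩ ⟨hs1, hr1⟩
      obtain ⟨-, -, _, h6⟩ := hB.parent s hs s2 hs2 hb2 _ ⟨hs, h2⟩ ⟨hs2, hr2⟩
      exact hJ _ h3 h4 i hi j hj h5 h6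
    · exact hJ s hs hst
  · rintro x hx τ hF ⟨h1, h2, h3⟩
    rw [hP.n_eq] at hx
    have e1 : τ.sc .l = t := by rw [hF.sc .l (by decide), hl]
    have e2 : τ.ar .W = W := by rw [hF.ar .W (by decide), hW]
    rw [wp_when]
    simp only [holds_mul, holds_not, holds_ar, entry, eval_add, eval_mul, eval_sc, eval_var,
      Function.update_self, e1, e2, h1.n_eq, wp_seq, wp_set, not_not, ne_eq]
    constructor
    · rintro ⟨h4, h5⟩
      have hrx : rel n W t x := ⟨hx, h4⟩
      have hnew : ∀ s < m, Before M s t → ¬ rel n W s x := fun s hs hb hr =>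
        ((h2 x hx).2 (Or.inl ⟨s, hs, hb, hr⟩)) h5
      set τ' := τ.setSc .u x with hτ'
      refine ⟨hx.le.trans hu, ?_⟩
      have hP' : Placed n adj w τ' := h1.congr (by simp [hτ']) (by simp [hτ']) rfl rfl rfl
      have hJ' : ∀ S, IsJoined n τ S → IsJoined n τ' S := fun S hS =>
        hS.congr (by simp [hτ']) rfl rfl
      have hW' : τ'.ar .W = W := by rw [hτ', St.setSc_ar, e2]
      have hplc' : τ'.ar .plc = τ.ar .plc := rfl
      refine (wp_place hP' (u := x) (l := t) (by simp [hτ']) (by simp [hτ', e1]) hx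
        (by rw [hplc', h5]) ?_ ?_ ?_ hidx hval hpc).mono ?_
      · rw [hW']
        exact (hJ' _ (h3 t ht (Or.inl rfl))).mono fun i hi hw => ⟨hP'.ord_lt i hi, hw⟩
      · intro v hv hp ha
        rw [hW']
        rw [hplc', h2 v hv] at hp
        rcases hp with ⟨s, hs, hb, hr⟩ | ⟨-, hr⟩
        · exact (hB.nbr t ht s hs hb x v ⟨ht, hrx⟩ (fun s' hs' hb' hr' => hnew s' hs' hb' hr'.2)
            ⟨hs, hr⟩ ⟨hx, hv, ha⟩).2.2
        · exact hr.2
      · have hsub : insert x {v ∈ range n | τ'.ar .plc v ≠ 0 ∧ τ'.ar .W (t * n + v) ≠ 0} ⊆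
            {v ∈ range n | rel n W t v} := by
          intro v hv
          rw [mem_insert, mem_filter, hW'] at hv
          rw [mem_filter]
          rcases hv with rfl | hv
          · exact ⟨mem_range.2 hx, hrx⟩
          · exact ⟨hv.1, mem_range.1 hv.1, hv.2.2⟩
        have := card_le_card hsub
        rw [card_insert_of_notMem (by simp [hplc', h5])] at this
        exact this.trans hw
      · rintro υ - ⟨g1, g2, g3⟩
        refine ⟨g1, fun v hv => ?_, fun s hs hst => g3 _ (hJ' _ (h3 s hs hst)) ?_⟩
        · have hvx : v < x + 1 ↔ v = x ∨ v < x := by omega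
          rw [← ne_eq, g2, hplc', h2 v hv, hvx]
          by_cases hvx' : v = x
          · subst hvx'; simp [hrx]
          · simp [hvx']
        · intro hsx v hv _ hsv
          rw [hW']
          rcases hst with rfl | hst
          · exact hsv.2
          · exact absurd hsx (hnew s hs hst)
    · intro h4
      refine ⟨h1, fun v hv => ?_, h3⟩
      rw [← ne_eq, h2 v hv]
      constructor
      · rintro (h | ⟨h, h'⟩)
        · exact Or.inl h
        · exact Or.inr ⟨by omega, h'⟩
      · rintro (h | ⟨h, h'⟩)
        · exact Or.inl h
        · by_cases hvx : v = x
          · subst hvx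
            exact (h2 v hv).1 fun h7 => h4 ⟨h'.2, h7⟩
          · exact Or.inr ⟨by omega, h'⟩
  · rintro τ hF ⟨h1, h2, h3⟩
    refine ⟨h1, fun v hv => ?_, h3⟩
    rw [h2 v hv, hP.n_eq]
    constructor
    · rintro (⟨s, hs, hb, hr⟩ | ⟨-, hr⟩)
      · exact ⟨s, hs, Or.inr hb, hr⟩
      · exact ⟨t, ht, Or.inl rfl, hr⟩
    · rintro ⟨s, hs, rfl | hb, hr⟩
      · exact Or.inr ⟨hv, hr⟩
      · exact Or.inl ⟨s, hs, hb, hr⟩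

open Classical in
lemma wp_placeBags (hB : BagOrder n m (fun u v => u < n ∧ v < n ∧ adj (u * n + v) ≠ 0)
      (fun t v => t < m ∧ rel n W t v) M F)
    (hn : σ.sc .n = n) (hm : σ.sc .m = m) (hW : σ.ar .W = W) (hD : σ.ar .D = M)
    (hM : ∀ t < m, M t ≠ 0 ∧ M t ≤ σ.sc .cnt) (hpc0 : σ.sc .pc = 0)
    (hplc0 : ∀ v < n, σ.ar .plc v = 0) (hw : ∀ t < m, #{v ∈ range n | rel n W t v} ≤ w)
    (hidx : n * n ≤ bd.idx) (hval : n ≤ bd.val) (hpc : n ≤ bd.sc .pc) (hu : n ≤ bd.sc .u)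
    (hl : m ≤ bd.sc .l) :
    Wp I bd placeBagsCmd ρ (fun τ => Placed n adj w τ ∧ ∀ v < n, τ.ar .plc v ≠ 0) σ := by
  set Inv : (ℕ → Prop) → St → Prop := fun Z τ => Placed n adj w τ ∧
    (∀ v < n, τ.ar .plc v ≠ 0 ↔ ∃ s < m, Z s ∧ rel n W s v) ∧
    ∀ s < m, Z s → IsJoined n τ (rel n W s) with hInv
  have hcongr : ∀ Z Z' τ, (∀ s < m, Z s ↔ Z' s) → Inv Z τ → Inv Z' τ := by
    rintro Z Z' τ hZ ⟨h1, h2, h3⟩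
    refine ⟨h1, fun v hv => (h2 v hv).trans ?_, fun s hs hz => h3 s hs ((hZ s hs).2 hz)⟩
    exact exists_congr fun s => and_congr_right fun hs => and_congr_left' (hZ s hs)
  refine wp_loop (fun r τ => Inv (fun s => M s ≤ r) τ) ?_ ?_ ?_
  · refine ⟨⟨hn, by omega, ?_, ?_, ?_, ⟨?_, ?_, ?_⟩, ?_⟩, ?_, ?_⟩
    all_goals try (rw [hpc0]; intros; omega)
    · intro v hv; simp [hpc0, hplc0 v hv]
    · intro v hv
      simp only [hplc0 v hv, ne_eq, not_true_eq_false, false_iff, not_exists]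
      rintro s ⟨hs, h1, -⟩
      exact (hM s hs).1 (by omega)
    · intro s hs h1
      exact absurd (Nat.le_zero.1 h1) (hM s hs).1
  · intro r hr τ hF hI
    refine wp_loop (fun x υ => Inv (fun s => M s ≤ r ∨ M s = r + 1 ∧ s < x) υ) ?_ ?_ ?_
    · exact hcongr _ _ _ (fun s _ => by simp) hI
    · intro t ht υ hG hJ
      have e0 : τ.sc .m = m := by rw [hF.sc .m (by decide), hm]
      rw [e0] at ht
      have e2 : υ.ar .W = W := by rw [hG.ar .W (by decide), hF.ar .W (by decide), hW]
      have e3 : υ.ar .D = M := by rw [hG.ar .D (by decide), hF.ar .D (by decide), hD]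
      rw [wp_when]
      simp only [holds_eq, eval_ar, eval_var, Function.update_self, e3, eval_add, eval_one, ne_eq,
        zero_ne_one, not_false_eq_true, Function.update_of_ne, wp_seq, wp_set]
      constructor
      · intro hMt
        have hbef : ∀ s, (M s ≤ r ∨ M s = r + 1 ∧ s < t) ↔ Before M s t := fun s => by
          rw [Before, hMt]; omega
        obtain ⟨h1, h2, h3⟩ := hcongr _ _ _ (fun s _ => hbef s) hJ
        refine ⟨ht.le.trans hl, ?_⟩
        refine (wp_placeBag (σ := υ.setSc .l t) hB ht (by simp) e2
          (h1.congr (by simp) (by simp) rfl rfl rfl) h2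
          (fun s hs hb => (h3 s hs hb).congr (by simp) rfl rfl) (hw t ht) hidx hval hpc hu).mono ?_
        intro κ _ hK
        refine hcongr _ _ _ (fun s hs => ?_) hK
        rw [← hbef]
        constructor
        · rintro (rfl | h | h)
          · exact Or.inr ⟨hMt, by omega⟩
          · exact Or.inl h
          · exact Or.inr ⟨h.1, by omega⟩
        · rintro (h | h)
          · exact Or.inr (Or.inl h)
          · by_cases hst : s = t
            · exact Or.inl hst
            · exact Or.inr (Or.inr ⟨h.1, by omega⟩)
      · intro hMt
        refine hcongr _ _ _ (fun s hs => or_congr_right ?_) hJ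
        constructor
        · exact fun h => ⟨h.1, by omega⟩
        · rintro ⟨h, h'⟩
          have : s ≠ t := by rintro rfl; exact hMt h
          exact ⟨h, by omega⟩
    · intro υ hG hJ
      refine hcongr _ _ _ (fun s hs => ?_) hJ
      rw [hF.sc .m (by decide), hm]
      omega
  · rintro τ hF ⟨h1, h2, -⟩
    refine ⟨h1, fun v hv => (h2 v hv).2 ?_⟩
    obtain ⟨t, ht, h3⟩ := hB.cover v hv
    exact ⟨t, ht, (hM t ht).2, h3.2⟩

end

/-! ### Reading the input -/

open Classical in
lemma encodeMatrix_eq_ofFn {r s : ℕ} (R : Fin r → Fin s → Prop) :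
    encodeMatrix R = List.ofFn fun x : Fin (r * s) => if R x.divNat x.modNat then 1 else 0 := by
  rw [encodeMatrix, List.ofFn_mul]
  congr 1
  refine congrArg _ (funext fun i => congrArg _ (funext fun j => ?_))
  have hs : 0 < s := j.pos
  have h1 : (⟨i * s + j, index_lt i.2 j.2⟩ : Fin (r * s)).divNat = i := by
    ext
    simp only [Fin.coe_divNat]
    rw [mul_comm, Nat.mul_add_div hs, Nat.div_eq_of_lt j.2, add_zero]
  have h2 : (⟨i * s + j, index_lt i.2 j.2⟩ : Fin (r * s)).modNat = j := by
    ext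
    simp only [Fin.coe_modNat]
    rw [mul_comm, Nat.mul_add_mod, Nat.mod_eq_of_lt j.2]
  rw [h1, h2]

lemma length_encodeMatrix {r s : ℕ} (R : Fin r → Fin s → Prop) :
    (encodeMatrix R).length = r * s := by
  rw [encodeMatrix_eq_ofFn, List.length_ofFn]

lemma getD_encodeMatrix_ne_zero {r s : ℕ} (R : Fin r → Fin s → Prop) (i : Fin r) (j : Fin s)
    (l : List ℕ) : (encodeMatrix R ++ l).getD (i * s + j) 0 ≠ 0 ↔ R i j := by
  classical
  have hlt := index_lt i.2 j.2
  have hs : 0 < s := j.pos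
  rw [List.getD_append _ _ _ _ (by rw [length_encodeMatrix]; exact hlt), encodeMatrix_eq_ofFn,
    List.getD_eq_getElem _ _ (by simpa using hlt), List.getElem_ofFn]
  have h1 : (⟨i * s + j, hlt⟩ : Fin (r * s)).divNat = i := by
    ext
    simp only [Fin.coe_divNat]
    rw [mul_comm, Nat.mul_add_div hs, Nat.div_eq_of_lt j.2, add_zero]
  have h2 : (⟨i * s + j, hlt⟩ : Fin (r * s)).modNat = j := by
    ext
    simp only [Fin.coe_modNat]
    rw [mul_comm, Nat.mul_add_mod, Nat.mod_eq_of_lt j.2]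
  rw [h1, h2]
  simp

lemma le_one_of_mem_encodeMatrix {r s : ℕ} {R : Fin r → Fin s → Prop} {a : ℕ}
    (h : a ∈ encodeMatrix R) : a ≤ 1 := by
  classical
  rw [encodeMatrix_eq_ofFn, List.mem_ofFn] at h
  obtain ⟨x, rfl⟩ := h
  split_ifs <;> omega

lemma Instance.length_encode (I : Instance) : I.encode.length = 4 + I.n * I.n := by
  simp [Instance.encode, encodeRat, length_encodeMatrix]; omega

lemma TreeDecomposition.length_encode {I : Instance} {m : ℕ} (D : TreeDecomposition I.graph m) :
    D.encode.length = 1 + m * m + m * I.n := by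
  simp [TreeDecomposition.encode, length_encodeMatrix]; omega

/-- What the entries of the input say about an instance. -/
structure Encodes (J : ℕ → ℕ) (I : Instance) : Prop where
  n_eq : J 0 = I.n
  sign : J 1 = 0 ↔ 0 ≤ I.N
  sign_le : J 1 ≤ 1
  num : J 2 = I.N.num.natAbs
  den : J 3 = I.N.den
  adj : ∀ u < I.n, ∀ v < I.n, J (4 + (u * I.n + v)) ≠ 0 ↔ I.adj u v
  le_one : ∀ a, 4 ≤ a → a < 4 + I.n * I.n → J a ≤ 1

lemma Instance.encodes (I : Instance) (l : List ℕ) :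
    Encodes (fun a => (I.encode ++ l).getD a 0) I := by
  have h4 : ∀ a, (I.encode ++ l).getD (4 + a) 0 = (encodeMatrix I.graph.Adj ++ l).getD a 0 := by
    intro a
    rw [add_comm]
    simp [Instance.encode, encodeRat]
  refine ⟨rfl, ?_, ?_, rfl, rfl, fun u hu v hv => ?_, fun a h1 h2 => ?_⟩
  · by_cases h : I.N < 0
    · simp [Instance.encode, encodeRat, h]
    · simp [Instance.encode, encodeRat, h, not_lt.1 h]
  · by_cases h : I.N < 0 <;> simp [Instance.encode, encodeRat, h]
  · rw [h4]
    refine (getD_encodeMatrix_ne_zero I.graph.Adj ⟨u, hu⟩ ⟨v, hv⟩ l).trans ?_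
    exact ⟨fun h => ⟨hu, hv, h⟩, fun ⟨_, _, h⟩ => h⟩
  · obtain ⟨b, rfl⟩ := Nat.exists_eq_add_of_le h1
    have hb : b < (encodeMatrix I.graph.Adj).length := by rw [length_encodeMatrix]; omega
    rw [h4, List.getD_append _ _ _ _ hb, List.getD_eq_getElem _ _ hb]
    exact le_one_of_mem_encodeMatrix (List.getElem_mem _)

/-- What the entries of the input say about a tree decomposition. -/
structure TreeEncodes (J : ℕ → ℕ) {I : Instance} {m : ℕ} (T : TreeDecomposition I.graph m) :
    Prop where
  m_eq : J (4 + I.n * I.n) = m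
  tree : ∀ a b : Fin m, J (5 + I.n * I.n + (a * m + b)) ≠ 0 ↔ T.tree.Adj a b
  bag : ∀ (t : Fin m) (v : Fin I.n), J (5 + I.n * I.n + m * m + (t * I.n + v)) ≠ 0 ↔ v ∈ T.bag t
  le_one : ∀ a, 5 + I.n * I.n ≤ a → J a ≤ 1

lemma TreeDecomposition.encodes {I : Instance} {m : ℕ} (T : TreeDecomposition I.graph m) :
    TreeEncodes (fun a => (I.encode ++ T.encode).getD a 0) T := by
  have h4 : ∀ a, (I.encode ++ T.encode).getD (4 + I.n * I.n + a) 0 = T.encode.getD a 0 := by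
    intro a
    rw [List.getD_append_right _ _ _ _ (by rw [I.length_encode]; omega), I.length_encode]
    congr 1; omega
  have h5 : ∀ a, (I.encode ++ T.encode).getD (5 + I.n * I.n + a) 0 =
      (encodeMatrix T.tree.Adj ++ encodeMatrix fun t v => v ∈ T.bag t).getD a 0 := by
    intro a
    rw [show 5 + I.n * I.n + a = 4 + I.n * I.n + (a + 1) by ring, h4]
    simp [TreeDecomposition.encode]
  refine ⟨h4 0, fun a b => ?_, fun t v => ?_, fun a h1 => ?_⟩
  · rw [h5]; exact getD_encodeMatrix_ne_zero T.tree.Adj a b _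
  · rw [add_assoc (5 + I.n * I.n), h5, List.getD_append_right _ _ _ _
      (by rw [length_encodeMatrix]; omega), length_encodeMatrix, Nat.add_sub_cancel_left]
    have := getD_encodeMatrix_ne_zero (fun t v => v ∈ T.bag t) t v []
    rwa [List.append_nil] at this
  · obtain ⟨b, rfl⟩ := Nat.exists_eq_add_of_le h1
    rw [h5]
    by_cases hb : b < (encodeMatrix T.tree.Adj ++ encodeMatrix fun t v => v ∈ T.bag t).length
    · rw [List.getD_eq_getElem _ _ hb]
      rcases List.mem_append.1 (List.getElem_mem hb) with h | h <;>
        exact le_one_of_mem_encodeMatrix h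
    · rw [List.getD_eq_default _ _ (by omega)]; exact Nat.zero_le _

/-- Copy a part of the input to an array, starting at position `e`. -/
def copyInput (a : Ar) (j : Sc) (e : Expr) : Cmd := .loop 0 j (.put a (var 0) (inp (e + var 0)))

/-- Read the graph. -/
def readGraphCmd : Cmd :=
  .set .n (inp 0) ;; .set .nsq (sc .n * sc .n) ;; copyInput .adj .nsq 4

/-- Read the tree decomposition. -/
def readTreeCmd : Cmd :=
  .set .m (inp (4 + sc .nsq)) ;; .set .nn (sc .m) ;; .set .msq (sc .m * sc .m) ;;
  copyInput .E .msq (5 + sc .nsq) ;; .set .mn (sc .m * sc .n) ;;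
  copyInput .W .mn (5 + sc .nsq + sc .msq)

/-- Turn a tree decomposition into an elimination order. -/
def treeCmd : Cmd :=
  readGraphCmd ;; readTreeCmd ;; .put .D 0 1 ;; .set .cnt 1 ;; searchCmd ;; placeBagsCmd

section
variable {J : ℕ → ℕ} {bd : Bounds} {ρ : ℕ → ℕ} {σ : St}

lemma wp_copyInput {a : Ar} {j : Sc} {e : Expr} {b : ℕ}
    (he : ∀ τ ρ', (∀ j, τ.sc j = σ.sc j) → e.eval J ρ' τ = b) (hidx : σ.sc j ≤ bd.idx)
    (hval : ∀ x < σ.sc j, J (b + x) ≤ bd.val) :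
    Wp J bd (copyInput a j e) ρ (fun τ => ∀ x < σ.sc j, τ.ar a x = J (b + x)) σ := by
  refine wp_loop (fun m τ => ∀ x < m, τ.ar a x = J (b + x)) (by simp) ?_ (fun τ _ h => h)
  intro m hm τ hF hI
  have h1 := he τ (Function.update ρ 0 m) fun j => hF.sc j (by simp [scs])
  simp only [wp_put, eval_var, Function.update_self, eval_inp, eval_add, h1, St.setAr_ar, true_and]
  refine ⟨⟨by omega, hval m hm⟩, fun x hx => ?_⟩
  by_cases hxm : x = m
  · simp [hxm]
  · rw [if_neg hxm]; exact hI x (by omega)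

lemma wp_readGraph {I : Instance} (hJ : Encodes J I) (hn : I.n ≤ bd.sc .n)
    (hnsq : I.n * I.n ≤ bd.sc .nsq) (hidx : I.n * I.n ≤ bd.idx) (hval : 1 ≤ bd.val) :
    Wp J bd readGraphCmd ρ (fun τ => τ.sc .n = I.n ∧ τ.sc .nsq = I.n * I.n ∧
      ∀ u < I.n, ∀ v < I.n, τ.ar .adj (u * I.n + v) ≠ 0 ↔ I.adj u v) σ := by
  rw [readGraphCmd]
  simp only [wp_seq, wp_set, eval_inp, eval_zero, hJ.n_eq, eval_mul, eval_sc, St.setSc_sc, if_true]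
  refine ⟨hn, hnsq, ?_⟩
  refine (wp_copyInput (b := 4) (fun _ _ _ => rfl) (by simpa using hidx) ?_).mono ?_
  · intro x hx
    exact (hJ.le_one _ (by omega) (by simpa using hx)).trans hval
  · intro τ hF h
    simp only [St.setSc_sc, if_true] at h
    refine ⟨by rw [hF.sc .n (by decide)]; simp, by rw [hF.sc .nsq (by decide)]; simp,
      fun u hu v hv => ?_⟩
    rw [h _ (index_lt hu hv)]
    exact hJ.adj u hu v hv

/-- Bounds that suffice for the elimination order. -/
structure TreeBounds (n m : ℕ) (bd : Bounds) : Prop where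
  sc_n : n ≤ bd.sc .n
  nsq : n * n ≤ bd.sc .nsq
  sc_m : m ≤ bd.sc .m
  nn : m ≤ bd.sc .nn
  msq : m * m ≤ bd.sc .msq
  mn : m * n ≤ bd.sc .mn
  cnt : m + 1 ≤ bd.sc .cnt
  pc : n ≤ bd.sc .pc
  u : n ≤ bd.sc .u
  l : m ≤ bd.sc .l
  idx_nsq : n * n ≤ bd.idx
  idx_msq : m * m ≤ bd.idx
  idx_mn : m * n ≤ bd.idx
  val_n : n ≤ bd.val
  val_m : m + 1 ≤ bd.val

lemma TreeDecomposition.card_bag_le {V : Type} {G : SimpleGraph V} {m : ℕ}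
    (T : TreeDecomposition G m) (t : Fin m) : #(T.bag t) ≤ T.width + 1 := by
  have : #(T.bag t) ≤ Finset.univ.sup fun t => (T.bag t).card :=
    Finset.le_sup (f := fun t => (T.bag t).card) (mem_univ t)
  rw [TreeDecomposition.width]
  omega

lemma wp_tree {I : Instance} {m : ℕ} {T : TreeDecomposition I.graph m} (hJ : Encodes J I)
    (hT : TreeEncodes J T) (hb : TreeBounds I.n m bd) (h0 : σ = St.zero) :
    Wp J bd treeCmd ρ (fun τ => Placed I.n (τ.ar .adj) (T.width + 1) τ ∧
      (∀ v < I.n, τ.ar .plc v ≠ 0) ∧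
      ∀ u < I.n, ∀ v < I.n, τ.ar .adj (u * I.n + v) ≠ 0 ↔ I.adj u v) σ := by
  classical
  have hm0 : 0 < m := (T.isTree.connected.nonempty).elim fun t => t.pos
  have hmm : m ≤ m * m := Nat.le_mul_of_pos_left _ hm0
  have := hb.idx_msq
  have := hb.val_m
  rw [treeCmd, wp_seq]
  refine (wp_readGraph hJ hb.sc_n hb.nsq hb.idx_nsq (by omega)).mono ?_
  rintro σ1 F1 ⟨n1, q1, a1⟩
  rw [readTreeCmd]
  simp only [wp_seq, wp_set, eval_inp, eval_add, eval_mul, eval_sc, eval_ofNat, q1, hT.m_eq,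
    St.setSc_sc, if_true, reduceCtorEq, if_false]
  refine ⟨hb.sc_m, hb.nn, hb.msq, ?_⟩
  set σ2 := ((σ1.setSc .m m).setSc .nn m).setSc .msq (m * m) with hσ2
  have msq2 : σ2.sc .msq = m * m := by simp [hσ2]
  refine (wp_copyInput (b := 5 + I.n * I.n) (fun τ _ h => ?_) (by rw [msq2]; exact hb.idx_msq)
    (fun x _ => (hT.le_one _ (by omega)).trans (by omega))).mono ?_
  · simp [h, hσ2, q1]
  rintro σ3 F3 h3
  rw [msq2] at h3
  have m3 : σ3.sc .m = m := by rw [F3.sc .m (by decide)]; simp [hσ2]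
  have n3 : σ3.sc .n = I.n := by rw [F3.sc .n (by decide)]; simp [hσ2, n1]
  have q3 : σ3.sc .nsq = I.n * I.n := by rw [F3.sc .nsq (by decide)]; simp [hσ2, q1]
  have msq3 : σ3.sc .msq = m * m := by rw [F3.sc .msq (by decide), msq2]
  simp only [wp_seq, wp_set, eval_mul, eval_sc, m3, n3]
  refine ⟨hb.mn, ?_⟩
  refine (wp_copyInput (b := 5 + I.n * I.n + m * m) (fun τ _ h => ?_) (by simpa using hb.idx_mn)
    (fun x _ => (hT.le_one _ (by omega)).trans (by omega))).mono ?_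
  · simp [h, q3, msq3]
  rintro σ4 F4 h4
  simp only [St.setSc_sc, if_true] at h4
  simp only [wp_seq, wp_put, eval_zero, eval_one, wp_set]
  have := hb.cnt
  refine ⟨⟨by omega, by omega⟩, by omega, ?_⟩
  set σ5 := (σ4.setAr .D 0 1).setSc .cnt 1 with hσ5
  have D5 : ∀ x, σ5.ar .D x = if x = 0 then 1 else 0 := by
    intro x
    simp [hσ5, F4.ar .D (by decide), F3.ar .D (by decide), hσ2, F1.ar .D (by decide), h0, St.zero]
  have nn5 : σ5.sc .nn = m := by simp [hσ5, F4.sc .nn (by decide), F3.sc .nn (by decide), hσ2]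
  have E5 : ∀ a b : Fin m, σ5.ar .E (a * m + b) ≠ 0 ↔ T.tree.Adj a b := by
    intro a b
    simp only [hσ5, St.setSc_ar, St.setAr_ar, reduceCtorEq, false_and, if_false,
      F4.ar .E (by decide)]
    rw [h3 _ (index_lt a.2 b.2)]
    exact hT.tree a b
  refine (wp_search (σ := σ5) nn5 ?_ ?_ (by omega) ?_).mono ?_
  · intro x _
    rw [D5]
    simp only [hσ5, St.setSc_sc, if_true]
    split_ifs <;> omega
  · simp only [hσ5, St.setSc_sc, if_true]; omega
  · simp only [hσ5, St.setSc_sc, if_true]; omega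
  rintro σ6 F6 ⟨hs, hc⟩
  have D60 : σ6.ar .D 0 ≠ 0 := by rw [hs.keep 0 (by simp [D5])]; simp [D5]
  have D6 := hc.forall_ne_zero T.isTree.connected E5 D60
  have n6 : σ6.sc .n = I.n := by
    rw [F6.sc .n (by decide)]; simp [hσ5, F4.sc .n (by decide), n3]
  have m6 : σ6.sc .m = m := by
    rw [F6.sc .m (by decide)]; simp [hσ5, F4.sc .m (by decide), m3]
  have pc6 : σ6.sc .pc = 0 := by
    rw [F6.sc .pc (by decide)]
    simp [hσ5, F4.sc .pc (by decide), F3.sc .pc (by decide), hσ2, F1.sc .pc (by decide), h0, St.zero]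
  have plc6 : ∀ v, σ6.ar .plc v = 0 := by
    intro v
    rw [F6.ar .plc (by decide)]
    simp [hσ5, F4.ar .plc (by decide), F3.ar .plc (by decide), hσ2, F1.ar .plc (by decide), h0,
      St.zero]
  have W6 : σ6.ar .W = σ4.ar .W := by
    rw [F6.ar .W (by decide)]; funext; simp [hσ5]
  have adj6 : σ6.ar .adj = σ1.ar .adj := by
    rw [F6.ar .adj (by decide)]
    funext
    simp [hσ5, F4.ar .adj (by decide), F3.ar .adj (by decide), hσ2]
  have hbag : ∀ t v, (t < m ∧ rel I.n (σ4.ar .W) t v) ↔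
      ∃ (ht : t < m) (hv : v < I.n), (⟨v, hv⟩ : Fin I.n) ∈ T.bag ⟨t, ht⟩ := by
    intro t v
    have : ∀ (ht : t < m) (hv : v < I.n), σ4.ar .W (t * I.n + v) ≠ 0 ↔
        (⟨v, hv⟩ : Fin I.n) ∈ T.bag ⟨t, ht⟩ := fun ht hv => by
      rw [h4 _ (index_lt ht hv)]
      exact hT.bag ⟨t, ht⟩ ⟨v, hv⟩
    constructor
    · rintro ⟨ht, hv, h⟩
      exact ⟨ht, hv, (this ht hv).1 h⟩
    · rintro ⟨ht, hv, h⟩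
      exact ⟨ht, hv, (this ht hv).2 h⟩
  have hB : BagOrder I.n m (fun u v => u < I.n ∧ v < I.n ∧ σ6.ar .adj (u * I.n + v) ≠ 0)
      (fun t v => t < m ∧ rel I.n (σ4.ar .W) t v) (σ6.ar .D) (σ6.ar .F) := by
    have h1 : (fun u v => u < I.n ∧ v < I.n ∧ σ6.ar .adj (u * I.n + v) ≠ 0) = I.adj := by
      funext u v
      rw [adj6]
      refine propext ⟨fun ⟨hu, hv, h⟩ => (a1 u hu v hv).1 h, fun h => ?_⟩
      obtain ⟨hu, hv, -⟩ := id h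
      exact ⟨hu, hv, (a1 u hu v hv).2 h⟩
    have h2 : (fun t v => t < m ∧ rel I.n (σ4.ar .W) t v) = fun t v =>
        ∃ (ht : t < m) (hv : v < I.n), (⟨v, hv⟩ : Fin I.n) ∈ T.bag ⟨t, ht⟩ :=
      funext fun t => funext fun v => propext (hbag t v)
    rw [h1, h2]
    refine T.bagOrder fun t ht ht0 => ?_
    obtain ⟨-, -, g1, g2, g3, g4⟩ := hs.new t (by simp [D5, ht0]) (D6 t ht)
    exact ⟨g1, g3, (E5 ⟨_, g1⟩ ⟨t, ht⟩).1 g4⟩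
  refine (wp_placeBags (w := T.width + 1) hB n6 m6 W6 rfl (fun t ht => ⟨D6 t ht, hs.le t ht⟩) pc6
    (fun v _ => plc6 v) (fun t ht => ?_) hb.idx_nsq hb.val_n hb.pc hb.u hb.l).mono ?_
  · refine le_trans ?_ (T.card_bag_le ⟨t, ht⟩)
    rw [← card_map Fin.valEmbedding]
    refine card_le_card fun v hv => ?_
    rw [mem_filter] at hv
    obtain ⟨_, hv', h⟩ := (hbag t v).1 ⟨ht, hv.2⟩
    exact mem_map.2 ⟨⟨v, hv'⟩, h, rfl⟩
  · rintro τ F7 ⟨h7, h8⟩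
    have : τ.ar .adj = σ6.ar .adj := F7.ar .adj (by decide)
    exact ⟨by rwa [this], h8, by rwa [this, adj6]⟩

open Classical in
/-- A graph with a tree decomposition of width `w` has an elimination order in which every set
`H i` has at most `w` elements. -/
theorem TreeDecomposition.exists_elim {I : Instance} {m : ℕ} (T : TreeDecomposition I.graph m) :
    ∃ (ord : ℕ → ℕ) (H : ℕ → ℕ → Prop), Set.BijOn ord (Set.Iio I.n) (Set.Iio I.n) ∧
      Elim I.n (fun i j => I.adj (ord i) (ord j)) H ∧
      ∀ i < I.n, #{j ∈ range I.n | H i j} ≤ T.width := by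
  set B := (I.n + m + 2) * (I.n + m + 2) with hB
  have hb : TreeBounds I.n m ⟨B, B, fun _ => B⟩ := by
    constructor <;> dsimp only <;> nlinarith
  obtain ⟨-, h1, h2, h3⟩ := wp_tree (ρ := fun _ => 0) (I.encodes T.encode) T.encodes hb rfl
  set τ := treeCmd.exec (fun a => (I.encode ++ T.encode).getD a 0) (fun _ => 0) St.zero
  obtain ⟨h4, h5⟩ := h1.bijOn h2
  refine ⟨τ.ar .ord, rel I.n (τ.ar .H), h5, ?_, fun i hi => ?_⟩
  · have := h1.elim
    rw [h4] at this
    refine ⟨this.lt, this.closed, fun i j hi hj ha => this.edge i j hi hj ?_⟩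
    exact (h3 _ (h5.mapsTo hi) _ (h5.mapsTo (hj.trans hi))).2 ha
  · have := h1.card i (by omega)
    omega

end

/-! ### The decision, given an elimination order -/

lemma wp_decide {J : ℕ → ℕ} {bd : Bounds} {ρ : ℕ → ℕ} {σ : St} {I : Instance} {k w : ℕ}
    (hk : 2 ≤ k) (hb : DPBounds I.n k w bd) (hJ : Encodes J I)
    (hP : Placed I.n (σ.ar .adj) w σ) (hall : ∀ v < I.n, σ.ar .plc v ≠ 0)
    (hadj : ∀ u < I.n, ∀ v < I.n, σ.ar .adj (u * I.n + v) ≠ 0 ↔ I.adj u v)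
    (hT : ∀ x, σ.ar .T x = 0) :
    Wp J bd (dpCmd k) ρ (fun τ => (τ.sc .out = 0 ∨ τ.sc .out = 1) ∧
      (τ.sc .out = 1 ↔ I.IsYes k)) σ := by
  obtain ⟨hpc, hbij⟩ := hP.bijOn hall
  have hpos : ∀ i < I.n, ∀ j < I.n, (posAdj I.n (σ.ar .adj) (σ.ar .ord) i j ↔
      I.adj (σ.ar .ord i) (σ.ar .ord j)) := fun i hi j hj =>
    hadj _ (hbij.mapsTo hi) _ (hbij.mapsTo hj)
  refine (wp_dp hb hk hP.n_eq (fun i hi j hj h => ?_) (hpc ▸ hP.elim) (hpc ▸ hP.card) hT hJ.sign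
    hJ.num hJ.den).mono ?_
  · rw [hpos j hj i hi]
    exact I.adj_symm ((hpos i hi j hj).1 h)
  · rintro τ - ⟨h1, h2⟩
    refine ⟨h1, h2.trans (Iff.trans ?_ ((I.isYes_iff (by omega)).trans
      (exists_isSolution_relabel (by omega) hbij)).symm)⟩
    exact exists_congr fun f => and_congr_right fun _ => isSolution_congr hpos

/-! ### Estimates of the time -/

namespace Expr

/-- The scalars that bound the sums of an expression. -/
def limits : Expr → List Sc
  | inp e | ar _ e => e.limits
  | add e f | sub e f | mul e f | div e f => e.limits ++ f.limits
  | sum _ j e => j :: e.limits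
  | _ => []

/-- The nesting depth of sums. -/
def depth : Expr → ℕ
  | inp e | ar _ e => e.depth
  | add e f | sub e f | mul e f | div e f => max e.depth f.depth
  | sum _ _ e => e.depth + 1
  | _ => 0

end Expr

namespace Cmd

/-- The scalars that bound the loops and sums of a command. -/
def limits : Cmd → List Sc
  | skip => []
  | set _ e => e.limits
  | put _ e f => e.limits ++ f.limits
  | seq c d => c.limits ++ d.limits
  | ite e c d => e.limits ++ (c.limits ++ d.limits)
  | loop _ j c => j :: c.limits

/-- The nesting depth of loops and sums. -/
def depth : Cmd → ℕ
  | skip => 0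
  | set _ e => e.depth
  | put _ e f => max e.depth f.depth
  | seq c d => max c.depth d.depth
  | ite e c d => max e.depth (max c.depth d.depth)
  | loop _ _ c => c.depth + 1

end Cmd

section
variable {B : Sc → ℕ} {X : ℕ}

lemma mul_pow_max_le {a b d d' x y : ℕ} (hX : 1 ≤ X) (hx : x ≤ a * X ^ d) (hy : y ≤ b * X ^ d') :
    x + y ≤ (a + b) * X ^ max d d' := by
  rw [add_mul]
  exact Nat.add_le_add (hx.trans (Nat.mul_le_mul_left _ (Nat.pow_le_pow_right hX (le_max_left _ _))))
    (hy.trans (Nat.mul_le_mul_left _ (Nat.pow_le_pow_right hX (le_max_right _ _))))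

lemma le_mul_pow {a x d e : ℕ} (hX : 1 ≤ X) (hx : x ≤ a * X ^ d) : x + e ≤ (a + e) * X ^ d := by
  have : 1 ≤ X ^ d := Nat.one_le_pow _ _ hX
  nlinarith

lemma Expr.cost_le (hX : 1 ≤ X) (e : Expr) (hB : ∀ j ∈ e.limits, B j ≤ X) :
    e.cost B ≤ e.cost (fun _ => 1) * X ^ e.depth := by
  induction e with
  | lit c => simp [cost, depth]
  | var x => simp [cost, depth]
  | sc j => simp [cost, depth]
  | inp e ih => exact le_mul_pow hX (ih hB)
  | ar a e ih => exact le_mul_pow hX (ih hB)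
  | sum x j e ih =>
    simp only [limits, List.mem_cons, forall_eq_or_imp] at hB
    refine le_mul_pow hX ?_
    rw [depth, pow_succ, one_mul, ← mul_assoc, mul_comm]
    exact Nat.mul_le_mul (le_mul_pow hX (ih hB.2)) hB.1
  | _ e f he hf =>
    simp only [limits, List.mem_append] at hB
    exact le_mul_pow hX (mul_pow_max_le hX (he fun j hj => hB j (Or.inl hj))
      (hf fun j hj => hB j (Or.inr hj)))

/-- If the limits of all loops are at most `X`, the time is polynomial in `X`, and the exponent is
the nesting depth. -/
lemma Cmd.cost_le (hX : 1 ≤ X) (c : Cmd) (hB : ∀ j ∈ c.limits, B j ≤ X) :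
    c.cost B ≤ c.cost (fun _ => 1) * X ^ c.depth := by
  induction c with
  | skip => simp [cost]
  | set j e => exact le_mul_pow hX (e.cost_le hX hB)
  | put a e f =>
    simp only [limits, List.mem_append] at hB
    exact le_mul_pow hX (mul_pow_max_le hX (e.cost_le hX fun j hj => hB j (Or.inl hj))
      (f.cost_le hX fun j hj => hB j (Or.inr hj)))
  | seq c d hc hd =>
    simp only [limits, List.mem_append] at hB
    exact mul_pow_max_le hX (hc fun j hj => hB j (Or.inl hj)) (hd fun j hj => hB j (Or.inr hj))
  | ite e c d hc hd =>
    simp only [limits, List.mem_append] at hB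
    have h (B : Sc → ℕ) : (ite e c d).cost B = e.cost B + (c.cost B + d.cost B) + 2 := by
      rw [cost]; ring
    rw [h, h]
    exact le_mul_pow hX (mul_pow_max_le hX (e.cost_le hX fun j hj => hB j (Or.inl hj))
      (mul_pow_max_le hX (hc fun j hj => hB j (Or.inr (Or.inl hj)))
        (hd fun j hj => hB j (Or.inr (Or.inr hj)))))
  | loop x j c ih =>
    simp only [limits, List.mem_cons, forall_eq_or_imp] at hB
    refine le_mul_pow hX ?_
    rw [depth, pow_succ, one_mul, ← mul_assoc, mul_comm]
    exact Nat.mul_le_mul (le_mul_pow hX (ih hB.2)) hB.1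

end

section
variable {B : Sc → ℕ} {n k : ℕ}

lemma cost_init (B : Sc → ℕ) : initCmd.cost B = B .nsucc * (B .K *
    ((put Ar.T (tEntry (var 0) (var 1) 0) 1).cost (fun _ => 0) + 4) + 3 + 4) + 3 := rfl

lemma cost_eliminate (B : Sc → ℕ) : eliminateCmd.cost B = B .n * (6 + (parentCmd.cost B + (B .K *
    (mergeCmd.cost B + 4) + 3)) + 4) + 3 := rfl

lemma radix_pow_pos (n k : ℕ) : 0 < radix n ^ k := pow_pos (radix_pos n) k

lemma le_radix_pow (n : ℕ) (hk : 2 ≤ k) : n * n ≤ radix n ^ k := by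
  refine le_trans ?_ (Nat.le_self_pow (by omega) _)
  unfold radix; nlinarith [Nat.zero_le (n * n)]

lemma cost_tables_le {w : ℕ} (hn : 1 ≤ n) (hBn : B .n = n) (hBk : B .kk = k) (hBw : B .w = w)
    (hw : w ≤ n) : (tablesCmd k).cost B ≤ (tablesCmd k).cost (fun _ => 1) * ((k + 2) * n) ^ 3 := by
  refine (tablesCmd k).cost_le (by nlinarith) fun j hj => ?_
  have : j ∈ [Sc.n, .kk, .w] := by
    revert j
    show ∀ j ∈ (tablesCmd 0).limits, _
    decide
  fin_cases this
  · rw [hBn]; nlinarith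
  · rw [hBk]; nlinarith
  · rw [hBw]; nlinarith

lemma cost_parent_le (hn : 1 ≤ n) (hBn : B .n = n) :
    parentCmd.cost B ≤ parentCmd.cost (fun _ => 1) * n := by
  have h := parentCmd.cost_le (B := B) hn fun j hj => ?_
  · rwa [show parentCmd.depth = 1 from rfl, pow_one] at h
  · have : j ∈ [Sc.n] := by revert j; decide
    fin_cases this
    rw [hBn]

lemma cost_merge_le (hn : 1 ≤ n) (hk : 2 ≤ k) (hBn : B .n = n) (hBk : B .kk = k)
    (hBM : B .M = radix n ^ k) :
    mergeCmd.cost B ≤ mergeCmd.cost (fun _ => 1) * k ^ 2 * (radix n ^ k) ^ 2 := by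
  have h1 := le_radix_pow n hk
  have h2 : n ≤ n * n := Nat.le_mul_of_pos_left _ hn
  generalize radix n ^ k = M at *
  have h3 : M ≤ k * M := Nat.le_mul_of_pos_left _ (by omega)
  have h := mergeCmd.cost_le (B := B) (X := k * M) (by omega) fun j hj => ?_
  · rwa [show mergeCmd.depth = 2 from rfl, mul_pow, ← mul_assoc] at h
  · have : j ∈ [Sc.M, .kk, .n] := by revert j; decide
    fin_cases this
    · rw [hBM]; exact h3
    · rw [hBk]; exact Nat.le_mul_of_pos_right _ (by omega)
    · rw [hBn]; omega

lemma cost_check_le (hn : 1 ≤ n) (hk : 2 ≤ k) (hBk : B .kk = k) (hBM : B .M = radix n ^ k) :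
    checkCmd.cost B ≤ checkCmd.cost (fun _ => 1) * k ^ 2 * (radix n ^ k) ^ 2 := by
  have h1 := le_radix_pow n hk
  have h2 : n ≤ n * n := Nat.le_mul_of_pos_left _ hn
  generalize radix n ^ k = M at *
  have h3 : M ≤ k * M := Nat.le_mul_of_pos_left _ (by omega)
  have h := checkCmd.cost_le (B := B) (X := k * M) (by omega) fun j hj => ?_
  · rwa [show checkCmd.depth = 2 from rfl, mul_pow, ← mul_assoc] at h
  · have : j ∈ [Sc.M, .kk] := by revert j; decide
    fin_cases this
    · rw [hBM]; exact h3
    · rw [hBk]; exact Nat.le_mul_of_pos_right _ (by omega)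

end

/-- A bound for the time in which the result for `n` vertices and bags of size `w` is found, once
there is an elimination order. -/
lemma cost_dp_le (k : ℕ) : ∃ C, ∀ (B : Sc → ℕ) (n w : ℕ), 1 ≤ n → 2 ≤ k → B .n = n →
    B .nsucc = n + 1 → B .kk = k → B .M = radix n ^ k → B .K = k ^ w → B .w = w → w ≤ n →
    (dpCmd k).cost B ≤ C * (n * k ^ w * (radix n ^ k) ^ 2) := by
  refine ⟨(tablesCmd k).cost (fun _ => 1) * (k + 2) ^ 3 +
    (2 * ((put Ar.T (tEntry (var 0) (var 1) 0) 1).cost (fun _ => 0) + 11) + 3) +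
    ((parentCmd.cost (fun _ => 1) + (mergeCmd.cost (fun _ => 1) * k ^ 2 + 20)) + 3) +
    checkCmd.cost (fun _ => 1) * k ^ 2, ?_⟩
  intro B n w hn hk hBn hBs hBk hBM hBK hBw hw
  have g0 := cost_tables_le hn hBn hBk hBw hw
  have g1 := cost_parent_le hn hBn
  have g2 := cost_merge_le hn hk hBn hBk hBM
  have g3 := cost_check_le hn hk hBk hBM
  have e1 := cost_init B
  have e3 := cost_eliminate B
  have hMn := le_radix_pow n hk
  have e4 : (dpCmd k).cost B = (tablesCmd k).cost B + (initCmd.cost B + (eliminateCmd.cost B +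
      checkCmd.cost B)) := rfl
  rw [e4, e1, e3, hBn, hBs, hBK]
  generalize radix n ^ k = M at *
  have hK1 : 1 ≤ k ^ w := Nat.one_le_pow _ _ (by omega)
  generalize k ^ w = K at *
  -- the costs of the parts of the program are constants
  generalize (put Ar.T (tEntry (var 0) (var 1) 0) 1).cost (fun _ => 0) = a
  generalize (tablesCmd k).cost (fun _ => 1) = c0 at *
  generalize parentCmd.cost (fun _ => 1) = c1 at *
  generalize mergeCmd.cost (fun _ => 1) * k ^ 2 = c2 at *
  generalize checkCmd.cost (fun _ => 1) * k ^ 2 = c3 at *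
  generalize (tablesCmd k).cost B = x0 at *
  generalize parentCmd.cost B = x1 at *
  generalize mergeCmd.cost B = x2 at *
  generalize checkCmd.cost B = x3 at *
  clear e1 e3 e4 hBn hBs hBk hBM hBK hBw
  obtain ⟨T, hT⟩ : ∃ T, T = n * K * M ^ 2 := ⟨_, rfl⟩
  have hnn : n ≤ n * n := Nat.le_mul_of_pos_left _ hn
  have hMM : M ≤ M ^ 2 := Nat.le_self_pow (by omega) _
  have hM0 : 0 < M ^ 2 := by omega
  have hT1 : n * K ≤ T := hT ▸ Nat.le_mul_of_pos_right _ hM0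
  have hT2 : M ^ 2 ≤ T := hT ▸ Nat.le_mul_of_pos_left _ (Nat.mul_pos hn hK1)
  have hT0 : 1 ≤ T := le_trans hM0 hT2
  have h1 : x0 ≤ c0 * (k + 2) ^ 3 * T := by
    refine g0.trans ?_
    rw [mul_pow, ← mul_assoc]
    refine Nat.mul_le_mul_left _ (le_trans ?_ hT2)
    calc n ^ 3 ≤ (n * n) ^ 2 := by
          rw [← sq, ← pow_mul]; exact Nat.pow_le_pow_right hn (by omega)
      _ ≤ M ^ 2 := Nat.pow_le_pow_left (by omega) 2
  have h2 : (n + 1) * (K * (a + 4) + 3 + 4) + 3 ≤ (2 * (a + 11) + 3) * T := by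
    have : K * (a + 4) + 3 + 4 ≤ (a + 11) * K := by nlinarith
    calc (n + 1) * (K * (a + 4) + 3 + 4) + 3 ≤ 2 * n * ((a + 11) * K) + 3 :=
          Nat.add_le_add_right (Nat.mul_le_mul (by omega) this) _
      _ = 2 * (a + 11) * (n * K) + 3 := by ring
      _ ≤ 2 * (a + 11) * T + 3 * T :=
          Nat.add_le_add (Nat.mul_le_mul_left _ hT1) (by omega)
      _ = _ := by ring
  have h3 : n * (6 + (x1 + (K * (x2 + 4) + 3)) + 4) + 3 ≤ (c1 + (c2 + 20) + 3) * T := by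
    have f1 : K * (x2 + 4) ≤ (c2 + 4) * (K * M ^ 2) := by
      calc K * (x2 + 4) ≤ K * (c2 * M ^ 2 + 4 * M ^ 2) := Nat.mul_le_mul_left _ (by omega)
        _ = _ := by ring
    have f2 : M ^ 2 ≤ K * M ^ 2 := Nat.le_mul_of_pos_left _ hK1
    have f3 : c1 * n ≤ c1 * (K * M ^ 2) := Nat.mul_le_mul_left _ (by omega)
    calc n * (6 + (x1 + (K * (x2 + 4) + 3)) + 4) + 3
        ≤ n * (c1 * (K * M ^ 2) + (c2 + 4) * (K * M ^ 2) + 13 * (K * M ^ 2)) + 3 := by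
          refine Nat.add_le_add_right (Nat.mul_le_mul_left _ ?_) _
          omega
      _ = (c1 + (c2 + 4) + 13) * T + 3 := by rw [hT]; ring
      _ ≤ (c1 + (c2 + 4) + 13) * T + 6 * T := by omega
      _ = _ := by ring
  have h4 : x3 ≤ c3 * T := g3.trans (Nat.mul_le_mul_left _ hT2)
  rw [← hT]
  refine (Nat.add_le_add h1 (Nat.add_le_add h2 (Nat.add_le_add h3 h4))).trans (le_of_eq ?_)
  ring

/-! ### Instances with a tree decomposition -/

/-- Code that computes the length of the encoding of an instance and a tree decomposition. -/
def treeLength : List Instr :=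
  [.const (rT 1) 0, .load (rT 1) (rT 1), .mul (rT 0) (rT 1) (rT 1), .const (rT 2) 4,
    .add (rT 2) (rT 0) (rT 2), .load (rT 3) (rT 2), .add (rT 1) (rT 1) (rT 3),
    .mul (rT 1) (rT 1) (rT 3), .add (rT 0) (rT 2) (rT 1), .const (rT 1) 1,
    .add (rT 0) (rT 0) (rT 1)]

lemma reach_treeLength {P : Program} {x : List ℕ} {A V n m : ℕ} (h0 : x.getD 0 0 = n)
    (h1 : x.getD (4 + n * n) 0 = m) (hlen : x.length = 5 + n * n + m * m + m * n)
    (hA : x.length ≤ A) (hV : x.length ≤ V) (hx : ∀ a, x.getD a 0 ≤ V)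
    (hP : CodeAt P 0 treeLength) :
    ∃ s, Reach P A V treeLength.length (start x) s ∧ s.Le V ∧
        s.pc = treeLength.length ∧ s.mem = (start x).mem ∧ s.reg (rT 0) = x.length ∧
        ∀ r, (∀ d, r ≠ rT d) → s.reg r = 0 := by
  have l0 : (start x).Le V := ⟨fun r => Nat.zero_le _, hx⟩
  have hn : n ≤ V := h0 ▸ hx 0
  have hm : m ≤ V := h1 ▸ hx _
  have e1 : x[0]?.getD 0 = n := by rw [← List.getD_eq_getElem?_getD]; exact h0
  have e2 : x[n * n + 4]?.getD 0 = m := by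
    rw [← List.getD_eq_getElem?_getD, add_comm]; exact h1
  have hnm : n + m ≤ V := by nlinarith [Nat.zero_le (m * n), sq_nonneg ((n : ℤ) - 1)]
  have hnm' : (n + m) * m ≤ V := by nlinarith
  have hstr : Straight A V treeLength (start x) := by
    simp only [treeLength, Straight, Instr.exec, Instr.address, Config.setReg_pc, Option.mem_def,
      reduceCtorEq, false_implies, implies_true, true_and, Config.setReg_reg, Option.some.injEq,
      forall_eq', Config.setReg_mem, and_true, rT_inj, if_true, if_false, Nat.reduceEqDiff]
    simp only [start, List.getD_eq_getElem?_getD, e1, e2]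
    have l1 := l0.setReg (r := rT 1) (v := 0) (by omega)
    have l2 := l1.setReg (r := rT 1) (v := n) hn
    have l3 := l2.setReg (r := rT 0) (v := n * n) (by omega)
    have l4 := l3.setReg (r := rT 2) (v := 4) (by omega)
    have l5 := l4.setReg (r := rT 2) (v := n * n + 4) (by omega)
    have l6 := l5.setReg (r := rT 3) (v := m) hm
    have l7 := l6.setReg (r := rT 1) (v := n + m) hnm
    have l8 := l7.setReg (r := rT 1) (v := (n + m) * m) hnm'
    have l9 := l8.setReg (r := rT 0) (v := n * n + 4 + (n + m) * m) (by
      rw [add_mul, mul_comm n m]; omega)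
    have l10 := l9.setReg (r := rT 1) (v := 1) (by omega)
    have l11 := l10.setReg (r := rT 0) (v := n * n + 4 + (n + m) * m + 1) (by
      rw [add_mul, mul_comm n m]; omega)
    exact ⟨l1, by omega, l2, l3, l4, l5, by omega, l6, l7, l8, l9, l10, l11⟩
  obtain ⟨r, l⟩ := reach_straight (s := start x) hP l0 hstr
  refine ⟨_, r, l, ?_, ?_, ?_, fun r hr => ?_⟩
  · simp [treeLength, Instr.exec, start]
  · simp [treeLength, Instr.exec, start]
  · rw [hlen]
    subst h1 h0
    simp only [treeLength, List.foldl, Instr.exec, Config.setReg_reg, Config.setReg_mem, start,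
      rT_inj, if_true, if_false, Nat.reduceEqDiff, zero_ne_one, one_ne_zero, OfNat.zero_ne_ofNat,
      OfNat.one_ne_ofNat, OfNat.ofNat_ne_zero, OfNat.ofNat_ne_one]
    ring_nf
  · simp [treeLength, Instr.exec, start, hr]

/-- The program for instances with a tree decomposition. -/
def treeProgram (k : ℕ) : Program := (treeCmd ;; dpCmd k).program treeLength

/-- A bound for all numbers that occur as values of variables. -/
def treeVal (k n m w : ℕ) : ℕ := 2 * (m + n + k + 2) ^ 2 * k ^ w * radix n ^ k

/-- The bounds of the command for instances with a tree decomposition. Those for the limits of loops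
are exact. -/
def treeBd (k n m w : ℕ) : Bounds where
  idx := (n + 1) * k ^ w * radix n ^ k + k + (n + m) ^ 2
  val := treeVal k n m w
  sc
    | .n => n
    | .nsucc => n + 1
    | .nsq => n * n
    | .m => m
    | .msq => m * m
    | .mn => m * n
    | .nn => m
    | .cnt => m + 1
    | .kk => k
    | .M => radix n ^ k
    | .K => k ^ w
    | .w => w
    | _ => treeVal k n m w

section
variable {k n m w : ℕ}

lemma treeVal_ge (hk : 2 ≤ k) : (m + n + k + 2) ^ 2 + (n + 1) * k ^ w * radix n ^ k ≤
    treeVal k n m w ∧ k ^ w ≤ treeVal k n m w ∧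
    radix n ^ k + n * ((n + 1) * (radix n ^ k + radix n ^ k)) ≤ treeVal k n m w := by
  have h1 : 1 ≤ k ^ w := Nat.one_le_pow _ _ (by omega)
  have h2 : 1 ≤ radix n ^ k := radix_pow_pos n k
  unfold treeVal
  generalize k ^ w = K at *
  generalize radix n ^ k = M at *
  have h3 : 1 ≤ K * M := Nat.mul_pos h1 h2
  have h4 : (n + 1) * (n + 1) ≤ (m + n + k + 2) ^ 2 := by
    rw [sq]; exact Nat.mul_le_mul (by omega) (by omega)
  generalize hS : (m + n + k + 2) ^ 2 = S at *
  have h5 : n + 1 ≤ S := by nlinarith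
  have h6 : S ≤ S * (K * M) := Nat.le_mul_of_pos_right _ h3
  have h7 : (n + 1) * (K * M) ≤ S * (K * M) := Nat.mul_le_mul_right _ h5
  refine ⟨by nlinarith, ?_, ?_⟩
  · calc K ≤ K * (2 * S * M) := Nat.le_mul_of_pos_right _ (Nat.mul_pos (by omega) h2)
      _ = 2 * S * K * M := by ring
  · calc M + n * ((n + 1) * (M + M)) ≤ 2 * ((n + 1) * (n + 1)) * M := by nlinarith
      _ ≤ 2 * S * M := Nat.mul_le_mul_right _ (by omega)
      _ ≤ 2 * S * M * K := Nat.le_mul_of_pos_right _ h1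
      _ = 2 * S * K * M := by ring

lemma treeVal_bounds (hk : 2 ≤ k) : n ≤ treeVal k n m w ∧ m + 1 ≤ treeVal k n m w ∧
    k ≤ treeVal k n m w ∧ n * n ≤ treeVal k n m w ∧ m * m ≤ treeVal k n m w ∧
    m * n ≤ treeVal k n m w ∧ radix n ^ k ≤ treeVal k n m w ∧ w ≤ treeVal k n m w ∧
    radix n ≤ treeVal k n m w ∧ 5 + n * n + m * m + m * n ≤ treeVal k n m w ∧
    (n + 1) * k ^ w * radix n ^ k + k + (n + m) ^ 2 ≤ treeVal k n m w ∧ n + 1 ≤ treeVal k n m w := by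
  obtain ⟨h1, h2, h3⟩ := treeVal_ge (n := n) (m := m) (w := w) hk
  have h4 : w < k ^ w := Nat.lt_pow_self (by omega)
  have h5 : radix n ≤ radix n ^ k := Nat.le_self_pow (by omega) _
  have h6 : (m + n + k + 2) ^ 2 = m * m + n * n + k * k + 4 + 2 * (m * n) + 2 * (m * k) +
    2 * (n * k) + 4 * m + 4 * n + 4 * k := by ring
  have h7 : (n + m) ^ 2 = m * m + n * n + 2 * (m * n) := by ring
  have h8 : radix n ^ k ≤ treeVal k n m w := le_trans (Nat.le_add_right _ _) h3
  refine ⟨?_, ?_, ?_, ?_, ?_, ?_, h8, ?_, ?_, ?_, ?_, ?_⟩ <;> omega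

lemma treeBd_tree (hk : 2 ≤ k) : TreeBounds n m (treeBd k n m w) := by
  obtain ⟨h1, h2, h3, h4, h5, h6, h7, h8, h9, h10, h11, h12⟩ :=
    treeVal_bounds (n := n) (m := m) (w := w) hk
  have h13 : (n + m) ^ 2 = m * m + n * n + 2 * (m * n) := by ring
  constructor <;> dsimp only [treeBd] <;> omega

lemma treeBd_dp (hk : 2 ≤ k) : DPBounds n k w (treeBd k n m w) := by
  obtain ⟨h1, h2, h3, h4, h5, h6, h7, h8, h9, h10, h11, h12⟩ :=
    treeVal_bounds (n := n) (m := m) (w := w) hk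
  obtain ⟨h13, h14, h15⟩ := treeVal_ge (n := n) (m := m) (w := w) hk
  constructor <;> dsimp only [treeBd] <;> omega

lemma treeBd_le (hk : 2 ≤ k) {Z : ℕ} (hZ : treeVal k n m w ≤ Z) : (treeBd k n m w).Le Z := by
  obtain ⟨h1, h2, h3, h4, h5, h6, h7, h8, h9, h10, h11, h12⟩ :=
    treeVal_bounds (n := n) (m := m) (w := w) hk
  obtain ⟨h13, h14, h15⟩ := treeVal_ge (n := n) (m := m) (w := w) hk
  refine ⟨fun j => ?_, hZ⟩
  cases j <;> dsimp only [treeBd] <;> omega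

lemma radix_pow_le (hn : 1 ≤ n) (k : ℕ) : radix n ^ k ≤ 4 ^ k * n ^ (3 * k) := by
  rw [pow_mul, ← mul_pow]
  refine Nat.pow_le_pow_left ?_ k
  have h1 : n * n + 1 ≤ 2 * (n * n) := by nlinarith
  calc radix n ≤ (2 * n) * (2 * (n * n)) := Nat.mul_le_mul (by omega) h1
    _ = _ := by ring

/-- All numbers are at most a fixed power of a number `b` that bounds the number of vertices and a
power of which bounds `k ^ w`. With a power of two for `b`, this bounds the number of bits. -/
lemma treeVal_le {b c : ℕ} (hb : 2 ≤ b) (hn : n + 1 ≤ b) (hm : m ≤ c * n)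
    (hkw : k ^ w ≤ b ^ (2 * k)) :
    treeVal k n m w ≤ b ^ (2 * (c + k + 6) + 5 * k + 1) := by
  have h1 : ∀ a : ℕ, a ≤ b ^ a := fun a => le_pow_self hb a
  have h2 : m ≤ b ^ (c + 1) := hm.trans (by
    rw [pow_succ]; exact Nat.mul_le_mul (h1 c) (by omega))
  have h3 : m + n + k + 2 ≤ b ^ (c + k + 6) := by
    have := add_le_pow_add hb (by omega) (by omega) (add_le_pow_add hb (by omega) (by omega)
      (add_le_pow_add hb (by omega) one_pos h2 (by rw [pow_one]; omega : n ≤ b ^ 1))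
      (le_trans (h1 k) (Nat.pow_le_pow_right (by omega) (by omega : k ≤ k + 1)))) (h1 2)
    refine this.trans (Nat.pow_le_pow_right (by omega) (by omega))
  have h4 : radix n ≤ b ^ 3 := by
    have : n * n + 1 ≤ b ^ 2 := by nlinarith
    calc radix n ≤ b * b ^ 2 := Nat.mul_le_mul hn this
      _ = b ^ 3 := by ring
  have h5 : radix n ^ k ≤ b ^ (3 * k) := by
    rw [pow_mul]; exact Nat.pow_le_pow_left h4 k
  calc treeVal k n m w ≤ b * (b ^ (c + k + 6)) ^ 2 * b ^ (2 * k) * b ^ (3 * k) :=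
        Nat.mul_le_mul (Nat.mul_le_mul (Nat.mul_le_mul hb (Nat.pow_le_pow_left h3 2)) hkw) h5
    _ = _ := by ring

end

section
variable {k : ℕ} {I : Instance} {m : ℕ}

lemma TreeDecomposition.width_lt (D : TreeDecomposition I.graph m) (hn : 1 ≤ I.n) :
    D.width < I.n := by
  have : (univ.sup fun t => (D.bag t).card) ≤ I.n := Finset.sup_le fun t _ => by
    simpa using card_le_univ (D.bag t)
  rw [width]
  omega

lemma length_treeInput (D : TreeDecomposition I.graph m) :
    (I.encode ++ D.encode).length = 5 + I.n * I.n + m * m + m * I.n := by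
  rw [List.length_append, I.length_encode, D.length_encode]
  omega

lemma treeInput_le (D : TreeDecomposition I.graph m) {Z : ℕ} (hZ : 1 ≤ Z) (hn : I.n ≤ Z)
    (hm : m ≤ Z) (h2 : I.N.num.natAbs ≤ Z) (h3 : I.N.den ≤ Z) (a : ℕ) :
    (I.encode ++ D.encode).getD a 0 ≤ Z := by
  have hJ := I.encodes D.encode
  have hD := D.encodes
  rcases lt_or_ge a 4 with h | h
  · interval_cases a
    · exact hJ.n_eq.trans_le hn
    · exact hJ.sign_le.trans hZ
    · exact hJ.num.trans_le h2
    · exact hJ.den.trans_le h3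
  rcases lt_trichotomy a (4 + I.n * I.n) with h' | rfl | h'
  · exact (hJ.le_one a h h').trans hZ
  · exact hD.m_eq.trans_le hm
  · exact (hD.le_one a (by omega)).trans hZ

lemma dp_scoped (k : ℕ) : (dpCmd k).Scoped [] := by
  -- the number `k` occurs only as a constant
  change (dpCmd 0).Scoped []
  decide

lemma tree_scoped (k : ℕ) : (treeCmd ;; dpCmd k).Scoped [] := ⟨by decide, dp_scoped k⟩

lemma cost_tree_le {c : ℕ} {B : Sc → ℕ} {n : ℕ} (hn : 1 ≤ n) (hm : m ≤ c * n) (h1 : B .n = n)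
    (h2 : B .nsq = n * n) (h3 : B .m = m) (h4 : B .msq = m * m) (h5 : B .mn = m * n)
    (h6 : B .nn = m) (h7 : B .cnt = m + 1) :
    treeCmd.cost B ≤ treeCmd.cost (fun _ => 1) * (c + 1) ^ 8 * n ^ 8 := by
  have e1 : m ≤ (c + 1) * n := hm.trans (Nat.mul_le_mul_right _ (by omega))
  have e2 : n ≤ (c + 1) * n := Nat.le_mul_of_pos_left _ (by omega)
  have e3 : m + 1 ≤ (c + 1) * n := by rw [add_mul, one_mul]; omega
  have hX : ((c + 1) * n) ^ 2 = ((c + 1) * n) * ((c + 1) * n) := sq _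
  have e4 : (c + 1) * n ≤ ((c + 1) * n) ^ 2 := Nat.le_self_pow (by omega) _
  have h := treeCmd.cost_le (B := B) (X := ((c + 1) * n) ^ 2) (by omega) fun j hj => ?_
  · rw [show treeCmd.depth = 4 from rfl] at h
    refine h.trans (le_of_eq ?_)
    generalize treeCmd.cost (fun _ => 1) = c0
    ring
  · have : j ∈ [Sc.n, .nsq, .m, .msq, .mn, .nn, .cnt] := by revert j; decide
    fin_cases this
    · rw [h1]; omega
    · rw [h2, hX]; exact Nat.mul_le_mul e2 e2
    · rw [h3]; omega
    · rw [h4, hX]; exact Nat.mul_le_mul e1 e1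
    · rw [h5, hX]; exact Nat.mul_le_mul e1 e2
    · rw [h6]; omega
    · rw [h7]; omega

/-- The program answers correctly, and its time, space and numbers are bounded by the cost and the
bounds of the command it was translated from. -/
theorem treeProgram_spec (hk : 2 ≤ k) (c : ℕ) (D : TreeDecomposition I.graph m) (hn : 1 ≤ I.n)
    (hm : m ≤ c * I.n) {L : ℕ} (hL : L = D.width + I.n.size + ratSize I.N) :
    ∃ t ≤ 14 + (treeCmd.cost (treeBd k I.n m (D.width + 1)).sc +
        (dpCmd k).cost (treeBd k I.n m (D.width + 1)).sc),
      Halted (treeProgram k) (run (treeProgram k) (I.encode ++ D.encode) t) ∧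
      (I.IsYes k → (run (treeProgram k) (I.encode ++ D.encode) t).reg 0 = 1) ∧
      (¬ I.IsYes k → (run (treeProgram k) (I.encode ++ D.encode) t).reg 0 = 0) ∧
      SpaceBound (treeProgram k) (I.encode ++ D.encode)
        ((I.encode ++ D.encode).length + (treeBd k I.n m (D.width + 1)).idx * stride) ∧
      WordBound (treeProgram k) (I.encode ++ D.encode)
        (((2 * (c + k + 6) + 5 * k + 1) * ((treeCmd ;; dpCmd k).deg + 6) + 1) * L) := by
  set g := 2 * (c + k + 6) + 5 * k + 1 with hg
  set w := D.width + 1 with hw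
  set d := (treeCmd ;; dpCmd k).deg with hd
  have hs : 1 ≤ I.n.size := Nat.size_pos.2 hn
  have hL1 : w ≤ L := by omega
  have hb : 2 ≤ 2 ^ L := Nat.le_self_pow (by omega) 2
  have lt_of {a : ℕ} (h : a.size ≤ L) : a < 2 ^ L := Nat.size_le.1 h
  have hnb : I.n < 2 ^ L := lt_of (by omega)
  have hr : ratSize I.N = I.N.num.natAbs.size + I.N.den.size := rfl
  have hkw : k ^ w ≤ (2 ^ L) ^ (2 * k) := by
    calc k ^ w ≤ (2 ^ k) ^ w := Nat.pow_le_pow_left Nat.lt_two_pow_self.le _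
      _ = 2 ^ (k * w) := (pow_mul _ _ _).symm
      _ ≤ 2 ^ (L * (2 * k)) := Nat.pow_le_pow_right (by omega) (by nlinarith)
      _ = _ := pow_mul _ _ _
  have hval : treeVal k I.n m w ≤ (2 ^ L) ^ g := treeVal_le hb hnb hm hkw
  obtain ⟨v1, v2, v3, v4, v5, v6, v7, v8, v9, v10, v11, v12⟩ :=
    treeVal_bounds (n := I.n) (m := m) (w := w) hk
  have hbZ : 2 ^ L ≤ (2 ^ L) ^ g := Nat.le_self_pow (by omega) _
  have hlen := length_treeInput D
  have hb' := treeBd_le hk hval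
  have hidx : (treeBd k I.n m w).idx ≤ (2 ^ L) ^ g := le_trans v11 hval
  have hpow : ((2 ^ L) ^ g) ^ (d + 6) = 2 ^ (g * (d + 6) * L) := by
    rw [← pow_mul, ← pow_mul]; congr 1; ring
  generalize hZ : (2 ^ L) ^ g = Z at *
  have hZ6 : 21 * Z ≤ Z ^ (d + 6) := by
    have : 2 ^ 5 ≤ Z ^ (d + 5) :=
      (Nat.pow_le_pow_left (by omega) 5).trans (Nat.pow_le_pow_right (by omega) (by omega))
    calc 21 * Z ≤ Z ^ (d + 5) * Z := Nat.mul_le_mul_right _ (by omega)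
      _ = _ := by rw [← pow_succ]
  have hp : Params (fun a => (I.encode ++ D.encode).getD a 0) (I.encode ++ D.encode).length
      (treeBd k I.n m w).idx Z (Z ^ (d + 6)) := by
    refine ⟨by omega, ?_, fun a ha => List.getD_eq_default _ _ ha, by omega, by omega, ?_⟩
    · exact treeInput_le D (by omega) (by omega) (by omega)
        ((lt_of (by omega)).le.trans hbZ) ((lt_of (by omega)).le.trans hbZ)
    · rw [hlen, show stride = 20 from rfl]; omega
  have hJ := I.encodes D.encode
  have hD := D.encodes
  have hsafe : (treeCmd ;; dpCmd k).Wp (fun a => (I.encode ++ D.encode).getD a 0)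
      (treeBd k I.n m w) (fun _ => 0) (fun τ => (τ.sc .out = 0 ∨ τ.sc .out = 1) ∧
        (τ.sc .out = 1 ↔ I.IsYes k)) St.zero := by
    rw [wp_seq]
    refine (wp_tree hJ hD (treeBd_tree hk) rfl).mono ?_
    rintro τ F ⟨hP, hall, hadj⟩
    exact wp_decide hk (treeBd_dp hk) hJ hP hall hadj fun x => by
      rw [F.ar .T (by decide)]; rfl
  obtain ⟨τ, ⟨q1, q2⟩, t, ht, hh, hreg, hspace, hword⟩ := Cmd.program_spec
    (pre := treeLength) hp hb' (fun hP => reach_treeLength hJ.n_eq hD.m_eq hlen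
      (by omega) (by omega) (fun a => (hp.inp_le a).trans (by omega)) hP) (tree_scoped k)
    (Nat.pow_le_pow_right (by omega) (by omega)) hsafe
  refine ⟨t, ht, hh, fun h => hreg.trans (q2.2 h), fun h => hreg.trans ?_, hspace, ?_⟩
  · exact q1.resolve_right fun h' => h (q2.1 h')
  · have : ∀ v, v ≤ Z ^ (d + 6) → v.size ≤ (g * (d + 6) + 1) * L := fun v hv => by
      refine Nat.size_le.2 (hv.trans_lt ?_)
      rw [hpow]
      exact Nat.pow_lt_pow_right (by omega) (by rw [add_mul (g * (d + 6))]; omega)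
    exact fun t a => ⟨this _ (hword t a).1, this _ (hword t a).2⟩

lemma treeSpace_le {n w c : ℕ} (hk : 2 ≤ k) (hn : 1 ≤ n) (hm : m ≤ c * n) :
    5 + n * n + m * m + m * n + (treeBd k n m (w + 1)).idx * stride ≤
      (6 + c * c + c + 20 * (2 * k * 4 ^ k + k + (c + 1) ^ 2)) * (k ^ w * n ^ (3 * k + 1)) := by
  have h1 : 1 ≤ k ^ w := Nat.one_le_pow _ _ (by omega)
  have h2 : n * n ≤ n ^ (3 * k + 1) := by
    rw [← sq]; exact Nat.pow_le_pow_right hn (by omega)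
  have h3 : n ^ (3 * k + 1) ≤ k ^ w * n ^ (3 * k + 1) := Nat.le_mul_of_pos_left _ h1
  have h4 : (n + 1) * k ^ (w + 1) * radix n ^ k ≤ 2 * k * 4 ^ k * (k ^ w * n ^ (3 * k + 1)) := by
    calc (n + 1) * k ^ (w + 1) * radix n ^ k ≤ (2 * n) * k ^ (w + 1) * (4 ^ k * n ^ (3 * k)) :=
          Nat.mul_le_mul (Nat.mul_le_mul_right _ (by omega)) (radix_pow_le hn k)
      _ = _ := by ring
  simp only [treeBd, show stride = 20 from rfl]
  generalize (n + 1) * k ^ (w + 1) * radix n ^ k = A at *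
  generalize k ^ w * n ^ (3 * k + 1) = T at *
  generalize n ^ (3 * k + 1) = T' at *
  have h5 : m * m ≤ c * c * T := by
    calc m * m ≤ (c * n) * (c * n) := Nat.mul_le_mul hm hm
      _ = c * c * (n * n) := by ring
      _ ≤ c * c * T := Nat.mul_le_mul_left _ (by omega)
  have h6 : m * n ≤ c * T := by
    calc m * n ≤ (c * n) * n := Nat.mul_le_mul_right _ hm
      _ = c * (n * n) := by ring
      _ ≤ c * T := Nat.mul_le_mul_left _ (by omega)
  have h7 : (n + m) ^ 2 ≤ (c + 1) ^ 2 * T := by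
    calc (n + m) ^ 2 ≤ ((c + 1) * n) ^ 2 := Nat.pow_le_pow_left (by rw [add_mul]; omega) 2
      _ = (c + 1) ^ 2 * (n * n) := by ring
      _ ≤ (c + 1) ^ 2 * T := Nat.mul_le_mul_left _ (by omega)
  have hT : 1 ≤ T := by nlinarith
  have h8 : k ≤ k * T := Nat.le_mul_of_pos_right _ hT
  generalize (n + m) ^ 2 = s at *
  generalize (c + 1) ^ 2 = c1 at *
  generalize 2 * k * 4 ^ k = c2 at *
  have e : (6 + c * c + c + 20 * (c2 + k + c1)) * T =
    6 * T + c * c * T + c * T + 20 * (c2 * T) + 20 * (k * T) + 20 * (c1 * T) := by ring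
  rw [e]
  omega

/-- With a tree decomposition the problem is solved within the given bounds. -/
theorem treeProgram_bounds (hk : 2 ≤ k) (c : ℕ) : ∃ C : ℕ,
    ∀ (I : Instance) (m : ℕ) (D : TreeDecomposition I.graph m), 1 ≤ I.n → m ≤ c * I.n →
      AnswersWithin (treeProgram k) (I.encode ++ D.encode) (I.IsYes k)
          (C * (k ^ D.width * I.n ^ (6 * k + 1))) ∧
        SpaceBound (treeProgram k) (I.encode ++ D.encode)
          (C * (k ^ D.width * I.n ^ (3 * k + 1))) ∧
        WordBound (treeProgram k) (I.encode ++ D.encode)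
          (C * (D.width + I.n.size + ratSize I.N)) := by
  obtain ⟨Cd, hCd⟩ := cost_dp_le k
  set C1 := 14 + (treeCmd.cost (fun _ => 1) * (c + 1) ^ 8 + Cd * (k * 16 ^ k)) with hC1
  set C2 := 6 + c * c + c + 20 * (2 * k * 4 ^ k + k + (c + 1) ^ 2) with hC2
  set C3 := (2 * (c + k + 6) + 5 * k + 1) * ((treeCmd ;; dpCmd k).deg + 6) + 1 with hC3
  refine ⟨C1 + C2 + C3, fun I m D hn hm => ?_⟩
  obtain ⟨t, ht, hh, hy, hno, hspace, hword⟩ := treeProgram_spec hk c D hn hm rfl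
  have hw := D.width_lt hn
  refine ⟨⟨t, ht.trans ?_, hh, hy, hno⟩, fun s i hi a ha => (hspace s i hi a ha).trans_le ?_,
    fun s a => ⟨(hword s a).1.trans ?_, (hword s a).2.trans ?_⟩⟩
  · have g1 := cost_tree_le (B := (treeBd k I.n m (D.width + 1)).sc) hn hm rfl rfl rfl rfl rfl
      rfl rfl
    have g2 := hCd (treeBd k I.n m (D.width + 1)).sc I.n (D.width + 1) hn hk rfl rfl rfl rfl rfl
      rfl (by omega)
    have hK : 1 ≤ k ^ D.width := Nat.one_le_pow _ _ (by omega)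
    have h8 : I.n ^ 8 ≤ k ^ D.width * I.n ^ (6 * k + 1) :=
      (Nat.pow_le_pow_right hn (by omega)).trans (Nat.le_mul_of_pos_left _ hK)
    have h9 : I.n * k ^ (D.width + 1) * (radix I.n ^ k) ^ 2 ≤
        k * 16 ^ k * (k ^ D.width * I.n ^ (6 * k + 1)) := by
      calc I.n * k ^ (D.width + 1) * (radix I.n ^ k) ^ 2
          ≤ I.n * k ^ (D.width + 1) * (4 ^ k * I.n ^ (3 * k)) ^ 2 :=
            Nat.mul_le_mul_left _ (Nat.pow_le_pow_left (radix_pow_le hn k) 2)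
        _ = _ := by
          rw [show (16 : ℕ) ^ k = (4 ^ k) ^ 2 by rw [← pow_mul, mul_comm, pow_mul]; norm_num]
          ring
    have hT : 1 ≤ k ^ D.width * I.n ^ (6 * k + 1) := le_trans (Nat.one_le_pow _ _ hn) h8
    generalize k ^ D.width * I.n ^ (6 * k + 1) = T at *
    generalize I.n * k ^ (D.width + 1) * (radix I.n ^ k) ^ 2 = T2 at *
    generalize treeCmd.cost (treeBd k I.n m (D.width + 1)).sc = x1 at *
    generalize (dpCmd k).cost (treeBd k I.n m (D.width + 1)).sc = x2 at *
    generalize treeCmd.cost (fun _ => 1) * (c + 1) ^ 8 = c1 at *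
    have f1 : x1 ≤ c1 * T := g1.trans (Nat.mul_le_mul_left _ h8)
    have f2 : x2 ≤ Cd * (k * 16 ^ k) * T := g2.trans (by
      rw [mul_assoc]; exact Nat.mul_le_mul_left _ h9)
    calc 14 + (x1 + x2) ≤ 14 * T + (c1 * T + Cd * (k * 16 ^ k) * T) := by omega
      _ = C1 * T := by rw [hC1]; ring
      _ ≤ (C1 + C2 + C3) * T := Nat.mul_le_mul_right _ (by omega)
  · rw [length_treeInput]
    exact (treeSpace_le hk hn hm).trans (Nat.mul_le_mul_right _ (by omega))
  · exact Nat.mul_le_mul_right _ (by omega)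
  · exact Nat.mul_le_mul_right _ (by omega)

end

/-! ### Augmenting paths -/

/-- The sum of the capacities of the pairs that leave a set `Z` of nodes. -/
def cutValue (nn : ℕ) (f : ℕ → ℕ → ℕ) (Z : ℕ → Prop) [DecidablePred Z] : ℕ :=
  ∑ x ∈ (range nn ×ˢ range nn) with Z x.1 ∧ ¬ Z x.2, f x.1 x.2

section
variable {nn : ℕ} {f f' : ℕ → ℕ → ℕ} {Z : ℕ → Prop} [DecidablePred Z]

lemma cutValue_congr (h : ∀ a < nn, ∀ b < nn, f a b = f' a b) :
    cutValue nn f Z = cutValue nn f' Z := by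
  refine sum_congr rfl fun x hx => ?_
  simp only [mem_filter, mem_product, mem_range] at hx
  exact h _ hx.1.1 _ hx.1.2

/-- The effect of a change of one entry. -/
lemma cutValue_update {p c : ℕ} (hp : p < nn) (hc : c < nn)
    (h : ∀ a < nn, ∀ b < nn, ¬ (a = p ∧ b = c) → f' a b = f a b) :
    cutValue nn f' Z + (if Z p ∧ ¬ Z c then f p c else 0) =
      cutValue nn f Z + (if Z p ∧ ¬ Z c then f' p c else 0) := by
  unfold cutValue
  by_cases hZ : Z p ∧ ¬ Z c
  · have hm : (p, c) ∈ ((range nn ×ˢ range nn).filter fun x => Z x.1 ∧ ¬ Z x.2) := by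
      simp [hp, hc, hZ]
    rw [if_pos hZ, if_pos hZ, ← add_sum_erase _ _ hm, ← add_sum_erase _ (fun x => f x.1 x.2) hm]
    have : ∀ x ∈ ((range nn ×ˢ range nn).filter fun x => Z x.1 ∧ ¬ Z x.2).erase (p, c),
        f' x.1 x.2 = f x.1 x.2 := by
      intro x hx
      simp only [mem_erase, mem_filter, mem_product, mem_range] at hx
      exact h _ hx.2.1.1 _ hx.2.1.2 fun hh => hx.1 (Prod.ext hh.1 hh.2)
    rw [sum_congr rfl this]
    dsimp only
    omega
  · rw [if_neg hZ, if_neg hZ]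
    congr 1
    refine sum_congr rfl fun x hx => ?_
    simp only [mem_filter, mem_product, mem_range] at hx
    refine h _ hx.1.1 _ hx.1.2 ?_
    rintro ⟨h1, h2⟩
    rw [h1, h2] at hx
    exact hZ hx.2

end

/-- Send one unit along the path to `cur` that the last search has found. -/
def augmentCmd : Cmd :=
  .loop 4 .nn (.when ((1 : Expr).lt (ar .D (sc .cur)))
    (.set .y (ar .F (sc .cur)) ;;
    .put .E (sc .y * sc .nn + sc .cur) (ar .E (sc .y * sc .nn + sc .cur) - 1) ;;
    .put .E (sc .cur * sc .nn + sc .y) (ar .E (sc .cur * sc .nn + sc .y) + 1) ;;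
    .set .cur (sc .y)))

section
variable {I : ℕ → ℕ} {bd : Bounds} {ρ : ℕ → ℕ} {σ : St} {nn : ℕ} {E D0 : ℕ → ℕ}

lemma wp_augment {y e : ℕ} (h : SearchInv nn E D0 1 σ) (hD0 : ∀ x < nn, D0 x ≤ 1)
    (hy : σ.sc .cur = y) (hyn : y < nn) (hyD : σ.ar .D y ≠ 0) (hE : ∀ a < nn, ∀ b < nn, E (a * nn + b) ≤ e)
    (hval : e + nn ≤ bd.val) (hidx : nn * nn ≤ bd.idx) (hsy : nn ≤ bd.sc .y)
    (hsc : nn ≤ bd.sc .cur) :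
    Wp I bd augmentCmd ρ (fun τ => (∀ a < nn, ∀ b < nn, τ.ar .E (a * nn + b) ≤ e + nn) ∧
      ∀ (Z : ℕ → Prop) [DecidablePred Z], (∀ x < nn, D0 x ≠ 0 → Z x) → ¬ Z y →
        cutValue nn (fun a b => τ.ar .E (a * nn + b)) Z + 1 =
          cutValue nn (fun a b => E (a * nn + b)) Z) σ := by
  refine wp_loop (fun r τ => (∀ a < nn, ∀ b < nn, τ.ar .E (a * nn + b) ≤ e + r) ∧
    τ.sc .cur < nn ∧
    σ.ar .D (τ.sc .cur) ≠ 0 ∧ (σ.ar .D (τ.sc .cur) ≤ 1 ∨ σ.ar .D (τ.sc .cur) + r ≤ nn + 1) ∧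
    (∀ a < nn, ∀ b < nn, σ.ar .D b ≤ σ.ar .D (τ.sc .cur) →
      E (a * nn + b) ≤ τ.ar .E (a * nn + b)) ∧
    ∀ (Z : ℕ → Prop) [DecidablePred Z], ¬ Z y →
        cutValue nn (fun a b => τ.ar .E (a * nn + b)) Z + (if Z (τ.sc .cur) then 1 else 0) =
          cutValue nn (fun a b => E (a * nn + b)) Z) ?_ ?_ ?_
  · have h1 := h.le y hyn
    have h2 := h.cnt_le
    refine ⟨fun a ha b hb => by rw [h.E_eq]; exact hE a ha b hb, hy ▸ hyn, hy ▸ hyD, Or.inr ?_, ?_, ?_⟩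
    · rw [hy]; omega
    · intro a _ b _ _; rw [h.E_eq]
    · intro Z _ hZ; rw [h.E_eq, hy, if_neg hZ, add_zero]
  · rintro r hr τ hF ⟨i1, i2, i3, i4, i5, i6⟩
    rw [h.nn_eq] at hr
    have tn : τ.sc .nn = nn := by rw [hF.sc .nn (by decide), h.nn_eq]
    have tD : τ.ar .D = σ.ar .D := hF.ar .D (by decide)
    have tF : τ.ar .F = σ.ar .F := hF.ar .F (by decide)
    generalize hc : τ.sc .cur = c at *
    rw [wp_when]
    simp only [holds_lt, eval_one, eval_ar, eval_sc, hc, tD]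
    constructor
    · intro hlt
      have hnew : D0 c = 0 := by
        by_contra h0
        have h1 := h.keep c h0
        have h2 := hD0 c i2
        omega
      obtain ⟨-, k2, k3, k4, k5, k6⟩ := h.new c hnew i3
      generalize hp : σ.ar .F c = p at *
      have hpc : p ≠ c := by rintro rfl; omega
      have hE1 : 1 ≤ τ.ar .E (p * nn + c) :=
        (Nat.one_le_iff_ne_zero.2 k6).trans (i5 p k3 c i2 le_rfl)
      have hne : ¬ (c = p ∧ p = c) := fun hh => hpc hh.2
      have hidx1 := index_lt k3 i2
      have hidx2 := index_lt i2 k3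
      simp only [wp_seq, wp_set, wp_put, eval_ar, eval_sc, hc, tF, hp, St.setSc_ar, St.setSc_sc,
        if_true, reduceCtorEq, if_false, tn, eval_add, eval_mul, eval_sub, eval_one, St.setAr_sc,
        St.setAr_ar, true_and, index_inj k3 i2, hne]
      refine ⟨by omega, ⟨by omega, ?_⟩, ⟨by omega, ?_⟩, by omega, ?_⟩
      · have := i1 p k3 c i2; omega
      · have := i1 c i2 p k3; omega
      obtain ⟨E', tE⟩ : ∃ E' : ℕ → ℕ, ∀ x, E' x = if x = c * nn + p then
          τ.ar .E (c * nn + p) + 1 else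
          if x = p * nn + c then τ.ar .E (p * nn + c) - 1 else τ.ar .E x := ⟨_, fun _ => rfl⟩
      simp only [← tE]
      have tE' : ∀ a < nn, ∀ b < nn, E' (a * nn + b) =
          if a = c ∧ b = p then τ.ar .E (c * nn + p) + 1 else
          if a = p ∧ b = c then τ.ar .E (p * nn + c) - 1 else τ.ar .E (a * nn + b) :=
        fun a _ b hb => by rw [tE]; simp only [index_inj hb k3, index_inj hb i2]
      refine ⟨fun a ha b hb => ?_, k3, k4, ?_, ?_, ?_⟩
      · have h1 := i1 a ha b hb
        have h2 := i1 c i2 p k3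
        have h3 := i1 p k3 c i2
        rw [tE' a ha b hb]
        split_ifs <;> omega
      · right
        rcases i4 with h1 | h1 <;> omega
      · intro a ha b hb hab
        have h1 := i5 a ha b hb (by omega)
        rw [tE' a ha b hb]
        split_ifs with h2 h3
        · rw [← h2.1, ← h2.2]; omega
        · rw [h3.2] at hab; omega
        · exact h1
      · intro Z _ hZ
        rw [← i6 Z hZ]
        have u1 := cutValue_update (Z := Z) (f := fun a b => τ.ar .E (a * nn + b))
          (f' := fun a b => if a = p ∧ b = c then τ.ar .E (p * nn + c) - 1
            else τ.ar .E (a * nn + b)) k3 i2 fun a _ b _ hab => by simp only [if_neg hab]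
        have u2 := cutValue_update (Z := Z) (f := fun a b => if a = p ∧ b = c then
            τ.ar .E (p * nn + c) - 1 else τ.ar .E (a * nn + b))
          (f' := fun a b => E' (a * nn + b)) i2 k3 fun a ha b hb hab => by
            rw [tE' a ha b hb, if_neg hab]
        simp only [true_and, if_true, hne, if_false] at u1 u2
        rw [tE' c i2 p k3] at u2
        simp only [true_and, if_true] at u2
        by_cases hZp : Z p <;> by_cases hZc : Z c <;>
          simp only [hZp, hZc, true_and, false_and, not_true_eq_false, not_false_eq_true, if_true,
            if_false] at u1 u2 ⊢ <;> omega
    · intro hlt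
      have hle : σ.ar .D c ≤ 1 := by omega
      refine ⟨fun a ha b hb => (i1 a ha b hb).trans (by omega), ?_⟩
      exact ⟨i2, i3, Or.inl hle, i5, i6⟩
  · rintro τ hF ⟨i1, i2, i3, i4, i5, i6⟩
    rw [h.nn_eq] at i1 i4
    refine ⟨i1, fun Z _ hZ hZy => ?_⟩
    have hsrc : D0 (τ.sc .cur) ≠ 0 := by
      intro h0
      have := (h.new _ h0 i3).2.1
      omega
    have := i6 Z hZy
    rwa [if_pos (hZ _ i2 hsrc)] at this

end

/-! ### Small separators by maximum flows

A vertex `v` is represented by two nodes `v` and `n + v`, joined by an arc of capacity one, and an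
edge `uv` by the arcs from `n + u` to `v` and from `n + v` to `u`, with a capacity too large for
the cuts in question. -/

/-- The capacity of the arc from `a` to `b`. Here `s + 1` is large enough for an arc that no cut of
value at most `s` may contain. -/
def capacity (n : ℕ) (adj : ℕ → ℕ) (s a b : ℕ) : ℕ :=
  (if b = n + a then 1 else 0) +
    if n ≤ a ∧ b < n ∧ adj ((a - n) * n + b) ≠ 0 then s + 1 else 0

open Classical in
/-- The marks `D` describe a separation: the vertices `v` with `D (n + v) ≠ 0` have neighbours among
themselves and in the set of vertices with `D v ≠ 0` and `D (n + v) = 0` only, and this set has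
at most `s` elements. The set `P` avoids the other side, and `Q` avoids the first. -/
structure IsCut (n : ℕ) (adj : ℕ → ℕ) (s : ℕ) (P Q : ℕ → Prop) (D : ℕ → ℕ) : Prop where
  src : ∀ v < n, P v → D v ≠ 0
  tgt : ∀ v < n, Q v → D (n + v) = 0
  edge : ∀ v < n, ∀ u < n, D (n + v) ≠ 0 → adj (v * n + u) ≠ 0 → D u ≠ 0
  card : #{v ∈ range n | D v ≠ 0 ∧ D (n + v) = 0} ≤ s

section
variable {n s : ℕ} {adj D : ℕ → ℕ} {P Q : ℕ → Prop}

open Classical in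
/-- A cut of small value gives a small separator. -/
lemma IsCut.of_cutValue (h1 : ∀ v < n, P v → D v ≠ 0) (h2 : ∀ v < n, Q v → D (n + v) = 0)
    (h : cutValue (2 * n) (capacity n adj s) (fun x => D x ≠ 0) ≤ s) : IsCut n adj s P Q D := by
  refine ⟨h1, h2, fun v hv u hu hD ha => ?_, ?_⟩
  · by_contra hDu
    have hm : (n + v, u) ∈ ((range (2 * n) ×ˢ range (2 * n)).filter
        fun x => D x.1 ≠ 0 ∧ ¬ D x.2 ≠ 0) := by
      simp only [mem_filter, mem_product, mem_range]
      exact ⟨⟨by omega, by omega⟩, hD, not_not.2 hDu⟩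
    have := single_le_sum (f := fun x : ℕ × ℕ => capacity n adj s x.1 x.2)
      (fun _ _ => Nat.zero_le _) hm
    have h3 : s + 1 ≤ capacity n adj s (n + v) u := by
      rw [capacity, if_neg (by omega), if_pos ⟨by omega, hu, by simpa using ha⟩, zero_add]
    exact absurd (h3.trans (this.trans h)) (by omega)
  · refine le_trans ?_ h
    rw [card_eq_sum_ones]
    calc ∑ v ∈ range n with D v ≠ 0 ∧ D (n + v) = 0, 1
        ≤ ∑ v ∈ range n with D v ≠ 0 ∧ D (n + v) = 0, capacity n adj s v (n + v) := by
          refine sum_le_sum fun v _ => ?_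
          rw [capacity, if_pos rfl]; omega
      _ = ∑ x ∈ ({v ∈ range n | D v ≠ 0 ∧ D (n + v) = 0}).image fun v => (v, n + v),
          capacity n adj s x.1 x.2 := by
          rw [sum_image]
          intro a _ b _ hab
          exact congrArg Prod.fst hab
      _ ≤ cutValue (2 * n) (capacity n adj s) (fun x => D x ≠ 0) := by
          refine sum_le_sum_of_subset fun x hx => ?_
          simp only [mem_image, mem_filter, mem_range] at hx
          obtain ⟨v, ⟨h1, h2, h3⟩, rfl⟩ := hx
          simp only [mem_filter, mem_product, mem_range]
          exact ⟨⟨by omega, by omega⟩, h2, by simpa using h3⟩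

/-- A small separator gives a cut of small value. -/
lemma cutValue_le_of_separation {A X : Finset ℕ}
    (hA : ∀ a ∈ A, ∀ b < n, adj (a * n + b) ≠ 0 → b ∈ A ∪ X) :
    cutValue (2 * n) (capacity n adj s)
      (fun x => x < n ∧ x ∈ A ∪ X ∨ n ≤ x ∧ x - n ∈ A) ≤ #X := by
  have h1 : ∀ x ∈ (range (2 * n) ×ˢ range (2 * n)).filter
      (fun x => (x.1 < n ∧ x.1 ∈ A ∪ X ∨ n ≤ x.1 ∧ x.1 - n ∈ A) ∧
        ¬ (x.2 < n ∧ x.2 ∈ A ∪ X ∨ n ≤ x.2 ∧ x.2 - n ∈ A)),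
      capacity n adj s x.1 x.2 ≤ if x.1 ∈ X ∧ x.2 = n + x.1 then 1 else 0 := by
    rintro ⟨a, b⟩ hx
    simp only [mem_filter, mem_product, mem_range] at hx ⊢
    obtain ⟨⟨hx1, hx2⟩, ha, hb⟩ := hx
    have hsnd : ¬ (n ≤ a ∧ b < n ∧ adj ((a - n) * n + b) ≠ 0) := by
      rintro ⟨c1, c2, c3⟩
      rcases ha with ha | ha
      · omega
      · exact hb (Or.inl ⟨c2, hA _ ha.2 b c2 c3⟩)
    rw [capacity, if_neg hsnd, add_zero]
    by_cases hab : b = n + a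
    · subst hab
      have haX : a ∈ X := by
        rcases ha with ha | ha
        · refine (mem_union.1 ha.2).resolve_left fun h => hb (Or.inr ⟨by omega, ?_⟩)
          simpa using h
        · omega
      simp [haX]
    · simp [hab]
  refine (sum_le_sum h1).trans ?_
  rw [← sum_filter, ← card_eq_sum_ones]
  refine card_le_card_of_injOn Prod.fst ?_ ?_
  · intro x hx
    simp only [coe_filter, Set.mem_ofPred_eq] at hx
    exact hx.2.1
  · intro x hx y hy hxy
    simp only [coe_filter, Set.mem_ofPred_eq] at hx hy
    refine Prod.ext hxy ?_
    rw [hx.2.2, hy.2.2, hxy]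

end

/-- Store the capacities in `E`. -/
def capacityCmd : Cmd :=
  .loop 4 .nn (.loop 5 .nn (.put .E (var 4 * sc .nn + var 5)
    (((var 5).eq (sc .n + var 4)).tv + ((sc .n).le (var 4) * (var 5).lt (sc .n) *
      ar .adj ((var 4 - sc .n) * sc .n + var 5)).tv * (sc .s + 1))))

/-- Search for a path from the vertices in row `l` of `W` that have `side` different from `0` to the
others. If there is one, augment the flow. -/
def roundCmd : Cmd :=
  .loop 4 .nn (.put .D (var 4)
    ((var 4).lt (sc .n) * entry .W (sc .l) (var 4) * ar .side (var 4)).tv) ;;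
  .set .cnt 1 ;; searchCmd ;; .set .hit 0 ;;
  .loop 5 .n (.when (ar .D (sc .n + var 5) * entry .W (sc .l) (var 5) * (ar .side (var 5)).not)
    (.set .hit 1 ;; .set .cur (sc .n + var 5))) ;;
  .ite (sc .hit) augmentCmd (.set .found 1)

/-- Decide with `s + 1` rounds whether there is a cut of value at most `s`. -/
def flowCmd : Cmd := capacityCmd ;; .loop 3 .rounds (.when ((sc .found).eq 0) roundCmd)

/-- Bounds that suffice for the flow computations. -/
structure FlowBounds (n s : ℕ) (bd : Bounds) : Prop where
  cnt : 2 * n + 1 ≤ bd.sc .cnt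
  hit : 1 ≤ bd.sc .hit
  found : 1 ≤ bd.sc .found
  cur : 2 * n ≤ bd.sc .cur
  y : 2 * n ≤ bd.sc .y
  idx : 2 * n * (2 * n) ≤ bd.idx
  val : s + 2 + (s + 1) * (2 * n) + 2 * n ≤ bd.val

section
variable {I : ℕ → ℕ} {bd : Bounds} {ρ : ℕ → ℕ} {σ : St} {n s l : ℕ} {adj : ℕ → ℕ} {P Q : ℕ → Prop}

lemma capacity_le {a b : ℕ} : capacity n adj s a b ≤ s + 2 := by
  unfold capacity; split_ifs <;> omega

lemma wp_capacity (hn : σ.sc .n = n) (hnn : σ.sc .nn = 2 * n) (hs : σ.sc .s = s)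
    (hadj : σ.ar .adj = adj) (hb : FlowBounds n s bd) :
    Wp I bd capacityCmd ρ (fun τ => ∀ a < 2 * n, ∀ b < 2 * n,
      τ.ar .E (a * (2 * n) + b) = capacity n adj s a b) σ := by
  have hidx := hb.idx
  have hval := hb.val
  refine wp_loop (fun a' τ => ∀ a < a', ∀ b < 2 * n,
    τ.ar .E (a * (2 * n) + b) = capacity n adj s a b) (by simp) ?_ ?_
  · intro a' ha' τ hF hI
    rw [hnn] at ha'
    refine wp_loop (fun b' υ => ∀ a, ∀ b < 2 * n, a < a' ∨ a = a' ∧ b < b' →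
      υ.ar .E (a * (2 * n) + b) = capacity n adj s a b) ?_ ?_ ?_
    · intro a b hb h
      exact hI a (by omega) b hb
    · intro b' hb' υ hG hJ
      have tnn : τ.sc .nn = 2 * n := by rw [hF.sc .nn (by decide), hnn]
      have un : υ.sc .n = n := by rw [hG.sc .n (by decide), hF.sc .n (by decide), hn]
      have unn : υ.sc .nn = 2 * n := by rw [hG.sc .nn (by decide), tnn]
      have us : υ.sc .s = s := by rw [hG.sc .s (by decide), hF.sc .s (by decide), hs]
      have ua : υ.ar .adj = adj := by rw [hG.ar .adj (by decide), hF.ar .adj (by decide), hadj]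
      rw [tnn] at hb'
      have hlt := index_lt ha' hb'
      have hcap : (if b' = n + a' then 1 else 0) +
          (if (n ≤ a' ∧ b' < n) ∧ adj ((a' - n) * n + b') ≠ 0 then 1 else 0) * (s + 1) =
          capacity n adj s a' b' := by
        simp only [capacity, and_assoc, ite_mul, one_mul, zero_mul]
      simp only [wp_put, eval_add, eval_mul, eval_sub, eval_var, eval_sc, unn, eval_tv, holds_eq,
        holds_mul, holds_le, holds_lt, holds_ar, Function.update_self, un, us, ua, eval_one,
        Function.update_of_ne (show (4 : ℕ) ≠ 5 by decide), St.setAr_ar, true_and, hcap]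
      refine ⟨⟨by omega, capacity_le.trans (by omega)⟩, fun a b hbn h => ?_⟩
      simp only [index_inj hbn hb']
      by_cases hab : a = a' ∧ b = b'
      · rw [if_pos hab, hab.1, hab.2]
      · rw [if_neg hab]
        exact hJ a b hbn (by omega)
    · intro υ hG hJ a ha b hbn
      have tnn : τ.sc .nn = 2 * n := by rw [hF.sc .nn (by decide), hnn]
      exact hJ a b hbn (by omega)
  · intro τ hF hI
    rwa [hnn] at hI

lemma wp_round {r e : ℕ} (hn : σ.sc .n = n) (hnn : σ.sc .nn = 2 * n) (hl : σ.sc .l = l)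
    (hf : σ.sc .found = 0) (hr : r ≤ s) (he : e ≤ s + 2 + (s + 1) * (2 * n))
    (hP : ∀ v < n, P v ↔ σ.ar .W (l * n + v) ≠ 0 ∧ σ.ar .side v ≠ 0)
    (hQ : ∀ v < n, Q v ↔ σ.ar .W (l * n + v) ≠ 0 ∧ σ.ar .side v = 0)
    (hE : ∀ a < 2 * n, ∀ b < 2 * n, σ.ar .E (a * (2 * n) + b) ≤ e)
    (hflow : ∀ (Z : ℕ → Prop) [DecidablePred Z], (∀ v < n, P v → Z v) → (∀ v < n, Q v → ¬ Z (n + v)) →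
      cutValue (2 * n) (fun a b => σ.ar .E (a * (2 * n) + b)) Z + r =
        cutValue (2 * n) (capacity n adj s) Z)
    (hb : FlowBounds n s bd) :
    Wp I bd roundCmd ρ (fun τ => (τ.sc .found = 0 ∧
      (∀ a < 2 * n, ∀ b < 2 * n, τ.ar .E (a * (2 * n) + b) ≤ e + 2 * n) ∧
      ∀ (Z : ℕ → Prop) [DecidablePred Z], (∀ v < n, P v → Z v) → (∀ v < n, Q v → ¬ Z (n + v)) →
        cutValue (2 * n) (fun a b => τ.ar .E (a * (2 * n) + b)) Z + (r + 1) =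
          cutValue (2 * n) (capacity n adj s) Z) ∨
      (τ.sc .found = 1 ∧ IsCut n adj s P Q (τ.ar .D))) σ := by
  classical
  obtain ⟨b1, b2, b3, b4, b5, b6, b7⟩ := hb
  have hnn4 : 2 * n ≤ 2 * n * (2 * n) := by nlinarith
  rw [roundCmd, wp_seq]
  refine wp_loop (fun m τ => ∀ x < m, τ.ar .D x = if x < n ∧ P x then 1 else 0) (by simp) ?_ ?_
  · intro m hm τ hF hI
    rw [hnn] at hm
    have tn : τ.sc .n = n := by rw [hF.sc .n (by decide), hn]
    have tl : τ.sc .l = l := by rw [hF.sc .l (by decide), hl]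
    have tW : τ.ar .W = σ.ar .W := hF.ar .W (by decide)
    have ts : τ.ar .side = σ.ar .side := hF.ar .side (by decide)
    simp only [wp_put, entry, eval_var, eval_tv, holds_mul, holds_lt, holds_ar, eval_add, eval_mul,
      eval_sc, tn, tl, tW, ts, Function.update_self, St.setAr_ar, true_and]
    refine ⟨⟨by omega, by split_ifs <;> omega⟩, fun x hx => ?_⟩
    by_cases hxm : x = m
    · subst hxm
      rw [if_pos rfl]
      refine if_congr ?_ rfl rfl
      rw [and_assoc]
      exact and_congr_right fun h => (hP x h).symm
    · rw [if_neg hxm]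
      exact hI x (by omega)
  · intro σ1 F1 h1
    rw [hnn] at h1
    simp only [wp_seq, wp_set, eval_one]
    refine ⟨by omega, ?_⟩
    set σ2 := σ1.setSc .cnt 1 with hσ2
    have d2 : ∀ x < 2 * n, σ2.ar .D x = if x < n ∧ P x then 1 else 0 := h1
    have c2 : σ2.sc .cnt = 1 := by simp [hσ2]
    have n2 : σ2.sc .nn = 2 * n := by
      simp only [hσ2, St.setSc_sc, reduceCtorEq, if_false]; rw [F1.sc .nn (by decide), hnn]
    have o2 : ∀ j, j ≠ .cnt → σ2.sc j = σ.sc j := fun j hj => by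
      simp only [hσ2, St.setSc_sc, hj, if_false]; exact F1.sc j (by simp [scs])
    have e2 : ∀ a, a ≠ .D → σ2.ar a = σ.ar a := fun a ha => F1.ar a (by simpa [ars] using ha)
    refine (wp_search n2 (fun x hx => ?_) (by omega) (by omega) (by omega)).mono ?_
    · rw [d2 x hx, c2]; split_ifs <;> omega
    rintro σ3 F3 ⟨S3, M3⟩
    rw [c2] at S3
    rw [wp_seq, wp_set, eval_zero, wp_seq]
    refine ⟨Nat.zero_le _, ?_⟩
    have a3 : ∀ a, a ≠ .D → a ≠ .F → σ3.ar a = σ.ar a := fun a h1 h2 => by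
      rw [F3.ar a (by simp [searchCmd, visitCmd, when, ars, h1, h2]), e2 a h1]
    have s3 : ∀ j, j ≠ .cnt → σ3.sc j = σ.sc j := fun j hj => by
      rw [F3.sc j (by simp [searchCmd, visitCmd, when, scs, hj]), o2 j hj]
    refine wp_loop (fun m τ => (τ.sc .hit = 0 ∧ ∀ v < m, Q v → σ3.ar .D (n + v) = 0) ∨
      (τ.sc .hit = 1 ∧ ∃ v < n, Q v ∧ σ3.ar .D (n + v) ≠ 0 ∧ τ.sc .cur = n + v))
      (Or.inl (by simp)) ?_ ?_
    · intro m hm τ hF hI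
      replace hm : m < n := by
        simpa only [St.setSc_sc, reduceCtorEq, if_false, s3 .n (by decide), hn] using hm
      have tn : τ.sc .n = n := by
        rw [hF.sc .n (by decide)]
        simp only [St.setSc_sc, reduceCtorEq, if_false, s3 .n (by decide), hn]
      have tl : τ.sc .l = l := by
        rw [hF.sc .l (by decide)]
        simp only [St.setSc_sc, reduceCtorEq, if_false, s3 .l (by decide), hl]
      have tD : τ.ar .D = σ3.ar .D := hF.ar .D (by decide)
      have tW : τ.ar .W = σ.ar .W := (hF.ar .W (by decide)).trans (a3 .W (by decide) (by decide))
      have ts : τ.ar .side = σ.ar .side :=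
        (hF.ar .side (by decide)).trans (a3 .side (by decide) (by decide))
      rw [wp_when]
      simp only [holds_mul, holds_ar, eval_add, eval_sc, eval_var, holds_not, entry, eval_mul, tn,
        tl, tW, tD, ts, Function.update_self, wp_seq, wp_set, eval_one, St.setSc_sc, if_true,
        reduceCtorEq, if_false, not_not, and_assoc, ← hQ m hm]
      constructor
      · rintro ⟨k1, k2⟩
        exact ⟨b2, by omega, Or.inr ⟨trivial, m, hm, k2, k1, rfl⟩⟩
      · intro k
        rcases hI with ⟨i1, i2⟩ | hI
        · refine Or.inl ⟨i1, fun v hv hQv => ?_⟩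
          by_cases hvm : v = m
          · subst hvm
            by_contra h0
            exact k ⟨h0, hQv⟩
          · exact i2 v (by omega) hQv
        · exact Or.inr hI
    · intro τ hF hI
      simp only [St.setSc_sc, reduceCtorEq, if_false, s3 .n (by decide), hn] at hI
      have ta : ∀ a, τ.ar a = σ3.ar a := fun a => hF.ar a (by simp [when, ars])
      have ts : ∀ j, j ≠ .hit → j ≠ .cur → τ.sc j = σ3.sc j := fun j h1 h2 => by
        rw [hF.sc j (by simp [when, scs, h1, h2])]
        simp [h1]
      have tf : τ.sc .found = 0 := by
        rw [ts .found (by decide) (by decide), s3 .found (by decide), hf]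
      have hsrc : ∀ v < n, P v → σ3.ar .D v ≠ 0 := fun v hv hPv => by
        have : σ2.ar .D v = 1 := by rw [d2 v (by omega), if_pos ⟨hv, hPv⟩]
        rw [S3.keep v (by omega), this]
        exact one_ne_zero
      rw [wp_ite]
      simp only [holds_sc]
      rw [e2 .E (by decide)] at S3 M3
      constructor
      · intro hhit
        rcases hI with ⟨i1, -⟩ | ⟨-, v, hv, hQv, hDv, hcur⟩
        · exact absurd i1 hhit
        have S4 : SearchInv (2 * n) (σ.ar .E) (σ2.ar .D) 1 τ := by
          obtain ⟨q1, q2, q3, q4, q5, q6⟩ := S3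
          have r1 := ts .nn (by decide) (by decide)
          have r2 := ts .cnt (by decide) (by decide)
          constructor
          · rw [r1, q1]
          · rw [ta, q2]
          · rw [ta]; exact q3
          · rw [ta, ta]; exact q4
          · rw [ta, r2]; exact q5
          · rw [ta, r2]; exact q6
        refine (wp_augment (y := n + v) (e := e) S4
          (fun x hx => by rw [d2 x hx]; split_ifs <;> omega) hcur (by omega)
          (by rw [ta]; exact hDv) hE (by omega) b6 b5 b4).mono ?_
        rintro υ F5 ⟨g1, g2⟩
        refine Or.inl ⟨by rw [F5.sc .found (by decide), tf], g1, fun Z _ hZP hZQ => ?_⟩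
        rw [← hflow Z hZP hZQ, ← g2 Z ?_ (hZQ v hv hQv)]
        · omega
        · intro x hx hx0
          rw [d2 x hx] at hx0
          by_cases hxP : x < n ∧ P x
          · exact hZP x hxP.1 hxP.2
          · rw [if_neg hxP] at hx0; exact absurd rfl hx0
      · intro hhit
        rcases hI with ⟨-, i2⟩ | ⟨i1, -⟩
        swap
        · rw [i1] at hhit; exact absurd one_ne_zero hhit
        simp only [wp_set, eval_one, St.setSc_sc, if_true, St.setSc_ar]
        refine ⟨b3, Or.inr ⟨trivial, ?_⟩⟩
        rw [ta]
        refine IsCut.of_cutValue hsrc i2 ?_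
        rw [← hflow _ hsrc (fun v hv hQv => not_not.2 (i2 v hv hQv))]
        have : cutValue (2 * n) (fun a b => σ.ar .E (a * (2 * n) + b))
            (fun x => σ3.ar .D x ≠ 0) = 0 := by
          refine sum_eq_zero fun x hx => ?_
          simp only [mem_filter, mem_product, mem_range] at hx
          by_contra h0
          exact hx.2.2 (M3 x.2 hx.1.2 x.1 hx.1.1 hx.2.1 h0)
        omega

/-- Either a cut of value at most `s` is found, or there is no separator of size `s`. -/
lemma wp_flow (hn : σ.sc .n = n) (hnn : σ.sc .nn = 2 * n) (hl : σ.sc .l = l) (hs : σ.sc .s = s)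
    (hrounds : σ.sc .rounds = s + 1) (hadj : σ.ar .adj = adj) (hf : σ.sc .found = 0)
    (hP : ∀ v < n, P v ↔ σ.ar .W (l * n + v) ≠ 0 ∧ σ.ar .side v ≠ 0)
    (hQ : ∀ v < n, Q v ↔ σ.ar .W (l * n + v) ≠ 0 ∧ σ.ar .side v = 0)
    (hb : FlowBounds n s bd) :
    Wp I bd flowCmd ρ (fun τ => (τ.sc .found = 0 ∧ ∀ A X : Finset ℕ, #X ≤ s →
        (∀ a ∈ A, ∀ b < n, adj (a * n + b) ≠ 0 → b ∈ A ∪ X) →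
        (∀ v < n, P v → v ∈ A ∪ X) → ¬ ∀ v < n, Q v → v ∉ A) ∨
      (τ.sc .found = 1 ∧ IsCut n adj s P Q (τ.ar .D))) σ := by
  classical
  rw [flowCmd, wp_seq]
  refine (wp_capacity hn hnn hs hadj hb).mono ?_
  intro σ1 F1 h1
  refine wp_loop (fun r τ => (τ.sc .found = 0 ∧
      (∀ a < 2 * n, ∀ b < 2 * n, τ.ar .E (a * (2 * n) + b) ≤ s + 2 + r * (2 * n)) ∧
      ∀ (Z : ℕ → Prop) [DecidablePred Z], (∀ v < n, P v → Z v) → (∀ v < n, Q v → ¬ Z (n + v)) →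
        cutValue (2 * n) (fun a b => τ.ar .E (a * (2 * n) + b)) Z + r =
          cutValue (2 * n) (capacity n adj s) Z) ∨
      (τ.sc .found = 1 ∧ IsCut n adj s P Q (τ.ar .D))) ?_ ?_ ?_
  · refine Or.inl ⟨by rw [F1.sc .found (by decide), hf], fun a ha b hb => ?_, fun Z _ _ _ => ?_⟩
    · rw [h1 a ha b hb]; exact capacity_le.trans (by omega)
    · exact cutValue_congr h1
  · intro r hr τ hF hI
    rw [F1.sc .rounds (by decide), hrounds] at hr
    have tW : τ.ar .W = σ.ar .W := by rw [hF.ar .W (by decide), F1.ar .W (by decide)]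
    have ts : τ.ar .side = σ.ar .side := by rw [hF.ar .side (by decide), F1.ar .side (by decide)]
    rw [wp_when]
    simp only [holds_eq, eval_sc, eval_zero]
    rcases hI with ⟨i1, i2, i3⟩ | hI
    · refine ⟨fun _ => ?_, fun h => absurd i1 h⟩
      refine (wp_round (by rw [hF.sc .n (by decide), F1.sc .n (by decide), hn])
        (by rw [hF.sc .nn (by decide), F1.sc .nn (by decide), hnn])
        (by rw [hF.sc .l (by decide), F1.sc .l (by decide), hl]) i1 (by omega) ?_
        (by rw [tW, ts]; exact hP) (by rw [tW, ts]; exact hQ) i2 i3 hb).mono ?_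
      · exact Nat.add_le_add_left (Nat.mul_le_mul_right _ (by omega)) _
      · rintro υ - h
        refine h.imp_left fun ⟨k1, k2, k3⟩ => ⟨k1, fun a ha b hb => ?_, k3⟩
        rw [add_mul, one_mul, ← add_assoc]
        exact k2 a ha b hb
    · exact ⟨fun h => absurd (hI.1.symm.trans h) one_ne_zero, fun _ => Or.inr hI⟩
  · intro τ hF hI
    rw [F1.sc .rounds (by decide), hrounds] at hI
    refine hI.imp_left fun ⟨i1, _, i3⟩ => ⟨i1, fun A X hX hA hPA hQA => ?_⟩
    have h2 := i3 (fun x => x < n ∧ x ∈ A ∪ X ∨ n ≤ x ∧ x - n ∈ A)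
      (fun v hv hPv => Or.inl ⟨hv, hPA v hv hPv⟩) (fun v hv hQv h => ?_)
    · have h3 := cutValue_le_of_separation (n := n) (s := s) (adj := adj) hA
      omega
    · rcases h with h | h
      · omega
      · exact hQA v hv hQv (by simpa using h.2)

end

/-! ### Regions of vertices without a place -/

/-- Append the vertex `u` to the elimination order and add it to row `l` of `W`. -/
def placeInCmd : Cmd := placeCmd ;; .put .W (sc .l * sc .n + sc .u) 1

/-- The vertices without a place are divided into regions by their labels `lab`. There are no edges
between different regions, and row `l` of `W` is a set of placed vertices which are joined to each
other and which contains all placed neighbours of the region with label `l`. -/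
structure Regions (n : ℕ) (adj : ℕ → ℕ) (w : ℕ) (σ : St) : Prop where
  placed : Placed n adj w σ
  joined : ∀ u < n, σ.ar .plc u = 0 → IsJoined n σ fun v => σ.ar .W (σ.ar .lab u * n + v) ≠ 0
  nbr : ∀ u < n, σ.ar .plc u = 0 → ∀ v < n, σ.ar .plc v ≠ 0 → adj (u * n + v) ≠ 0 →
    σ.ar .W (σ.ar .lab u * n + v) ≠ 0
  lab : ∀ u < n, σ.ar .plc u = 0 → ∀ v < n, σ.ar .plc v = 0 → adj (u * n + v) ≠ 0 →
    σ.ar .lab v = σ.ar .lab u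
  sub : ∀ u < n, σ.ar .plc u = 0 → ∀ v < n, σ.ar .W (σ.ar .lab u * n + v) ≠ 0 → σ.ar .plc v ≠ 0

section
variable {I : ℕ → ℕ} {bd : Bounds} {ρ : ℕ → ℕ} {σ : St} {n s w l : ℕ} {adj : ℕ → ℕ}

lemma Regions.congr {τ : St} (h : Regions n adj w σ) (h1 : τ.sc .n = σ.sc .n)
    (h2 : τ.sc .pc = σ.sc .pc) (h3 : ∀ a ∈ [Ar.ord, .plc, .H, .W, .lab], τ.ar a = σ.ar a) :
    Regions n adj w τ := by
  simp only [List.mem_cons, List.not_mem_nil, or_false, forall_eq_or_imp, forall_eq] at h3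
  obtain ⟨e1, e2, e3, e4, e5⟩ := h3
  constructor
  · exact h.placed.congr h1 h2 e1 e2 e3
  · rw [e2, e4, e5]; exact fun u hu hp => (h.joined u hu hp).congr h2 e1 e3
  · rw [e2, e4, e5]; exact h.nbr
  · rw [e2, e5]; exact h.lab
  · rw [e2, e4, e5]; exact h.sub

/-- The bounds that suffice for building an elimination order. -/
structure RegionBounds (n : ℕ) (bd : Bounds) : Prop where
  idx : (2 * n + 1) * n ≤ bd.idx
  idx_sq : n * n ≤ bd.idx
  val : 2 * n ≤ bd.val
  pc : n ≤ bd.sc .pc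
  u : n ≤ bd.sc .u
  l : 2 * n ≤ bd.sc .l

open Classical in
lemma wp_placeIn (h : Regions n adj w σ) {u : ℕ} (hu : σ.sc .u = u) (hl : σ.sc .l = l)
    (hun : u < n) (hup : σ.ar .plc u = 0) (hlu : σ.ar .lab u = l) (hl2 : l ≤ 2 * n)
    (hw : #{v ∈ range n | σ.ar .W (l * n + v) ≠ 0} + 1 ≤ w) (hb : RegionBounds n bd) :
    Wp I bd placeInCmd ρ (fun τ => Regions n adj w τ ∧
      (∀ v, τ.ar .plc v ≠ 0 ↔ v = u ∨ σ.ar .plc v ≠ 0) ∧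
      ∀ i, ∀ v < n, τ.ar .W (i * n + v) ≠ 0 ↔ (i = l ∧ v = u) ∨ σ.ar .W (i * n + v) ≠ 0) σ := by
  subst hlu
  have hval := hb.val
  rw [placeInCmd, wp_seq]
  refine (wp_place h.placed hu hl hun hup (h.joined u hun hup) (h.nbr u hun hup) ?_ hb.idx_sq
    (by omega) hb.pc).mono ?_
  · refine le_trans (Nat.add_le_add_right (card_le_card fun v hv => ?_) 1) hw
    simp only [mem_filter] at hv ⊢
    exact ⟨hv.1, hv.2.2⟩
  rintro σ1 F1 ⟨P1, p1, j1⟩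
  set l := σ.ar .lab u
  have W1 : σ1.ar .W = σ.ar .W := F1.ar .W (by decide)
  have lab1 : σ1.ar .lab = σ.ar .lab := F1.ar .lab (by decide)
  rw [wp_put]
  simp only [eval_add, eval_mul, eval_sc, eval_one, P1.n_eq, F1.sc .u (by decide), hu,
    F1.sc .l (by decide), hl]
  refine ⟨⟨(index_lt (m := 2 * n + 1) (by omega) hun).trans_le hb.idx, by omega⟩, ?_⟩
  set τ := σ1.setAr .W (l * n + u) 1 with hτ
  have ta : ∀ a, a ≠ .W → τ.ar a = σ1.ar a := fun a ha => by funext i; simp [hτ, ha]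
  have tp : ∀ v, τ.ar .plc v ≠ 0 ↔ v = u ∨ σ.ar .plc v ≠ 0 := fun v => by
    rw [ta .plc (by decide)]; exact p1 v
  have tW : ∀ i, ∀ v < n, τ.ar .W (i * n + v) ≠ 0 ↔
      (i = l ∧ v = u) ∨ σ.ar .W (i * n + v) ≠ 0 := fun i v hv => by
    simp only [hτ, St.setAr_ar, true_and, index_inj hv hun, W1]
    by_cases hh : i = l ∧ v = u <;> simp [hh]
  have tl : τ.ar .lab = σ.ar .lab := by rw [ta .lab (by decide), lab1]
  have tp0 : ∀ v, τ.ar .plc v = 0 → v ≠ u ∧ σ.ar .plc v = 0 := fun v hv => by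
    have := tp v
    simp only [hv, ne_eq, not_true_eq_false, false_iff, not_or, not_not] at this
    exact this
  refine ⟨⟨P1.congr rfl rfl (ta _ (by decide)) (ta _ (by decide)) (ta _ (by decide)), ?_, ?_, ?_,
    ?_⟩, tp, tW⟩
  · intro v hv hv0
    obtain ⟨hvu, hv1⟩ := tp0 v hv0
    have hplc : ∀ i < σ.sc .pc, σ.ar .plc (σ.ar .ord i) ≠ 0 := fun i hi =>
      (h.placed.plc_iff _ (h.placed.ord_lt i hi)).2 ⟨i, hi, rfl⟩
    refine (j1 (fun x => τ.ar .W (τ.ar .lab v * n + x) ≠ 0) ?_ ?_).congr rfl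
      (ta _ (by decide)) (ta _ (by decide))
    · refine (h.joined v hv hv1).mono fun i hi hi' => ?_
      rw [tl, tW _ _ (h.placed.ord_lt i hi)] at hi'
      refine hi'.resolve_left fun hh => hplc i hi ?_
      rw [hh.2, hup]
    · intro hu' x hx hx0 hx'
      rw [tl, tW _ _ hun] at hu'
      rw [tl, tW _ _ hx] at hx'
      have hxW := hx'.resolve_left fun hh => hx0 (by rw [hh.2, hup])
      rcases hu' with hu' | hu'
      · rwa [hu'.1] at hxW
      · exact absurd hup (h.sub v hv hv1 u hun hu')
  · intro v hv hv0 x hx hx0 ha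
    obtain ⟨hvu, hv1⟩ := tp0 v hv0
    rw [tl, tW _ _ hx]
    rcases (tp x).1 hx0 with rfl | hx0
    · exact Or.inl ⟨(h.lab v hv hv1 x hun hup ha).symm, rfl⟩
    · exact Or.inr (h.nbr v hv hv1 x hx hx0 ha)
  · intro v hv hv0 x hx hx0 ha
    rw [tl]
    exact h.lab v hv (tp0 v hv0).2 x hx (tp0 x hx0).2 ha
  · intro v hv hv0 x hx hx'
    rw [tl, tW _ _ hx] at hx'
    rw [tp]
    rcases hx' with hx' | hx'
    · exact Or.inl hx'.2
    · exact Or.inr (h.sub v hv (tp0 v hv0).2 x hx hx')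

open Classical in
/-- The marks `D` describe a separation by a set of at most `s` vertices for which at most `2 s`
elements of the set `S` lie on either side. -/
structure IsSplit (n : ℕ) (adj : ℕ → ℕ) (s : ℕ) (S : ℕ → Prop) (D : ℕ → ℕ) : Prop where
  edge : ∀ v < n, ∀ u < n, D (n + v) ≠ 0 → adj (v * n + u) ≠ 0 → D u ≠ 0
  card : #{v ∈ range n | D v ≠ 0 ∧ D (n + v) = 0} ≤ s
  fst : #{v ∈ range n | S v ∧ D (n + v) ≠ 0} ≤ 2 * s
  snd : #{v ∈ range n | S v ∧ D v = 0 ∧ D (n + v) = 0} ≤ 2 * s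

end

/-- Divide the region with label `l` along the separation described by `D`. The variable `0` serves
to make new labels. -/
def divideCmd : Cmd :=
  .loop 2 .n (.when ((ar .plc (var 2)).eq 0 * (ar .lab (var 2)).eq (sc .l) *
      ar .D (var 2) * (ar .D (sc .n + var 2)).not) (.set .u (var 2) ;; placeInCmd)) ;;
  .loop 2 .n (
    .put .W ((2 * var 0 + 1) * sc .n + var 2)
      (entry .W (sc .l) (var 2) * (ar .D (var 2) + ar .D (sc .n + var 2))).tv ;;
    .put .W ((2 * var 0 + 2) * sc .n + var 2)
      (entry .W (sc .l) (var 2) * (ar .D (sc .n + var 2)).not).tv ;;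
    .when ((ar .plc (var 2)).eq 0 * (ar .lab (var 2)).eq (sc .l))
      (.put .lab (var 2) (2 * var 0 + 2 - (ar .D (var 2) + ar .D (sc .n + var 2)).tv)))

section
variable {I : ℕ → ℕ} {bd : Bounds} {ρ : ℕ → ℕ} {σ : St} {n s w l it : ℕ} {adj : ℕ → ℕ}

open Classical in
lemma wp_divide (h : Regions n adj w σ) (hsym : ∀ u < n, ∀ v < n, adj (u * n + v) ≠ 0 →
      adj (v * n + u) ≠ 0) (hl : σ.sc .l = l) (hit : ρ 0 = it) (hitn : it < n) (hl2 : l ≤ 2 * it)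
    (hlab : ∀ u < n, σ.ar .plc u = 0 → σ.ar .lab u ≤ 2 * it)
    (hD : IsSplit n adj s (fun v => σ.ar .W (l * n + v) ≠ 0) (σ.ar .D))
    (hS : #{v ∈ range n | σ.ar .W (l * n + v) ≠ 0} ≤ 3 * s + 1) (hw : 4 * s + 2 ≤ w)
    (hcard : ∀ u < n, σ.ar .plc u = 0 → σ.ar .lab u ≠ l →
      #{v ∈ range n | σ.ar .W (σ.ar .lab u * n + v) ≠ 0} ≤ 3 * s) (hb : RegionBounds n bd) :
    Wp I bd divideCmd ρ (fun τ => Regions n adj w τ ∧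
      (∀ v < n, σ.ar .plc v ≠ 0 → τ.ar .plc v ≠ 0) ∧
      (∀ u < n, τ.ar .plc u = 0 → τ.ar .lab u ≤ 2 * (it + 1)) ∧
      ∀ u < n, τ.ar .plc u = 0 →
        #{v ∈ range n | τ.ar .W (τ.ar .lab u * n + v) ≠ 0} ≤ 3 * s) σ := by
  have hval := hb.val
  have hidx := hb.idx
  set D := σ.ar .D with hDdef
  have hn := h.placed.n_eq
  rw [divideCmd, wp_seq]
  refine wp_loop (fun m τ => Regions n adj w τ ∧
    (∀ v, τ.ar .plc v ≠ 0 ↔ (σ.ar .plc v = 0 ∧ σ.ar .lab v = l ∧ D v ≠ 0 ∧ D (n + v) = 0 ∧ v < m) ∨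
      σ.ar .plc v ≠ 0) ∧
    ∀ i, ∀ v < n, τ.ar .W (i * n + v) ≠ 0 ↔ (i = l ∧ σ.ar .plc v = 0 ∧ σ.ar .lab v = l ∧ D v ≠ 0 ∧
      D (n + v) = 0 ∧ v < m) ∨ σ.ar .W (i * n + v) ≠ 0) ?_ ?_ ?_
  · exact ⟨h, fun v => by simp, fun i v _ => by simp⟩
  · rintro m hm τ F ⟨R, p, W⟩
    rw [hn] at hm
    have tl : τ.sc .l = l := by rw [F.sc .l (by decide), hl]
    have tn := R.placed.n_eq
    have tD : τ.ar .D = D := F.ar .D (by decide)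
    have tlab : τ.ar .lab = σ.ar .lab := F.ar .lab (by decide)
    rw [wp_when]
    simp only [holds_mul, holds_eq, eval_ar, eval_var, eval_zero, eval_sc, holds_ar, holds_not,
      eval_add, Function.update_self, tl, tn, tD, tlab, not_not, and_assoc]
    have hpm : τ.ar .plc m = 0 ↔ σ.ar .plc m = 0 := by
      have := p m
      simp only [lt_irrefl, and_false, false_or] at this
      exact not_iff_not.1 this
    constructor
    · rintro ⟨k1, k2, k3, k4⟩
      rw [wp_seq, wp_set, eval_var, Function.update_self]
      refine ⟨by have := hb.u; omega, ?_⟩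
      have R' : Regions n adj w (τ.setSc .u m) := R.congr (by simp) (by simp) fun a _ => rfl
      refine (wp_placeIn (l := l) R' (by simp) (by simpa using tl) hm (by simpa using k1)
        (by simpa [tlab] using k2) (by omega) ?_ hb).mono ?_
      · have : #{v ∈ range n | τ.ar .W (l * n + v) ≠ 0} ≤
            #{v ∈ range n | σ.ar .W (l * n + v) ≠ 0} + #{v ∈ range n | D v ≠ 0 ∧ D (n + v) = 0} := by
          refine (card_le_card fun v hv => ?_).trans (card_union_le _ _)
          simp only [mem_filter, mem_union, mem_range] at hv ⊢
          rcases (W l v hv.1).1 hv.2 with hh | hh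
          · exact Or.inr ⟨hv.1, hh.2.2.2.1, hh.2.2.2.2.1⟩
          · exact Or.inl ⟨hv.1, hh⟩
        have := hD.card
        change #{v ∈ range n | τ.ar .W (l * n + v) ≠ 0} + 1 ≤ w
        omega
      · rintro υ - ⟨R2, p2, W2⟩
        refine ⟨R2, fun v => ?_, fun i v hv => ?_⟩
        · rw [p2 v]
          simp only [St.setSc_ar]
          rw [p v]
          by_cases hvm : v = m
          · subst hvm
            have := hpm.1 k1
            simp only [true_or, true_iff]
            exact Or.inl ⟨this, k2, k3, k4, by omega⟩
          · simp only [hvm, false_or]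
            rw [show v < m + 1 ↔ v < m by omega]
        · rw [W2 i v hv]
          simp only [St.setSc_ar]
          rw [W i v hv]
          by_cases hvm : v = m
          · subst hvm
            have := hpm.1 k1
            simp only [lt_irrefl, and_false, false_or, Nat.lt_succ_self, and_true, k2, k3, k4,
              this, ne_eq, not_false_eq_true]
          · simp only [hvm, and_false, false_or]
            rw [show v < m + 1 ↔ v < m by omega]
    · intro hk
      have key : ∀ v, (σ.ar .plc v = 0 ∧ σ.ar .lab v = l ∧ D v ≠ 0 ∧ D (n + v) = 0 ∧ v < m + 1) ↔
          (σ.ar .plc v = 0 ∧ σ.ar .lab v = l ∧ D v ≠ 0 ∧ D (n + v) = 0 ∧ v < m) := by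
        intro v
        constructor
        · rintro ⟨c1, c2, c3, c4, c5⟩
          refine ⟨c1, c2, c3, c4, lt_of_le_of_ne (by omega) ?_⟩
          rintro rfl
          exact hk ⟨hpm.2 c1, c2, c3, c4⟩
        · rintro ⟨c1, c2, c3, c4, c5⟩
          exact ⟨c1, c2, c3, c4, by omega⟩
      simp only [key]
      exact ⟨R, p, W⟩
  · rintro σ1 F1 ⟨R, p, W⟩
    rw [hn] at p W
    have n1 := R.placed.n_eq
    have l1 : σ1.sc .l = l := by rw [F1.sc .l (by decide), hl]
    have D1 : σ1.ar .D = D := F1.ar .D (by decide)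
    have lab1 : σ1.ar .lab = σ.ar .lab := F1.ar .lab (by decide)
    -- the description of the result
    refine wp_loop (fun m τ => (∀ i, ∀ v < n, τ.ar .W (i * n + v) ≠ 0 ↔
        if i = 2 * it + 1 ∧ v < m then σ1.ar .W (l * n + v) ≠ 0 ∧ (D v ≠ 0 ∨ D (n + v) ≠ 0) else
        if i = 2 * it + 2 ∧ v < m then σ1.ar .W (l * n + v) ≠ 0 ∧ D (n + v) = 0 else
          σ1.ar .W (i * n + v) ≠ 0) ∧
      ∀ v, τ.ar .lab v = if σ1.ar .plc v = 0 ∧ σ.ar .lab v = l ∧ v < m then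
        if D v ≠ 0 ∨ D (n + v) ≠ 0 then 2 * it + 1 else 2 * it + 2 else σ.ar .lab v) ?_ ?_ ?_
    · exact ⟨fun i v _ => by simp, fun v => by simp [lab1]⟩
    · rintro m hm τ F ⟨W2, L2⟩
      rw [n1] at hm
      have tn : τ.sc .n = n := by rw [F.sc .n (by decide), n1]
      have tl : τ.sc .l = l := by rw [F.sc .l (by decide), l1]
      have tD : τ.ar .D = D := by rw [F.ar .D (by decide), D1]
      have tp : τ.ar .plc = σ1.ar .plc := F.ar .plc (by decide)
      have i1 : (2 * it + 1) * n + m < (2 * n + 1) * n := index_lt (by omega) hm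
      have i2 : (2 * it + 2) * n + m < (2 * n + 1) * n := index_lt (by omega) hm
      have tWl : τ.ar .W (l * n + m) ≠ 0 ↔ σ1.ar .W (l * n + m) ≠ 0 := by
        rw [W2 l m hm, if_neg (by omega), if_neg (by omega)]
      have hll : ¬ (l = 2 * it + 1) := by omega
      have hρ0 : Function.update ρ 2 m 0 = it := by simp [hit]
      have hρ2 : Function.update ρ 2 m 2 = m := by simp
      simp only [wp_seq, wp_put, entry, eval_add, eval_mul, eval_sub, eval_var, eval_sc, eval_one,
        eval_ofNat, eval_tv, holds_mul, holds_add, holds_ar, holds_not, tn, tl, tD, St.setAr_sc,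
        St.setAr_ar, true_and, reduceCtorEq, false_and, if_false, hρ0, hρ2, index_inj hm hm,
        and_true, hll, wp_when, holds_eq, eval_ar, eval_zero, tWl, not_not, tp]
      refine ⟨⟨by omega, by split_ifs <;> omega⟩, ⟨by omega, by split_ifs <;> omega⟩, ?_⟩
      have hW3 : ∀ i, ∀ v < n, (if i * n + v = (2 * it + 2) * n + m then
          (if σ1.ar .W (l * n + m) ≠ 0 ∧ D (n + m) = 0 then 1 else 0) else
          if i * n + v = (2 * it + 1) * n + m then
            (if σ1.ar .W (l * n + m) ≠ 0 ∧ (D m ≠ 0 ∨ D (n + m) ≠ 0) then 1 else 0) else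
            τ.ar .W (i * n + v)) ≠ 0 ↔
          if i = 2 * it + 1 ∧ v < m + 1 then
            σ1.ar .W (l * n + v) ≠ 0 ∧ (D v ≠ 0 ∨ D (n + v) ≠ 0) else
          if i = 2 * it + 2 ∧ v < m + 1 then σ1.ar .W (l * n + v) ≠ 0 ∧ D (n + v) = 0 else
            σ1.ar .W (i * n + v) ≠ 0 := by
        intro i v hv
        simp only [index_inj hv hm]
        by_cases hvm : v = m
        · subst hvm
          by_cases e1 : i = 2 * it + 1
          · subst e1
            simp
            tauto
          · by_cases e2 : i = 2 * it + 2
            · subst e2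
              simp
            · have := W2 i v hv
              simp only [e1, e2, false_and, if_false] at this ⊢
              exact this
        · simp only [hvm, and_false, if_false]
          rw [W2 i v hv]
          simp only [show v < m + 1 ↔ v < m by omega]
      have hLm : τ.ar .lab m = σ.ar .lab m := by rw [L2, if_neg (by omega)]
      have hLne : ∀ v, v ≠ m → τ.ar .lab v = if σ1.ar .plc v = 0 ∧ σ.ar .lab v = l ∧ v < m + 1 then
        if D v ≠ 0 ∨ D (n + v) ≠ 0 then 2 * it + 1 else 2 * it + 2 else σ.ar .lab v := by
        intro v hv
        simp only [L2, show v < m + 1 ↔ v < m by omega]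
      simp only [hLm]
      constructor
      · rintro ⟨k1, k2⟩
        refine ⟨⟨by omega, by split_ifs <;> omega⟩, hW3, fun v => ?_⟩
        by_cases hvm : v = m
        · subst hvm
          simp only [if_true, k1, k2, true_and, Nat.lt_succ_self]
          by_cases hh : D v ≠ 0 ∨ D (n + v) ≠ 0
          · simp only [if_pos hh]; omega
          · simp only [if_neg hh]; omega
        · rw [if_neg hvm]
          exact hLne v hvm
      · intro k
        refine ⟨hW3, fun v => ?_⟩
        by_cases hvm : v = m
        · subst hvm
          rw [hLm, if_neg fun hh => k ⟨hh.1, hh.2.1⟩]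
        · exact hLne v hvm
    · rintro τ F ⟨W2, L2⟩
      rw [n1] at W2 L2
      have tp : τ.ar .plc = σ1.ar .plc := F.ar .plc (by decide)
      have tP : Placed n adj w τ := R.placed.congr (F.sc .n (by decide)) (F.sc .pc (by decide))
        (F.ar .ord (by decide)) tp (F.ar .H (by decide))
      have tpc : τ.sc .pc = σ1.sc .pc := F.sc .pc (by decide)
      have tord : τ.ar .ord = σ1.ar .ord := F.ar .ord (by decide)
      have tH : τ.ar .H = σ1.ar .H := F.ar .H (by decide)
      have hp0 : ∀ v, σ1.ar .plc v = 0 → σ.ar .plc v = 0 := fun v hv => by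
        by_contra h0
        exact (p v).2 (Or.inr h0) hv
      -- a vertex of the region is in no separator any more
      have hp1 : ∀ v < n, σ1.ar .plc v = 0 → σ.ar .lab v = l → D v ≠ 0 → D (n + v) ≠ 0 := by
        intro v hv hv0 hvl h1 h2
        exact (p v).2 (Or.inl ⟨hp0 v hv0, hvl, h1, h2, hv⟩) hv0
      have rowA : ∀ v < n, τ.ar .W ((2 * it + 1) * n + v) ≠ 0 ↔
          σ1.ar .W (l * n + v) ≠ 0 ∧ (D v ≠ 0 ∨ D (n + v) ≠ 0) := fun v hv => by
        rw [W2 _ v hv, if_pos ⟨rfl, hv⟩]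
      have rowB : ∀ v < n, τ.ar .W ((2 * it + 2) * n + v) ≠ 0 ↔
          σ1.ar .W (l * n + v) ≠ 0 ∧ D (n + v) = 0 := fun v hv => by
        rw [W2 _ v hv, if_neg (by omega), if_pos ⟨rfl, hv⟩]
      have rowO : ∀ i ≤ 2 * it, ∀ v < n, τ.ar .W (i * n + v) ≠ 0 ↔ σ1.ar .W (i * n + v) ≠ 0 :=
        fun i hi v hv => by rw [W2 _ v hv, if_neg (by omega), if_neg (by omega)]
      -- the three kinds of vertices without a place
      have cases3 : ∀ u < n, τ.ar .plc u = 0 → (τ.ar .lab u = 2 * it + 1 ∧ σ.ar .lab u = l ∧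
          D (n + u) ≠ 0) ∨ (τ.ar .lab u = 2 * it + 2 ∧ σ.ar .lab u = l ∧ D u = 0 ∧
          D (n + u) = 0) ∨ (τ.ar .lab u = σ.ar .lab u ∧ σ.ar .lab u ≠ l ∧
          σ.ar .lab u ≤ 2 * it) := by
        intro u hu hu0
        rw [tp] at hu0
        rw [L2]
        by_cases hul : σ.ar .lab u = l
        · rw [if_pos ⟨hu0, hul, hu⟩]
          by_cases hA : D u ≠ 0 ∨ D (n + u) ≠ 0
          · rw [if_pos hA]
            exact Or.inl ⟨rfl, hul, hA.elim (hp1 u hu hu0 hul) id⟩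
          · rw [if_neg hA]
            simp only [not_or, not_not] at hA
            exact Or.inr (Or.inl ⟨rfl, hul, hA⟩)
        · rw [if_neg fun hh => hul hh.2.1]
          exact Or.inr (Or.inr ⟨rfl, hul, hlab u hu (hp0 u hu0)⟩)
      have row_le : ∀ u < n, τ.ar .plc u = 0 → ∀ v < n, τ.ar .W (τ.ar .lab u * n + v) ≠ 0 →
          σ1.ar .W (σ1.ar .lab u * n + v) ≠ 0 := by
        intro u hu hu0 v hv hW
        rw [lab1]
        rcases cases3 u hu hu0 with ⟨e, e', -⟩ | ⟨e, e', -⟩ | ⟨e, -, e'⟩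
        · rw [e, rowA v hv] at hW; rw [e']; exact hW.1
        · rw [e, rowB v hv] at hW; rw [e']; exact hW.1
        · rw [e, rowO _ e' v hv] at hW; exact hW
      refine ⟨⟨tP, ?_, ?_, ?_, ?_⟩, fun v _ hv => ?_, fun u hu hu0 => ?_, fun u hu hu0 => ?_⟩
      · intro u hu hu0
        refine ((R.joined u hu (by rwa [tp] at hu0)).mono fun i hi hi' => ?_).congr tpc tord tH
        exact row_le u hu hu0 _ (R.placed.ord_lt i hi) hi'
      · intro u hu hu0 v hv hv0 ha
        have h1 := R.nbr u hu (by rwa [tp] at hu0) v hv (by rwa [tp] at hv0) ha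
        rw [lab1] at h1
        rcases cases3 u hu hu0 with ⟨e, e', hDu⟩ | ⟨e, e', hDu, -⟩ | ⟨e, -, e'⟩
        · rw [e, rowA v hv, ← e']
          exact ⟨h1, Or.inl (hD.edge u hu v hv hDu ha)⟩
        · rw [e, rowB v hv, ← e']
          refine ⟨h1, ?_⟩
          by_contra h0
          exact hD.edge v hv u hu h0 (hsym u hu v hv ha) hDu
        · rw [e, rowO _ e' v hv]
          exact h1
      · intro u hu hu0 v hv hv0 ha
        have h1 := R.lab u hu (by rwa [tp] at hu0) v hv (by rwa [tp] at hv0) ha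
        rw [lab1] at h1
        rcases cases3 u hu hu0 with ⟨e, e', hDu⟩ | ⟨e, e', hDu, -⟩ | ⟨e, e', -⟩ <;>
          rcases cases3 v hv hv0 with ⟨f, f', hDv⟩ | ⟨f, f', hDv, -⟩ | ⟨f, f', -⟩
        · rw [e, f]
        · exact absurd hDv (hD.edge u hu v hv hDu ha)
        · exact absurd (h1.trans e') f'
        · exact absurd hDu (hD.edge v hv u hu hDv (hsym u hu v hv ha))
        · rw [e, f]
        · exact absurd (h1.trans e') f'
        · exact absurd (h1.symm.trans f') e'
        · exact absurd (h1.symm.trans f') e'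
        · rw [e, f, h1]
      · intro u hu hu0 v hv hW
        rw [tp]
        exact R.sub u hu (by rwa [tp] at hu0) v hv (row_le u hu hu0 v hv hW)
      · rw [tp, p]
        exact Or.inr hv
      · rcases cases3 u hu hu0 with ⟨e, -⟩ | ⟨e, -⟩ | ⟨e, -, e'⟩ <;> omega
      · have hX := hD.card
        rcases cases3 u hu hu0 with ⟨e, -⟩ | ⟨e, -⟩ | ⟨e, hul, e'⟩
        · have : #{v ∈ range n | τ.ar .W (τ.ar .lab u * n + v) ≠ 0} ≤
              #{v ∈ range n | σ.ar .W (l * n + v) ≠ 0 ∧ D (n + v) ≠ 0} +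
                #{v ∈ range n | D v ≠ 0 ∧ D (n + v) = 0} := by
            refine (card_le_card fun v hv => ?_).trans (card_union_le _ _)
            simp only [mem_filter, mem_union, mem_range] at hv ⊢
            obtain ⟨hv, hW⟩ := hv
            rw [e, rowA v hv, W l v hv] at hW
            tauto
          have : #{v ∈ range n | σ.ar .W (l * n + v) ≠ 0 ∧ D (n + v) ≠ 0} ≤ 2 * s := by
            convert hD.fst
          omega
        · have : #{v ∈ range n | τ.ar .W (τ.ar .lab u * n + v) ≠ 0} ≤
              #{v ∈ range n | σ.ar .W (l * n + v) ≠ 0 ∧ D v = 0 ∧ D (n + v) = 0} +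
                #{v ∈ range n | D v ≠ 0 ∧ D (n + v) = 0} := by
            refine (card_le_card fun v hv => ?_).trans (card_union_le _ _)
            simp only [mem_filter, mem_union, mem_range] at hv ⊢
            obtain ⟨hv, hW⟩ := hv
            rw [e, rowB v hv, W l v hv] at hW
            tauto
          have : #{v ∈ range n | σ.ar .W (l * n + v) ≠ 0 ∧ D v = 0 ∧ D (n + v) = 0} ≤ 2 * s := by
            convert hD.snd
          omega
        · refine le_trans (card_le_card fun v hv => ?_)
            (hcard u hu (hp0 u (by rwa [tp] at hu0)) hul)
          simp only [mem_filter, mem_range] at hv ⊢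
          obtain ⟨hv, hW⟩ := hv
          rw [e, rowO _ e' v hv, W _ v hv] at hW
          exact ⟨hv, hW.resolve_left fun hh => hul hh.1⟩

end

/-! ### Balanced separations -/

open Classical in
/-- The number of smaller elements of a set of numbers. -/
noncomputable def rank (S : ℕ → Prop) (v : ℕ) : ℕ := #{x ∈ range v | S x}

section
variable {S : ℕ → Prop}

lemma rank_succ_of_mem {v : ℕ} (h : S v) : rank S (v + 1) = rank S v + 1 := by
  classical
  unfold rank
  rw [range_add_one, filter_insert, if_pos h, card_insert_of_notMem (by simp)]

lemma rank_succ_of_notMem {v : ℕ} (h : ¬ S v) : rank S (v + 1) = rank S v := by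
  classical
  unfold rank
  rw [range_add_one, filter_insert, if_neg h]

lemma rank_lt {n v : ℕ} (hv : v < n) (h : S v) : rank S v < rank S n := by
  classical
  have h1 : rank S (v + 1) ≤ rank S n := by
    refine card_le_card fun x hx => ?_
    simp only [mem_filter, mem_range] at hx ⊢
    exact ⟨by omega, hx.2⟩
  rw [rank_succ_of_mem h] at h1
  omega

/-- Every subset is described by the binary digits of some number. -/
lemma exists_testBit_rank (S P : ℕ → Prop) (n : ℕ) : ∃ q < 2 ^ rank S n,
    ∀ v < n, S v → (q.testBit (rank S v) = true ↔ P v) := by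
  classical
  induction n with
  | zero => exact ⟨0, by positivity, by simp⟩
  | succ n ih =>
    obtain ⟨q, hq, h⟩ := ih
    by_cases hS : S n
    · rw [rank_succ_of_mem hS, pow_succ]
      by_cases hP : P n
      · refine ⟨2 ^ rank S n + q, by omega, fun v hv hSv => ?_⟩
        rcases Nat.lt_succ_iff_lt_or_eq.1 hv with hv | rfl
        · rw [Nat.testBit_two_pow_add_gt (rank_lt hv hSv)]
          exact h v hv hSv
        · rw [Nat.testBit_two_pow_add_eq, Nat.testBit_lt_two_pow hq]
          simpa using hP
      · refine ⟨q, by omega, fun v hv hSv => ?_⟩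
        rcases Nat.lt_succ_iff_lt_or_eq.1 hv with hv | rfl
        · exact h v hv hSv
        · rw [Nat.testBit_lt_two_pow hq]
          simpa using hP
    · rw [rank_succ_of_notMem hS]
      refine ⟨q, hq, fun v hv hSv => ?_⟩
      rcases Nat.lt_succ_iff_lt_or_eq.1 hv with hv | rfl
      · exact h v hv hSv
      · exact absurd hSv hS

end

/-- Store in `side` the subset of row `l` of `W` that the binary digits of variable `1` describe. -/
def sideCmd : Cmd :=
  .set .y (var 1) ;;
  .loop 2 .n (.when (entry .W (sc .l) (var 2))
    (.put .side (var 2) ((sc .y).mod 2) ;; .set .y (sc .y / 2)))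

/-- Search for a small separator between the subset given by variable `1` and the rest, if neither
of them is too large. -/
def tryCmd : Cmd :=
  sideCmd ;;
  .when (((entry .W (sc .l) (var 6) * ar .side (var 6)).count 6 .n).le (2 * sc .s) *
      ((entry .W (sc .l) (var 6) * (ar .side (var 6)).not).count 6 .n).le (2 * sc .s)) flowCmd

/-- Search for a balanced separation of row `l` of `W`. -/
def splitCmd : Cmd := .set .found 0 ;; .loop 1 .choices (.when ((sc .found).eq 0) tryCmd)

section
variable {I : ℕ → ℕ} {bd : Bounds} {ρ : ℕ → ℕ} {σ : St} {n s l : ℕ} {adj : ℕ → ℕ}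

lemma wp_side {q : ℕ} (hn : σ.sc .n = n) (hl : σ.sc .l = l) (hq : ρ 1 = q) (hqy : q ≤ bd.sc .y)
    (hidx : n ≤ bd.idx) (hval : 1 ≤ bd.val) :
    Wp I bd sideCmd ρ (fun τ => ∀ v < n, σ.ar .W (l * n + v) ≠ 0 → (τ.ar .side v ≠ 0 ↔
      q.testBit (rank (fun x => σ.ar .W (l * n + x) ≠ 0) v) = true)) σ := by
  set S := fun x => σ.ar .W (l * n + x) ≠ 0 with hS
  rw [sideCmd, wp_seq, wp_set, eval_var, hq]
  refine ⟨hqy, ?_⟩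
  refine wp_loop (fun m τ => τ.sc .y = q / 2 ^ rank S m ∧ ∀ v < m, S v → (τ.ar .side v ≠ 0 ↔
      q.testBit (rank S v) = true)) ?_ ?_ ?_
  · simp [rank]
  · rintro m hm τ F ⟨h1, h2⟩
    simp only [St.setSc_sc, reduceCtorEq, if_false, hn] at hm
    have tn : τ.sc .n = n := by rw [F.sc .n (by decide)]; simp [hn]
    have tl : τ.sc .l = l := by rw [F.sc .l (by decide)]; simp [hl]
    have tW : τ.ar .W = σ.ar .W := by rw [F.ar .W (by decide)]; rfl
    rw [wp_when]
    simp only [entry, holds_ar, eval_add, eval_mul, eval_sc, eval_var, tn, tl, tW,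
      Function.update_self, wp_seq, wp_put, wp_set, eval_mod, eval_ofNat, eval_div, h1, St.setAr_sc,
      St.setSc_sc, if_true, St.setSc_ar, St.setAr_ar, true_and]
    constructor
    · intro hSm
      have hdiv : q / 2 ^ rank S m / 2 ≤ q := (Nat.div_le_self _ _).trans (Nat.div_le_self _ _)
      refine ⟨⟨by omega, by omega⟩, by omega, ?_, fun v hv hSv => ?_⟩
      · rw [rank_succ_of_mem (S := S) hSm, pow_succ, Nat.div_div_eq_div_mul]
      · by_cases hvm : v = m
        · subst hvm
          rw [if_pos rfl, Nat.testBit_eq_decide_div_mod_eq, decide_eq_true_iff]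
          omega
        · rw [if_neg hvm]
          exact h2 v (by omega) hSv
    · intro hSm
      refine ⟨by rw [rank_succ_of_notMem (S := S) hSm], fun v hv hSv => ?_⟩
      refine h2 v (lt_of_le_of_ne (by omega) ?_) hSv
      rintro rfl
      exact hSm hSv
  · rintro τ F ⟨-, h2⟩
    simp only [St.setSc_sc, reduceCtorEq, if_false, hn] at h2
    exact h2

open Classical in
/-- There is no small separator that separates the subset `P` of `S` from the rest, or one of the
two parts is too large. -/
def NotSeparable (n : ℕ) (adj : ℕ → ℕ) (s : ℕ) (S P : ℕ → Prop) : Prop :=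
  #{v ∈ range n | S v ∧ P v} ≤ 2 * s → #{v ∈ range n | S v ∧ ¬ P v} ≤ 2 * s →
    ∀ A X : Finset ℕ, #X ≤ s → (∀ a ∈ A, ∀ b < n, adj (a * n + b) ≠ 0 → b ∈ A ∪ X) →
      (∀ v < n, S v ∧ P v → v ∈ A ∪ X) → ¬ ∀ v < n, S v ∧ ¬ P v → v ∉ A

open Classical in
lemma wp_try {q : ℕ} (hn : σ.sc .n = n) (hnn : σ.sc .nn = 2 * n) (hl : σ.sc .l = l)
    (hs : σ.sc .s = s) (hrounds : σ.sc .rounds = s + 1) (hadj : σ.ar .adj = adj)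
    (hf : σ.sc .found = 0) (hq : ρ 1 = q) (hqy : q ≤ bd.sc .y) (hb : FlowBounds n s bd) :
    Wp I bd tryCmd ρ (fun τ =>
      (τ.sc .found = 0 ∧ NotSeparable n adj s (fun v => σ.ar .W (l * n + v) ≠ 0)
        fun v => q.testBit (rank (fun x => σ.ar .W (l * n + x) ≠ 0) v) = true) ∨
      (τ.sc .found = 1 ∧ IsSplit n adj s (fun v => σ.ar .W (l * n + v) ≠ 0) (τ.ar .D))) σ := by
  have hidx := hb.idx
  have hval := hb.val
  have hnn4 : 2 * n ≤ 2 * n * (2 * n) := by nlinarith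
  set S : ℕ → Prop := fun v => σ.ar .W (l * n + v) ≠ 0 with hS
  set P : ℕ → Prop := fun v => q.testBit (rank S v) = true with hP
  rw [tryCmd, wp_seq]
  refine (wp_side hn hl hq hqy (by omega) (by omega)).mono ?_
  intro σ1 F1 h1
  have n1 : σ1.sc .n = n := by rw [F1.sc .n (by decide), hn]
  have l1 : σ1.sc .l = l := by rw [F1.sc .l (by decide), hl]
  have s1 : σ1.sc .s = s := by rw [F1.sc .s (by decide), hs]
  have W1 : σ1.ar .W = σ.ar .W := F1.ar .W (by decide)
  have f1 : σ1.sc .found = 0 := by rw [F1.sc .found (by decide), hf]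
  have hPv : ∀ v < n, (S v ∧ P v ↔ σ1.ar .W (l * n + v) ≠ 0 ∧ σ1.ar .side v ≠ 0) := fun v hv => by
    rw [W1]
    exact and_congr_right fun h => (h1 v hv h).symm
  have hQv : ∀ v < n, (S v ∧ ¬ P v ↔ σ1.ar .W (l * n + v) ≠ 0 ∧ σ1.ar .side v = 0) :=
    fun v hv => by
    rw [W1]
    exact and_congr_right fun h => by rw [hP]; dsimp only; rw [← h1 v hv h, not_not]
  have c1 : #{v ∈ range n | σ1.ar .W (l * n + v) ≠ 0 ∧ σ1.ar .side v ≠ 0} =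
      #{v ∈ range n | S v ∧ P v} :=
    congrArg card (filter_congr fun v hv => (hPv v (mem_range.1 hv)).symm)
  have c2 : #{v ∈ range n | σ1.ar .W (l * n + v) ≠ 0 ∧ σ1.ar .side v = 0} =
      #{v ∈ range n | S v ∧ ¬ P v} :=
    congrArg card (filter_congr fun v hv => (hQv v (mem_range.1 hv)).symm)
  rw [wp_when]
  simp only [holds_mul, holds_le, eval_count, entry, holds_ar, holds_not, eval_add, eval_mul,
    eval_sc, eval_var, Function.update_self, n1, l1, s1, eval_ofNat, not_not]
  constructor
  · rintro ⟨k1, k2⟩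
    have k1' : #{v ∈ range n | S v ∧ P v} ≤ 2 * s := by rw [← c1]; convert k1
    have k2' : #{v ∈ range n | S v ∧ ¬ P v} ≤ 2 * s := by rw [← c2]; convert k2
    refine (wp_flow n1 (by rw [F1.sc .nn (by decide), hnn]) l1 s1
      (by rw [F1.sc .rounds (by decide), hrounds]) (by rw [F1.ar .adj (by decide), hadj]) f1 hPv hQv
      hb).mono ?_
    rintro τ - (⟨t1, t2⟩ | ⟨t1, t2⟩)
    · exact Or.inl ⟨t1, fun _ _ => t2⟩
    · refine Or.inr ⟨t1, t2.edge, by convert t2.card, (card_le_card fun v hv => ?_).trans k1',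
        (card_le_card fun v hv => ?_).trans k2'⟩
      · simp only [mem_filter, mem_range] at hv ⊢
        refine ⟨hv.1, hv.2.1, ?_⟩
        by_contra hPv
        exact hv.2.2 (t2.tgt v hv.1 ⟨hv.2.1, hPv⟩)
      · simp only [mem_filter, mem_range] at hv ⊢
        exact ⟨hv.1, hv.2.1, fun hPv => t2.src v hv.1 ⟨hv.2.1, hPv⟩ hv.2.2.1⟩
  · intro k
    refine Or.inl ⟨f1, fun k1 k2 => absurd ⟨?_, ?_⟩ k⟩
    · have k1' : #{v ∈ range n | S v ∧ P v} ≤ 2 * s := by convert k1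
      rw [← c1] at k1'; convert k1'
    · have k2' : #{v ∈ range n | S v ∧ ¬ P v} ≤ 2 * s := by convert k2
      rw [← c2] at k2'; convert k2'

open Classical in
/-- `A` and `X` form a balanced separation of the set `S`. -/
structure IsSeparation (n : ℕ) (adj : ℕ → ℕ) (s : ℕ) (S : ℕ → Prop) (A X : Finset ℕ) : Prop where
  card : #X ≤ s
  edge : ∀ a ∈ A, ∀ b < n, adj (a * n + b) ≠ 0 → b ∈ A ∪ X
  fst : #{v ∈ range n | S v ∧ v ∈ A} ≤ 2 * s
  snd : #{v ∈ range n | S v ∧ v ∉ A ∪ X} ≤ 2 * s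

open Classical in
/-- If there is a balanced separation of `S`, then some subset of `S` has a small separator from
the rest. -/
lemma IsSeparation.exists_separable {S : ℕ → Prop} {A X : Finset ℕ}
    (h : IsSeparation n adj s S A X) (hs : 1 ≤ s) (hS : rank S n = 3 * s + 1) :
    ∃ q < 2 ^ (3 * s + 1), ¬ NotSeparable n adj s S fun v => q.testBit (rank S v) = true := by
  have h1 : ({v ∈ range n | S v ∧ v ∈ A} : Finset ℕ) ⊆ {v ∈ range n | S v ∧ v ∈ A ∪ X} := by
    intro v hv
    simp only [mem_filter, mem_union] at hv ⊢
    exact ⟨hv.1, hv.2.1, Or.inl hv.2.2⟩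
  have h2 : #{v ∈ range n | S v ∧ v ∈ A ∪ X} + #{v ∈ range n | S v ∧ v ∉ A ∪ X} = 3 * s + 1 := by
    rw [← hS, rank, ← card_filter_add_card_filter_not (s := {v ∈ range n | S v}) (· ∈ A ∪ X),
      filter_filter, filter_filter]
  have h3 := h.snd
  have h4 := h.fst
  have h5 := card_le_card h1
  -- both parts get at most `2 s` elements
  obtain ⟨R, hR1, hR2, hR3⟩ := exists_subsuperset_card_eq h1
    (n := max (s + 1) #{v ∈ range n | S v ∧ v ∈ A}) (by omega) (by omega)
  obtain ⟨q, hq, hqR⟩ := exists_testBit_rank S (· ∈ R) n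
  rw [hS] at hq
  have hR4 : ({v ∈ range n | S v ∧ q.testBit (rank S v) = true} : Finset ℕ) = R := by
    ext v
    simp only [mem_filter, mem_range]
    constructor
    · rintro ⟨k1, k2, k3⟩
      exact (hqR v k1 k2).1 k3
    · intro hv
      have := hR2 hv
      simp only [mem_filter, mem_range] at this
      exact ⟨this.1, this.2.1, (hqR v this.1 this.2.1).2 hv⟩
  have h6 : #{v ∈ range n | S v ∧ q.testBit (rank S v) = true} +
      #{v ∈ range n | S v ∧ ¬ q.testBit (rank S v) = true} = 3 * s + 1 := by
    rw [← hS, rank, ← card_filter_add_card_filter_not (s := {v ∈ range n | S v})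
      (fun v => q.testBit (rank S v) = true), filter_filter, filter_filter]
  refine ⟨q, hq, fun hN => hN ?_ ?_ A X h.card h.edge ?_ ?_⟩
  · have h7 : #{v ∈ range n | S v ∧ q.testBit (rank S v) = true} ≤ 2 * s := by
      rw [hR4, hR3]; omega
    convert h7
  · have h7 : #{v ∈ range n | S v ∧ ¬ q.testBit (rank S v) = true} ≤ 2 * s := by
      rw [hR4, hR3] at h6; omega
    convert h7
  · rintro v hv ⟨hv1, hv2⟩
    have := hR2 ((hqR v hv hv1).1 hv2)
    simp only [mem_filter] at this
    exact this.2.2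
  · rintro v hv ⟨hv1, hv2⟩ hvA
    refine hv2 ((hqR v hv hv1).2 (hR1 ?_))
    simp only [mem_filter, mem_range]
    exact ⟨hv, hv1, hvA⟩

/-- Either a balanced separation is found, or there is none. -/
lemma wp_split (hn : σ.sc .n = n) (hnn : σ.sc .nn = 2 * n) (hl : σ.sc .l = l)
    (hs : σ.sc .s = s) (hrounds : σ.sc .rounds = s + 1) (hchoices : σ.sc .choices = 2 ^ (3 * s + 1))
    (hadj : σ.ar .adj = adj) (hs1 : 1 ≤ s)
    (hS : rank (fun v => σ.ar .W (l * n + v) ≠ 0) n = 3 * s + 1) (hy : 2 ^ (3 * s + 1) ≤ bd.sc .y)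
    (hb : FlowBounds n s bd) :
    Wp I bd splitCmd ρ (fun τ =>
      (τ.sc .found = 0 ∧ ∀ A X, ¬ IsSeparation n adj s (fun v => σ.ar .W (l * n + v) ≠ 0) A X) ∨
      (τ.sc .found = 1 ∧ IsSplit n adj s (fun v => σ.ar .W (l * n + v) ≠ 0) (τ.ar .D))) σ := by
  set S : ℕ → Prop := fun v => σ.ar .W (l * n + v) ≠ 0 with hSdef
  rw [splitCmd, wp_seq, wp_set]
  refine ⟨Nat.zero_le _, ?_⟩
  rw [eval_zero]
  refine wp_loop (fun q τ => (τ.sc .found = 0 ∧ ∀ q' < q,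
      NotSeparable n adj s S fun v => q'.testBit (rank S v) = true) ∨
    (τ.sc .found = 1 ∧ IsSplit n adj s S (τ.ar .D))) (Or.inl (by simp)) ?_ ?_
  · intro q hq τ F hI
    simp only [St.setSc_sc, reduceCtorEq, if_false, hchoices] at hq
    have ts : ∀ j, j ∉ (when ((sc .found).eq 0) tryCmd).scs → j ≠ .found → τ.sc j = σ.sc j :=
      fun j h1 h2 => by rw [F.sc j h1]; simp [h2]
    have ta : ∀ a, a ∉ (when ((sc .found).eq 0) tryCmd).ars → τ.ar a = σ.ar a :=
      fun a h1 => by rw [F.ar a h1]; rfl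
    rw [wp_when]
    simp only [holds_eq, eval_sc, eval_zero]
    rcases hI with ⟨i1, i2⟩ | hI
    · refine ⟨fun _ => ?_, fun h => absurd i1 h⟩
      refine (wp_try (l := l) (q := q) (by rw [ts .n (by decide) (by decide), hn])
        (by rw [ts .nn (by decide) (by decide), hnn]) (by rw [ts .l (by decide) (by decide), hl])
        (by rw [ts .s (by decide) (by decide), hs])
        (by rw [ts .rounds (by decide) (by decide), hrounds])
        (by rw [ta .adj (by decide), hadj]) i1 (by simp) (by omega) hb).mono ?_
      intro υ _ h
      rw [ta .W (by decide)] at h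
      refine h.imp_left fun ⟨k1, k2⟩ => ⟨k1, fun q' hq' => ?_⟩
      by_cases hqq : q' = q
      · rw [hqq]; exact k2
      · exact i2 q' (by omega)
    · exact ⟨fun h => absurd (hI.1.symm.trans h) one_ne_zero, fun _ => Or.inr hI⟩
  · intro τ F hI
    simp only [St.setSc_sc, reduceCtorEq, if_false, hchoices] at hI
    refine hI.imp_left fun ⟨i1, i2⟩ => ⟨i1, fun A X hAX => ?_⟩
    obtain ⟨q, hq, hN⟩ := hAX.exists_separable hs1 hS
    exact hN (i2 q hq)

end

/-! ### An elimination order for a graph of small treewidth -/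

open Classical in
/-- In a graph with a tree decomposition of width `w`, every set of `3 (w + 1) + 1` vertices has a
balanced separation by at most `w + 1` vertices. -/
lemma TreeDecomposition.exists_isSeparation {I : Instance} {m : ℕ}
    (T : TreeDecomposition I.graph m) {adj : ℕ → ℕ}
    (hadj : ∀ u < I.n, ∀ v < I.n, adj (u * I.n + v) ≠ 0 ↔ I.adj u v) {S : ℕ → Prop}
    (hS : rank S I.n = 3 * (T.width + 1) + 1) :
    ∃ A X, IsSeparation I.n adj (T.width + 1) S A X := by
  obtain ⟨ord, H, hbij, hE, hH⟩ := T.exists_elim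
  have hlt : ∀ i < I.n, ord i < I.n := fun i hi => hbij.mapsTo hi
  have hsurj : ∀ v < I.n, ∃ i < I.n, ord i = v := fun v hv => hbij.surjOn hv
  have hW : #{i ∈ range I.n | S (ord i)} = 3 * (T.width + 1) + 1 := by
    rw [← hS, rank]
    refine card_bij (fun i _ => ord i) ?_ ?_ ?_
    · intro i hi
      simp only [mem_filter, mem_range] at hi ⊢
      exact ⟨hlt i hi.1, hi.2⟩
    · intro i hi j hj
      simp only [mem_filter, mem_range] at hi hj
      exact hbij.injOn hi.1 hj.1
    · intro v hv
      simp only [mem_filter, mem_range] at hv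
      obtain ⟨i, hi, rfl⟩ := hsurj v hv.1
      exact ⟨i, by simpa using ⟨hi, hv.2⟩, rfl⟩
  obtain ⟨A, X, -, -, h3, h4, h5, h6⟩ := hE.exists_separation
    (fun i j h => I.adj_symm h) (s := T.width + 1) (fun i hi => Nat.add_le_add_right
      ((card_le_card (filter_subset_filter _ (range_subset_range.2 hi.le))).trans (hH i hi)) 1)
    (filter_subset _ _) hW
  refine ⟨(A ∩ range I.n).image ord, X.image ord, card_image_le.trans h3, ?_, ?_, ?_⟩
  · intro a ha b hb hab
    obtain ⟨i, hi, rfl⟩ := mem_image.1 ha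
    obtain ⟨hi, hin⟩ := mem_inter.1 hi
    rw [mem_range] at hin
    obtain ⟨j, hj, rfl⟩ := hsurj b hb
    rcases mem_union.1 (h6 i hi j hj ((hadj _ (hlt i hin) _ hb).1 hab)) with h | h
    · exact mem_union_left _ (mem_image_of_mem _ (mem_inter.2 ⟨h, mem_range.2 hj⟩))
    · exact mem_union_right _ (mem_image_of_mem _ h)
  · refine (card_le_card fun v hv => ?_).trans ((card_image_le (f := ord)).trans h4)
    simp only [mem_filter, mem_image, mem_inter, mem_range] at hv ⊢
    obtain ⟨hv, hSv, i, ⟨hi, hin⟩, rfl⟩ := hv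
    exact ⟨i, ⟨⟨hin, hSv⟩, hi⟩, rfl⟩
  · refine (card_le_card fun v hv => ?_).trans ((card_image_le (f := ord)).trans h5)
    rw [mem_filter, mem_range] at hv
    obtain ⟨hv, hSv, hvA⟩ := hv
    obtain ⟨i, hi, rfl⟩ := hsurj v hv
    refine mem_image_of_mem _ (mem_sdiff.2 ⟨by simpa using ⟨hi, hSv⟩, fun h => hvA ?_⟩)
    rcases mem_union.1 h with h | h
    · exact mem_union_left _ (mem_image_of_mem _ (mem_inter.2 ⟨h, mem_range.2 hi⟩))
    · exact mem_union_right _ (mem_image_of_mem _ h)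

/-- Increase the size of the separators. -/
def growCmd : Cmd :=
  .set .s (sc .s + 1) ;; .set .rounds (sc .s + 1) ;; .set .choices (sc .choices * 8)

/-- Give a place to the vertex in variable `0`, and divide its region if too many vertices are
adjacent to it. -/
def stepCmd : Cmd :=
  .set .u (var 0) ;; .set .l (ar .lab (var 0)) ;; placeInCmd ;;
  .when ((3 * sc .s).lt ((entry .W (sc .l) (var 6)).count 6 .n))
    (splitCmd ;; .ite (sc .found) divideCmd growCmd)

/-- Compute an elimination order. -/
def orderCmd : Cmd :=
  readGraphCmd ;; .set .nn (2 * sc .n) ;; .set .s 1 ;; .set .rounds 2 ;; .set .choices 16 ;;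
  .loop 0 .n (.when ((ar .plc (var 0)).eq 0) stepCmd)

/-- Bounds that suffice for separators of at most `s` vertices. -/
structure OrderBounds (n s : ℕ) (bd : Bounds) : Prop where
  flow : FlowBounds n s bd
  regions : RegionBounds n bd
  sc_n : n ≤ bd.sc .n
  nsq : n * n ≤ bd.sc .nsq
  nn : 2 * n ≤ bd.sc .nn
  sc_s : s ≤ bd.sc .s
  rounds : s + 1 ≤ bd.sc .rounds
  choices : 2 ^ (3 * s + 1) ≤ bd.sc .choices
  y : 2 ^ (3 * s + 1) ≤ bd.sc .y

open Classical in
/-- The state when the first `it` vertices have a place: `s` is at most `smax`, and at most `3 s`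
vertices are adjacent to each region. -/
structure OrderInv (n : ℕ) (adj : ℕ → ℕ) (smax it : ℕ) (σ : St) : Prop where
  regions : Regions n adj (4 * smax + 2) σ
  adj_eq : σ.ar .adj = adj
  nn : σ.sc .nn = 2 * n
  one_le : 1 ≤ σ.sc .s
  le : σ.sc .s ≤ smax
  rounds : σ.sc .rounds = σ.sc .s + 1
  choices : σ.sc .choices = 2 ^ (3 * σ.sc .s + 1)
  lab_le : ∀ u < n, σ.ar .plc u = 0 → σ.ar .lab u ≤ 2 * it
  card : ∀ u < n, σ.ar .plc u = 0 →
    #{v ∈ range n | σ.ar .W (σ.ar .lab u * n + v) ≠ 0} ≤ 3 * σ.sc .s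
  done : ∀ v < it, σ.ar .plc v ≠ 0

section
variable {J : ℕ → ℕ} {bd : Bounds} {ρ : ℕ → ℕ} {σ : St} {n smax it : ℕ} {adj : ℕ → ℕ}

open Classical in
lemma wp_step (h : OrderInv n adj smax it σ) (hit : ρ 0 = it) (hitn : it < n)
    (h0 : σ.ar .plc it = 0) (hsym : ∀ u < n, ∀ v < n, adj (u * n + v) ≠ 0 → adj (v * n + u) ≠ 0)
    (hsep : ∀ S, rank S n = 3 * smax + 1 → ∃ A X, IsSeparation n adj smax S A X)
    (hb : OrderBounds n smax bd) :
    Wp J bd stepCmd ρ (OrderInv n adj smax (it + 1)) σ := by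
  obtain ⟨R, ha, hnn, hs1, hsm, hr, hc, hl, hcard, hd⟩ := h
  have hlit := hl it hitn h0
  have b1 := hb.regions.u
  have b2 := hb.regions.l
  have hcl := hcard it hitn h0
  generalize hs : σ.sc .s = s at *
  generalize hlab : σ.ar .lab it = l at *
  rw [stepCmd, wp_seq, wp_set, eval_var, hit, wp_seq, wp_set, eval_ar, eval_var, hit]
  simp only [St.setSc_ar, hlab]
  refine ⟨by omega, by omega, ?_⟩
  have R' : Regions n adj (4 * smax + 2) ((σ.setSc .u it).setSc .l l) :=
    R.congr (by simp) (by simp) fun a _ => rfl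
  rw [wp_seq]
  refine (wp_placeIn (u := it) (l := l) R' (by simp) (by simp) hitn (by simpa using h0)
    (by simpa using hlab) (by omega) ?_ hb.regions).mono ?_
  · change #{v ∈ range n | σ.ar .W (l * n + v) ≠ 0} + 1 ≤ _
    omega
  rintro σ1 F1 ⟨R1, p1, W1⟩
  have c1 : ∀ j, j ∉ placeInCmd.scs → j ≠ .u → j ≠ .l → σ1.sc j = σ.sc j := fun j h1 h2 h3 => by
    rw [F1.sc j h1]; simp [h2, h3]
  simp only [St.setSc_ar] at p1 W1
  have l1 : σ1.sc .l = l := by rw [F1.sc .l (by decide)]; simp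
  have s1 : σ1.sc .s = s := by rw [c1 .s (by decide) (by decide) (by decide), hs]
  have n1 := R1.placed.n_eq
  have lab1 : σ1.ar .lab = σ.ar .lab := F1.ar .lab (by decide)
  have r1 : σ1.sc .rounds = s + 1 := by rw [c1 .rounds (by decide) (by decide) (by decide), hr]
  have ch1 : σ1.sc .choices = 2 ^ (3 * s + 1) := by
    rw [c1 .choices (by decide) (by decide) (by decide), hc]
  have nn1 : σ1.sc .nn = 2 * n := by rw [c1 .nn (by decide) (by decide) (by decide), hnn]
  have a1 : σ1.ar .adj = adj := by rw [F1.ar .adj (by decide)]; exact ha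
  have hp0 : ∀ v, σ1.ar .plc v = 0 → σ.ar .plc v = 0 := fun v hv => by
    by_contra h
    exact (p1 v).2 (Or.inr h) hv
  have done1 : ∀ v < it + 1, σ1.ar .plc v ≠ 0 := fun v hv => by
    rw [p1]
    rcases Nat.lt_succ_iff_lt_or_eq.1 hv with hv | rfl
    · exact Or.inr (hd v hv)
    · exact Or.inl rfl
  have labl1 : ∀ u < n, σ1.ar .plc u = 0 → σ1.ar .lab u ≤ 2 * it := fun u hu hu0 => by
    rw [lab1]; exact hl u hu (hp0 u hu0)
  -- only row `l` has changed
  have card1 : ∀ u < n, σ1.ar .plc u = 0 → σ1.ar .lab u ≠ l →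
      #{v ∈ range n | σ1.ar .W (σ1.ar .lab u * n + v) ≠ 0} ≤ 3 * s := fun u hu hu0 hul => by
    refine (card_le_card fun v hv => ?_).trans (hcard u hu (hp0 u hu0))
    simp only [mem_filter, mem_range] at hv ⊢
    refine ⟨hv.1, ?_⟩
    have := (W1 _ v hv.1).1 hv.2
    rw [lab1] at this hul
    exact this.resolve_left fun hh => hul hh.1
  have cardl : #{v ∈ range n | σ1.ar .W (l * n + v) ≠ 0} ≤ 3 * s + 1 := by
    refine le_trans (card_le_card (t := insert it {v ∈ range n | σ.ar .W (l * n + v) ≠ 0})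
      fun v hv => ?_) ((card_insert_le _ _).trans (by omega))
    simp only [mem_filter, mem_range, mem_insert] at hv ⊢
    exact ((W1 _ v hv.1).1 hv.2).imp (fun hh => hh.2) fun hh => ⟨hv.1, hh⟩
  rw [wp_when]
  simp only [holds_lt, eval_mul, eval_ofNat, eval_sc, s1, eval_count, entry, holds_ar, eval_add,
    eval_var, l1, n1, Function.update_self]
  constructor
  · intro hlt
    have hrank : rank (fun v => σ1.ar .W (l * n + v) ≠ 0) n = 3 * s + 1 := by
      have h1 : rank (fun v => σ1.ar .W (l * n + v) ≠ 0) n ≤ 3 * s + 1 := by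
        unfold rank; convert cardl
      have h2 : 3 * s < rank (fun v => σ1.ar .W (l * n + v) ≠ 0) n := by
        unfold rank; convert hlt
      omega
    have hle : 2 ^ (3 * s + 1) ≤ 2 ^ (3 * smax + 1) := Nat.pow_le_pow_right (by omega) (by omega)
    have hfb : FlowBounds n s bd := by
      obtain ⟨f1, f2, f3, f4, f5, f6, f7⟩ := hb.flow
      refine ⟨f1, f2, f3, f4, f5, f6, le_trans ?_ f7⟩
      have : (s + 1) * (2 * n) ≤ (smax + 1) * (2 * n) := Nat.mul_le_mul_right _ (by omega)
      omega
    rw [wp_seq]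
    refine (wp_split n1 nn1 l1 s1 r1 ch1 a1 hs1 hrank (hle.trans hb.y) hfb).mono ?_
    intro σ2 F2 h2
    have s2 : σ2.sc .s = s := by rw [F2.sc .s (by decide), s1]
    have r2 : σ2.sc .rounds = s + 1 := by rw [F2.sc .rounds (by decide), r1]
    have ch2 : σ2.sc .choices = 2 ^ (3 * s + 1) := by rw [F2.sc .choices (by decide), ch1]
    have nn2 : σ2.sc .nn = 2 * n := by rw [F2.sc .nn (by decide), nn1]
    have a2 : σ2.ar .adj = adj := by rw [F2.ar .adj (by decide), a1]
    have e1 : σ2.ar .plc = σ1.ar .plc := F2.ar .plc (by decide)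
    have e2 : σ2.ar .W = σ1.ar .W := F2.ar .W (by decide)
    have e3 : σ2.ar .lab = σ1.ar .lab := F2.ar .lab (by decide)
    have R2 : Regions n adj (4 * smax + 2) σ2 := by
      refine R1.congr (F2.sc .n (by decide)) (F2.sc .pc (by decide)) fun a ha => F2.ar a ?_
      fin_cases ha <;> decide
    rw [wp_ite]
    simp only [holds_sc]
    constructor
    · intro hf
      obtain ⟨-, hsp⟩ := h2.resolve_left fun hh => hf hh.1
      refine (wp_divide (l := l) (it := it) (s := s) R2 hsym (by rw [F2.sc .l (by decide), l1]) hit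
        hitn hlit (by rw [e1, e3]; exact labl1) (by rw [e2]; exact hsp) (by rw [e2]; exact cardl)
        (by omega) (by rw [e1, e2, e3]; exact card1) hb.regions).mono ?_
      rintro τ F3 ⟨t1, t2, t3, t4⟩
      have t5 : τ.sc .s = s := by rw [F3.sc .s (by decide), s2]
      refine ⟨t1, by rw [F3.ar .adj (by decide), a2], by rw [F3.sc .nn (by decide), nn2],
        by omega, by omega, by rw [F3.sc .rounds (by decide), r2, t5],
        by rw [F3.sc .choices (by decide), ch2, t5], t3, by rw [t5]; exact t4, fun v hv => ?_⟩
      exact t2 v (by omega) (by rw [e1]; exact done1 v hv)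
    · intro hf
      rcases h2 with ⟨-, hsp⟩ | ⟨hf', -⟩
      swap
      · exact absurd (by rw [hf']; exact one_ne_zero) hf
      have hlt' : s < smax := by
        refine lt_of_le_of_ne hsm ?_
        rintro rfl
        obtain ⟨A, X, hAX⟩ := hsep _ hrank
        exact hsp A X hAX
      have b3 := hb.sc_s
      have b4 := hb.rounds
      have hpow : 2 ^ (3 * s + 1) * 8 = 2 ^ (3 * (s + 1) + 1) := by
        rw [show 3 * (s + 1) + 1 = 3 * s + 1 + 3 by ring, pow_add _ (3 * s + 1) 3]
        norm_num
      simp only [growCmd, wp_seq, wp_set, eval_add, eval_mul, eval_sc, eval_one, eval_ofNat,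
        St.setSc_sc, s2, ch2, if_true, reduceCtorEq, if_false, hpow]
      refine ⟨by omega, by omega,
        le_trans (Nat.pow_le_pow_right (by omega) (by omega)) hb.choices, ?_⟩
      constructor
      · exact R2.congr (by simp) (by simp) fun a _ => rfl
      · exact a2
      · simp [nn2]
      · simp
      · simpa using hlt'
      · simp
      · simp
      · intro u hu hu0
        simp only [St.setSc_ar, e1, e3] at hu0 ⊢
        have := labl1 u hu hu0
        omega
      · intro u hu hu0
        simp only [St.setSc_ar, e1] at hu0
        change #{v ∈ range n | σ2.ar .W (σ2.ar .lab u * n + v) ≠ 0} ≤ _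
        simp only [St.setSc_sc, reduceCtorEq, if_false, if_true]
        rw [e2, e3]
        by_cases hul : σ1.ar .lab u = l
        · rw [hul]; omega
        · have := card1 u hu hu0 hul; omega
      · intro v hv
        simp only [St.setSc_ar, e1]
        exact done1 v hv
  · intro hlt
    have hlt' : #{v ∈ range n | σ1.ar .W (l * n + v) ≠ 0} ≤ 3 * s := by
      rw [not_lt] at hlt
      convert hlt
    refine ⟨R1, a1, nn1, by omega, by omega, by omega, by rw [s1, ch1], fun u hu hu0 => ?_,
      fun u hu hu0 => ?_, done1⟩
    · have := labl1 u hu hu0; omega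
    · rw [s1]
      by_cases hul : σ1.ar .lab u = l
      · rw [hul]; exact hlt'
      · exact card1 u hu hu0 hul

lemma wp_order {I : Instance} (hJ : Encodes J I) (hs : 1 ≤ smax)
    (hsep : ∀ adj, (∀ u < I.n, ∀ v < I.n, adj (u * I.n + v) ≠ 0 ↔ I.adj u v) →
      ∀ S, rank S I.n = 3 * smax + 1 → ∃ A X, IsSeparation I.n adj smax S A X)
    (hb : OrderBounds I.n smax bd) :
    Wp J bd orderCmd ρ (fun τ => Placed I.n (τ.ar .adj) (4 * smax + 2) τ ∧
      (∀ v < I.n, τ.ar .plc v ≠ 0) ∧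
      ∀ u < I.n, ∀ v < I.n, τ.ar .adj (u * I.n + v) ≠ 0 ↔ I.adj u v) St.zero := by
  have b1 := hb.sc_s
  have b2 := hb.rounds
  have b3 : 2 ^ (3 * 1 + 1) ≤ 2 ^ (3 * smax + 1) := Nat.pow_le_pow_right (by omega) (by omega)
  have b4 := hb.choices
  have b5 := hb.flow.val
  rw [orderCmd, wp_seq]
  refine (wp_readGraph hJ hb.sc_n hb.nsq hb.regions.idx_sq (by omega)).mono ?_
  rintro σ1 F1 ⟨n1, -, a1⟩
  simp only [wp_seq, wp_set, eval_mul, eval_ofNat, eval_sc, n1, eval_one]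
  refine ⟨hb.nn, by omega, by omega, by omega, ?_⟩
  set σ2 := (((σ1.setSc .nn (2 * I.n)).setSc .s 1).setSc .rounds 2).setSc .choices 16 with hσ2
  have z2 : ∀ a, a ≠ .adj → ∀ x, σ2.ar a x = 0 := fun a ha x => by
    have : σ1.ar a = fun _ => 0 := F1.ar a (by simpa [readGraphCmd, copyInput, ars] using ha)
    simp [hσ2, this]
  have n2 : σ2.sc .n = I.n := by simp [hσ2, n1]
  have pc2 : σ2.sc .pc = 0 := by
    simp only [hσ2, St.setSc_sc, reduceCtorEq, if_false]
    exact F1.sc .pc (by decide)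
  have hpl : ∀ u, σ2.ar .plc u = 0 := z2 .plc (by decide)
  refine wp_loop (fun it τ => OrderInv I.n (σ1.ar .adj) smax it τ) ?_ ?_ ?_
  · refine ⟨⟨⟨n2, by omega, by omega, by omega, fun v _ => by simp [hpl, pc2], ?_, by omega⟩,
      ?_, ?_, ?_, ?_⟩, rfl, by simp [hσ2], by simp [hσ2], by simpa [hσ2] using hs, by simp [hσ2],
      by simp [hσ2], fun u _ _ => by simp [z2 .lab], fun u _ _ => by simp [z2 .W], by omega⟩
    · exact ⟨by omega, by omega, by omega⟩
    · intro u _ _ i hi; omega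
    · intro u _ _ v _ hv; exact absurd (hpl v) hv
    · intro u _ _ v _ _ _; simp [z2 .lab]
    · intro u _ _ v _ hv; exact absurd (z2 .W (by decide) _) hv
  · intro it hit τ F hI
    rw [n2] at hit
    rw [wp_when]
    simp only [holds_eq, eval_ar, eval_var, Function.update_self, eval_zero]
    refine ⟨fun h0 => wp_step hI (by simp) hit h0 (fun u hu v hv huv => ?_)
      (hsep _ a1) hb, fun h0 => ?_⟩
    · exact (a1 v hv u hu).2 (I.adj_symm ((a1 u hu v hv).1 huv))
    · obtain ⟨k1, k2, k3, k4, k5, k6, k7, k8, k9, k10⟩ := hI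
      refine ⟨k1, k2, k3, k4, k5, k6, k7, fun u hu hu0 => (k8 u hu hu0).trans (by omega), k9,
        fun v hv => ?_⟩
      rcases Nat.lt_succ_iff_lt_or_eq.1 hv with hv | rfl
      · exact k10 v hv
      · exact h0
  · intro τ F hI
    rw [n2] at hI
    rw [hI.adj_eq]
    exact ⟨hI.regions.placed, hI.done, a1⟩

end

/-! ### Fixed-parameter tractability -/

lemma exists_treeDecomposition_width {n : ℕ} (G : SimpleGraph (Fin n)) :
    ∃ (m : ℕ) (T : TreeDecomposition G m), T.width = treewidth G := by
  refine Nat.sInf_mem (s := {w | ∃ (m : ℕ) (D : TreeDecomposition G m), D.width = w}) ?_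
  -- there is a decomposition with one node
  refine ⟨_, 1, ⟨⊥, SimpleGraph.IsTree.of_subsingleton, fun _ => univ, fun v => ⟨0, mem_univ v⟩,
    fun u v _ => ⟨0, mem_univ u, mem_univ v⟩, fun v => ?_⟩, rfl⟩
  have : Nonempty {t : Fin 1 | v ∈ (univ : Finset (Fin n))} := ⟨⟨0, mem_univ v⟩⟩
  exact SimpleGraph.Connected.of_subsingleton

/-- Code that computes the length of the encoding of an instance. -/
def graphLength : List Instr :=
  [.const (rT 1) 0, .load (rT 1) (rT 1), .mul (rT 0) (rT 1) (rT 1), .const (rT 1) 4,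
    .add (rT 0) (rT 0) (rT 1)]

lemma reach_graphLength {P : Program} {x : List ℕ} {A V n : ℕ} (h0 : x.getD 0 0 = n)
    (hlen : x.length = 4 + n * n) (hA : x.length ≤ A) (hV : x.length ≤ V)
    (hx : ∀ a, x.getD a 0 ≤ V) (hP : CodeAt P 0 graphLength) :
    ∃ s, Reach P A V graphLength.length (start x) s ∧ s.Le V ∧
        s.pc = graphLength.length ∧ s.mem = (start x).mem ∧ s.reg (rT 0) = x.length ∧
        ∀ r, (∀ d, r ≠ rT d) → s.reg r = 0 := by
  have l0 : (start x).Le V := ⟨fun r => Nat.zero_le _, hx⟩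
  have hn : n ≤ V := h0 ▸ hx 0
  have e1 : x[0]?.getD 0 = n := by rw [← List.getD_eq_getElem?_getD]; exact h0
  have hstr : Straight A V graphLength (start x) := by
    simp only [graphLength, Straight, Instr.exec, Instr.address, Config.setReg_pc, Option.mem_def,
      reduceCtorEq, false_implies, implies_true, true_and, Config.setReg_reg, Option.some.injEq,
      forall_eq', Config.setReg_mem, and_true, rT_inj, if_true, if_false]
    simp only [start, List.getD_eq_getElem?_getD, e1]
    have l1 := l0.setReg (r := rT 1) (v := 0) (by omega)
    have l2 := l1.setReg (r := rT 1) (v := n) hn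
    have l3 := l2.setReg (r := rT 0) (v := n * n) (by omega)
    have l4 := l3.setReg (r := rT 1) (v := 4) (by omega)
    have l5 := l4.setReg (r := rT 0) (v := n * n + 4) (by omega)
    exact ⟨l1, by omega, l2, l3, l4, l5⟩
  obtain ⟨r, l⟩ := reach_straight (s := start x) hP l0 hstr
  refine ⟨_, r, l, ?_, ?_, ?_, fun r hr => ?_⟩
  · simp [graphLength, Instr.exec, start]
  · simp [graphLength, Instr.exec, start]
  · rw [hlen]
    subst h0
    simp only [graphLength, List.foldl, Instr.exec, Config.setReg_reg, Config.setReg_mem, start,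
      rT_inj, if_true, if_false, zero_ne_one]
    ring
  · simp [graphLength, Instr.exec, start, hr]

/-- The program for instances without a tree decomposition. -/
def graphProgram (k : ℕ) : Program := (orderCmd ;; dpCmd k).program graphLength

/-- A bound for all scalars and indices, in terms of the number of vertices and the treewidth. -/
def graphBd (k n t : ℕ) : ℕ :=
  8 * (2 ^ (3 * (t + 1) + 1) * k ^ (4 * (t + 1) + 2)) * ((n + 1) ^ 2 * radix n ^ k)

section
variable {k n t : ℕ}

lemma graphBd_ge (hk : 2 ≤ k) : DPBounds n k (4 * (t + 1) + 2)
      ⟨graphBd k n t, graphBd k n t, fun _ => graphBd k n t⟩ ∧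
    OrderBounds n (t + 1) ⟨graphBd k n t, graphBd k n t, fun _ => graphBd k n t⟩ := by
  have h1 : 4 * (t + 1) + 2 < k ^ (4 * (t + 1) + 2) := Nat.lt_pow_self (by omega)
  have h2 : radix n ≤ radix n ^ k := Nat.le_self_pow (by omega) _
  have h3 : 1 ≤ radix n ^ k := radix_pow_pos n k
  have h4 : 3 * (t + 1) + 1 < 2 ^ (3 * (t + 1) + 1) := Nat.lt_two_pow_self
  have h5 : k ≤ k ^ (4 * (t + 1) + 2) := Nat.le_self_pow (by omega) k
  obtain ⟨B, hB⟩ : ∃ B, B = graphBd k n t := ⟨_, rfl⟩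
  rw [← hB]
  rw [graphBd] at hB
  generalize hK : k ^ (4 * (t + 1) + 2) = K at *
  generalize hM : radix n ^ k = M at *
  generalize hT : 2 ^ (3 * (t + 1) + 1) = T at *
  have a1 : T ≤ T * K := Nat.le_mul_of_pos_right _ (by omega)
  have a2 : K ≤ T * K := Nat.le_mul_of_pos_left _ (by omega)
  have a3 : (n + 1) ^ 2 ≤ (n + 1) ^ 2 * M := Nat.le_mul_of_pos_right _ (by omega)
  have a4 : M ≤ (n + 1) ^ 2 * M := Nat.le_mul_of_pos_left _ (by positivity)
  have a5 : (n + 1) ^ 2 = n * n + 2 * n + 1 := by ring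
  -- the products that occur in the bounds
  have b1 : T * K * ((n + 1) ^ 2 * M) * 8 = B := by rw [hB]; ring
  have b2 : T * (n + 1) ^ 2 ≤ T * K * ((n + 1) ^ 2 * M) := Nat.mul_le_mul a1 a3
  have b3 : 1 * ((n + 1) ^ 2 * M) ≤ T * K * ((n + 1) ^ 2 * M) :=
    Nat.mul_le_mul_right _ (by omega)
  have b4 : T * K * 1 ≤ T * K * ((n + 1) ^ 2 * M) := Nat.mul_le_mul_left _ (by omega)
  have b5 : (n + 1) * K * M ≤ T * K * ((n + 1) ^ 2 * M) := by
    calc (n + 1) * K * M = K * ((n + 1) * M) := by ring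
      _ ≤ T * K * ((n + 1) ^ 2 * M) :=
        Nat.mul_le_mul a2 (Nat.mul_le_mul_right _ (by omega))
  have b6 : n * ((n + 1) * (M + M)) ≤ 2 * ((n + 1) ^ 2 * M) := by
    calc n * ((n + 1) * (M + M)) = 2 * ((n * (n + 1)) * M) := by ring
      _ ≤ 2 * ((n + 1) ^ 2 * M) := Nat.mul_le_mul_left _ (Nat.mul_le_mul_right _ (by nlinarith))
  have b7 : (t + 1) * (2 * n) ≤ T * (n + 1) ^ 2 := Nat.mul_le_mul (by omega) (by omega)
  have b8 : (t + 1 + 1) * (2 * n) ≤ T * (n + 1) ^ 2 := Nat.mul_le_mul (by omega) (by omega)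
  have b9 : 2 * n * (2 * n) = 4 * (n * n) := by ring
  have b10 : (2 * n + 1) * n = 2 * (n * n) + n := by ring
  have b11 : 1 * (n + 1) ^ 2 ≤ T * (n + 1) ^ 2 := Nat.mul_le_mul_right _ (by omega)
  clear hB
  generalize T * K * ((n + 1) ^ 2 * M) = U at *
  generalize (n + 1) ^ 2 * M = U2 at *
  refine ⟨?_, ⟨?_, ?_, ?_, ?_, ?_, ?_, ?_, ?_, ?_⟩⟩
  · constructor <;> simp only [hK, hM] <;> omega
  · constructor <;> dsimp only <;> omega
  · constructor <;> dsimp only <;> omega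
  all_goals simp only [hT]; omega

lemma graphBd_le {N : ℕ} (hn : n + 1 ≤ N) : graphBd k n t ≤
    8 * (2 ^ (3 * (t + 1) + 1) * k ^ (4 * (t + 1) + 2)) * N ^ (3 * k + 2) := by
  have h1 : radix n ≤ N ^ 3 := by
    have : n * n + 1 ≤ N ^ 2 := by nlinarith
    calc radix n ≤ N * N ^ 2 := Nat.mul_le_mul hn this
      _ = N ^ 3 := by ring
  refine Nat.mul_le_mul_left _ ?_
  calc (n + 1) ^ 2 * radix n ^ k ≤ N ^ 2 * (N ^ 3) ^ k :=
        Nat.mul_le_mul (Nat.pow_le_pow_left hn 2) (Nat.pow_le_pow_left h1 k)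
    _ = N ^ (3 * k + 2) := by rw [← pow_mul, ← pow_add]; congr 1; ring

end

lemma length_le_inputSize (x : List ℕ) : x.length ≤ inputSize x := by
  have := List.length_le_sum_of_one_le (x.map fun a => a.size + 1) (by simp)
  rwa [List.length_map] at this

lemma getD_lt_two_pow_inputSize (x : List ℕ) (a : ℕ) : x.getD a 0 < 2 ^ inputSize x := by
  rcases lt_or_ge a x.length with h | h
  · rw [List.getD_eq_getElem _ _ h]
    have : x[a].size + 1 ≤ inputSize x :=
      List.le_sum_of_mem (List.mem_map_of_mem (List.getElem_mem h))
    exact Nat.size_le.1 (by omega)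
  · rw [List.getD_eq_default _ _ h]
    positivity

lemma graph_scoped (k : ℕ) : (orderCmd ;; dpCmd k).Scoped [] := ⟨by decide, dp_scoped k⟩

theorem graphProgram_spec {k : ℕ} (hk : 2 ≤ k) (I : Instance) :
    ∃ t ≤ 8 + (orderCmd ;; dpCmd k).cost (fun _ => graphBd k I.n (treewidth I.graph)),
      Halted (graphProgram k) (run (graphProgram k) I.encode t) ∧
      (I.IsYes k → (run (graphProgram k) I.encode t).reg 0 = 1) ∧
      (¬ I.IsYes k → (run (graphProgram k) I.encode t).reg 0 = 0) ∧
      WordBound (graphProgram k) I.encode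
        ((graphBd k I.n (treewidth I.graph) + inputSize I.encode) *
          ((orderCmd ;; dpCmd k).deg + 6) + 1) := by
  obtain ⟨m, T, hT⟩ := exists_treeDecomposition_width I.graph
  rw [← hT]
  obtain ⟨g1, g2⟩ := graphBd_ge (n := I.n) (t := T.width) hk
  have hidx := g2.flow.idx
  have hval := g2.regions.val
  dsimp only at hidx hval
  have hlen := I.length_encode
  have hinp := getD_lt_two_pow_inputSize I.encode
  have hlen2 := length_le_inputSize I.encode
  have hJ : Encodes (fun a => I.encode.getD a 0) I := by simpa using I.encodes []
  set N := inputSize I.encode with hN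
  set B := graphBd k I.n T.width with hB
  set d := (orderCmd ;; dpCmd k).deg with hd
  have hN1 : N < 2 ^ N := Nat.lt_two_pow_self
  have hB1 : B < 2 ^ B := Nat.lt_two_pow_self
  have hpow : (2 ^ (B + N)) ^ (d + 6) = 2 ^ ((B + N) * (d + 6)) := (pow_mul _ _ _).symm
  have hBZ : B ≤ 2 ^ (B + N) := hB1.le.trans (Nat.pow_le_pow_right (by omega) (by omega))
  have hNZ : 2 ^ N ≤ 2 ^ (B + N) := Nat.pow_le_pow_right (by omega) (by omega)
  generalize hZ : 2 ^ (B + N) = Z at *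
  have hZ6 : 21 * Z ≤ Z ^ (d + 6) := by
    have : 2 ^ 5 ≤ Z ^ (d + 5) :=
      (Nat.pow_le_pow_left (by omega) 5).trans (Nat.pow_le_pow_right (by omega) (by omega))
    calc 21 * Z ≤ Z ^ (d + 5) * Z := Nat.mul_le_mul_right _ (by omega)
      _ = _ := by rw [← pow_succ]
  have hp : Params (fun a => I.encode.getD a 0) I.encode.length B Z (Z ^ (d + 6)) := by
    refine ⟨by omega, fun a => (hinp a).le.trans hNZ, fun a ha => List.getD_eq_default _ _ ha,
      by omega, by omega, ?_⟩
    rw [show stride = 20 from rfl]; omega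
  have hsafe : (orderCmd ;; dpCmd k).Wp (fun a => I.encode.getD a 0)
      ⟨B, B, fun _ => B⟩ (fun _ => 0) (fun τ => (τ.sc .out = 0 ∨ τ.sc .out = 1) ∧
        (τ.sc .out = 1 ↔ I.IsYes k)) St.zero := by
    rw [wp_seq]
    refine (wp_order hJ (by omega) (fun adj hadj S hS => T.exists_isSeparation hadj hS) g2).mono ?_
    rintro τ F ⟨hP, hall, hadj⟩
    exact wp_decide hk g1 hJ hP hall hadj fun x => by
      rw [F.ar .T (by decide)]; rfl
  obtain ⟨τ, ⟨q1, q2⟩, t, ht, hh, hreg, -, hword⟩ := Cmd.program_spec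
    (bd := ⟨B, B, fun _ => B⟩) (pre := graphLength) hp ⟨fun _ => hBZ, hBZ⟩
    (fun hP => reach_graphLength hJ.n_eq hlen (by omega) (by omega)
      (fun a => (hp.inp_le a).trans (by omega)) hP) (graph_scoped k)
    (Nat.pow_le_pow_right (by omega) (by omega)) hsafe
  refine ⟨t, ht, hh, fun h => hreg.trans (q2.2 h), fun h => hreg.trans ?_, ?_⟩
  · exact q1.resolve_right fun h' => h (q2.1 h')
  · have : ∀ v, v ≤ Z ^ (d + 6) → v.size ≤ (B + N) * (d + 6) + 1 := fun v hv => by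
      refine Nat.size_le.2 (hv.trans_lt ?_)
      rw [hpow]
      exact Nat.pow_lt_pow_right (by omega) (by omega)
    exact fun t a => ⟨this _ (hword t a).1, this _ (hword t a).2⟩

lemma primrec_pow_const {f : ℕ → ℕ} (hf : Primrec f) (d : ℕ) : Primrec fun t => f t ^ d := by
  induction d with
  | zero => simpa using Primrec.const 1
  | succ d ih => simpa only [pow_succ] using Primrec.nat_mul.comp ih hf

lemma primrec_const_pow {f : ℕ → ℕ} (hf : Primrec f) (a : ℕ) : Primrec fun t => a ^ f t := by
  have h : Primrec fun t => a ^ t := by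
    refine (Primrec.nat_rec₁ (f := fun _ y => y * a) 1
      (Primrec.nat_mul.comp Primrec.snd (Primrec.const a))).of_eq fun t => ?_
    induction t with
    | zero => rfl
    | succ t ih => rw [pow_succ, ← ih]
  exact h.comp hf

/-- The problem is fixed-parameter tractable in the treewidth. -/
theorem fixedParameterTractable {k : ℕ} (hk : 2 ≤ k) :
    FixedParameterTractable Instance.encode (Instance.IsYes k) fun I => treewidth I.graph := by
  set d := (orderCmd ;; dpCmd k).deg with hd
  set D := (orderCmd ;; dpCmd k).depth with hD
  set c0 := (orderCmd ;; dpCmd k).cost (fun _ => 1) with hc0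
  set G : ℕ → ℕ := fun t => 8 * (2 ^ (3 * (t + 1) + 1) * k ^ (4 * (t + 1) + 2)) with hG
  refine ⟨graphProgram k, fun t => (8 + c0 + 2 * (d + 7)) * G t ^ (D + 1),
    (3 * k + 3) * (D + 1), ?_, fun I => ?_⟩
  · have h1 : Primrec fun t : ℕ => t + 1 := Primrec.succ
    have h2 (a b : ℕ) : Primrec fun t : ℕ => a * (t + 1) + b :=
      Primrec.nat_add.comp (Primrec.nat_mul.comp (Primrec.const a) h1) (Primrec.const b)
    have h3 : Primrec G := Primrec.nat_mul.comp (Primrec.const 8)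
      (Primrec.nat_mul.comp (primrec_const_pow (h2 3 1) 2) (primrec_const_pow (h2 4 2) k))
    exact (Primrec.nat_mul.comp (Primrec.const _) (primrec_pow_const h3 (D + 1))).to_comp
  obtain ⟨t, ht, hh, hy, hno, hword⟩ := graphProgram_spec hk I
  have hlen := length_le_inputSize I.encode
  rw [I.length_encode] at hlen
  have hn : I.n + 1 ≤ inputSize I.encode := by nlinarith
  have hB : _ ≤ G (treewidth I.graph) * _ := graphBd_le (k := k) hn
  have hpos : 1 ≤ graphBd k I.n (treewidth I.graph) := by
    have := (graphBd_ge (n := I.n) (t := treewidth I.graph) hk).1.out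
    exact this
  have hcost := Cmd.cost_le (B := fun _ => graphBd k I.n (treewidth I.graph)) hpos
    (orderCmd ;; dpCmd k) fun j _ => le_rfl
  rw [← hD, ← hc0] at hcost
  rw [← hd] at hword
  clear_value c0 d D G
  dsimp only
  generalize (orderCmd ;; dpCmd k).cost (fun _ => graphBd k I.n (treewidth I.graph)) = x at *
  generalize graphBd k I.n (treewidth I.graph) = B at *
  generalize inputSize I.encode = N at *
  generalize G (treewidth I.graph) = g at *
  have hBN : B * N ≤ g * N ^ (3 * k + 3) := by
    calc B * N ≤ g * N ^ (3 * k + 2) * N := Nat.mul_le_mul_right _ hB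
      _ = _ := by ring
  have hU : (B * N) ^ (D + 1) ≤ g ^ (D + 1) * N ^ ((3 * k + 3) * (D + 1)) := by
    rw [pow_mul, ← mul_pow]
    exact Nat.pow_le_pow_left hBN _
  have hN : 1 ≤ N := by omega
  have hBN1 : 1 ≤ B * N := Nat.mul_pos hpos hN
  have h1 : B ^ D ≤ (B * N) ^ (D + 1) :=
    (Nat.pow_le_pow_left (Nat.le_mul_of_pos_right _ hN) D).trans
      (Nat.pow_le_pow_right hBN1 (by omega))
  have h2 : B * N ≤ (B * N) ^ (D + 1) := Nat.le_self_pow (by omega) _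
  have h3 : B + N ≤ 2 * (B * N) := by nlinarith
  rw [mul_assoc]
  refine ⟨⟨t, ?_, hh, hy, hno⟩, fun s a => ?_⟩
  · refine le_trans ?_ (Nat.mul_le_mul_left _ hU)
    calc t ≤ 8 + c0 * B ^ D := ht.trans (Nat.add_le_add_left hcost _)
      _ ≤ 8 * (B * N) ^ (D + 1) + c0 * (B * N) ^ (D + 1) :=
        Nat.add_le_add (Nat.le_mul_of_pos_right _ (by omega)) (Nat.mul_le_mul_left _ h1)
      _ = (8 + c0) * (B * N) ^ (D + 1) := by ring
      _ ≤ _ := Nat.mul_le_mul_right _ (by omega)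
  · have h4 : (B + N) * (d + 6) + 1 ≤
        (8 + c0 + 2 * (d + 7)) * (g ^ (D + 1) * N ^ ((3 * k + 3) * (D + 1))) := by
      refine le_trans ?_ (Nat.mul_le_mul_left _ hU)
      calc (B + N) * (d + 6) + 1 ≤ 2 * (B * N) * (d + 6) + 2 * (B * N) :=
            Nat.add_le_add (Nat.mul_le_mul_right _ h3) (by omega)
        _ = 2 * (d + 7) * (B * N) := by ring
        _ ≤ (8 + c0 + 2 * (d + 7)) * (B * N) ^ (D + 1) := Nat.mul_le_mul (by omega) h2
    exact ⟨(hword s a).1.trans h4, (hword s a).2.trans h4⟩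

end SparsestCut

theorem mainTheorem1 (k : ℕ) (hk : 2 ≤ k) :
    (∃ P : SparsestCut.Program, ∀ c : ℕ, ∃ C : ℕ,
      ∀ (I : SparsestCut.Instance) (m : ℕ) (D : SparsestCut.TreeDecomposition I.graph m),
        1 ≤ I.n → m ≤ c * I.n →
          SparsestCut.AnswersWithin P (I.encode ++ D.encode) (I.IsYes k)
            (C * (k ^ D.width * I.n ^ (6 * k + 1))) ∧
          SparsestCut.SpaceBound P (I.encode ++ D.encode)
            (C * (k ^ D.width * I.n ^ (3 * k + 1))) ∧
          SparsestCut.WordBound P (I.encode ++ D.encode)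
            (C * (D.width + I.n.size + SparsestCut.ratSize I.N))) ∧
    SparsestCut.FixedParameterTractable SparsestCut.Instance.encode
      (SparsestCut.Instance.IsYes k) (fun I => SparsestCut.treewidth I.graph) :=
  ⟨⟨_, SparsestCut.treeProgram_bounds hk⟩, SparsestCut.fixedParameterTractable hk⟩
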